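/- **Setting.** Let $(T_i,Y_{0i},Y_{1i},X_i)_{i\ge 1}$ be i.i.d. with $T_i\in\{0,1\}$, real potential outcomes $Y_{0i},Y_{1i}$ and Euclidean covariates $X_i=(U_i,Z_i)$; one observes $W_i=(T_i,Y_i,X_i)$, $Y_i=T_iY_{1i}+(1-T_i)Y_{0i}$. Suppose $\mathrm{pr}(T=1\mid Y_0,X)=\pi(Y_0,U;\theta^0)$ for a known parametric family $\pi(\theta)=\pi(y_0,u;\theta)$, $\theta\in\mathbb R^d$, with gradient $\dot\pi(\theta)$ in $\theta$. Let $f_t(y\mid x,t)$ be the conditional density of $Y_t$ given $X=x,T=t$ with respect to a $\sigma$-finite measure on the range $\mathcal Y_t$ of $Y_t$, and write $E_t(\cdot\mid x,t)$ for the corresponding conditional mean. Put $p=\mathrm{pr}(T=1)$ and $\Delta^0=E(Y_1-Y_0\mid T=1)$. For a given $f_0$ and $\theta$ let $\{1-w(x)\}^{-1}=E_0[\{1-\pi(\theta)\}^{-1}\mid x,0]$, $$A(x)=\{1-w(x)\}E_0[\{1-\pi(\theta)\}^{-2}\dot\pi(\theta)\mid x,0],\qquad B(x)=\{1-w(x)\}E_0[\{1-\pi(\theta)\}^{-2}\pi(\theta)\mid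 x,0],$$ $$K(x)=w(x)E_1(Y_1\mid x,1)+\{1-w(x)\}E_0\!\left[\tfrac{\pi(\theta)^2}{\{1-\pi(\theta)\}^2}Y_0\,\Big|\,x,0\right],\qquad V(x)=K(x)-w(x)\Delta,$$ $$R=\frac{t-\pi(\theta)}{1-\pi(\theta)}=t-(1-t)\frac{\pi(y_0,u;\theta)}{1-\pi(y_0,u;\theta)},\qquad S_{\rm eff}(w;\theta)=R\,\frac{A(x)}{B(x)},$$ and, at $\theta=\theta^0,\Delta=\Delta^0$ and the true densities, $M=E[B(X)^{-1}A(X)A(X)^{\rm T}]$, $Q=E[Y_0\{1-\pi(\theta)\}^{-1}\dot\pi(\theta)]$, $D=E[B(X)^{-1}V(X)A(X)]$. Let $$\phi_{\rm alt}=p^{-1}\Big\{ty_1-(1-t)\tfrac{\pi(\theta)}{1-\pi(\theta)}y_0-t\Delta\Big\},\quad \phi=p^{-1}\Big\{Ry-R\tfrac{K(x)}{B(x)}-\Delta\Big(t-R\tfrac{w(x)}{B(x)}\Big)\Big\},\quad \phi_{\rm eff}=\phi+p^{-1}(D-Q)^{\rm T}M^{-1}S_{\rm eff}.$$ **Assumptions.**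 $\theta$ ranges over a compact set $\Theta\subset\mathbb R^d$ with $\theta^0$ in its interior; $c<\pi(\theta)<1-c$ for some $c>0$, for all $\theta\in\Theta$ and all $y_0$ and $x$ in their ranges $\mathcal Y_0,\mathcal X$; $\pi$ is three times continuously differentiable in $\theta$ on a neighbourhood of $\Theta$ with derivatives of orders $1,2,3$ bounded uniformly in $(y_0,u)$; $\mathcal Y_0,\mathcal Y_1$ are bounded; $f_0,f_1$ are bounded away from $0$ and $\infty$ on $\mathcal Y_t\times\mathcal X$; $M$ is invertible; and $\theta^0$ is the only $\theta\in\Theta$ with $E\{S_{\rm eff}(W;\theta)\}=0$ (with the true $f_0$). For a fixed $K_0\ge1$, $\{1,\dots,n\}$ is randomly partitioned, independently of the sample, into folds $I_1,\dots,I_{K_0}$ of equal size (up to rounding). For each $k$, estimates $\hat f_t^{[-k]}$ of $f_t$, $t=0,1$, are measurable functions of $(W_i)_{i\notin I_k}$ such that $\sup_{\mathcal Y_t\times\mathcal X}|\hat f_t^{[-k]}-f_t|=o_p(1)$ and the $L^2(P)$ norm of $\hat f_t^{[-k]}(Y_t\mid X,t)-f_t(Y_t\mid X,t)$ (over $T=t$)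 is $o_p(n^{-1/4})$. **Estimators.** $\hat\theta_{\rm eff}\in\Theta$ is measurable and, with probability tending to one, solves $\frac1n\sum_k\sum_{i\in I_k}S_{\rm eff}(W_i;\theta,\hat f^{[-k]})=0$. Put $$\hat\Delta_{\rm alt}(\theta)=\frac{\frac1n\sum_i\{T_iY_{1i}-(1-T_i)\frac{\pi_i(\theta)}{1-\pi_i(\theta)}Y_{0i}\}}{\frac1n\sum_iT_i},$$ and let $\hat\Delta_{\rm eff}(\theta)$ be the solution in $\Delta$ of the equation $\frac1n\sum_k\sum_{i\in I_k}\phi(W_i;\theta,\Delta,\hat f^{[-k]})=0$, which is linear in $\Delta$. **Efficiency bound.** In the semiparametric model for the law of $W$ with parameter $\theta\in\Theta$, unrestricted conditional densities $f_0,f_1$ and unrestricted law $g$ of $X$, and likelihood $w(x)^t\{1-w(x)\}^{1-t}f_1(y\mid x,1)^tf_0(y\mid x,0)^{1-t}g(x)$, the average treatment effect on the treated is the functional $$\Delta(\theta,f_0,f_1,g)=\frac{\int\big(w(x)E_1(Y_1\mid x,1)-\{1-w(x)\}E_0[\tfrac{\pi(\theta)}{1-\pi(\theta)}Y_0\mid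 x,0]\big)\,dg(x)}{\int w(x)\,dg(x)}.$$ The semiparametric efficiency bound is the supremum of the Cramér–Rao bounds $\{\tfrac{d}{dh}\Delta|_{h=0}\}^2/E(s^2)$ over all one-dimensional submodels through the truth that are differentiable in quadratic mean at $h=0$, with square-integrable score $s$, and along which $\theta$ is differentiable at $h=0$ (the ratio being read as $0$ if $E(s^2)=0$). **Lemma.** All functions below being taken at $(\theta^0,\Delta^0)$ and the true densities, put $\psi_{\rm alt}=\phi_{\rm alt}-p^{-1}Q^{\rm T}M^{-1}S_{\rm eff}$. 1. $\hat\Delta_{\rm alt}(\hat\theta_{\rm eff})$ is asymptotically linear with influence function $\psi_{\rm alt}$: $E\psi_{\rm alt}(W)=0$, $E\psi_{\rm alt}(W)^2<\infty$ and $$\sqrt n\{\hat\Delta_{\rm alt}(\hat\theta_{\rm eff})-\Delta^0\}=n^{-1/2}\sum_{i=1}^n\psi_{\rm alt}(W_i)+o_p(1)\xrightarrow{d}N(0,E\psi_{\rm alt}^2).$$ 2. $E\phi_{\rm eff}^2$ is the semiparametric efficiency bound for $\Delta$, and it is attained by $\hat\Delta_{\rm eff}(\hat\theta_{\rm eff})$: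 $E\phi_{\rm eff}(W)=0$, $E\phi_{\rm eff}(W)^2<\infty$ and $$\sqrt n\{\hat\Delta_{\rm eff}(\hat\theta_{\rm eff})-\Delta^0\}=n^{-1/2}\sum_{i=1}^n\phi_{\rm eff}(W_i)+o_p(1)\xrightarrow{d}N(0,E\phi_{\rm eff}^2).$$ 3. $\hat\Delta_{\rm alt}(\hat\theta_{\rm eff})$ is no more efficient than $\hat\Delta_{\rm eff}(\hat\theta_{\rm eff})$: $E\psi_{\rm alt}^2\ge E\phi_{\rm eff}^2$. -/

import Mathlib

open MeasureTheory ProbabilityTheory Filter Topology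
open scoped ENNReal Matrix

/-- Covariate vectors `x = (u, z)`. -/
abbrev Cov (dU dZ : ℕ) : Type :=
  EuclideanSpace ℝ (Fin dU) × EuclideanSpace ℝ (Fin dZ)

/-- One observation `w = (t, y, x)`: treatment, observed outcome, covariates. -/
abbrev Obs (dU dZ : ℕ) : Type := Fin 2 × ℝ × Cov dU dZ

/-- The treatment as a real number (`0` or `1`). -/
def tval (t : Fin 2) : ℝ := ((t : ℕ) : ℝ)

/-- The known ingredients of the model. Conditional densities of `Y_t` given `X, T = t` are taken
with respect to `ν t` on the outcome range `𝒴 t` (Lebesgue measure for continuous outcomes,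
counting measure for discrete ones); `π y₀ u θ` is the parametric treatment model. -/
structure ATTSetup (d dU dZ : ℕ) where
  /-- dominating measures -/
  ν : Fin 2 → Measure ℝ
  /-- ranges of the potential outcomes -/
  𝒴 : Fin 2 → Set ℝ
  /-- range of the covariates -/
  𝒳 : Set (Cov dU dZ)
  /-- parameter set of `θ` -/
  Θ : Set (EuclideanSpace ℝ (Fin d))
  /-- treatment probability `π(y₀, u; θ)` -/
  π : ℝ → EuclideanSpace ℝ (Fin dU) → EuclideanSpace ℝ (Fin d) → ℝ

namespace ATTSetup

noncomputable section

variable {d dU dZ : ℕ} (𝔖 : ATTSetup d dU dZ)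

/-- The `j`-th partial derivative of `π` in `θ`. -/
def πdot (y : ℝ) (u : EuclideanSpace ℝ (Fin dU)) (θ : EuclideanSpace ℝ (Fin d)) (j : Fin d) : ℝ :=
  gradient (𝔖.π y u) θ j

/-- `E_t{a(Y_t) ∣ x, t}`, the conditional mean under the conditional density `f t`. -/
def condE (f : Fin 2 → ℝ → Cov dU dZ → ℝ) (t : Fin 2) (a : ℝ → ℝ) (x : Cov dU dZ) : ℝ :=
  ∫ y in 𝔖.𝒴 t, a y * f t y x ∂(𝔖.ν t)

variable (f : Fin 2 → ℝ → Cov dU dZ → ℝ) (θ : EuclideanSpace ℝ (Fin d))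

/-- `w(x) = pr(T = 1 ∣ x)`, through `{1 - w(x)}⁻¹ = E₀[{1 - π(θ)}⁻¹ ∣ x, 0]`. -/
def w (x : Cov dU dZ) : ℝ :=
  1 - (𝔖.condE f 0 (fun y => (1 - 𝔖.π y x.1 θ)⁻¹) x)⁻¹

/-- `A(x) = {1 - w(x)} E₀[{1 - π(θ)}⁻² ∂π(θ)/∂θ ∣ x, 0]`. -/
def A (x : Cov dU dZ) (j : Fin d) : ℝ :=
  (1 - 𝔖.w f θ x) *
    𝔖.condE f 0 (fun y => ((1 - 𝔖.π y x.1 θ) ^ 2)⁻¹ * 𝔖.πdot y x.1 θ j) x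

/-- `B(x) = {1 - w(x)} E₀[{1 - π(θ)}⁻² π(θ) ∣ x, 0]`. -/
def B (x : Cov dU dZ) : ℝ :=
  (1 - 𝔖.w f θ x) *
    𝔖.condE f 0 (fun y => ((1 - 𝔖.π y x.1 θ) ^ 2)⁻¹ * 𝔖.π y x.1 θ) x

/-- `w(x) E₁(Y₁ ∣ x, 1) + {1 - w(x)} E₀[Y₀ π(θ)² / {1 - π(θ)}² ∣ x, 0]`. -/
def K (x : Cov dU dZ) : ℝ :=
  𝔖.w f θ x * 𝔖.condE f 1 (fun y => y) x +
    (1 - 𝔖.w f θ x) *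
      𝔖.condE f 0 (fun y => (𝔖.π y x.1 θ) ^ 2 / (1 - 𝔖.π y x.1 θ) ^ 2 * y) x

/-- `V(x) = w E₁(Y₁ ∣ x, 1) - w Δ + (1 - w) E₀[Y₀ {1 - π(θ)}⁻² π(θ)² ∣ x, 0]`. -/
def V (Δ : ℝ) (x : Cov dU dZ) : ℝ := 𝔖.K f θ x - 𝔖.w f θ x * Δ

/-- `{t - π(θ)} / {1 - π(θ)}`: it is `1` for `t = 1` and `-π(θ)/{1 - π(θ)}` for `t = 0`, in which
case the observed outcome is `y₀`. -/
def resid (θ : EuclideanSpace ℝ (Fin d)) (o : Obs dU dZ) : ℝ :=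
  tval o.1 - (1 - tval o.1) * (𝔖.π o.2.1 o.2.2.1 θ / (1 - 𝔖.π o.2.1 o.2.2.1 θ))

/-- The efficient score `S_eff(w; θ)`. -/
def Seff (o : Obs dU dZ) (j : Fin d) : ℝ :=
  𝔖.resid θ o *
    (𝔖.condE f 0 (fun y => ((1 - 𝔖.π y o.2.2.1 θ) ^ 2)⁻¹ * 𝔖.πdot y o.2.2.1 θ j) o.2.2 /
      𝔖.condE f 0 (fun y => ((1 - 𝔖.π y o.2.2.1 θ) ^ 2)⁻¹ * 𝔖.π y o.2.2.1 θ) o.2.2)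

/-- `t y₁ - (1 - t) π(θ) / {1 - π(θ)} y₀`. -/
def altNum (θ : EuclideanSpace ℝ (Fin d)) (o : Obs dU dZ) : ℝ :=
  tval o.1 * o.2.1 -
    (1 - tval o.1) * (𝔖.π o.2.1 o.2.2.1 θ / (1 - 𝔖.π o.2.1 o.2.2.1 θ)) * o.2.1

/-- `φ_alt(w; θ, Δ)`, where `p = pr(T = 1)`. -/
def φalt (p Δ : ℝ) (θ : EuclideanSpace ℝ (Fin d)) (o : Obs dU dZ) : ℝ :=
  p⁻¹ * (𝔖.altNum θ o - tval o.1 * Δ)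

/-- `{t - π}/{1 - π} y - {t - π}/{1 - π} B(x)⁻¹ K(x)`, the numerator of the efficient estimator. -/
def effNum (o : Obs dU dZ) : ℝ :=
  𝔖.resid θ o * o.2.1 - 𝔖.resid θ o * (𝔖.B f θ o.2.2)⁻¹ * 𝔖.K f θ o.2.2

/-- `t - {t - π}/{1 - π} w(x) / B(x)`, the denominator of the efficient estimator. -/
def effDen (o : Obs dU dZ) : ℝ :=
  tval o.1 - 𝔖.resid θ o * (𝔖.w f θ o.2.2 / 𝔖.B f θ o.2.2)

/-- `φ(w; θ, Δ)`. -/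
def φ (p Δ : ℝ) (o : Obs dU dZ) : ℝ :=
  p⁻¹ * (𝔖.effNum f θ o - Δ * 𝔖.effDen f θ o)

/-- `M = E[B(X)⁻¹ A(X) A(X)ᵀ]`, where `PX` is the law of `X`. -/
def M (PX : Measure (Cov dU dZ)) : Matrix (Fin d) (Fin d) ℝ :=
  Matrix.of fun j l => ∫ x, (𝔖.B f θ x)⁻¹ * (𝔖.A f θ x j * 𝔖.A f θ x l) ∂PX

/-- `D = E[B(X)⁻¹ V(X) A(X)]`. -/
def D (PX : Measure (Cov dU dZ)) (Δ : ℝ) (j : Fin d) : ℝ :=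
  ∫ x, (𝔖.B f θ x)⁻¹ * 𝔖.V f θ Δ x * 𝔖.A f θ x j ∂PX

/-- `Q = E[Y₀ {1 - π(θ)}⁻¹ ∂π(θ)/∂θ]`. -/
def Q {Ω : Type*} [MeasurableSpace Ω] (μ : Measure Ω) (Y0 : Ω → ℝ) (X : Ω → Cov dU dZ)
    (θ : EuclideanSpace ℝ (Fin d)) (j : Fin d) : ℝ :=
  ∫ ω, Y0 ω * (1 - 𝔖.π (Y0 ω) (X ω).1 θ)⁻¹ * 𝔖.πdot (Y0 ω) (X ω).1 θ j ∂μ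

/-- The efficient influence function `φ_eff = φ + Hᵀ S_eff` with `H = p⁻¹ M⁻¹ (D - Q)`. -/
def φeff (PX : Measure (Cov dU dZ)) (q : Fin d → ℝ) (p Δ : ℝ) (o : Obs dU dZ) : ℝ :=
  𝔖.φ f θ p Δ o +
    (p⁻¹ • ((𝔖.M f θ PX)⁻¹ *ᵥ (𝔖.D f θ PX Δ - q))) ⬝ᵥ 𝔖.Seff f θ o

/-! ### The semiparametric model and its efficiency bound -/

/-- A parameter `(θ, f₀, f₁, g)` of the observed-data model. -/
structure Param (d dU dZ : ℕ) where
  /-- finite-dimensional parameter of the treatment model -/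
  θ : EuclideanSpace ℝ (Fin d)
  /-- conditional densities of `Y_t` given `X, T = t` -/
  f : Fin 2 → ℝ → Cov dU dZ → ℝ
  /-- law of the covariates -/
  g : Measure (Cov dU dZ)

/-- The parameter space of the semiparametric model: the conditional densities and the law of the
covariates are unrestricted. -/
structure IsParam (q : Param d dU dZ) : Prop where
  theta_mem : q.θ ∈ 𝔖.Θ
  measurable_f : ∀ t, Measurable (fun r : ℝ × Cov dU dZ => q.f t r.1 r.2)
  f_nonneg : ∀ t, ∀ y ∈ 𝔖.𝒴 t, ∀ x ∈ 𝔖.𝒳, 0 ≤ q.f t y x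
  prob : IsProbabilityMeasure q.g
  ae_mem : ∀ᵐ x ∂q.g, x ∈ 𝔖.𝒳
  f_density : ∀ t, ∀ᵐ x ∂q.g, ∫⁻ y in 𝔖.𝒴 t, ENNReal.ofReal (q.f t y x) ∂(𝔖.ν t) = 1

/-- The law of `W = (T, Y, X)` under a parameter: the measure with likelihood
`w(x)ᵗ {1 - w(x)}¹⁻ᵗ f₁(y ∣ x, 1)ᵗ f₀(y ∣ x, 0)¹⁻ᵗ g(x)`. -/
def law (q : Param d dU dZ) : Measure (Obs dU dZ) :=
  ∑ t : Fin 2,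
    ((((𝔖.ν t).restrict (𝔖.𝒴 t)).prod q.g).withDensity (fun r =>
      ENNReal.ofReal ((if t = 1 then 𝔖.w q.f q.θ r.2 else 1 - 𝔖.w q.f q.θ r.2) *
        q.f t r.1 r.2))).map (fun r => ((t, r) : Obs dU dZ))

/-- The average treatment effect on the treated as a functional of the parameter. -/
def att (q : Param d dU dZ) : ℝ :=
  (∫ x, (𝔖.w q.f q.θ x * 𝔖.condE q.f 1 (fun y => y) x -
      (1 - 𝔖.w q.f q.θ x) *
        𝔖.condE q.f 0 (fun y => 𝔖.π y x.1 q.θ / (1 - 𝔖.π y x.1 q.θ) * y) x) ∂q.g) /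
    ∫ x, 𝔖.w q.f q.θ x ∂q.g

/-- `γ` is a regular one-dimensional parametric submodel through `q₀` with score `s`: it lies in
the model, its `θ`-component is differentiable at `0`, and the laws are differentiable in quadratic
mean at `0`, i.e. `∫ {(√dP_h - √dP_0)/h - s √dP_0 / 2}² → 0` (densities are taken with respect to
`P_h + P_0`). -/
structure IsRegularSubmodel (q₀ : Param d dU dZ) (γ : ℝ → Param d dU dZ)
    (s : Obs dU dZ → ℝ) : Prop where
  at_zero : γ 0 = q₀
  mem : ∀ᶠ h in 𝓝 (0 : ℝ), 𝔖.IsParam (γ h)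
  theta_diff : DifferentiableAt ℝ (fun h => (γ h).θ) 0
  score_memLp : MemLp s 2 (𝔖.law q₀)
  dqm : Tendsto (fun h : ℝ =>
      ∫⁻ o, ENNReal.ofReal
        (((√((𝔖.law (γ h)).rnDeriv (𝔖.law (γ h) + 𝔖.law q₀) o).toReal -
            √((𝔖.law q₀).rnDeriv (𝔖.law (γ h) + 𝔖.law q₀) o).toReal) / h -
          s o * √((𝔖.law q₀).rnDeriv (𝔖.law (γ h) + 𝔖.law q₀) o).toReal / 2) ^ 2)
        ∂(𝔖.law (γ h) + 𝔖.law q₀)) (𝓝[≠] 0) (𝓝 0)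

/-- The Cramér–Rao bounds for the average treatment effect on the treated of all regular parametric
submodels through `q₀`. (A submodel whose score vanishes contributes `0`.) -/
def cramerRaoBounds (q₀ : Param d dU dZ) : Set ℝ :=
  {b | ∃ (γ : ℝ → Param d dU dZ) (s : Obs dU dZ → ℝ) (Δ' : ℝ),
    𝔖.IsRegularSubmodel q₀ γ s ∧ HasDerivAt (fun h => 𝔖.att (γ h)) Δ' 0 ∧
      b = Δ' ^ 2 / ∫ o, s o ^ 2 ∂(𝔖.law q₀)}

/-- `b` is the semiparametric efficiency bound at `q₀`: the supremum of the Cramér–Rao bounds of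
the regular parametric submodels. -/
def IsEfficiencyBound (q₀ : Param d dU dZ) (b : ℝ) : Prop := IsLUB (𝔖.cramerRaoBounds q₀) b

/-! ### The data-generating process and the assumptions -/

section Sampling

variable {Ω : Type*} [MeasurableSpace Ω] (μ : Measure Ω)
  (T : ℕ → Ω → Fin 2) (Y : Fin 2 → ℕ → Ω → ℝ) (X : ℕ → Ω → Cov dU dZ)

/-- `(T_i, Y_{0i}, Y_{1i}, X_i)` is an i.i.d. sequence whose treatment mechanism is
`pr(T = 1 ∣ Y₀, X) = π(Y₀, U; θ)` and for which `f t` is the conditional density of `Y_t` given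
`X` and `T = t`. -/
structure IsSample : Prop where
  measurable_T : ∀ i, Measurable (T i)
  measurable_Y : ∀ t i, Measurable (Y t i)
  measurable_X : ∀ i, Measurable (X i)
  indep : iIndepFun (fun i ω => (T i ω, (fun t => Y t i ω), X i ω)) μ
  ident : ∀ i, IdentDistrib (fun ω => (T i ω, (fun t => Y t i ω), X i ω))
    (fun ω => (T 0 ω, (fun t => Y t 0 ω), X 0 ω)) μ μ
  sigmaFinite : ∀ t, SigmaFinite (𝔖.ν t)
  measurableSet_𝒴 : ∀ t, MeasurableSet (𝔖.𝒴 t)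
  measurableSet_𝒳 : MeasurableSet 𝔖.𝒳
  ae_mem_𝒴 : ∀ t, ∀ᵐ ω ∂μ, Y t 0 ω ∈ 𝔖.𝒴 t
  ae_mem_𝒳 : ∀ᵐ ω ∂μ, X 0 ω ∈ 𝔖.𝒳
  measurable_π : ∀ θ, Measurable (fun r : ℝ × EuclideanSpace ℝ (Fin dU) => 𝔖.π r.1 r.2 θ)
  treatment : μ[fun ω => tval (T 0 ω) |
      MeasurableSpace.comap (fun ω => (Y 0 0 ω, X 0 ω)) inferInstance] =ᵐ[μ]
    fun ω => 𝔖.π (Y 0 0 ω) (X 0 ω).1 θ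
  measurable_f : ∀ t, Measurable (fun r : ℝ × Cov dU dZ => f t r.1 r.2)
  density : ∀ t, (μ.restrict {ω | T 0 ω = t}).map (fun ω => (Y t 0 ω, X 0 ω)) =
    (((𝔖.ν t).restrict (𝔖.𝒴 t)).prod ((μ.restrict {ω | T 0 ω = t}).map (X 0))).withDensity
      (fun r => ENNReal.ofReal (f t r.1 r.2))

/-- The observation `W_i = (T_i, Y_i, X_i)`, where `Y_i = T_i Y_{1i} + (1 - T_i) Y_{0i}`. -/
def obs (i : ℕ) (ω : Ω) : Obs dU dZ := (T i ω, Y (T i ω) i ω, X i ω)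

/-- `p = pr(T = 1)`. -/
def p : ℝ := μ.real {ω | T 0 ω = 1}

/-- `Δ = E(Y₁ - Y₀ ∣ T = 1)`. -/
def Δtrue : ℝ := (∫ ω in {ω | T 0 ω = 1}, (Y 1 0 ω - Y 0 0 ω) ∂μ) / p μ T

/-- The regularity conditions: `Θ` is compact with the true `θ` in its interior, overlap, three
bounded continuous derivatives of `π` in `θ`, bounded outcomes, conditional densities bounded away
from `0` and `∞`, invertibility of `M`, and identification of `θ` by the efficient score. -/
structure Regularity : Prop where
  compact : IsCompact 𝔖.Θ
  interior : θ ∈ interior 𝔖.Θ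
  overlap : ∃ c > 0, ∀ y ∈ 𝔖.𝒴 0, ∀ x ∈ 𝔖.𝒳, ∀ θ' ∈ 𝔖.Θ,
    c < 𝔖.π y x.1 θ' ∧ 𝔖.π y x.1 θ' < 1 - c
  smooth : ∃ O : Set (EuclideanSpace ℝ (Fin d)), IsOpen O ∧ 𝔖.Θ ⊆ O ∧ ∃ L : ℝ,
    ∀ y ∈ 𝔖.𝒴 0, ∀ x ∈ 𝔖.𝒳, ContDiffOn ℝ 3 (𝔖.π y x.1) O ∧
      ∀ θ' ∈ O, ∀ k ∈ Finset.Icc 1 3, ‖iteratedFDeriv ℝ k (𝔖.π y x.1) θ'‖ ≤ L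
  bounded : ∃ C : ℝ, ∀ t, ∀ y ∈ 𝔖.𝒴 t, |y| ≤ C
  density_bounds : ∃ c > 0, ∃ C : ℝ, ∀ t, ∀ y ∈ 𝔖.𝒴 t, ∀ x ∈ 𝔖.𝒳, c ≤ f t y x ∧ f t y x ≤ C
  invertible : IsUnit (𝔖.M f θ (μ.map (X 0))).det
  identified : ∀ θ' ∈ 𝔖.Θ, (∀ j, ∫ ω, 𝔖.Seff f θ' (obs T Y X 0 ω) j ∂μ = 0) → θ' = θ

end Sampling

/-! ### Cross-fitting and the estimators -/

section Estimators

variable {Ω : Type*} [MeasurableSpace Ω] (μ : Measure Ω)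
  (T : ℕ → Ω → Fin 2) (Y : Fin 2 → ℕ → Ω → ℝ) (X : ℕ → Ω → Cov dU dZ)

/-- A learner of the two conditional densities: from the observations with indices in a subset `S`
of a sample of size `n` it returns, for `t = 0, 1`, a function of `(y, x)`. -/
abbrev Learner (dU dZ : ℕ) : Type :=
  ∀ n : ℕ, Fin 2 → (S : Finset (Fin n)) → (S → Obs dU dZ) → ℝ → Cov dU dZ → ℝ

/-- Joint measurability of the learner in the training data and the point of evaluation. -/
def MeasurableLearner (learn : Learner dU dZ) : Prop :=
  ∀ n t (S : Finset (Fin n)),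
    Measurable (fun r : (S → Obs dU dZ) × ℝ × Cov dU dZ => learn n t S r.1 r.2.1 r.2.2)

variable {Kf : ℕ} (fold : ∀ n : ℕ, Ω → Fin n → Fin Kf) (learn : Learner dU dZ)

/-- `fold n` is a random partition of `{1, …, n}` into `Kf` folds of equal size (up to rounding)
which is independent of the sample; `fold n ω i` is the fold of the index `i`. -/
structure IsRandomPartition : Prop where
  measurable : ∀ n, Measurable (fold n)
  balanced : ∀ n ω k,
    |((Finset.univ.filter (fun i => fold n ω i = k)).card : ℝ) - (n : ℝ) / (Kf : ℝ)| < 1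
  indep : ∀ n, IndepFun (fold n) (fun ω (i : Fin n) => obs T Y X (i : ℕ) ω) μ

/-- The estimated densities `f̂_t^{[-k]}`, trained on the indices outside fold `k`. -/
def fhat (n : ℕ) (k : Fin Kf) (ω : Ω) : Fin 2 → ℝ → Cov dU dZ → ℝ := fun t =>
  learn n t (Finset.univ.filter (fun i => fold n ω i ≠ k)) (fun i => obs T Y X (i : ℕ) ω)

/-- Quality of the nuisance estimates: for every fold, uniform consistency and mean-square rate
`o_p(n^{-1/4})`. (The mean-square norm is over the units with `T = t`, for which `Y_t` is
observed.) -/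
structure NuisanceQuality : Prop where
  sup : ∀ t (k : Fin Kf), ∀ ε > 0, Tendsto (fun n : ℕ => μ {ω | ∃ y ∈ 𝔖.𝒴 t, ∃ x ∈ 𝔖.𝒳,
    ε < |fhat T Y X fold learn n k ω t y x - f t y x|}) atTop (𝓝 0)
  rate : ∀ t (k : Fin Kf), ∀ ε > 0, Tendsto (fun n : ℕ => μ {ω | ENNReal.ofReal ε <
    ENNReal.ofReal ((n : ℝ) ^ (1 / 4 : ℝ)) *
      eLpNorm (fun r : ℝ × Cov dU dZ =>
        fhat T Y X fold learn n k ω t r.1 r.2 - f t r.1 r.2) 2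
        ((μ.restrict {ω' | T 0 ω' = t}).map (fun ω' => (Y t 0 ω', X 0 ω')))}) atTop (𝓝 0)

/-- `θhat` is an efficient estimator of `θ`: with probability tending to one it solves the
cross-fitted efficient score equation
`n⁻¹ ∑_k ∑_{i ∈ I_k} S_eff(W_i; θ, f̂^{[-k]}) = 0` in `Θ`. -/
structure IsEfficientTheta (θhat : ℕ → Ω → EuclideanSpace ℝ (Fin d)) : Prop where
  measurable : ∀ n, Measurable (θhat n)
  mem : ∀ n ω, θhat n ω ∈ 𝔖.Θ
  solves : Tendsto (fun n : ℕ => μ {ω | ¬ ∀ j : Fin d,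
    (n : ℝ)⁻¹ * ∑ i : Fin n, 𝔖.Seff (fhat T Y X fold learn n (fold n ω i) ω) (θhat n ω)
      (obs T Y X (i : ℕ) ω) j = 0}) atTop (𝓝 0)

/-- `Δ̂_alt(θ)`. -/
def Δalt (n : ℕ) (θ : EuclideanSpace ℝ (Fin d)) (ω : Ω) : ℝ :=
  ((n : ℝ)⁻¹ * ∑ i : Fin n, 𝔖.altNum θ (obs T Y X (i : ℕ) ω)) /
    ((n : ℝ)⁻¹ * ∑ i : Fin n, tval (T (i : ℕ) ω))

/-- `Δ̂_eff(θ)`: the solution in `Δ` of `n⁻¹ ∑_k ∑_{i ∈ I_k} φ(W_i; θ, Δ, f̂^{[-k]}) = 0`. -/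
def Δeff (n : ℕ) (θ : EuclideanSpace ℝ (Fin d)) (ω : Ω) : ℝ :=
  ((n : ℝ)⁻¹ * ∑ i : Fin n,
      𝔖.effNum (fhat T Y X fold learn n (fold n ω i) ω) θ (obs T Y X (i : ℕ) ω)) /
    ((n : ℝ)⁻¹ * ∑ i : Fin n,
      𝔖.effDen (fhat T Y X fold learn n (fold n ω i) ω) θ (obs T Y X (i : ℕ) ω))

/-- The estimator `est` of `Δ` is asymptotically linear with influence function `ψ`:
`E ψ(W) = 0`, `E ψ(W)² < ∞` and `√n (est - Δ) = n^{-1/2} ∑ ψ(W_i) + o_p(1)`. -/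
structure HasInfluenceFunction (est : ℕ → Ω → ℝ) (Δ : ℝ) (ψ : Obs dU dZ → ℝ) : Prop where
  memLp : MemLp (fun ω => ψ (obs T Y X 0 ω)) 2 μ
  mean_zero : ∫ ω, ψ (obs T Y X 0 ω) ∂μ = 0
  linear : TendstoInMeasure μ (fun (n : ℕ) ω =>
    √(n : ℝ) * (est n ω - Δ) - (√(n : ℝ))⁻¹ * ∑ i : Fin n, ψ (obs T Y X (i : ℕ) ω))
    atTop (fun _ => 0)

/-- `√n (est - Δ)` converges in distribution to `N(0, v)`, i.e. `est` has asymptotic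
variance `v`. -/
def HasAsymptoticVariance [IsProbabilityMeasure μ] (est : ℕ → Ω → ℝ) (Δ v : ℝ) : Prop :=
  0 ≤ v ∧ TendstoInDistribution (fun (n : ℕ) ω => √(n : ℝ) * (est n ω - Δ)) atTop
    (id : ℝ → ℝ) (fun _ => μ) (gaussianReal 0 v.toNNReal)

end Estimators

end

end ATTSetup

/-!
Write `R = (t - π) / (1 - π)` for the residual (`ATTSetup.resid`). Given the covariates it is centred
and has conditional variance `B` (`condMean_resid`, `condMean_resid_sq`), and the conditional mean of
minus its gradient in `θ` is `A`. Every part of the theorem comes from these three facts.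

*Efficiency bound.* On the model the average treatment effect on the treated is
`E(R Y) / pr(T = 1)`. Differentiating along a regular submodel with score `s`, the change of the law
contributes a covariance with `s` and the change of `θ` contributes `-Qᵀ θ'`. Differentiating the
identity `E{R a(X)} = 0`, valid throughout the model, gives `E(R a s) = E(a A)ᵀ θ'`
(`integral_resid_mul_score`); with `a = A / B` this expresses `θ'` through the covariance of `s` with
the efficient score, and with `a = V / B` it allows the removal of the component along `R`. The
outcome is that the derivative is `E(φeff s)` for every regular submodel (`hasDerivAt_att`), and the
Cauchy–Schwarz inequality bounds all Cramér–Rao bounds by `E(φeff²)` (`cramerRao_le`). Equality needs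
a submodel with score `φeff`. Any bounded centred `φ` with `E(R φ ∣ x) = vᵀ A(x)` is a score: its
components in the two arms and in the covariates tilt the densities, `θ` moves in the direction `v`,
and the condition on `v` makes the propensity, which is a function of `θ` and `f₀`, move as it should
(`isRegularSubmodel_tiltPath`). The function `φeff` satisfies the condition
(`condMean_resid_mul_φeff`), whence `isEfficiencyBound`.

*Estimators.* Convergence in probability along the sample is convergence along the filter `whp μ` on
pairs `(n, ω)`. Outside the fold of an observation the nuisance estimate is independent of it, and `R`
is conditionally centred, so replacing `a(X; f)` by `a(X; f̂)` in an average of `R a` costs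
`o_p(n^{-1/2})` as soon as `f̂` is uniformly consistent (`tendsto_crossfit_whp`,
`tendsto_cross_resid_mul`): the error is an average of `R` times a small function of the covariates,
and `R` involves no estimated nuisances. A uniform law of large numbers, compactness and
identification give the consistency of the estimator of `θ` (`tendsto_theta`). A first-order expansion
(`isLittleO_expand`) with Jacobian `-M` for the score and the invertibility of `M` give root-`n`
consistency (`tendsto_of_isLittleO`) and the representation of the estimator by the efficient score
(`tendsto_sum_mul_theta`). Inserting it into the expansions of numerator and denominator gives the
influence functions (`tendsto_Δalt`, `tendsto_Δeff`), and the central limit theorem the limit laws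
(`hasAsymptoticVariance`).

*Comparison.* The difference of the influence functions is `R b(X) / p`, where `b` is the residual of
the `B`-weighted regression of `V / B` on the components of `A / B`. It is orthogonal to `φeff`, whose
conditional covariance with `R` is a combination of the components of `A` (`integral_φeff_sq_le`).
-/

set_option linter.unusedSectionVars false

/-! ### Convergence in probability and cross-fitting -/

namespace ATTSetup

section Whp

variable {Ω : Type*} [MeasurableSpace Ω] {μ : Measure Ω}

/-- The filter of the events that hold with probability tending to one: a set `A` of pairs
`(n, ω)` belongs to it if the (outer) probability of its `n`-th section tends to one. Convergence
in probability is convergence along this filter, and the `o_p` calculus is the calculus of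
`=o[whp μ]`. -/
def whp (μ : Measure Ω) : Filter (ℕ × Ω) where
  sets := {A | Tendsto (fun n : ℕ => μ {ω | (n, ω) ∉ A}) atTop (𝓝 0)}
  univ_sets := by simp
  sets_of_superset := by
    intro A B hA hAB
    exact tendsto_of_tendsto_of_tendsto_of_le_of_le tendsto_const_nhds hA (fun _ => zero_le)
      (fun n => measure_mono fun ω h hB => h (hAB hB))
  inter_sets := by
    intro A B hA hB
    have h := Tendsto.add hA hB
    rw [add_zero] at h
    refine tendsto_of_tendsto_of_tendsto_of_le_of_le tendsto_const_nhds h (fun _ => zero_le)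
      (fun n => (measure_mono ?_).trans (measure_union_le _ _))
    intro ω h
    by_cases hA : (n, ω) ∈ A
    · exact Or.inr fun hB => h ⟨hA, hB⟩
    · exact Or.inl hA

lemma eventually_whp {P : ℕ × Ω → Prop} :
    (∀ᶠ q in whp μ, P q) ↔ Tendsto (fun n : ℕ => μ {ω | ¬ P (n, ω)}) atTop (𝓝 0) := Iff.rfl

lemma eventually_whp_of_ae {P : ℕ × Ω → Prop} (h : ∀ n, ∀ᵐ ω ∂μ, P (n, ω)) :
    ∀ᶠ q in whp μ, P q := by
  rw [eventually_whp]
  have : ∀ n, μ {ω | ¬ P (n, ω)} = 0 := fun n => ae_iff.1 (h n)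
  simp [this]

lemma tendstoInMeasure_iff_whp {Z : ℕ → Ω → ℝ} {c : ℝ} :
    TendstoInMeasure μ Z atTop (fun _ => c) ↔
      Tendsto (fun q : ℕ × Ω => Z q.1 q.2) (whp μ) (𝓝 c) := by
  rw [tendstoInMeasure_iff_norm, Metric.tendsto_nhds]
  refine forall₂_congr fun ε hε => ?_
  rw [eventually_whp]
  simp [dist_eq_norm]

/-- An `o_p(1 + |Z_n|)` term is `o_p(1)` if the second moments of `Z_n` are bounded. -/
lemma tendsto_zero_of_isLittleO_tight [IsProbabilityMeasure μ] {V : ℕ × Ω → ℝ}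
    {Z : ℕ → Ω → ℝ} {B : ℝ}
    (hZ : ∀ n, AEMeasurable (Z n) μ) (hB : ∀ n, ∫⁻ ω, ENNReal.ofReal (Z n ω ^ 2) ∂μ ≤ ENNReal.ofReal B)
    (hV : V =o[whp μ] fun q => 1 + |Z q.1 q.2|) : Tendsto V (whp μ) (𝓝 0) := by
  rw [Metric.tendsto_nhds]
  intro ε hε
  rw [eventually_whp, ENNReal.tendsto_nhds_zero]
  intro η hη
  -- the level `K` is chosen so that Chebyshev's bound `B / K²` is at most `η / 2`
  obtain ⟨K, hK, hKη⟩ : ∃ K : ℝ, 0 < K ∧ ENNReal.ofReal B / ENNReal.ofReal (K ^ 2) ≤ η / 2 := by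
    have h1 : Tendsto (fun K : ℝ => ENNReal.ofReal B / ENNReal.ofReal (K ^ 2)) atTop (𝓝 0) := by
      have : Tendsto (fun K : ℝ => ENNReal.ofReal (K ^ 2)) atTop (𝓝 ∞) :=
        ENNReal.tendsto_ofReal_nhds_top.2 (tendsto_pow_atTop two_ne_zero)
      have h := ENNReal.Tendsto.const_div (a := ENNReal.ofReal B) this
        (Or.inr ENNReal.ofReal_ne_top)
      simpa using h
    have h2 := (ENNReal.tendsto_nhds_zero.1 h1) (η / 2) (ENNReal.half_pos hη.ne')
    obtain ⟨K, hK1, hK2⟩ := (h2.and (eventually_gt_atTop 0)).exists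
    exact ⟨K, hK2, hK1⟩
  have hc : 0 < ε / (2 * (1 + K)) := by positivity
  have h1 := hV.def hc
  rw [eventually_whp, ENNReal.tendsto_nhds_zero] at h1
  filter_upwards [h1 (η / 2) (ENNReal.half_pos hη.ne')] with n hn
  calc _ ≤ μ ({ω | ¬ ‖V (n, ω)‖ ≤ ε / (2 * (1 + K)) * ‖1 + |Z n ω|‖} ∪
        {ω | ENNReal.ofReal (K ^ 2) ≤ ENNReal.ofReal (Z n ω ^ 2)}) := by
        refine measure_mono fun ω hω => ?_
        by_contra hcon
        simp only [Set.mem_union, Set.mem_ofPred_eq, not_or, not_le] at hcon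
        obtain ⟨h2, h3⟩ := hcon
        apply hω
        rw [dist_zero_right]
        have h4 : Z n ω ^ 2 < K ^ 2 := by
          by_contra h5
          exact absurd h3 (not_lt.2 (ENNReal.ofReal_le_ofReal (not_lt.1 h5)))
        have h5 : |Z n ω| < K := abs_lt_of_sq_lt_sq h4 hK.le
        have h6 : ‖1 + |Z n ω|‖ ≤ 1 + K := by
          rw [Real.norm_of_nonneg (by positivity)]; linarith
        calc ‖V (n, ω)‖ ≤ ε / (2 * (1 + K)) * ‖1 + |Z n ω|‖ := not_lt.1 h2
          _ ≤ ε / (2 * (1 + K)) * (1 + K) := by gcongr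
          _ = ε / 2 := by field_simp
          _ < ε := by linarith
    _ ≤ η / 2 + η / 2 := by
        refine (measure_union_le _ _).trans (add_le_add hn ?_)
        refine (meas_ge_le_lintegral_div (((hZ n).pow_const 2).ennreal_ofReal)
          (by simpa using hK.ne') ENNReal.ofReal_ne_top).trans ?_
        exact (ENNReal.div_le_div_right (hB n) _).trans hKη
    _ = η := ENNReal.add_halves η

end Whp

section IID

variable {Ω : Type*} [MeasurableSpace Ω] {μ : Measure Ω} [IsProbabilityMeasure μ]
  {𝒲 : Type*} [MeasurableSpace 𝒲] {W : ℕ → Ω → 𝒲}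

/-- The weak law of large numbers. -/
lemma tendsto_average_whp (hind : iIndepFun W μ) (hid : ∀ i, IdentDistrib (W i) (W 0) μ μ)
    {g : 𝒲 → ℝ} (hg : Integrable g (μ.map (W 0))) :
    Tendsto (fun q : ℕ × Ω => (q.1 : ℝ)⁻¹ * ∑ i : Fin q.1, g (W i q.2)) (whp μ)
      (𝓝 (∫ ω, g (W 0 ω) ∂μ)) := by
  have hW : ∀ i, AEMeasurable (W i) μ := fun i => (hid i).aemeasurable_fst
  have hmap : ∀ i, μ.map (W i) = μ.map (W 0) := fun i => (hid i).map_eq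
  have hgm : ∀ i, AEMeasurable g (μ.map (W i)) := fun i => by
    rw [hmap]; exact hg.aemeasurable
  have hind' : iIndepFun (fun i ω => g (W i ω)) μ := hind.comp₀ (fun _ => g) hW hgm
  have hid' : ∀ i, IdentDistrib (fun ω => g (W i ω)) (fun ω => g (W 0 ω)) μ μ := fun i => by
    refine ⟨(hgm i).comp_aemeasurable (hW i), (hgm 0).comp_aemeasurable (hW 0), ?_⟩
    have := fun j => AEMeasurable.map_map_of_aemeasurable (hgm j) (hW j)
    change μ.map (g ∘ W i) = μ.map (g ∘ W 0)
    rw [← this, ← this, hmap]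
  have hint : Integrable (fun ω => g (W 0 ω)) μ := hg.comp_aemeasurable (hW 0)
  -- the almost sure law implies convergence in probability
  have hs := strong_law_ae_real (fun i ω => g (W i ω)) hint
    (fun i j hij => hind'.indepFun hij) hid'
  have hm := tendstoInMeasure_of_tendsto_ae (μ := μ)
    (f := fun (n : ℕ) ω => (∑ i ∈ Finset.range n, g (W i ω)) / n) ?_ hs
  · have h2 := tendstoInMeasure_iff_whp.1 hm
    refine h2.congr fun q => ?_
    rw [Finset.sum_range, div_eq_inv_mul]
  · intro n
    refine AEMeasurable.aestronglyMeasurable ?_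
    exact (Finset.aemeasurable_fun_sum _ fun i _ => (hid' i).aemeasurable_fst).div_const _

/-- Fubini for independent variables: the mean is zero if the inner means are. -/
lemma integral_eq_zero_of_indepFun {α β : Type*} [MeasurableSpace α] [MeasurableSpace β]
    {A : Ω → α} {B : Ω → β} (hA : Measurable A) (hB : Measurable B) (h : IndepFun A B μ)
    {H : α × β → ℝ} (hH : Measurable H) {C : ℝ} (hC : ∀ r, |H r| ≤ C)
    (h0 : ∀ b, ∫ a, H (a, b) ∂(μ.map A) = 0) : ∫ ω, H (A ω, B ω) ∂μ = 0 := by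
  have := Measure.isProbabilityMeasure_map (μ := μ) hA.aemeasurable
  have := Measure.isProbabilityMeasure_map (μ := μ) hB.aemeasurable
  have h1 := (indepFun_iff_map_prod_eq_prod_map_map hA.aemeasurable hB.aemeasurable).1 h
  have h2 : ∫ ω, H (A ω, B ω) ∂μ = ∫ r, H r ∂(μ.map fun ω => (A ω, B ω)) :=
    (integral_map (hA.prodMk hB).aemeasurable hH.aestronglyMeasurable).symm
  rw [h2, h1, integral_prod_symm]
  · simp [h0]
  · exact Integrable.of_bound hH.aestronglyMeasurable C (ae_of_all _ hC)

/-- For a fixed set `S` of training indices, a function of the training data and of one further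
observation whose conditional mean given the training data vanishes has uncorrelated values at the
observations outside `S`. -/
lemma lintegral_sq_sum_compl_le (hW : ∀ i, Measurable (W i)) (hind : iIndepFun W μ)
    (hid : ∀ i, IdentDistrib (W i) (W 0) μ μ) {n : ℕ} (S : Finset (Fin n))
    {g : (S → 𝒲) × 𝒲 → ℝ} (hg : Measurable g) {B : ℝ} (hB : ∀ r, |g r| ≤ B)
    (h0 : ∀ c, ∫ w, g (c, w) ∂(μ.map (W 0)) = 0) :
    ∫ ω, (∑ i ∈ Sᶜ, g (fun j : S => W (j : Fin n) ω, W i ω)) ^ 2 ∂μ ≤ n * B ^ 2 := by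
  have hc : Measurable (fun ω => (fun j : S => W (j : Fin n) ω)) :=
    measurable_pi_lambda _ fun j => hW _
  have hm : ∀ i : Fin n, Measurable (fun ω => g (fun j : S => W (j : Fin n) ω, W i ω)) :=
    fun i => hg.comp (hc.prodMk (hW i))
  have hint : ∀ i j : Fin n, Integrable (fun ω => g (fun j : S => W (j : Fin n) ω, W i ω) *
      g (fun j : S => W (j : Fin n) ω, W j ω)) μ := fun i j =>
    Integrable.of_bound ((hm i).mul (hm j)).aestronglyMeasurable (B * B) (ae_of_all _ fun ω => by
      rw [norm_mul]
      exact mul_le_mul (hB _) (hB _) (norm_nonneg _) ((abs_nonneg _).trans (hB (fun j : S => W (j : Fin n) ω, W i ω))))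
  simp_rw [pow_two (Finset.sum _ _), Finset.sum_mul_sum]
  rw [integral_finsetSum _ fun i _ => integrable_finsetSum _ fun j _ => hint i j]
  simp_rw [integral_finsetSum _ fun j _ => hint _ j]
  -- observation `i` is independent of the others, and the inner mean over it vanishes
  have hoff : ∀ i ∈ Sᶜ, ∀ j ∈ Sᶜ, i ≠ j → ∫ ω, g (fun j : S => W (j : Fin n) ω, W i ω) *
      g (fun j : S => W (j : Fin n) ω, W j ω) ∂μ = 0 := by
    intro i hi j hj hij
    have hind' : iIndepFun (fun (i : Fin n) => W i) μ :=
      hind.precomp (g := fun i : Fin n => (i : ℕ)) Fin.val_injective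
    have hsub : ∀ l : S, (l : Fin n) ∈ Finset.univ.erase i := fun l =>
      Finset.mem_erase.2 ⟨fun h => Finset.mem_compl.1 hi (h ▸ l.2), Finset.mem_univ _⟩
    have h2 : IndepFun (W i) (fun ω (l : (Finset.univ.erase i : Finset (Fin n))) => W l ω) μ := by
      have h3 := hind'.indepFun_finset {i} (Finset.univ.erase i) (by simp) (fun i => hW i)
      exact h3.comp (φ := fun v : (({i} : Finset (Fin n)) → 𝒲) => v ⟨i, by simp⟩)
        (measurable_pi_apply _) measurable_id
    refine integral_eq_zero_of_indepFun (H := fun r => g (fun l : S => r.2 ⟨l, hsub l⟩, r.1) *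
      g (fun l : S => r.2 ⟨l, hsub l⟩, r.2 ⟨j, by simp [hij.symm]⟩)) (C := B * B) (hW i)
      (measurable_pi_lambda _ fun _ => hW _) h2 ?_ ?_ ?_
    · refine (hg.comp ?_).mul (hg.comp ?_) <;> fun_prop
    · intro r
      rw [abs_mul]
      exact mul_le_mul (hB _) (hB _) (abs_nonneg _) ((abs_nonneg _).trans (hB (fun l : S => r.2 ⟨l, hsub l⟩, r.1)))
    · intro b
      refine (integral_mul_const (g (fun l : S => b ⟨l, hsub l⟩, b ⟨j, by simp [hij.symm]⟩))
        (fun a => g (fun l : S => b ⟨l, hsub l⟩, a))).trans ?_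
      rw [(hid i).map_eq, h0, zero_mul]
  calc _ = ∑ i ∈ Sᶜ, ∫ ω, g (fun j : S => W (j : Fin n) ω, W i ω) *
      g (fun j : S => W (j : Fin n) ω, W i ω) ∂μ := by
        refine Finset.sum_congr rfl fun i hi => ?_
        exact Finset.sum_eq_single_of_mem i hi fun j hj hij => hoff i hi j hj hij.symm
    _ ≤ ∑ i ∈ Sᶜ, B ^ 2 := by
        refine Finset.sum_le_sum fun i _ => ?_
        calc _ ≤ ∫ ω, B ^ 2 ∂μ := by
              refine integral_mono (hint i i) (integrable_const _) fun ω => ?_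
              rw [← sq]
              exact sq_le_sq' (abs_le.1 (hB _)).1 (abs_le.1 (hB _)).2
          _ = B ^ 2 := by simp
    _ ≤ n * B ^ 2 := by
        rw [Finset.sum_const, nsmul_eq_mul]
        gcongr
        exact_mod_cast (Finset.card_le_univ _).trans (by simp)

/-- Chebyshev's inequality for the sum over a fold of a function fitted outside the fold, with
conditional means zero. The bound does not depend on the number of folds. -/
lemma measure_crossfit_gt_le (hW : ∀ i, Measurable (W i)) (hind : iIndepFun W μ)
    (hid : ∀ i, IdentDistrib (W i) (W 0) μ μ) {n Kf : ℕ} {fold : Ω → Fin n → Fin Kf}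
    (hfold : Measurable fold) (hfi : IndepFun fold (fun ω (i : Fin n) => W i ω) μ)
    {g : (S : Finset (Fin n)) → (S → 𝒲) × 𝒲 → ℝ} (hg : ∀ S, Measurable (g S)) {B : ℝ}
    (hB : ∀ S r, |g S r| ≤ B) (h0 : ∀ S c, ∫ w, g S (c, w) ∂(μ.map (W 0)) = 0) (k : Fin Kf)
    {t : ℝ} (ht : 0 < t) :
    μ {ω | t ≤ |∑ i with fold ω i = k, g (Finset.univ.filter fun j => fold ω j ≠ k)
      (fun j => W (j : Fin n) ω, W i ω)|} ≤ ENNReal.ofReal (n * B ^ 2 / t ^ 2) := by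
  classical
  -- the sum as a function of the partition and the data, which are independent, so that the
  -- partition may be fixed
  set Z : (Fin n → Fin Kf) → (Fin n → 𝒲) → ℝ := fun v c =>
    ∑ i with v i = k, g (Finset.univ.filter fun j => v j ≠ k) (fun j => c j, c i) with hZ
  have hZm : ∀ v, Measurable (Z v) := fun v => by
    refine Finset.measurable_sum _ fun i _ => (hg _).comp ?_
    fun_prop
  have hdata : Measurable (fun ω (i : Fin n) => W i ω) := measurable_pi_lambda _ fun _ => hW _
  have hv : ∀ v, μ {ω | t ≤ |Z v (fun i => W i ω)|} ≤ ENNReal.ofReal (n * B ^ 2 / t ^ 2) := by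
    intro v
    have hcompl : (Finset.univ.filter fun j => v j ≠ k)ᶜ = Finset.univ.filter fun j => v j = k := by
      ext j; simp
    have h2 := lintegral_sq_sum_compl_le hW hind hid (Finset.univ.filter fun j => v j ≠ k)
      (hg _) (hB _) (h0 _)
    rw [hcompl] at h2
    have h3 : Integrable (fun ω => Z v (fun i => W i ω) ^ 2) μ := by
      refine Integrable.of_bound (((hZm v).comp hdata).pow_const 2).aestronglyMeasurable
        ((n * B) ^ 2) (ae_of_all _ fun ω => ?_)
      rw [norm_pow, Real.norm_eq_abs]
      gcongr
      calc _ ≤ ∑ i with v i = k, |g (Finset.univ.filter fun j => v j ≠ k)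
            (fun j => W (j : Fin n) ω, W i ω)| := Finset.abs_sum_le_sum_abs _ _
        _ ≤ ∑ i with v i = k, B := Finset.sum_le_sum fun i _ => hB _ _
        _ ≤ ∑ i : Fin n, B := by
          refine Finset.sum_le_sum_of_subset_of_nonneg (Finset.subset_univ _) fun i _ _ => ?_
          exact (abs_nonneg _).trans (hB ∅ (fun j => W (j : Fin n) ω, W i ω))
        _ = n * B := by simp
    -- Chebyshev
    have h4 := meas_ge_le_lintegral_div (μ := μ)
      (f := fun ω => ENNReal.ofReal (Z v (fun i => W i ω) ^ 2))
      (((hZm v).comp hdata).pow_const 2).ennreal_ofReal.aemeasurable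
      (ε := ENNReal.ofReal (t ^ 2)) (by simpa using ht.ne') ENNReal.ofReal_ne_top
    rw [← ofReal_integral_eq_lintegral_ofReal h3 (ae_of_all _ fun _ => sq_nonneg _),
      ← ENNReal.ofReal_div_of_pos (by positivity)] at h4
    refine (measure_mono fun ω hω => ?_).trans (h4.trans (ENNReal.ofReal_le_ofReal ?_))
    · refine ENNReal.ofReal_le_ofReal ?_
      exact (pow_le_pow_left₀ ht.le hω 2).trans_eq (sq_abs _)
    · gcongr
  have hsum : ∑ v, μ (fold ⁻¹' {v}) = 1 := by
    have h5 := sum_measure_preimage_singleton (μ := μ) (f := fold) Finset.univ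
      (fun v _ => hfold (measurableSet_singleton v))
    rw [h5]
    simp
  calc _ ≤ μ (⋃ v ∈ (Finset.univ : Finset (Fin n → Fin Kf)), fold ⁻¹' {v} ∩
        (fun ω (i : Fin n) => W i ω) ⁻¹' {c | t ≤ |Z v c|}) := by
        refine measure_mono fun ω hω => ?_
        simp only [Set.mem_iUnion]
        exact ⟨fold ω, Finset.mem_univ _, rfl, hω⟩
    _ ≤ ∑ v, μ (fold ⁻¹' {v} ∩ (fun ω (i : Fin n) => W i ω) ⁻¹' {c | t ≤ |Z v c|}) :=
        measure_biUnion_finset_le _ _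
    _ = ∑ v, μ (fold ⁻¹' {v}) * μ ((fun ω (i : Fin n) => W i ω) ⁻¹' {c | t ≤ |Z v c|}) := by
        refine Finset.sum_congr rfl fun v _ => ?_
        exact hfi.measure_inter_preimage_eq_mul _ _ (measurableSet_singleton v)
          (measurableSet_le measurable_const (hZm v).abs)
    _ ≤ ∑ v, μ (fold ⁻¹' {v}) * ENNReal.ofReal (n * B ^ 2 / t ^ 2) :=
        Finset.sum_le_sum fun v _ => mul_le_mul_right (hv v) _
    _ = _ := by rw [← Finset.sum_mul, hsum, one_mul]

/-- Cross-fitting: if `E{R(W) ∣ x(W)} = 0` and the functions `h`, fitted outside the fold of the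
observation at which they are evaluated, become uniformly small, then
`n^{-1/2} ∑ R(W_i) h(x(W_i))` tends to `0` in probability. No rate is needed for `h`, since given
the training data the summands are centered and uncorrelated. -/
lemma tendsto_crossfit_whp {𝒳 : Type*} [MeasurableSpace 𝒳]
    (hW : ∀ i, Measurable (W i)) (hind : iIndepFun W μ)
    (hid : ∀ i, IdentDistrib (W i) (W 0) μ μ) {Kf : ℕ} {fold : ∀ n : ℕ, Ω → Fin n → Fin Kf}
    (hfold : ∀ n, Measurable (fold n))
    (hfi : ∀ n, IndepFun (fold n) (fun ω (i : Fin n) => W i ω) μ)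
    {x : 𝒲 → 𝒳} (hx : Measurable x) {R : 𝒲 → ℝ} (hR : Measurable R) {C : ℝ}
    (hC : ∀ w, |R w| ≤ C)
    (hR0 : ∀ (φ : 𝒳 → ℝ) (B : ℝ), Measurable φ → (∀ x, |φ x| ≤ B) →
      ∫ w, R w * φ (x w) ∂(μ.map (W 0)) = 0)
    {h : ∀ n (S : Finset (Fin n)), (S → 𝒲) × 𝒳 → ℝ} (hh : ∀ n S, Measurable (h n S))
    (hsmall : ∀ ε > 0, ∀ᶠ q in whp μ, ∀ i : Fin q.1,
      |h q.1 (Finset.univ.filter fun j => fold q.1 q.2 j ≠ fold q.1 q.2 i)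
        (fun j => W (j : Fin q.1) q.2, x (W i q.2))| ≤ ε) :
    Tendsto (fun q : ℕ × Ω => (√(q.1 : ℝ))⁻¹ * ∑ i : Fin q.1, R (W i q.2) *
      h q.1 (Finset.univ.filter fun j => fold q.1 q.2 j ≠ fold q.1 q.2 i)
        (fun j => W (j : Fin q.1) q.2, x (W i q.2))) (whp μ) (𝓝 0) := by
  classical
  have hC0 : 0 ≤ C := by
    obtain ⟨ω⟩ : Nonempty Ω := nonempty_of_isProbabilityMeasure μ
    exact (abs_nonneg _).trans (hC (W 0 ω))
  have key : ∀ k : Fin Kf, Tendsto (fun q : ℕ × Ω => (√(q.1 : ℝ))⁻¹ *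
      ∑ i with fold q.1 q.2 i = k, R (W i q.2) *
        h q.1 (Finset.univ.filter fun j => fold q.1 q.2 j ≠ k)
          (fun j => W (j : Fin q.1) q.2, x (W i q.2))) (whp μ) (𝓝 0) := by
    intro k
    rw [Metric.tendsto_nhds]
    intro ε hε
    rw [eventually_whp, ENNReal.tendsto_nhds_zero]
    intro η hη
    obtain ⟨δ, hδ, hδη⟩ : ∃ δ : ℝ, 0 < δ ∧ ENNReal.ofReal ((C * δ) ^ 2 / ε ^ 2) ≤ η / 2 := by
      have h1 : Tendsto (fun δ : ℝ => ENNReal.ofReal ((C * δ) ^ 2 / ε ^ 2)) (𝓝[>] 0) (𝓝 0) := by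
        have h2 : Continuous fun δ : ℝ => ENNReal.ofReal ((C * δ) ^ 2 / ε ^ 2) :=
          ENNReal.continuous_ofReal.comp (by fun_prop)
        have h3 := h2.tendsto 0
        simp only [mul_zero, ne_eq, OfNat.ofNat_ne_zero, not_false_eq_true, zero_pow, zero_div,
          ENNReal.ofReal_zero] at h3
        exact h3.mono_left nhdsWithin_le_nhds
      have h2 := (ENNReal.tendsto_nhds_zero.1 h1) (η / 2) (ENNReal.half_pos hη.ne')
      obtain ⟨δ, h3, h4⟩ := (h2.and self_mem_nhdsWithin).exists
      exact ⟨δ, h4, h3⟩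
    have hs := hsmall δ hδ
    rw [eventually_whp, ENNReal.tendsto_nhds_zero] at hs
    -- values of `h` above the level `δ` are discarded, which makes the summands bounded
    set g : ∀ n (S : Finset (Fin n)), (S → 𝒲) × 𝒲 → ℝ := fun n S r =>
      R r.2 * {a : ℝ | |a| ≤ δ}.indicator id (h n S (r.1, x r.2)) with hgdef
    have hclip : Measurable ({a : ℝ | |a| ≤ δ}.indicator (id : ℝ → ℝ)) :=
      measurable_id.indicator (measurableSet_le measurable_id.abs measurable_const)
    have hclip_le : ∀ a : ℝ, |{a : ℝ | |a| ≤ δ}.indicator (id : ℝ → ℝ) a| ≤ δ := by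
      intro a
      by_cases ha : |a| ≤ δ
      · rw [Set.indicator_of_mem (by exact ha)]; exact ha
      · rw [Set.indicator_of_notMem (by exact ha), abs_zero]; exact hδ.le
    filter_upwards [hs (η / 2) (ENNReal.half_pos hη.ne')] with n hn
    rcases Nat.eq_zero_or_pos n with rfl | hnpos
    · simp [hε, hη.le]
    have hn' : 0 < √(n : ℝ) := Real.sqrt_pos.2 (by exact_mod_cast hnpos)
    have hcheb := measure_crossfit_gt_le hW hind hid (hfold n) (hfi n) (g := g n)
      (B := C * δ) (fun S => ?_) (fun S r => ?_) (fun S c => ?_) k (t := √n * ε) (by positivity)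
    · calc _ ≤ μ ({ω | ¬ ∀ i : Fin n, |h n (Finset.univ.filter fun j => fold n ω j ≠ fold n ω i)
            (fun j => W (j : Fin n) ω, x (W i ω))| ≤ δ} ∪
          {ω | √n * ε ≤ |∑ i with fold n ω i = k, g n (Finset.univ.filter fun j => fold n ω j ≠ k)
            (fun j => W (j : Fin n) ω, W i ω)|}) := by
            refine measure_mono fun ω hω => ?_
            by_contra hcon
            rw [Set.mem_union, not_or] at hcon
            obtain ⟨h1, h2⟩ := hcon
            have h1 : ∀ i : Fin n, |h n (Finset.univ.filter fun j => fold n ω j ≠ fold n ω i)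
              (fun j => W (j : Fin n) ω, x (W i ω))| ≤ δ := not_not.1 h1
            have h2 : |∑ i with fold n ω i = k, g n (Finset.univ.filter fun j => fold n ω j ≠ k)
              (fun j => W (j : Fin n) ω, W i ω)| < √n * ε := not_le.1 h2
            apply hω
            have h3 : ∑ i with fold n ω i = k, g n (Finset.univ.filter fun j => fold n ω j ≠ k)
                (fun j => W (j : Fin n) ω, W i ω) = ∑ i with fold n ω i = k, R (W i ω) *
                  h n (Finset.univ.filter fun j => fold n ω j ≠ k)
                    (fun j => W (j : Fin n) ω, x (W i ω)) := by
              refine Finset.sum_congr rfl fun i hi => ?_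
              have h4 := h1 i
              rw [(Finset.mem_filter.1 hi).2] at h4
              simp only [hgdef]
              rw [Set.indicator_of_mem (by exact h4)]
              rfl
            rw [h3] at h2
            change dist ((√(n : ℝ))⁻¹ * _) 0 < ε
            rw [dist_zero_right, norm_mul, norm_inv, Real.norm_of_nonneg hn'.le, Real.norm_eq_abs,
              inv_mul_lt_iff₀ hn']
            exact h2
        _ ≤ η / 2 + η / 2 := by
            refine (measure_union_le _ _).trans (add_le_add hn (hcheb.trans ?_))
            refine le_trans (le_of_eq ?_) hδη
            congr 1
            rw [mul_pow √_, Real.sq_sqrt (by positivity)]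
            field_simp
        _ = η := ENNReal.add_halves η
    · exact (hR.comp measurable_snd).mul (hclip.comp ((hh n S).comp
        (measurable_fst.prodMk (hx.comp measurable_snd))))
    · rw [abs_mul]
      exact mul_le_mul (hC _) (hclip_le _) (abs_nonneg _) hC0
    · exact hR0 (fun y => {a : ℝ | |a| ≤ δ}.indicator id (h n S (c, y))) δ
        (hclip.comp ((hh n S).comp measurable_prodMk_left)) (fun y => hclip_le _)
  have hsum := tendsto_finsetSum (Finset.univ : Finset (Fin Kf)) fun k _ => key k
  rw [Finset.sum_const_zero] at hsum
  refine hsum.congr fun q => ?_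
  rw [← Finset.mul_sum]
  congr 1
  rw [← Finset.sum_fiberwise _ (fun i => fold q.1 q.2 i)]
  refine Finset.sum_congr rfl fun k _ => Finset.sum_congr rfl fun i hi => ?_
  rw [(Finset.mem_filter.1 hi).2]

end IID
end ATTSetup

/-! ### First-order expansions with uniform remainders -/

namespace ATTSetup

section Jets

variable {d : ℕ} {κ : Type*} {Θ : Set (EuclideanSpace ℝ (Fin d))} {θ₀ : EuclideanSpace ℝ (Fin d)}
  {S : Set κ} {b : κ → κ} {δ : κ → ℝ}
  {F F' : κ → EuclideanSpace ℝ (Fin d) → ℝ} {G G' : κ → Fin d → ℝ} {C C' : ℝ}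

/-- A family `F k`, `k ∈ S`, of functions on `Θ` that are uniformly bounded, uniformly Lipschitz
and, uniformly in `k`, have the first-order expansion at `θ₀` with gradient `G k` and a quadratic
remainder. The index `k` carries a perturbation of size `δ k` of the unperturbed index `b k`, and
both `F k` and `G k` are within `C * δ k` of their unperturbed values. -/
structure JetBound (Θ : Set (EuclideanSpace ℝ (Fin d))) (θ₀ : EuclideanSpace ℝ (Fin d))
    (S : Set κ) (b : κ → κ) (δ : κ → ℝ) (F : κ → EuclideanSpace ℝ (Fin d) → ℝ)
    (G : κ → Fin d → ℝ) (C : ℝ) : Prop where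
  bdd : ∀ k ∈ S, ∀ θ ∈ Θ, |F k θ| ≤ C
  lip : ∀ k ∈ S, ∀ θ ∈ Θ, ∀ θ' ∈ Θ, |F k θ - F k θ'| ≤ C * ‖θ - θ'‖
  near : ∀ k ∈ S, ∀ θ ∈ Θ, |F k θ - F (b k) θ| ≤ C * δ k
  expand : ∀ k ∈ S, ∀ θ ∈ Θ,
    |F k θ - F k θ₀ - ∑ l, G k l * (θ l - θ₀ l)| ≤ C * ‖θ - θ₀‖ ^ 2
  grad_bdd : ∀ k ∈ S, ∀ l, |G k l| ≤ C
  grad_near : ∀ k ∈ S, ∀ l, |G k l - G (b k) l| ≤ C * δ k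

/-- `JetBound` with an unspecified nonnegative constant. -/
def Jet (Θ : Set (EuclideanSpace ℝ (Fin d))) (θ₀ : EuclideanSpace ℝ (Fin d))
    (S : Set κ) (b : κ → κ) (δ : κ → ℝ) (F : κ → EuclideanSpace ℝ (Fin d) → ℝ)
    (G : κ → Fin d → ℝ) : Prop :=
  ∃ C, 0 ≤ C ∧ JetBound Θ θ₀ S b δ F G C

lemma JetBound.mono (h : JetBound Θ θ₀ S b δ F G C) (hδ : ∀ k ∈ S, 0 ≤ δ k) (hC : C ≤ C') :
    JetBound Θ θ₀ S b δ F G C' where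
  bdd k hk θ hθ := (h.bdd k hk θ hθ).trans hC
  lip k hk θ hθ θ' hθ' := (h.lip k hk θ hθ θ' hθ').trans (by gcongr)
  near k hk θ hθ := (h.near k hk θ hθ).trans (mul_le_mul_of_nonneg_right hC (hδ k hk))
  expand k hk θ hθ := (h.expand k hk θ hθ).trans (by gcongr)
  grad_bdd k hk l := (h.grad_bdd k hk l).trans hC
  grad_near k hk l := (h.grad_near k hk l).trans (mul_le_mul_of_nonneg_right hC (hδ k hk))

lemma Jet.congr (h : Jet Θ θ₀ S b δ F G) (hb : ∀ k ∈ S, b k ∈ S) (hθ₀ : θ₀ ∈ Θ)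
    (hF : ∀ k ∈ S, ∀ θ ∈ Θ, F' k θ = F k θ) (hG : ∀ k ∈ S, ∀ l, G' k l = G k l) :
    Jet Θ θ₀ S b δ F' G' := by
  obtain ⟨C, hC0, h⟩ := h
  refine ⟨C, hC0, ⟨fun k hk θ hθ => ?_, fun k hk θ hθ θ' hθ' => ?_, fun k hk θ hθ => ?_,
    fun k hk θ hθ => ?_, fun k hk l => ?_, fun k hk l => ?_⟩⟩
  · rw [hF k hk θ hθ]; exact h.bdd k hk θ hθ
  · rw [hF k hk θ hθ, hF k hk θ' hθ']; exact h.lip k hk θ hθ θ' hθ'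
  · rw [hF k hk θ hθ, hF _ (hb k hk) θ hθ]; exact h.near k hk θ hθ
  · rw [hF k hk θ hθ, hF k hk θ₀ hθ₀, Finset.sum_congr rfl fun l _ => by rw [hG k hk l]]
    exact h.expand k hk θ hθ
  · rw [hG k hk]; exact h.grad_bdd k hk l
  · rw [hG k hk, hG _ (hb k hk)]; exact h.grad_near k hk l

/-- Jets form an algebra, which is closed under inversion of families bounded away from zero. This
yields all smoothness and stability estimates for the functions `w`, `A`, `B`, `K` below. -/
lemma Jet.add (h : Jet Θ θ₀ S b δ F G) (h' : Jet Θ θ₀ S b δ F' G') :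
    Jet Θ θ₀ S b δ (fun k θ => F k θ + F' k θ) (fun k l => G k l + G' k l) := by
  obtain ⟨C, hC, h⟩ := h
  obtain ⟨D, hD, h'⟩ := h'
  refine ⟨C + D, by positivity, ⟨fun k hk θ hθ => ?_, fun k hk θ hθ θ' hθ' => ?_,
    fun k hk θ hθ => ?_, fun k hk θ hθ => ?_, fun k hk l => ?_, fun k hk l => ?_⟩⟩
  · exact (abs_add_le _ _).trans (add_le_add (h.bdd k hk θ hθ) (h'.bdd k hk θ hθ))
  · rw [add_sub_add_comm, add_mul]
    exact (abs_add_le _ _).trans (add_le_add (h.lip k hk θ hθ _ hθ') (h'.lip k hk θ hθ _ hθ'))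
  · rw [add_sub_add_comm, add_mul]
    exact (abs_add_le _ _).trans (add_le_add (h.near k hk θ hθ) (h'.near k hk θ hθ))
  · simp only [add_mul, Finset.sum_add_distrib]
    rw [add_sub_add_comm, add_sub_add_comm]
    exact (abs_add_le _ _).trans (add_le_add (h.expand k hk θ hθ) (h'.expand k hk θ hθ))
  · exact (abs_add_le _ _).trans (add_le_add (h.grad_bdd k hk l) (h'.grad_bdd k hk l))
  · rw [add_sub_add_comm, add_mul]
    exact (abs_add_le _ _).trans (add_le_add (h.grad_near k hk l) (h'.grad_near k hk l))

/-- Quantities that do not depend on `θ`. -/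
lemma Jet.const {g : κ → ℝ} (hC : 0 ≤ C) (hδ : ∀ k ∈ S, 0 ≤ δ k) (hg : ∀ k ∈ S, |g k| ≤ C)
    (hg' : ∀ k ∈ S, |g k - g (b k)| ≤ C * δ k) :
    Jet Θ θ₀ S b δ (fun k _ => g k) (fun _ _ => 0) := by
  refine ⟨C, hC, ⟨fun k hk θ hθ => hg k hk, fun k hk θ hθ θ' hθ' => ?_,
    fun k hk θ hθ => hg' k hk, fun k hk θ hθ => ?_, fun k hk l => ?_, fun k hk l => ?_⟩⟩
  · simp; positivity
  · simp; positivity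
  · simpa using hC
  · simpa using mul_nonneg hC (hδ k hk)

lemma abs_mul_sub_mul_le {x y x' y' C e : ℝ} (hx : |x| ≤ C) (hy' : |y'| ≤ C)
    (h1 : |x - x'| ≤ e) (h2 : |y - y'| ≤ e) : |x * y - x' * y'| ≤ 2 * C * e := by
  have hC : 0 ≤ C := (abs_nonneg _).trans hx
  have : x * y - x' * y' = x * (y - y') + (x - x') * y' := by ring
  rw [this]
  calc _ ≤ |x| * |y - y'| + |x - x'| * |y'| := by
        rw [← abs_mul, ← abs_mul]; exact abs_add_le _ _
    _ ≤ C * e + e * C := by gcongr; exact (abs_nonneg _).trans h1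
    _ = _ := by ring

lemma Jet.mul (h : Jet Θ θ₀ S b δ F G) (h' : Jet Θ θ₀ S b δ F' G') (hb : ∀ k ∈ S, b k ∈ S)
    (hδ : ∀ k ∈ S, 0 ≤ δ k) (hθ₀ : θ₀ ∈ Θ) :
    Jet Θ θ₀ S b δ (fun k θ => F k θ * F' k θ)
      (fun k l => F k θ₀ * G' k l + F' k θ₀ * G k l) := by
  obtain ⟨C₁, hC₁, h⟩ := h
  obtain ⟨C₂, hC₂, h'⟩ := h'
  obtain ⟨C, hC, h1C, h2C⟩ : ∃ C, 0 ≤ C ∧ C₁ ≤ C ∧ C₂ ≤ C :=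
    ⟨max C₁ C₂, hC₁.trans (le_max_left _ _), le_max_left _ _, le_max_right _ _⟩
  replace h := h.mono hδ h1C
  replace h' := h'.mono hδ h2C
  refine ⟨4 * C ^ 2, by positivity, ⟨fun k hk θ hθ => ?_, fun k hk θ hθ θ' hθ' => ?_,
    fun k hk θ hθ => ?_, fun k hk θ hθ => ?_, fun k hk l => ?_, fun k hk l => ?_⟩⟩
  · rw [abs_mul]
    calc _ ≤ C * C := mul_le_mul (h.bdd k hk θ hθ) (h'.bdd k hk θ hθ) (abs_nonneg _) hC
      _ ≤ _ := by nlinarith [mul_nonneg hC hC]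
  · refine (abs_mul_sub_mul_le (h.bdd k hk θ hθ) (h'.bdd k hk _ hθ') (h.lip k hk θ hθ _ hθ')
      (h'.lip k hk θ hθ _ hθ')).trans ?_
    nlinarith [mul_nonneg (mul_nonneg hC hC) (norm_nonneg (θ - θ'))]
  · refine (abs_mul_sub_mul_le (h.bdd k hk θ hθ) (h'.bdd _ (hb k hk) _ hθ) (h.near k hk θ hθ)
      (h'.near k hk θ hθ)).trans ?_
    nlinarith [mul_nonneg (mul_nonneg hC hC) (hδ k hk)]
  -- the product rule, with the two remainders and the product of the increments left over
  · have e : F k θ * F' k θ - F k θ₀ * F' k θ₀ -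
        ∑ l, (F k θ₀ * G' k l + F' k θ₀ * G k l) * (θ l - θ₀ l) =
        F k θ₀ * (F' k θ - F' k θ₀ - ∑ l, G' k l * (θ l - θ₀ l)) +
        F' k θ₀ * (F k θ - F k θ₀ - ∑ l, G k l * (θ l - θ₀ l)) +
        (F k θ - F k θ₀) * (F' k θ - F' k θ₀) := by
      simp only [add_mul, Finset.sum_add_distrib, mul_assoc, ← Finset.mul_sum]
      ring
    rw [e]
    have e1 := h.expand k hk θ hθ
    have e2 := h'.expand k hk θ hθ
    have e3 := h.lip k hk θ hθ _ hθ₀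
    have e4 := h'.lip k hk θ hθ _ hθ₀
    have e5 := h.bdd k hk _ hθ₀
    have e6 := h'.bdd k hk _ hθ₀
    calc _ ≤ |F k θ₀| * |F' k θ - F' k θ₀ - ∑ l, G' k l * (θ l - θ₀ l)| +
        |F' k θ₀| * |F k θ - F k θ₀ - ∑ l, G k l * (θ l - θ₀ l)| +
        |F k θ - F k θ₀| * |F' k θ - F' k θ₀| := by
          simp only [← abs_mul]
          exact (abs_add_le _ _).trans (add_le_add_left (abs_add_le _ _) _)
      _ ≤ C * (C * ‖θ - θ₀‖ ^ 2) + C * (C * ‖θ - θ₀‖ ^ 2) +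
          (C * ‖θ - θ₀‖) * (C * ‖θ - θ₀‖) := by gcongr
      _ ≤ 4 * C ^ 2 * ‖θ - θ₀‖ ^ 2 := by
          nlinarith [mul_nonneg (mul_nonneg hC hC) (sq_nonneg (‖θ - θ₀‖))]
  · calc _ ≤ |F k θ₀| * |G' k l| + |F' k θ₀| * |G k l| := by
          rw [← abs_mul, ← abs_mul]; exact abs_add_le _ _
      _ ≤ C * C + C * C := by
          gcongr
          · exact h.bdd k hk _ hθ₀
          · exact h'.grad_bdd k hk l
          · exact h'.bdd k hk _ hθ₀
          · exact h.grad_bdd k hk l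
      _ ≤ _ := by nlinarith [mul_nonneg hC hC]
  · rw [add_sub_add_comm]
    refine (abs_add_le _ _).trans ((add_le_add (abs_mul_sub_mul_le (h.bdd k hk _ hθ₀)
      (h'.grad_bdd _ (hb k hk) l) (h.near k hk _ hθ₀) (h'.grad_near k hk l))
      (abs_mul_sub_mul_le (h'.bdd k hk _ hθ₀) (h.grad_bdd _ (hb k hk) l)
      (h'.near k hk _ hθ₀) (h.grad_near k hk l))).trans (le_of_eq ?_))
    ring

lemma Jet.const_mul {c : ℝ} (h : Jet Θ θ₀ S b δ F G) (hδ : ∀ k ∈ S, 0 ≤ δ k)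
    (hb : ∀ k ∈ S, b k ∈ S) (hθ₀ : θ₀ ∈ Θ) :
    Jet Θ θ₀ S b δ (fun k θ => c * F k θ) (fun k l => c * G k l) := by
  have h1 : Jet Θ θ₀ S b δ (fun _ _ => c) (fun _ _ => 0) :=
    Jet.const (g := fun _ => c) (C := |c|) (abs_nonneg c) hδ (fun _ _ => le_rfl)
      (fun k hk => by simpa using mul_nonneg (abs_nonneg c) (hδ k hk))
  refine (h1.mul h hb hδ hθ₀).congr hb hθ₀ (fun _ _ _ _ => rfl) fun k _ l => by simp

lemma Jet.sub (h : Jet Θ θ₀ S b δ F G) (h' : Jet Θ θ₀ S b δ F' G') (hδ : ∀ k ∈ S, 0 ≤ δ k)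
    (hb : ∀ k ∈ S, b k ∈ S) (hθ₀ : θ₀ ∈ Θ) :
    Jet Θ θ₀ S b δ (fun k θ => F k θ - F' k θ) (fun k l => G k l - G' k l) := by
  refine (h.add (h'.const_mul (c := -1) hδ hb hθ₀)).congr hb hθ₀ (fun _ _ _ _ => ?_)
    fun _ _ _ => ?_ <;> ring

lemma abs_inv_sub_inv_le {x y m e : ℝ} (hm : 0 < m) (hx : m ≤ |x|) (hy : m ≤ |y|)
    (h : |x - y| ≤ e) : |x⁻¹ - y⁻¹| ≤ m⁻¹ ^ 2 * e := by
  have hx0 : x ≠ 0 := abs_pos.1 (hm.trans_le hx)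
  have hy0 : y ≠ 0 := abs_pos.1 (hm.trans_le hy)
  have : x⁻¹ - y⁻¹ = x⁻¹ * y⁻¹ * (y - x) := by field_simp
  rw [this, abs_mul, abs_mul, abs_inv, abs_inv, abs_sub_comm, sq]
  gcongr

lemma Jet.inv (h : Jet Θ θ₀ S b δ F G) (hb : ∀ k ∈ S, b k ∈ S)
    (hδ : ∀ k ∈ S, 0 ≤ δ k) (hθ₀ : θ₀ ∈ Θ) {m : ℝ} (hm : 0 < m)
    (hF : ∀ k ∈ S, ∀ θ ∈ Θ, m ≤ |F k θ|) :
    Jet Θ θ₀ S b δ (fun k θ => (F k θ)⁻¹) (fun k l => -((F k θ₀)⁻¹ ^ 2 * G k l)) := by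
  obtain ⟨C, hC, h⟩ := h
  set μ := m⁻¹ with hμ
  have hμ0 : 0 < μ := inv_pos.2 hm
  have hinv : ∀ k ∈ S, ∀ θ ∈ Θ, |(F k θ)⁻¹| ≤ μ := fun k hk θ hθ => by
    rw [abs_inv]
    exact inv_anti₀ hm (hF k hk θ hθ)
  -- each of the six bounds contributes one summand to the constant
  refine ⟨μ + μ ^ 2 * C + μ ^ 3 * C ^ 2 * 2, by positivity, ⟨fun k hk θ hθ => ?_,
    fun k hk θ hθ θ' hθ' => ?_, fun k hk θ hθ => ?_, fun k hk θ hθ => ?_, fun k hk l => ?_,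
    fun k hk l => ?_⟩⟩
  · refine (hinv k hk θ hθ).trans ?_
    have : 0 ≤ μ ^ 2 * C + μ ^ 3 * C ^ 2 * 2 := by positivity
    linarith
  · refine (abs_inv_sub_inv_le hm (hF k hk θ hθ) (hF k hk _ hθ') (h.lip k hk θ hθ _ hθ')).trans ?_
    rw [← hμ, ← mul_assoc]
    gcongr
    have : 0 ≤ μ + μ ^ 3 * C ^ 2 * 2 := by positivity
    linarith
  · refine (abs_inv_sub_inv_le hm (hF k hk θ hθ) (hF _ (hb k hk) _ hθ)
      (h.near k hk θ hθ)).trans ?_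
    rw [← hμ, ← mul_assoc]
    refine mul_le_mul_of_nonneg_right ?_ (hδ k hk)
    have : 0 ≤ μ + μ ^ 3 * C ^ 2 * 2 := by positivity
    linarith
  · have hx0 : F k θ ≠ 0 := abs_pos.1 (hm.trans_le (hF k hk θ hθ))
    have hy0 : F k θ₀ ≠ 0 := abs_pos.1 (hm.trans_le (hF k hk _ hθ₀))
    -- exact form of the remainder, from `1/x - 1/y = -(x - y)/y² + (x - y)²/(x y²)`
    have e : (F k θ)⁻¹ - (F k θ₀)⁻¹ - ∑ l, -((F k θ₀)⁻¹ ^ 2 * G k l) * (θ l - θ₀ l) =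
        -((F k θ₀)⁻¹ ^ 2 * (F k θ - F k θ₀ - ∑ l, G k l * (θ l - θ₀ l))) +
        (F k θ)⁻¹ * (F k θ₀)⁻¹ ^ 2 * (F k θ - F k θ₀) ^ 2 := by
      simp only [neg_mul, mul_assoc, Finset.sum_neg_distrib, ← Finset.mul_sum]
      field_simp
      ring
    have e1 := h.expand k hk θ hθ
    have e3 := h.lip k hk θ hθ _ hθ₀
    rw [e]
    calc _ ≤ |(F k θ₀)⁻¹| ^ 2 * |F k θ - F k θ₀ - ∑ l, G k l * (θ l - θ₀ l)| +
          |(F k θ)⁻¹| * |(F k θ₀)⁻¹| ^ 2 * |F k θ - F k θ₀| ^ 2 := by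
          refine (abs_add_le _ _).trans (le_of_eq ?_)
          rw [abs_neg, abs_mul, abs_mul, abs_mul, abs_pow, abs_pow]
      _ ≤ μ ^ 2 * (C * ‖θ - θ₀‖ ^ 2) + μ * μ ^ 2 * (C * ‖θ - θ₀‖) ^ 2 := by
          gcongr
          · exact hinv k hk _ hθ₀
          · exact hinv k hk _ hθ
          · exact hinv k hk _ hθ₀
      _ = (μ ^ 2 * C + μ ^ 3 * C ^ 2) * ‖θ - θ₀‖ ^ 2 := by ring
      _ ≤ _ := by
          refine mul_le_mul_of_nonneg_right ?_ (sq_nonneg _)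
          have : 0 ≤ μ + μ ^ 3 * C ^ 2 := by positivity
          linarith
  · rw [abs_neg, abs_mul, abs_pow]
    calc _ ≤ μ ^ 2 * C := by
          gcongr
          · exact hinv k hk _ hθ₀
          · exact h.grad_bdd k hk l
      _ ≤ _ := by
          have : 0 ≤ μ + μ ^ 3 * C ^ 2 * 2 := by positivity
          linarith
  · have hd := abs_inv_sub_inv_le hm (hF k hk _ hθ₀) (hF _ (hb k hk) _ hθ₀) (h.near k hk _ hθ₀)
    rw [← hμ] at hd
    have h3 := hinv k hk _ hθ₀
    have h4 := hinv _ (hb k hk) _ hθ₀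
    have h5 := h.grad_near k hk l
    have h6 := h.grad_bdd k hk l
    have hδk := hδ k hk
    have e : -((F k θ₀)⁻¹ ^ 2 * G k l) - -((F (b k) θ₀)⁻¹ ^ 2 * G (b k) l) =
        -((F (b k) θ₀)⁻¹ ^ 2 * (G k l - G (b k) l) +
        ((F k θ₀)⁻¹ + (F (b k) θ₀)⁻¹) * ((F k θ₀)⁻¹ - (F (b k) θ₀)⁻¹) * G k l) := by ring
    rw [e, abs_neg]
    calc _ ≤ |(F (b k) θ₀)⁻¹| ^ 2 * |G k l - G (b k) l| +
          (|(F k θ₀)⁻¹| + |(F (b k) θ₀)⁻¹|) * |(F k θ₀)⁻¹ - (F (b k) θ₀)⁻¹| * |G k l| := by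
          refine (abs_add_le _ _).trans ?_
          rw [abs_mul, abs_mul, abs_mul, abs_pow]
          gcongr
          exact abs_add_le _ _
      _ ≤ μ ^ 2 * (C * δ k) + (μ + μ) * (μ ^ 2 * (C * δ k)) * C := by gcongr
      _ = (μ ^ 2 * C + μ ^ 3 * C ^ 2 * 2) * δ k := by ring
      _ ≤ _ := by
          refine mul_le_mul_of_nonneg_right ?_ hδk
          linarith

/-- Reindexing. -/
lemma Jet.comp {κ' : Type*} {S' : Set κ'} {b' : κ' → κ'} {δ' : κ' → ℝ} (φ : κ' → κ)
    (h : Jet Θ θ₀ S b δ F G) (hS : ∀ k ∈ S', φ k ∈ S)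
    (hF : ∀ k ∈ S', F (b (φ k)) = F (φ (b' k))) (hG : ∀ k ∈ S', G (b (φ k)) = G (φ (b' k)))
    (hδ : ∀ k ∈ S', δ (φ k) ≤ δ' k) :
    Jet Θ θ₀ S' b' δ' (fun k => F (φ k)) (fun k => G (φ k)) := by
  obtain ⟨C, hC, h⟩ := h
  refine ⟨C, hC, ⟨fun k hk => h.bdd _ (hS k hk), fun k hk => h.lip _ (hS k hk),
    fun k hk θ hθ => ?_, fun k hk => h.expand _ (hS k hk), fun k hk => h.grad_bdd _ (hS k hk),
    fun k hk l => ?_⟩⟩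
  · rw [← hF k hk]
    exact (h.near _ (hS k hk) θ hθ).trans (mul_le_mul_of_nonneg_left (hδ k hk) hC)
  · rw [← hG k hk]
    exact (h.grad_near _ (hS k hk) l).trans (mul_le_mul_of_nonneg_left (hδ k hk) hC)

end Jets
end ATTSetup

/-! ### Smoothness of the treatment model -/

namespace ATTSetup

section Taylor

variable {d : ℕ} {κ : Type*} {Θ O : Set (EuclideanSpace ℝ (Fin d))}
  {θ₀ : EuclideanSpace ℝ (Fin d)}

lemma apply_eq_sum_single (φ : EuclideanSpace ℝ (Fin d) →L[ℝ] ℝ) (v : EuclideanSpace ℝ (Fin d)) :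
    φ v = ∑ l, φ (EuclideanSpace.single l 1) * v l := by
  conv_lhs => rw [← (EuclideanSpace.basisFun (Fin d) ℝ).sum_repr v]
  simp [mul_comm]

/-- Twice continuously differentiable functions with bounds that are uniform on a neighbourhood of
the compact set `Θ`. Points of `Θ` at distance less than a Lebesgue number of the neighbourhood
are joined by a segment inside it; for the others the bounds hold trivially. -/
lemma Jet.of_contDiffOn {S : Set κ} {g : κ → EuclideanSpace ℝ (Fin d) → ℝ} (hΘ : IsCompact Θ)
    (hO : IsOpen O) (hΘO : Θ ⊆ O) (hθ₀ : θ₀ ∈ Θ) (hg : ∀ k ∈ S, ContDiffOn ℝ 2 (g k) O) {L : ℝ}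
    (hL : 0 ≤ L) (h0 : ∀ k ∈ S, ∀ θ ∈ Θ, |g k θ| ≤ L)
    (h1 : ∀ k ∈ S, ∀ θ ∈ O, ‖iteratedFDeriv ℝ 1 (g k) θ‖ ≤ L)
    (h2 : ∀ k ∈ S, ∀ θ ∈ O, ‖iteratedFDeriv ℝ 2 (g k) θ‖ ≤ L) :
    Jet Θ θ₀ S id (fun _ => 0) g (fun k l => fderiv ℝ (g k) θ₀ (EuclideanSpace.single l 1)) := by
  -- `Θ` need not be convex: near points are compared along a segment in a ball inside `O`, and for
  -- points at distance at least `r` the uniform bounds suffice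
  obtain ⟨r, hr, hrO⟩ := hΘ.exists_thickening_subset_open hO hΘO
  have hball : ∀ θ ∈ Θ, Metric.ball θ r ⊆ O := fun θ hθ =>
    (Metric.ball_subset_thickening hθ r).trans hrO
  have hd : ∀ k ∈ S, ∀ θ ∈ O, DifferentiableAt ℝ (g k) θ := fun k hk θ hθ =>
    ((hg k hk).contDiffAt (hO.mem_nhds hθ)).differentiableAt (by norm_num)
  have hd1 : ∀ k ∈ S, ∀ θ ∈ O, ‖fderiv ℝ (g k) θ‖ ≤ L := fun k hk θ hθ => by
    rw [← norm_iteratedFDeriv_one]; exact h1 k hk θ hθ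
  have hdd : ∀ k ∈ S, ∀ θ ∈ O, DifferentiableAt ℝ (fderiv ℝ (g k)) θ := fun k hk θ hθ =>
    (((hg k hk).contDiffAt (hO.mem_nhds hθ)).fderiv_right (m := 1) (by norm_num)).differentiableAt
      (by norm_num)
  have hd2 : ∀ k ∈ S, ∀ θ ∈ O, ‖fderiv ℝ (fderiv ℝ (g k)) θ‖ ≤ L := fun k hk θ hθ => by
    rw [← norm_iteratedFDeriv_one, norm_iteratedFDeriv_fderiv]; exact h2 k hk θ hθ
  refine ⟨L + 2 * L / r + (2 * L / r ^ 2 + L / r), by positivity, ⟨fun k hk θ hθ => ?_,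
    fun k hk θ hθ θ' hθ' => ?_, fun k hk θ hθ => by simp, fun k hk θ hθ => ?_,
    fun k hk l => ?_, fun k hk l => by simp⟩⟩
  · refine (h0 k hk θ hθ).trans ?_
    have : 0 ≤ 2 * L / r + (2 * L / r ^ 2 + L / r) := by positivity
    linarith
  · rcases lt_or_ge ‖θ - θ'‖ r with hlt | hge
    · have := (convex_ball θ' r).norm_image_sub_le_of_norm_fderiv_le (𝕜 := ℝ) (f := g k) (C := L)
        (fun x hx => hd k hk x (hball θ' hθ' hx)) (fun x hx => hd1 k hk x (hball θ' hθ' hx))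
        (Metric.mem_ball_self hr) (y := θ) (by rwa [mem_ball_iff_norm])
      refine this.trans ?_
      gcongr
      have : 0 ≤ 2 * L / r + (2 * L / r ^ 2 + L / r) := by positivity
      linarith
    · calc |g k θ - g k θ'| ≤ L + L :=
            (abs_sub _ _).trans (add_le_add (h0 k hk θ hθ) (h0 k hk θ' hθ'))
        _ = 2 * L / r * r := by field_simp; ring
        _ ≤ 2 * L / r * ‖θ - θ'‖ := by gcongr
        _ ≤ _ := by
            gcongr
            have : 0 ≤ L + (2 * L / r ^ 2 + L / r) := by positivity
            linarith
  · have e : ∑ l, fderiv ℝ (g k) θ₀ (EuclideanSpace.single l 1) * (θ l - θ₀ l) =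
        fderiv ℝ (g k) θ₀ (θ - θ₀) := by
      rw [apply_eq_sum_single _ (θ - θ₀)]; rfl
    rw [e]
    rcases lt_or_ge ‖θ - θ₀‖ r with hlt | hge
    · have hsub : Metric.closedBall θ₀ ‖θ - θ₀‖ ⊆ O :=
        (Metric.closedBall_subset_ball hlt).trans (hball θ₀ hθ₀)
      have hl : ∀ x ∈ Metric.closedBall θ₀ ‖θ - θ₀‖,
          ‖fderiv ℝ (g k) x - fderiv ℝ (g k) θ₀‖ ≤ L * ‖θ - θ₀‖ := by
        intro x hx
        have := (convex_closedBall θ₀ ‖θ - θ₀‖).norm_image_sub_le_of_norm_fderiv_le (𝕜 := ℝ)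
          (f := fderiv ℝ (g k)) (C := L) (fun x hx => hdd k hk x (hsub hx))
          (fun x hx => hd2 k hk x (hsub hx)) (Metric.mem_closedBall_self (norm_nonneg _)) hx
        refine this.trans ?_
        gcongr
        exact mem_closedBall_iff_norm.1 hx
      have := (convex_closedBall θ₀ ‖θ - θ₀‖).norm_image_sub_le_of_norm_hasFDerivWithin_le'
        (f := g k) (f' := fderiv ℝ (g k))
        (fun x hx => ((hd k hk x (hsub hx)).hasFDerivAt).hasFDerivWithinAt) hl
        (Metric.mem_closedBall_self (norm_nonneg _)) (y := θ) (by rw [mem_closedBall_iff_norm])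
      rw [Real.norm_eq_abs] at this
      refine this.trans ?_
      rw [mul_assoc, ← sq]
      gcongr
      have : 0 ≤ 2 * L / r + (2 * L / r ^ 2 + L / r) := by positivity
      linarith
    · have h3 : |fderiv ℝ (g k) θ₀ (θ - θ₀)| ≤ L * ‖θ - θ₀‖ :=
        ((fderiv ℝ (g k) θ₀).le_opNorm _).trans
          (mul_le_mul_of_nonneg_right (hd1 k hk _ (hΘO hθ₀)) (norm_nonneg _))
      have h4 : 1 ≤ ‖θ - θ₀‖ / r := (one_le_div hr).2 hge
      calc _ ≤ L + L + L * ‖θ - θ₀‖ := (abs_sub _ _).trans (add_le_add ((abs_sub _ _).trans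
            (add_le_add (h0 k hk θ hθ) (h0 k hk _ hθ₀))) h3)
        _ ≤ (L + L) * (‖θ - θ₀‖ / r) ^ 2 + L * ‖θ - θ₀‖ * (‖θ - θ₀‖ / r) := by
            refine add_le_add (le_mul_of_one_le_right (by positivity) (one_le_pow₀ h4))
              (le_mul_of_one_le_right (by positivity) h4)
        _ = (2 * L / r ^ 2 + L / r) * ‖θ - θ₀‖ ^ 2 := by field_simp; ring
        _ ≤ _ := by
            refine mul_le_mul_of_nonneg_right ?_ (sq_nonneg _)
            have : 0 ≤ L + 2 * L / r := by positivity
            linarith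
  · have h3 : |fderiv ℝ (g k) θ₀ (EuclideanSpace.single l 1)| ≤ L * 1 := by
      refine ((fderiv ℝ (g k) θ₀).le_opNorm _).trans ?_
      rw [PiLp.norm_single]
      simpa using hd1 k hk _ (hΘO hθ₀)
    refine h3.trans ?_
    have : 0 ≤ 2 * L / r + (2 * L / r ^ 2 + L / r) := by positivity
    linarith

/-- The gradient at an interior point is a limit of difference quotients. -/
lemma Jet.measurable_grad [MeasurableSpace κ] {S : Set κ} {b : κ → κ} {δ : κ → ℝ}
    {F : κ → EuclideanSpace ℝ (Fin d) → ℝ} {G : κ → Fin d → ℝ} (h : Jet Θ θ₀ S b δ F G)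
    (hθ₀ : θ₀ ∈ interior Θ) (hm : ∀ θ ∈ Θ, Measurable (S.indicator fun k => F k θ)) (l : Fin d) :
    Measurable (S.indicator fun k => G k l) := by
  obtain ⟨C, hC, h⟩ := h
  obtain ⟨r, hr, hrΘ⟩ := Metric.isOpen_iff.1 isOpen_interior θ₀ hθ₀
  obtain ⟨N, hN⟩ := exists_nat_one_div_lt hr
  set e : EuclideanSpace ℝ (Fin d) := EuclideanSpace.single l 1 with he
  have hnorm : ‖e‖ = 1 := by rw [he, PiLp.norm_single]; simp
  -- step sizes small enough to stay inside `Θ`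
  set s : ℕ → ℝ := fun n => 1 / (((n + N : ℕ) : ℝ) + 1) with hs
  have hs0 : ∀ n, 0 < s n := fun n => Nat.one_div_pos_of_nat
  have hmem : ∀ n, θ₀ + s n • e ∈ Θ := fun n => by
    refine interior_subset (hrΘ ?_)
    rw [mem_ball_iff_norm, add_sub_cancel_left, norm_smul, hnorm, mul_one,
      Real.norm_of_nonneg (hs0 n).le]
    refine lt_of_le_of_lt ?_ hN
    exact Nat.one_div_le_one_div (Nat.le_add_left N n)
  have hlim : Tendsto s atTop (𝓝 0) :=
    tendsto_one_div_add_atTop_nhds_zero_nat.comp (tendsto_add_atTop_nat N)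
  have hθ₀' := interior_subset hθ₀
  refine measurable_of_tendsto_metrizable (f := fun n k => (s n)⁻¹ *
    (S.indicator (fun k => F k (θ₀ + s n • e)) k - S.indicator (fun k => F k θ₀) k))
    (fun n => ((hm _ (hmem n)).sub (hm _ hθ₀')).const_mul _) ?_
  rw [tendsto_pi_nhds]
  intro k
  by_cases hk : k ∈ S
  · simp only [Set.indicator_of_mem hk]
    rw [tendsto_iff_norm_sub_tendsto_zero]
    refine squeeze_zero (fun _ => norm_nonneg _) (g := fun n => C * s n) (fun n => ?_)
      (by simpa using hlim.const_mul C)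
    have h1 := h.expand k hk _ (hmem n)
    have h2 : ∑ i, G k i * ((θ₀ + s n • e) i - θ₀ i) = s n * G k l := by
      rw [Finset.sum_eq_single l]
      · simp [he, mul_comm]
      · intro i _ hi
        simp [he, hi]
      · simp
    rw [h2, add_sub_cancel_left, norm_smul, hnorm, mul_one, Real.norm_of_nonneg (hs0 n).le] at h1
    have h3 : (s n)⁻¹ * (F k (θ₀ + s n • e) - F k θ₀) - G k l =
        (s n)⁻¹ * (F k (θ₀ + s n • e) - F k θ₀ - s n * G k l) := by
      have := (hs0 n).ne'
      field_simp
    rw [h3, norm_mul, norm_inv, Real.norm_of_nonneg (hs0 n).le, Real.norm_eq_abs,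
      inv_mul_le_iff₀ (hs0 n)]
    exact h1.trans_eq (by ring)
  · simp [hk]

end Taylor

variable {d dU dZ : ℕ} {𝔖 : ATTSetup d dU dZ} {f : Fin 2 → ℝ → Cov dU dZ → ℝ}
  {θ₀ : EuclideanSpace ℝ (Fin d)} {c C : ℝ}

/-- The analytic part of the assumptions, with constants `c` and `C`. -/
structure RegularModel (𝔖 : ATTSetup d dU dZ) (f : Fin 2 → ℝ → Cov dU dZ → ℝ)
    (θ₀ : EuclideanSpace ℝ (Fin d)) (c C : ℝ) : Prop where
  compact : IsCompact 𝔖.Θ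
  interior : θ₀ ∈ interior 𝔖.Θ
  measurableSet_𝒴 : ∀ t, MeasurableSet (𝔖.𝒴 t)
  measurableSet_𝒳 : MeasurableSet 𝔖.𝒳
  measurable_π : ∀ θ, Measurable (fun r : ℝ × EuclideanSpace ℝ (Fin dU) => 𝔖.π r.1 r.2 θ)
  measurable_f : ∀ t, Measurable (fun r : ℝ × Cov dU dZ => f t r.1 r.2)
  finite : ∀ t, IsFiniteMeasure ((𝔖.ν t).restrict (𝔖.𝒴 t))
  c_pos : 0 < c
  C_nonneg : 0 ≤ C
  overlap : ∀ y ∈ 𝔖.𝒴 0, ∀ x ∈ 𝔖.𝒳, ∀ θ' ∈ 𝔖.Θ, c < 𝔖.π y x.1 θ' ∧ 𝔖.π y x.1 θ' < 1 - c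
  smooth : ∃ O : Set (EuclideanSpace ℝ (Fin d)), IsOpen O ∧ 𝔖.Θ ⊆ O ∧ ∃ L : ℝ,
    ∀ y ∈ 𝔖.𝒴 0, ∀ x ∈ 𝔖.𝒳, ContDiffOn ℝ 3 (𝔖.π y x.1) O ∧
      ∀ θ' ∈ O, ∀ k ∈ Finset.Icc 1 3, ‖iteratedFDeriv ℝ k (𝔖.π y x.1) θ'‖ ≤ L
  outcome_le : ∀ t, ∀ y ∈ 𝔖.𝒴 t, |y| ≤ C
  density_bounds : ∀ t, ∀ y ∈ 𝔖.𝒴 t, ∀ x ∈ 𝔖.𝒳, c ≤ f t y x ∧ f t y x ≤ C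

namespace RegularModel

lemma theta_mem (h : RegularModel 𝔖 f θ₀ c C) : θ₀ ∈ 𝔖.Θ := interior_subset h.interior

end RegularModel

lemma πdot_eq_fderiv (𝔖 : ATTSetup d dU dZ) (y : ℝ) (u : EuclideanSpace ℝ (Fin dU))
    (θ : EuclideanSpace ℝ (Fin d)) (j : Fin d) :
    𝔖.πdot y u θ j = fderiv ℝ (𝔖.π y u) θ (EuclideanSpace.single j 1) := by
  unfold πdot
  rw [← inner_gradient_left, EuclideanSpace.inner_single_right]
  simp

/-- The range of `(Y_t, X)`. -/
def rangeYX (𝔖 : ATTSetup d dU dZ) (t : Fin 2) : Set (ℝ × Cov dU dZ) := 𝔖.𝒴 t ×ˢ 𝔖.𝒳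

namespace RegularModel

lemma measurableSet_rangeYX (h : RegularModel 𝔖 f θ₀ c C) (t : Fin 2) :
    MeasurableSet (𝔖.rangeYX t) := (h.measurableSet_𝒴 t).prod h.measurableSet_𝒳

/-- Jets of functions of `(y₀, x)` and `θ`, without perturbation. -/
abbrev PointJet (𝔖 : ATTSetup d dU dZ) (θ₀ : EuclideanSpace ℝ (Fin d)) (t : Fin 2)
    (F : ℝ × Cov dU dZ → EuclideanSpace ℝ (Fin d) → ℝ) (G : ℝ × Cov dU dZ → Fin d → ℝ) : Prop :=
  Jet 𝔖.Θ θ₀ (𝔖.rangeYX t) id (fun _ => 0) F G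

lemma jet_π (h : RegularModel 𝔖 f θ₀ c C) :
    PointJet 𝔖 θ₀ 0 (fun r θ => 𝔖.π r.1 r.2.1 θ) (fun r l => 𝔖.πdot r.1 r.2.1 θ₀ l) := by
  obtain ⟨O, hO, hΘO, L, hL⟩ := h.smooth
  have hp : ∀ k ∈ 𝔖.rangeYX 0, ContDiffOn ℝ 3 (𝔖.π k.1 k.2.1) O ∧
      ∀ θ' ∈ O, ∀ j ∈ Finset.Icc 1 3, ‖iteratedFDeriv ℝ j (𝔖.π k.1 k.2.1) θ'‖ ≤ L :=
    fun k hk => hL k.1 hk.1 k.2 hk.2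
  have := Jet.of_contDiffOn (S := 𝔖.rangeYX 0) (g := fun r θ => 𝔖.π r.1 r.2.1 θ) (L := |L| + 1)
    h.compact hO hΘO h.theta_mem
    (fun k hk => (hp k hk).1.of_le (by norm_num)) (by positivity)
    (fun k hk θ hθ => by
      obtain ⟨h1, h2⟩ := h.overlap k.1 hk.1 k.2 hk.2 θ hθ
      have := h.c_pos
      have := abs_nonneg L
      rw [abs_le]; constructor <;> linarith)
    (fun k hk θ hθ => ((hp k hk).2 θ hθ 1 (by simp)).trans (by linarith [le_abs_self L]))
    (fun k hk θ hθ => ((hp k hk).2 θ hθ 2 (by simp)).trans (by linarith [le_abs_self L]))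
  exact this.congr (fun _ => id) h.theta_mem (fun _ _ _ _ => rfl)
    (fun k _ l => πdot_eq_fderiv 𝔖 _ _ _ _)

/-- The third derivative of `π` is used here: the components of the gradient are themselves smooth
in `θ` with uniform bounds. -/
lemma jet_πdot (h : RegularModel 𝔖 f θ₀ c C) (j : Fin d) :
    ∃ G, PointJet 𝔖 θ₀ 0 (fun r θ => 𝔖.πdot r.1 r.2.1 θ j) G := by
  obtain ⟨O, hO, hΘO, L, hL⟩ := h.smooth
  have hp : ∀ k ∈ 𝔖.rangeYX 0, ContDiffOn ℝ 3 (𝔖.π k.1 k.2.1) O ∧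
      ∀ θ' ∈ O, ∀ j ∈ Finset.Icc 1 3, ‖iteratedFDeriv ℝ j (𝔖.π k.1 k.2.1) θ'‖ ≤ L :=
    fun k hk => hL k.1 hk.1 k.2 hk.2
  set ev : (EuclideanSpace ℝ (Fin d) →L[ℝ] ℝ) →L[ℝ] ℝ :=
    ContinuousLinearMap.apply ℝ ℝ (EuclideanSpace.single j 1) with hev
  have hfun : ∀ k : ℝ × Cov dU dZ, (fun θ => 𝔖.πdot k.1 k.2.1 θ j) =
      ev ∘ fderiv ℝ (𝔖.π k.1 k.2.1) := fun k => by
    funext θ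
    simp [hev, πdot_eq_fderiv]
  have hev1 : ‖ev‖ ≤ 1 := by
    refine ContinuousLinearMap.opNorm_le_bound _ zero_le_one fun φ => ?_
    have := φ.le_opNorm (EuclideanSpace.single j 1)
    rw [PiLp.norm_single] at this
    simpa [hev] using this
  have hfd : ∀ k ∈ 𝔖.rangeYX 0, ContDiffOn ℝ 2 (fderiv ℝ (𝔖.π k.1 k.2.1)) O := fun k hk =>
    (hp k hk).1.fderiv_of_isOpen hO (by norm_num)
  have hbd : ∀ k ∈ 𝔖.rangeYX 0, ∀ θ ∈ O, ∀ i : ℕ, i ≤ 2 →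
      ‖iteratedFDeriv ℝ i (fun θ => 𝔖.πdot k.1 k.2.1 θ j) θ‖ ≤ |L| := by
    intro k hk θ hθ i hi
    rw [hfun k]
    calc _ ≤ ‖ev‖ * ‖iteratedFDeriv ℝ i (fderiv ℝ (𝔖.π k.1 k.2.1)) θ‖ :=
          ev.norm_iteratedFDeriv_comp_left ((hfd k hk).contDiffAt (hO.mem_nhds hθ))
            (by exact_mod_cast hi)
      _ ≤ 1 * L := by
          rw [norm_iteratedFDeriv_fderiv]
          gcongr
          exact (hp k hk).2 θ hθ (i + 1) (by simp; omega)
      _ ≤ |L| := by rw [one_mul]; exact le_abs_self L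
  exact ⟨_, Jet.of_contDiffOn (S := 𝔖.rangeYX 0) (g := fun r θ => 𝔖.πdot r.1 r.2.1 θ j)
    h.compact hO hΘO h.theta_mem
    (fun k hk => by
      rw [hfun k]
      exact ev.contDiff.comp_contDiffOn (hfd k hk)) (abs_nonneg L)
    (fun k hk θ hθ => by
      have := hbd k hk θ (hΘO hθ) 0 (by norm_num)
      rwa [norm_iteratedFDeriv_zero] at this)
    (fun k hk θ hθ => hbd k hk θ hθ 1 (by norm_num))
    (fun k hk θ hθ => hbd k hk θ hθ 2 (by norm_num))⟩

lemma measurable_π' (h : RegularModel 𝔖 f θ₀ c C) (θ : EuclideanSpace ℝ (Fin d)) :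
    Measurable (fun r : ℝ × Cov dU dZ => 𝔖.π r.1 r.2.1 θ) :=
  (h.measurable_π θ).comp (measurable_fst.prodMk (measurable_fst.comp measurable_snd))

lemma measurable_πdot (h : RegularModel 𝔖 f θ₀ c C) {θ : EuclideanSpace ℝ (Fin d)}
    (hθ : θ ∈ 𝔖.Θ) (j : Fin d) :
    Measurable ((𝔖.rangeYX 0).indicator fun r => 𝔖.πdot r.1 r.2.1 θ j) := by
  obtain ⟨O, hO, hΘO, L, hL⟩ := h.smooth
  refine measurable_of_tendsto_metrizable (f := fun (n : ℕ) => (𝔖.rangeYX 0).indicator fun r =>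
    (n : ℝ) * (𝔖.π r.1 r.2.1 (θ + (n : ℝ)⁻¹ • EuclideanSpace.single j 1) - 𝔖.π r.1 r.2.1 θ))
    (fun n => Measurable.indicator (((h.measurable_π' _).sub (h.measurable_π' _)).const_mul _)
      (h.measurableSet_rangeYX 0)) ?_
  rw [tendsto_pi_nhds]
  intro k
  by_cases hk : k ∈ 𝔖.rangeYX 0
  · simp only [Set.indicator_of_mem hk]
    rw [πdot_eq_fderiv]
    have hd : HasFDerivAt (𝔖.π k.1 k.2.1) (fderiv ℝ (𝔖.π k.1 k.2.1) θ) θ :=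
      (((hL k.1 hk.1 k.2 hk.2).1.contDiffAt (hO.mem_nhds (hΘO hθ))).differentiableAt
        (by norm_num)).hasFDerivAt
    exact (hd.lim_real (EuclideanSpace.single j 1)).comp tendsto_natCast_atTop_atTop
  · simp [hk]

end RegularModel
end ATTSetup

/-! ### Conditional means under perturbed densities -/

namespace ATTSetup

variable {d dU dZ : ℕ} {𝔖 : ATTSetup d dU dZ} {f : Fin 2 → ℝ → Cov dU dZ → ℝ}
  {θ₀ : EuclideanSpace ℝ (Fin d)} {c C : ℝ}

/-- Candidate conditional densities. -/
abbrev Nuis (dU dZ : ℕ) : Type := Fin 2 → ℝ → Cov dU dZ → ℝ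

/-- The covariate values at which the conditional densities integrate to one. -/
def goodX (𝔖 : ATTSetup d dU dZ) (f : Nuis dU dZ) : Set (Cov dU dZ) :=
  {x | x ∈ 𝔖.𝒳 ∧ ∀ t, ∫ y in 𝔖.𝒴 t, f t y x ∂(𝔖.ν t) = 1}

/-- `g` is uniformly within `δ` of `f`, and so close to it that it is still nonnegative and has
total masses bounded away from zero. -/
structure Adm (𝔖 : ATTSetup d dU dZ) (f g : Nuis dU dZ) (δ : ℝ) : Prop where
  nonneg : 0 ≤ δ
  le_one : δ ≤ 1
  meas : ∀ t, Measurable (fun r : ℝ × Cov dU dZ => g t r.1 r.2)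
  near : ∀ t, ∀ y ∈ 𝔖.𝒴 t, ∀ x ∈ 𝔖.𝒳, |g t y x - f t y x| ≤ δ
  dens_nonneg : ∀ t, ∀ y ∈ 𝔖.𝒴 t, ∀ x ∈ 𝔖.𝒳, 0 ≤ g t y x
  half_le : ∀ t, ∀ x ∈ goodX 𝔖 f, 1 / 2 ≤ ∫ y in 𝔖.𝒴 t, g t y x ∂(𝔖.ν t)

/-- Covariate values together with a perturbation of `f` and its size. -/
def idx (𝔖 : ATTSetup d dU dZ) (f : Nuis dU dZ) : Set (Cov dU dZ × Nuis dU dZ × ℝ) :=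
  {k | k.1 ∈ goodX 𝔖 f ∧ Adm 𝔖 f k.2.1 k.2.2}

/-- Jets of functions of `x` and `θ` that depend on the conditional densities. -/
abbrev CovJet (𝔖 : ATTSetup d dU dZ) (f : Nuis dU dZ) (θ₀ : EuclideanSpace ℝ (Fin d))
    (a : Nuis dU dZ → EuclideanSpace ℝ (Fin d) → Cov dU dZ → ℝ)
    (G : Cov dU dZ × Nuis dU dZ × ℝ → Fin d → ℝ) : Prop :=
  Jet 𝔖.Θ θ₀ (idx 𝔖 f) (fun k => (k.1, f, 0)) (fun k => k.2.2) (fun k θ => a k.2.1 θ k.1) G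

namespace RegularModel

lemma adm_self (h : RegularModel 𝔖 f θ₀ c C) : Adm 𝔖 f f 0 where
  nonneg := le_rfl
  le_one := zero_le_one
  meas := h.measurable_f
  near := by simp
  dens_nonneg t y hy x hx := h.c_pos.le.trans (h.density_bounds t y hy x hx).1
  half_le t x hx := by rw [hx.2 t]; norm_num

lemma idx_base (h : RegularModel 𝔖 f θ₀ c C) {k : Cov dU dZ × Nuis dU dZ × ℝ}
    (hk : k ∈ idx 𝔖 f) : ((k.1, f, 0) : Cov dU dZ × Nuis dU dZ × ℝ) ∈ idx 𝔖 f :=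
  ⟨hk.1, h.adm_self⟩

lemma idx_nonneg {k : Cov dU dZ × Nuis dU dZ × ℝ}
    (hk : k ∈ idx 𝔖 f) : 0 ≤ k.2.2 := hk.2.nonneg

lemma adm_le (h : RegularModel 𝔖 f θ₀ c C) {g : Nuis dU dZ} {δ : ℝ} (hg : Adm 𝔖 f g δ)
    {t : Fin 2} {y : ℝ} (hy : y ∈ 𝔖.𝒴 t) {x : Cov dU dZ} (hx : x ∈ 𝔖.𝒳) : |g t y x| ≤ C + 1 := by
  have h1 := hg.near t y hy x hx
  have h2 := (h.density_bounds t y hy x hx).2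
  have h3 := hg.dens_nonneg t y hy x hx
  have h4 := hg.le_one
  rw [abs_of_nonneg h3]
  linarith [le_abs_self (g t y x - f t y x)]

lemma aestronglyMeasurable_section (h : RegularModel 𝔖 f θ₀ c C) {t : Fin 2}
    {q : ℝ × Cov dU dZ → ℝ} (hq : Measurable ((𝔖.rangeYX t).indicator q)) {x : Cov dU dZ}
    (hx : x ∈ 𝔖.𝒳) :
    AEStronglyMeasurable (fun y => q (y, x)) ((𝔖.ν t).restrict (𝔖.𝒴 t)) := by
  have h1 : Measurable (fun y => (𝔖.rangeYX t).indicator q (y, x)) :=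
    hq.comp (measurable_id.prodMk measurable_const)
  refine h1.aestronglyMeasurable.congr ?_
  filter_upwards [ae_restrict_mem (h.measurableSet_𝒴 t)] with y hy
  exact Set.indicator_of_mem (show (y, x) ∈ 𝔖.rangeYX t from ⟨hy, hx⟩) _

lemma integrable_mul_dens (h : RegularModel 𝔖 f θ₀ c C) {t : Fin 2}
    {q : ℝ × Cov dU dZ → ℝ} (hq : Measurable ((𝔖.rangeYX t).indicator q)) {D : ℝ}
    (hD : ∀ r ∈ 𝔖.rangeYX t, |q r| ≤ D) {x : Cov dU dZ} (hx : x ∈ 𝔖.𝒳) {g : Nuis dU dZ} {δ : ℝ}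
    (hg : Adm 𝔖 f g δ) :
    Integrable (fun y => q (y, x) * g t y x) ((𝔖.ν t).restrict (𝔖.𝒴 t)) := by
  have := h.finite t
  have hm : Measurable fun y => g t y x := (hg.meas t).comp (measurable_id.prodMk measurable_const)
  refine Integrable.of_bound ((h.aestronglyMeasurable_section hq hx).mul hm.aestronglyMeasurable)
    (D * (C + 1)) ?_
  filter_upwards [ae_restrict_mem (h.measurableSet_𝒴 t)] with y hy
  rw [norm_mul]
  have h1 := hD (y, x) ⟨hy, hx⟩
  exact mul_le_mul h1 (h.adm_le hg hy hx) (norm_nonneg _) ((abs_nonneg _).trans h1)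

lemma abs_setIntegral_le (h : RegularModel 𝔖 f θ₀ c C) {t : Fin 2} {q : ℝ → ℝ} {D : ℝ}
    (hD : ∀ y ∈ 𝔖.𝒴 t, |q y| ≤ D) :
    |∫ y in 𝔖.𝒴 t, q y ∂(𝔖.ν t)| ≤ D * (𝔖.ν t).real (𝔖.𝒴 t) := by
  have := h.finite t
  refine norm_setIntegral_le_of_norm_le_const (f := q) (μ := 𝔖.ν t) ?_ hD
  simpa using measure_lt_top ((𝔖.ν t).restrict (𝔖.𝒴 t)) Set.univ

/-- A lower bound of the integrand, times the total mass of `g t`, which need not be one, bounds the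
conditional mean from below. -/
lemma condE_mono_of_le (h : RegularModel 𝔖 f θ₀ c C) {t : Fin 2}
    {q : ℝ × Cov dU dZ → ℝ} (hq : Measurable ((𝔖.rangeYX t).indicator q)) {D m : ℝ}
    (hD : ∀ r ∈ 𝔖.rangeYX t, |q r| ≤ D) {x : Cov dU dZ} (hx : x ∈ 𝔖.𝒳) {g : Nuis dU dZ} {δ : ℝ}
    (hg : Adm 𝔖 f g δ) (hm : ∀ r ∈ 𝔖.rangeYX t, m ≤ q r) :
    m * ∫ y in 𝔖.𝒴 t, g t y x ∂(𝔖.ν t) ≤ 𝔖.condE g t (fun y => q (y, x)) x := by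
  unfold condE
  rw [← integral_const_mul]
  refine setIntegral_mono_on ?_ (h.integrable_mul_dens hq hD hx hg) (h.measurableSet_𝒴 t)
    fun y hy => mul_le_mul_of_nonneg_right (hm _ ⟨hy, hx⟩) (hg.dens_nonneg t y hy x hx)
  exact h.integrable_mul_dens (q := fun _ => m)
    (measurable_const.indicator (h.measurableSet_rangeYX t)) (D := |m|) (fun _ _ => le_rfl) hx hg

/-- Jets are preserved by conditional means. -/
lemma jet_condE (h : RegularModel 𝔖 f θ₀ c C) {t : Fin 2}
    {q : ℝ × Cov dU dZ → EuclideanSpace ℝ (Fin d) → ℝ} {G : ℝ × Cov dU dZ → Fin d → ℝ}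
    (hq : PointJet 𝔖 θ₀ t q G)
    (hm : ∀ θ ∈ 𝔖.Θ, Measurable ((𝔖.rangeYX t).indicator fun r => q r θ)) :
    CovJet 𝔖 f θ₀ (fun g θ x => 𝔖.condE g t (fun y => q (y, x) θ) x)
      (fun k l => ∫ y in 𝔖.𝒴 t, G (y, k.1) l * k.2.1 t y k.1 ∂(𝔖.ν t)) := by
  have hGm := hq.measurable_grad h.interior hm
  obtain ⟨D, hD, hq⟩ := hq
  have hθ₀ := h.theta_mem
  -- all six bounds come from the pointwise ones: the dominating measure is finite on the range, and
  -- the perturbed density is at most `C + 1`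
  set N := (𝔖.ν t).real (𝔖.𝒴 t) with hN
  have hN0 : 0 ≤ N := measureReal_nonneg
  have hC := h.C_nonneg
  have hint : ∀ k ∈ idx 𝔖 f, ∀ θ ∈ 𝔖.Θ, Integrable (fun y => q (y, k.1) θ * k.2.1 t y k.1)
      ((𝔖.ν t).restrict (𝔖.𝒴 t)) := fun k hk θ hθ =>
    h.integrable_mul_dens (hm θ hθ) (fun r hr => hq.bdd r hr θ hθ) hk.1.1 hk.2
  have hintG : ∀ k ∈ idx 𝔖 f, ∀ l, Integrable (fun y => G (y, k.1) l * k.2.1 t y k.1)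
      ((𝔖.ν t).restrict (𝔖.𝒴 t)) := fun k hk l =>
    h.integrable_mul_dens (hGm l) (fun r hr => hq.grad_bdd r hr l) hk.1.1 hk.2
  have hbase : ∀ k ∈ idx 𝔖 f, ((k.1, f, 0) : Cov dU dZ × Nuis dU dZ × ℝ) ∈ idx 𝔖 f :=
    fun k hk => h.idx_base hk
  have key : ∀ k ∈ idx 𝔖 f, ∀ y ∈ 𝔖.𝒴 t, ∀ {a e : ℝ}, |a| ≤ D * e →
      |a * k.2.1 t y k.1| ≤ D * e * (C + 1) := fun k hk y hy a e ha => by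
    rw [abs_mul]
    exact mul_le_mul ha (h.adm_le hk.2 hy hk.1.1) (abs_nonneg _) ((abs_nonneg _).trans ha)
  have hcmp : ∀ e, 0 ≤ e → D * e * (C + 1) * N ≤ D * (C + 1) * (N + 1) * e := fun e he => by
    have : 0 ≤ D * (C + 1) * e := by positivity
    nlinarith
  have hcmp' : ∀ e, 0 ≤ e → D * e * N ≤ D * (C + 1) * (N + 1) * e := fun e he => by
    have h1 : 0 ≤ D * e := by positivity
    have h2 : 0 ≤ D * e * N := by positivity
    nlinarith [mul_nonneg h1 hC, mul_nonneg h2 hC]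
  have hdiff : ∀ k ∈ idx 𝔖 f, ∀ y ∈ 𝔖.𝒴 t, ∀ {a : ℝ}, |a| ≤ D →
      |a * k.2.1 t y k.1 - a * f t y k.1| ≤ D * k.2.2 := fun k hk y hy a ha => by
    rw [← mul_sub, abs_mul]
    exact mul_le_mul ha (hk.2.near t y hy _ hk.1.1) (abs_nonneg _) hD
  refine ⟨D * (C + 1) * (N + 1), by positivity, ⟨fun k hk θ hθ => ?_, fun k hk θ hθ θ' hθ' => ?_,
    fun k hk θ hθ => ?_, fun k hk θ hθ => ?_, fun k hk l => ?_, fun k hk l => ?_⟩⟩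
  · have := h.abs_setIntegral_le (t := t) (q := fun y => q (y, k.1) θ * k.2.1 t y k.1)
      fun y hy => key k hk y hy (e := 1) (by simpa using hq.bdd _ ⟨hy, hk.1.1⟩ θ hθ)
    exact this.trans (by simpa using hcmp 1 zero_le_one)
  · have := h.abs_setIntegral_le (t := t) (q := fun y => (q (y, k.1) θ - q (y, k.1) θ') *
        k.2.1 t y k.1) fun y hy => key k hk y hy (hq.lip _ ⟨hy, hk.1.1⟩ θ hθ θ' hθ')
    simp_rw [sub_mul] at this
    rw [integral_sub (hint k hk θ hθ) (hint k hk θ' hθ')] at this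
    exact this.trans (hcmp _ (norm_nonneg _))
  · have := h.abs_setIntegral_le (t := t) (q := fun y => q (y, k.1) θ * k.2.1 t y k.1 -
      q (y, k.1) θ * f t y k.1) fun y hy => hdiff k hk y hy (hq.bdd _ ⟨hy, hk.1.1⟩ θ hθ)
    rw [integral_sub (hint k hk θ hθ) (hint _ (hbase k hk) θ hθ)] at this
    exact this.trans (hcmp' _ hk.2.nonneg)
  · have := h.abs_setIntegral_le (t := t) (q := fun y => (q (y, k.1) θ - q (y, k.1) θ₀ -
        ∑ l, G (y, k.1) l * (θ l - θ₀ l)) * k.2.1 t y k.1)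
      fun y hy => key k hk y hy (hq.expand _ ⟨hy, hk.1.1⟩ θ hθ)
    have e : ∫ y in 𝔖.𝒴 t, (q (y, k.1) θ - q (y, k.1) θ₀ -
        ∑ l, G (y, k.1) l * (θ l - θ₀ l)) * k.2.1 t y k.1 ∂(𝔖.ν t) =
        𝔖.condE k.2.1 t (fun y => q (y, k.1) θ) k.1 - 𝔖.condE k.2.1 t (fun y => q (y, k.1) θ₀) k.1
        - ∑ l, (∫ y in 𝔖.𝒴 t, G (y, k.1) l * k.2.1 t y k.1 ∂(𝔖.ν t)) * (θ l - θ₀ l) := by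
      have e1 : ∀ y, (q (y, k.1) θ - q (y, k.1) θ₀ -
          ∑ l, G (y, k.1) l * (θ l - θ₀ l)) * k.2.1 t y k.1 = q (y, k.1) θ * k.2.1 t y k.1 -
          q (y, k.1) θ₀ * k.2.1 t y k.1 -
          ∑ l, (G (y, k.1) l * k.2.1 t y k.1) * (θ l - θ₀ l) := fun y => by
        rw [sub_mul, sub_mul, Finset.sum_mul]
        congr 1
        exact Finset.sum_congr rfl fun l _ => by ring
      simp_rw [e1]
      rw [integral_sub, integral_sub (hint k hk θ hθ) (hint k hk θ₀ hθ₀), integral_finsetSum]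
      · simp_rw [integral_mul_const]
        rfl
      · exact fun l _ => (hintG k hk l).mul_const _
      · exact (hint k hk θ hθ).sub (hint k hk θ₀ hθ₀)
      · exact integrable_finsetSum _ fun l _ => (hintG k hk l).mul_const _
    rw [e] at this
    exact this.trans (hcmp _ (sq_nonneg _))
  · have := h.abs_setIntegral_le (t := t) (q := fun y => G (y, k.1) l * k.2.1 t y k.1)
      fun y hy => key k hk y hy (e := 1) (by simpa using hq.grad_bdd _ ⟨hy, hk.1.1⟩ l)
    exact this.trans (by simpa using hcmp 1 zero_le_one)
  · have := h.abs_setIntegral_le (t := t) (q := fun y => G (y, k.1) l * k.2.1 t y k.1 -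
      G (y, k.1) l * f t y k.1) fun y hy => hdiff k hk y hy (hq.grad_bdd _ ⟨hy, hk.1.1⟩ l)
    rw [integral_sub (hintG k hk l) (hintG _ (hbase k hk) l)] at this
    exact this.trans (hcmp' _ hk.2.nonneg)

end RegularModel
end ATTSetup

/-! ### The functions `w`, `A`, `B` and `K` -/

namespace ATTSetup

variable {d dU dZ : ℕ} {𝔖 : ATTSetup d dU dZ} {f : Fin 2 → ℝ → Cov dU dZ → ℝ}
  {θ₀ : EuclideanSpace ℝ (Fin d)} {c C : ℝ}

/-- The ratio `A(x) / B(x)` in the efficient score. -/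
noncomputable def ratioA (𝔖 : ATTSetup d dU dZ) (j : Fin d) (g : Nuis dU dZ)
    (θ : EuclideanSpace ℝ (Fin d)) (x : Cov dU dZ) : ℝ :=
  𝔖.condE g 0 (fun y => ((1 - 𝔖.π y x.1 θ) ^ 2)⁻¹ * 𝔖.πdot y x.1 θ j) x /
    𝔖.condE g 0 (fun y => ((1 - 𝔖.π y x.1 θ) ^ 2)⁻¹ * 𝔖.π y x.1 θ) x

/-- The ratio `V(x) / B(x)` in the efficient influence function. -/
noncomputable def ratioV (𝔖 : ATTSetup d dU dZ) (Δ : ℝ) (g : Nuis dU dZ)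
    (θ : EuclideanSpace ℝ (Fin d)) (x : Cov dU dZ) : ℝ :=
  (𝔖.B g θ x)⁻¹ * 𝔖.K g θ x - Δ * (𝔖.w g θ x / 𝔖.B g θ x)

lemma Seff_eq (g : Nuis dU dZ) (θ : EuclideanSpace ℝ (Fin d)) (o : Obs dU dZ) (j : Fin d) :
    𝔖.Seff g θ o j = 𝔖.resid θ o * 𝔖.ratioA j g θ o.2.2 := rfl

lemma altNum_eq (θ : EuclideanSpace ℝ (Fin d)) (o : Obs dU dZ) :
    𝔖.altNum θ o = 𝔖.resid θ o * o.2.1 := by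
  unfold altNum resid; ring

lemma effNum_sub_mul_effDen (Δ : ℝ) (g : Nuis dU dZ) (θ : EuclideanSpace ℝ (Fin d))
    (o : Obs dU dZ) : 𝔖.effNum g θ o - Δ * 𝔖.effDen g θ o =
      𝔖.altNum θ o - tval o.1 * Δ - 𝔖.resid θ o * 𝔖.ratioV Δ g θ o.2.2 := by
  rw [altNum_eq]; unfold effNum effDen ratioV; ring

namespace RegularModel

section Point

lemma one_sub_pi_bounds (h : RegularModel 𝔖 f θ₀ c C) {r : ℝ × Cov dU dZ}
    (hr : r ∈ 𝔖.rangeYX 0) {θ : EuclideanSpace ℝ (Fin d)} (hθ : θ ∈ 𝔖.Θ) :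
    c ≤ 1 - 𝔖.π r.1 r.2.1 θ ∧ 1 - 𝔖.π r.1 r.2.1 θ ≤ 1 ∧ c ≤ 𝔖.π r.1 r.2.1 θ := by
  obtain ⟨h1, h2⟩ := h.overlap r.1 hr.1 r.2 hr.2 θ hθ
  have := h.c_pos
  refine ⟨?_, ?_, ?_⟩ <;> linarith

lemma pointJet_mul (h : RegularModel 𝔖 f θ₀ c C) {t : Fin 2}
    {q q' : ℝ × Cov dU dZ → EuclideanSpace ℝ (Fin d) → ℝ} {G G' : ℝ × Cov dU dZ → Fin d → ℝ}
    (hq : PointJet 𝔖 θ₀ t q G) (hq' : PointJet 𝔖 θ₀ t q' G') :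
    PointJet 𝔖 θ₀ t (fun r θ => q r θ * q' r θ)
      (fun r l => q r θ₀ * G' r l + q' r θ₀ * G r l) :=
  Jet.mul hq hq' (fun _ => id) (fun _ _ => le_rfl) h.theta_mem

lemma jet_inv_one_sub (h : RegularModel 𝔖 f θ₀ c C) :
    PointJet 𝔖 θ₀ 0 (fun r θ => (1 - 𝔖.π r.1 r.2.1 θ)⁻¹)
      (fun r l => ((1 - 𝔖.π r.1 r.2.1 θ₀) ^ 2)⁻¹ * 𝔖.πdot r.1 r.2.1 θ₀ l) := by
  have h1 : PointJet 𝔖 θ₀ 0 (fun _ _ => (1 : ℝ)) (fun _ _ => 0) :=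
    Jet.const (g := fun _ => 1) zero_le_one (fun _ _ => le_rfl) (fun _ _ => by simp)
      (fun _ _ => by simp)
  have h2 := Jet.sub h1 h.jet_π (fun _ _ => le_rfl) (fun _ => id) h.theta_mem
  have h3 := Jet.inv h2 (fun _ => id) (fun _ _ => le_rfl) h.theta_mem h.c_pos
    (fun k hk θ hθ => (h.one_sub_pi_bounds hk hθ).1.trans (le_abs_self _))
  refine h3.congr (fun _ => id) h.theta_mem (fun _ _ _ _ => rfl) fun k hk l => ?_
  rw [inv_pow]; ring

lemma jet_inv_sq (h : RegularModel 𝔖 f θ₀ c C) :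
    ∃ G, PointJet 𝔖 θ₀ 0 (fun r θ => ((1 - 𝔖.π r.1 r.2.1 θ) ^ 2)⁻¹) G :=
  ⟨_, (h.pointJet_mul h.jet_inv_one_sub h.jet_inv_one_sub).congr (fun _ => id) h.theta_mem
    (fun k hk θ hθ => by rw [sq, mul_inv]) fun _ _ _ => rfl⟩

/-- The gradient of the odds `π / (1 - π)` is `(1 - π)⁻²` times that of `π`. -/
lemma jet_odds (h : RegularModel 𝔖 f θ₀ c C) :
    PointJet 𝔖 θ₀ 0 (fun r θ => 𝔖.π r.1 r.2.1 θ / (1 - 𝔖.π r.1 r.2.1 θ))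
      (fun r l => ((1 - 𝔖.π r.1 r.2.1 θ₀) ^ 2)⁻¹ * 𝔖.πdot r.1 r.2.1 θ₀ l) := by
  refine (h.pointJet_mul h.jet_π h.jet_inv_one_sub).congr (fun _ => id) h.theta_mem
    (fun _ _ _ _ => div_eq_mul_inv _ _) fun k hk l => ?_
  have := (h.c_pos.trans_le (h.one_sub_pi_bounds hk h.theta_mem).1).ne'
  field_simp
  ring

lemma jet_outcome (h : RegularModel 𝔖 f θ₀ c C) (t : Fin 2) :
    PointJet 𝔖 θ₀ t (fun r _ => r.1) (fun _ _ => 0) :=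
  Jet.const (g := fun r : ℝ × Cov dU dZ => r.1) h.C_nonneg (fun _ _ => le_rfl)
    (fun r hr => h.outcome_le t r.1 hr.1) (fun _ _ => by simp)

end Point

section Cov

variable {a a' : Nuis dU dZ → EuclideanSpace ℝ (Fin d) → Cov dU dZ → ℝ}

lemma covJet_mul (h : RegularModel 𝔖 f θ₀ c C) (ha : ∃ G, CovJet 𝔖 f θ₀ a G)
    (ha' : ∃ G, CovJet 𝔖 f θ₀ a' G) :
    ∃ G, CovJet 𝔖 f θ₀ (fun g θ x => a g θ x * a' g θ x) G := by
  obtain ⟨G, hG⟩ := ha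
  obtain ⟨G', hG'⟩ := ha'
  exact ⟨_, Jet.mul hG hG' (fun k hk => h.idx_base hk) (fun k hk => idx_nonneg hk) h.theta_mem⟩

lemma covJet_add (ha : ∃ G, CovJet 𝔖 f θ₀ a G)
    (ha' : ∃ G, CovJet 𝔖 f θ₀ a' G) :
    ∃ G, CovJet 𝔖 f θ₀ (fun g θ x => a g θ x + a' g θ x) G := by
  obtain ⟨G, hG⟩ := ha
  obtain ⟨G', hG'⟩ := ha'
  exact ⟨_, Jet.add hG hG'⟩

lemma covJet_const (r : ℝ) : ∃ G, CovJet 𝔖 f θ₀ (fun _ _ _ => r) G :=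
  ⟨_, Jet.const (g := fun _ => r) (abs_nonneg r) (fun k hk => idx_nonneg hk)
    (fun _ _ => le_rfl) (fun k hk => by
      simpa using mul_nonneg (abs_nonneg r) (idx_nonneg hk))⟩

lemma covJet_inv (h : RegularModel 𝔖 f θ₀ c C) (ha : ∃ G, CovJet 𝔖 f θ₀ a G) {m : ℝ}
    (hm : 0 < m) (hma : ∀ k ∈ idx 𝔖 f, ∀ θ ∈ 𝔖.Θ, m ≤ a k.2.1 θ k.1) :
    ∃ G, CovJet 𝔖 f θ₀ (fun g θ x => (a g θ x)⁻¹) G := by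
  obtain ⟨G, hG⟩ := ha
  exact ⟨_, Jet.inv hG (fun k hk => h.idx_base hk) (fun k hk => idx_nonneg hk) h.theta_mem hm
    fun k hk θ hθ => (hma k hk θ hθ).trans (le_abs_self _)⟩

lemma measurable_odds_indicator (h : RegularModel 𝔖 f θ₀ c C) (φ : ℝ → ℝ → ℝ)
    (hφ : Measurable (Function.uncurry φ)) (t : Fin 2) (θ : EuclideanSpace ℝ (Fin d)) :
    Measurable ((𝔖.rangeYX t).indicator fun r => φ (𝔖.π r.1 r.2.1 θ) r.1) :=
  (hφ.comp ((h.measurable_π' θ).prodMk measurable_fst)).indicator (h.measurableSet_rangeYX t)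

lemma measurable_score_integrand (h : RegularModel 𝔖 f θ₀ c C) {θ : EuclideanSpace ℝ (Fin d)}
    (hθ : θ ∈ 𝔖.Θ) (j : Fin d) : Measurable ((𝔖.rangeYX 0).indicator fun r =>
      ((1 - 𝔖.π r.1 r.2.1 θ) ^ 2)⁻¹ * 𝔖.πdot r.1 r.2.1 θ j) := by
  rw [Set.indicator_mul]
  exact (h.measurable_odds_indicator (fun π _ => ((1 - π) ^ 2)⁻¹) (by fun_prop) 0 θ).mul
    (h.measurable_πdot hθ j)

/-- Conditional means given `T = 0` of continuous functions of `π` and the outcome. -/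
lemma covJet_condE (h : RegularModel 𝔖 f θ₀ c C) (φ : ℝ → ℝ → ℝ)
    (hφ : Measurable (Function.uncurry φ)) {t : Fin 2} {G : ℝ × Cov dU dZ → Fin d → ℝ}
    (hG : PointJet 𝔖 θ₀ t (fun r θ => φ (𝔖.π r.1 r.2.1 θ) r.1) G) :
    ∃ G, CovJet 𝔖 f θ₀ (fun g θ x => 𝔖.condE g t (fun y => φ (𝔖.π y x.1 θ) y) x) G :=
  ⟨_, h.jet_condE hG fun θ _ => h.measurable_odds_indicator φ hφ t θ⟩

lemma covJet_inv_mean (h : RegularModel 𝔖 f θ₀ c C) :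
    ∃ G, CovJet 𝔖 f θ₀ (fun g θ x => 𝔖.condE g 0 (fun y => (1 - 𝔖.π y x.1 θ)⁻¹) x) G :=
  h.covJet_condE (fun π _ => (1 - π)⁻¹) (by fun_prop) h.jet_inv_one_sub

lemma covJet_A_mean (h : RegularModel 𝔖 f θ₀ c C) (j : Fin d) :
    ∃ G, CovJet 𝔖 f θ₀ (fun g θ x => 𝔖.condE g 0
      (fun y => ((1 - 𝔖.π y x.1 θ) ^ 2)⁻¹ * 𝔖.πdot y x.1 θ j) x) G := by
  obtain ⟨G₁, h1⟩ := h.jet_inv_sq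
  obtain ⟨G₂, h2⟩ := h.jet_πdot j
  exact ⟨_, h.jet_condE (h.pointJet_mul h1 h2) fun θ hθ => h.measurable_score_integrand hθ j⟩

lemma covJet_B_mean (h : RegularModel 𝔖 f θ₀ c C) :
    ∃ G, CovJet 𝔖 f θ₀ (fun g θ x => 𝔖.condE g 0
      (fun y => ((1 - 𝔖.π y x.1 θ) ^ 2)⁻¹ * 𝔖.π y x.1 θ) x) G := by
  obtain ⟨G₁, h1⟩ := h.jet_inv_sq
  exact h.covJet_condE (fun π _ => ((1 - π) ^ 2)⁻¹ * π) (by fun_prop) (h.pointJet_mul h1 h.jet_π)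

lemma half_mul_le_condE (h : RegularModel 𝔖 f θ₀ c C) {t : Fin 2}
    {q : ℝ × Cov dU dZ → EuclideanSpace ℝ (Fin d) → ℝ} {G : ℝ × Cov dU dZ → Fin d → ℝ}
    (hq : PointJet 𝔖 θ₀ t q G) {θ : EuclideanSpace ℝ (Fin d)} (hθ : θ ∈ 𝔖.Θ)
    (hqm : Measurable ((𝔖.rangeYX t).indicator fun r => q r θ)) {m : ℝ} (hm0 : 0 ≤ m)
    (hm : ∀ r ∈ 𝔖.rangeYX t, m ≤ q r θ) {k : Cov dU dZ × Nuis dU dZ × ℝ} (hk : k ∈ idx 𝔖 f) :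
    m / 2 ≤ 𝔖.condE k.2.1 t (fun y => q (y, k.1) θ) k.1 := by
  obtain ⟨D, hD, hq⟩ := hq
  have := h.condE_mono_of_le hqm (fun r hr => hq.bdd r hr θ hθ) hk.1.1 hk.2 hm
  have h2 := mul_le_mul_of_nonneg_left (hk.2.half_le t _ hk.1) hm0
  linarith

lemma half_le_inv_mean (h : RegularModel 𝔖 f θ₀ c C) {k : Cov dU dZ × Nuis dU dZ × ℝ}
    (hk : k ∈ idx 𝔖 f) {θ : EuclideanSpace ℝ (Fin d)} (hθ : θ ∈ 𝔖.Θ) :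
    1 / 2 ≤ 𝔖.condE k.2.1 0 (fun y => (1 - 𝔖.π y k.1.1 θ)⁻¹) k.1 := by
  refine h.half_mul_le_condE h.jet_inv_one_sub hθ
    (h.measurable_odds_indicator (fun π _ => (1 - π)⁻¹) (by fun_prop) 0 θ) zero_le_one
    (fun r hr => ?_) hk
  obtain ⟨h1, h2, -⟩ := h.one_sub_pi_bounds hr hθ
  exact (one_le_inv₀ (h.c_pos.trans_le h1)).2 h2

lemma le_B_mean (h : RegularModel 𝔖 f θ₀ c C) {k : Cov dU dZ × Nuis dU dZ × ℝ}
    (hk : k ∈ idx 𝔖 f) {θ : EuclideanSpace ℝ (Fin d)} (hθ : θ ∈ 𝔖.Θ) :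
    c / 2 ≤ 𝔖.condE k.2.1 0 (fun y => ((1 - 𝔖.π y k.1.1 θ) ^ 2)⁻¹ * 𝔖.π y k.1.1 θ) k.1 := by
  obtain ⟨G₁, h1⟩ := h.jet_inv_sq
  refine h.half_mul_le_condE (h.pointJet_mul h1 h.jet_π) hθ
    (h.measurable_odds_indicator (fun π _ => ((1 - π) ^ 2)⁻¹ * π) (by fun_prop) 0 θ)
    h.c_pos.le (fun r hr => ?_) hk
  obtain ⟨h1, h2, h3⟩ := h.one_sub_pi_bounds hr hθ
  have h4 : 0 < 1 - 𝔖.π r.1 r.2.1 θ := h.c_pos.trans_le h1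
  have h5 : 1 ≤ ((1 - 𝔖.π r.1 r.2.1 θ) ^ 2)⁻¹ :=
    (one_le_inv₀ (by positivity)).2 (pow_le_one₀ h4.le h2)
  exact h3.trans (le_mul_of_one_le_left (h.c_pos.le.trans h3) h5)

lemma covJet_one_sub_w (h : RegularModel 𝔖 f θ₀ c C) :
    ∃ G, CovJet 𝔖 f θ₀ (fun g θ x => 1 - 𝔖.w g θ x) G := by
  obtain ⟨G, hG⟩ := h.covJet_inv h.covJet_inv_mean (m := 1 / 2) (by norm_num)
    (fun k hk θ hθ => h.half_le_inv_mean hk hθ)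
  exact ⟨G, hG.congr (fun k hk => h.idx_base hk) h.theta_mem
    (fun k hk θ hθ => by simp only [w]; ring) fun _ _ _ => rfl⟩

lemma covJet_w (h : RegularModel 𝔖 f θ₀ c C) :
    ∃ G, CovJet 𝔖 f θ₀ (fun g θ x => 𝔖.w g θ x) G := by
  obtain ⟨G, hG⟩ := covJet_add (covJet_const 1) (h.covJet_mul (covJet_const (-1))
    h.covJet_one_sub_w)
  exact ⟨G, hG.congr (fun k hk => h.idx_base hk) h.theta_mem
    (fun k hk θ hθ => by ring) fun _ _ _ => rfl⟩

lemma exists_le_one_sub_w (h : RegularModel 𝔖 f θ₀ c C) :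
    ∃ m, 0 < m ∧ ∀ k ∈ idx 𝔖 f, ∀ θ ∈ 𝔖.Θ, m ≤ 1 - 𝔖.w k.2.1 θ k.1 := by
  obtain ⟨G, D, hD, hG⟩ := h.covJet_inv_mean
  refine ⟨(D + 1)⁻¹, by positivity, fun k hk θ hθ => ?_⟩
  have h1 := hG.bdd k hk θ hθ
  have h2 := h.half_le_inv_mean hk hθ
  have h3 : (1 : ℝ) - 𝔖.w k.2.1 θ k.1 =
      (𝔖.condE k.2.1 0 (fun y => (1 - 𝔖.π y k.1.1 θ)⁻¹) k.1)⁻¹ := by simp only [w]; ring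
  rw [h3]
  refine inv_anti₀ (by linarith) ?_
  have := (le_abs_self _).trans h1
  linarith

lemma covJet_A (h : RegularModel 𝔖 f θ₀ c C) (j : Fin d) :
    ∃ G, CovJet 𝔖 f θ₀ (fun g θ x => 𝔖.A g θ x j) G :=
  h.covJet_mul h.covJet_one_sub_w (h.covJet_A_mean j)

lemma covJet_B (h : RegularModel 𝔖 f θ₀ c C) :
    ∃ G, CovJet 𝔖 f θ₀ (fun g θ x => 𝔖.B g θ x) G :=
  h.covJet_mul h.covJet_one_sub_w h.covJet_B_mean

lemma exists_le_B (h : RegularModel 𝔖 f θ₀ c C) :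
    ∃ m, 0 < m ∧ ∀ k ∈ idx 𝔖 f, ∀ θ ∈ 𝔖.Θ, m ≤ 𝔖.B k.2.1 θ k.1 := by
  obtain ⟨m, hm, hm'⟩ := h.exists_le_one_sub_w
  have := h.c_pos
  refine ⟨m * (c / 2), by positivity, fun k hk θ hθ => ?_⟩
  exact mul_le_mul (hm' k hk θ hθ) (h.le_B_mean hk hθ) (by positivity)
    (hm.le.trans (hm' k hk θ hθ))

lemma covJet_inv_B (h : RegularModel 𝔖 f θ₀ c C) :
    ∃ G, CovJet 𝔖 f θ₀ (fun g θ x => (𝔖.B g θ x)⁻¹) G := by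
  obtain ⟨m, hm, hm'⟩ := h.exists_le_B
  exact h.covJet_inv h.covJet_B hm hm'

lemma covJet_K (h : RegularModel 𝔖 f θ₀ c C) :
    ∃ G, CovJet 𝔖 f θ₀ (fun g θ x => 𝔖.K g θ x) G := by
  refine covJet_add (h.covJet_mul h.covJet_w (h.covJet_condE (fun _ y => y) (by fun_prop)
    (h.jet_outcome 1))) (h.covJet_mul h.covJet_one_sub_w ?_)
  have h1 := h.pointJet_mul (h.pointJet_mul h.jet_odds h.jet_odds) (h.jet_outcome 0)
  refine h.covJet_condE (fun π y => π ^ 2 / (1 - π) ^ 2 * y) (by fun_prop)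
    (Jet.congr h1 (fun _ => id) h.theta_mem (fun k hk θ hθ => ?_) fun _ _ _ => rfl)
  rw [← div_pow, sq]

lemma covJet_ratioA (h : RegularModel 𝔖 f θ₀ c C) (j : Fin d) :
    ∃ G, CovJet 𝔖 f θ₀ (𝔖.ratioA j) G := by
  have := h.c_pos
  obtain ⟨G, hG⟩ := h.covJet_mul (h.covJet_A_mean j) (h.covJet_inv h.covJet_B_mean (m := c / 2)
    (by positivity) fun k hk θ hθ => h.le_B_mean hk hθ)
  exact ⟨G, hG.congr (fun k hk => h.idx_base hk) h.theta_mem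
    (fun k hk θ hθ => div_eq_mul_inv _ _) fun _ _ _ => rfl⟩

lemma covJet_w_div_B (h : RegularModel 𝔖 f θ₀ c C) :
    ∃ G, CovJet 𝔖 f θ₀ (fun g θ x => 𝔖.w g θ x / 𝔖.B g θ x) G := by
  obtain ⟨G, hG⟩ := h.covJet_mul h.covJet_w h.covJet_inv_B
  exact ⟨G, hG.congr (fun k hk => h.idx_base hk) h.theta_mem
    (fun k hk θ hθ => div_eq_mul_inv _ _) fun _ _ _ => rfl⟩

lemma covJet_ratioV (h : RegularModel 𝔖 f θ₀ c C) (Δ : ℝ) :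
    ∃ G, CovJet 𝔖 f θ₀ (𝔖.ratioV Δ) G := by
  obtain ⟨G, hG⟩ := covJet_add (h.covJet_mul h.covJet_inv_B h.covJet_K)
    (h.covJet_mul (covJet_const (-Δ)) h.covJet_w_div_B)
  exact ⟨G, hG.congr (fun k hk => h.idx_base hk) h.theta_mem
    (fun k hk θ hθ => by unfold ratioV; ring) fun _ _ _ => rfl⟩

end Cov

end RegularModel
end ATTSetup

/-! ### Expansion of the residual and joint measurability -/

namespace ATTSetup

variable {d dU dZ : ℕ} {𝔖 : ATTSetup d dU dZ} {f : Fin 2 → ℝ → Cov dU dZ → ℝ}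
  {θ₀ : EuclideanSpace ℝ (Fin d)} {c C : ℝ}

@[simp] lemma tval_zero : tval 0 = 0 := by simp [tval]

@[simp] lemma tval_one : tval 1 = 1 := by simp [tval]

lemma fin_two_eq (t : Fin 2) : t = 0 ∨ t = 1 := by omega

/-- Observations in the range of `W` whose covariates are in `goodX`. -/
def goodObs (𝔖 : ATTSetup d dU dZ) (f : Nuis dU dZ) : Set (Obs dU dZ) :=
  {o | o.2.1 ∈ 𝔖.𝒴 o.1 ∧ o.2.2 ∈ goodX 𝔖 f}

/-- Jets of functions of an observation and `θ` that depend on the conditional densities. -/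
abbrev ObsJet (𝔖 : ATTSetup d dU dZ) (f : Nuis dU dZ) (θ₀ : EuclideanSpace ℝ (Fin d))
    (F : Nuis dU dZ → EuclideanSpace ℝ (Fin d) → Obs dU dZ → ℝ)
    (G : Obs dU dZ × Nuis dU dZ × ℝ → Fin d → ℝ) : Prop :=
  Jet 𝔖.Θ θ₀ {k : Obs dU dZ × Nuis dU dZ × ℝ | k.1 ∈ goodObs 𝔖 f ∧ Adm 𝔖 f k.2.1 k.2.2}
    (fun k => (k.1, f, 0)) (fun k => k.2.2) (fun k θ => F k.2.1 θ k.1) G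

/-- The gradient in `θ` of `resid`. -/
noncomputable def gradResid (𝔖 : ATTSetup d dU dZ) (θ : EuclideanSpace ℝ (Fin d))
    (o : Obs dU dZ) (l : Fin d) : ℝ :=
  -((1 - tval o.1) * (((1 - 𝔖.π o.2.1 o.2.2.1 θ) ^ 2)⁻¹ * 𝔖.πdot o.2.1 o.2.2.1 θ l))

lemma measurable_of_eq {α β : Type*} [MeasurableSpace α] [MeasurableSpace β] {u v : α → β}
    (h : Measurable u) (e : ∀ x, u x = v x) : Measurable v := (funext e : u = v) ▸ h

namespace RegularModel

lemma obsJet_resid (h : RegularModel 𝔖 f θ₀ c C) :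
    ObsJet 𝔖 f θ₀ (fun _ θ o => 𝔖.resid θ o) (fun k l => 𝔖.gradResid θ₀ k.1 l) := by
  obtain ⟨D, hD, hj⟩ := h.jet_odds
  refine ⟨D + 1, by positivity, ⟨fun k hk θ hθ => ?_, fun k hk θ hθ θ' hθ' => ?_,
    fun k hk θ hθ => ?_, fun k hk θ hθ => ?_, fun k hk l => ?_, fun k hk l => ?_⟩⟩
  all_goals
    obtain ⟨⟨t, y, x⟩, g, δ⟩ := k
    obtain ⟨⟨hy, hx⟩, hg⟩ := hk
    have hδ := hg.nonneg
    simp only at hy hx hδ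
    obtain rfl | rfl := fin_two_eq t
  · simp only [resid, tval_zero, sub_zero, one_mul, zero_sub, abs_neg]
    exact (hj.bdd (y, x) ⟨hy, hx.1⟩ θ hθ).trans (by linarith)
  · simp [resid, hD]
  · simp only [resid, tval_zero, sub_zero, one_mul, zero_sub]
    rw [neg_sub_neg, abs_sub_comm]
    refine (hj.lip (y, x) ⟨hy, hx.1⟩ θ hθ θ' hθ').trans ?_
    gcongr
    linarith
  · simp only [resid, tval_one, sub_self, zero_mul, sub_zero, abs_zero]
    positivity
  · simp only [sub_self, abs_zero]
    positivity
  · simp only [sub_self, abs_zero]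
    positivity
  · have := hj.expand (y, x) ⟨hy, hx.1⟩ θ hθ
    simp only [resid, gradResid, tval_zero, sub_zero, one_mul, zero_sub, neg_mul,
      Finset.sum_neg_distrib]
    rw [← abs_neg]
    have e : ∀ a b s : ℝ, -(-a - -b - -s) = a - b - s := fun a b s => by ring
    rw [e]
    refine this.trans ?_
    gcongr
    linarith
  · simp only [resid, gradResid, tval_one, sub_self, zero_mul, neg_zero,
      Finset.sum_const_zero, abs_zero]
    positivity
  · simp only [gradResid, tval_zero, sub_zero, one_mul, abs_neg]
    exact (hj.grad_bdd (y, x) ⟨hy, hx.1⟩ l).trans (by linarith)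
  · simp only [gradResid, tval_one, sub_self, zero_mul, neg_zero, abs_zero]
    positivity
  · simp only [sub_self, abs_zero]
    positivity
  · simp only [sub_self, abs_zero]
    positivity

lemma obs_base (h : RegularModel 𝔖 f θ₀ c C) {k : Obs dU dZ × Nuis dU dZ × ℝ}
    (hk : k.1 ∈ goodObs 𝔖 f ∧ Adm 𝔖 f k.2.1 k.2.2) :
    ((k.1, f, 0) : Obs dU dZ × Nuis dU dZ × ℝ) ∈
      {k : Obs dU dZ × Nuis dU dZ × ℝ | k.1 ∈ goodObs 𝔖 f ∧ Adm 𝔖 f k.2.1 k.2.2} :=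
  ⟨hk.1, h.adm_self⟩

lemma obsJet_resid_mul (h : RegularModel 𝔖 f θ₀ c C)
    {a : Nuis dU dZ → EuclideanSpace ℝ (Fin d) → Cov dU dZ → ℝ}
    {G : Cov dU dZ × Nuis dU dZ × ℝ → Fin d → ℝ} (ha : CovJet 𝔖 f θ₀ a G) :
    ObsJet 𝔖 f θ₀ (fun g θ o => 𝔖.resid θ o * a g θ o.2.2) (fun k l =>
      𝔖.resid θ₀ k.1 * G (k.1.2.2, k.2) l + a k.2.1 θ₀ k.1.2.2 * 𝔖.gradResid θ₀ k.1 l) := by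
  have h1 : ObsJet 𝔖 f θ₀ (fun g θ o => a g θ o.2.2) (fun k => G (k.1.2.2, k.2)) :=
    Jet.comp (fun k : Obs dU dZ × Nuis dU dZ × ℝ => (k.1.2.2, k.2)) ha (fun k hk => ⟨hk.1.2, hk.2⟩) (fun _ _ => rfl)
      (fun _ _ => rfl) fun _ _ => le_rfl
  exact Jet.mul h.obsJet_resid h1 (fun k hk => h.obs_base hk) (fun k hk => hk.2.nonneg) h.theta_mem

lemma obsJet_altNum (h : RegularModel 𝔖 f θ₀ c C) :
    ObsJet 𝔖 f θ₀ (fun _ θ o => 𝔖.altNum θ o) (fun k l => k.1.2.1 * 𝔖.gradResid θ₀ k.1 l) := by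
  have h1 : ObsJet 𝔖 f θ₀ (fun g θ o => o.2.1) (fun _ _ => 0) :=
    Jet.const (g := fun k : Obs dU dZ × Nuis dU dZ × ℝ => k.1.2.1) h.C_nonneg (fun k hk => hk.2.nonneg)
      (fun k hk => h.outcome_le _ _ hk.1.1)
      (fun k hk => by simpa using mul_nonneg h.C_nonneg hk.2.nonneg)
  exact (Jet.mul h.obsJet_resid h1 (fun k hk => h.obs_base hk) (fun k hk => hk.2.nonneg)
    h.theta_mem).congr (fun k hk => h.obs_base hk) h.theta_mem
    (fun k hk θ hθ => altNum_eq θ k.1) fun k hk l => by simp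

section Measurability

variable {P : Type*} [MeasurableSpace P]

/-- Measurability in a parameter and in `x` on the range of the covariates. -/
def JointMeas (𝔖 : ATTSetup d dU dZ) (a : P → Cov dU dZ → ℝ) : Prop :=
  Measurable fun s : P × Cov dU dZ => 𝔖.𝒳.indicator (a s.1) s.2

lemma JointMeas.mul {a a' : P → Cov dU dZ → ℝ} (h : JointMeas 𝔖 a) (h' : JointMeas 𝔖 a') :
    JointMeas 𝔖 (fun p x => a p x * a' p x) := by
  refine measurable_of_eq (Measurable.mul h h') fun s => ?_
  by_cases hs : s.2 ∈ 𝔖.𝒳 <;> simp [hs]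

lemma JointMeas.add {a a' : P → Cov dU dZ → ℝ} (h : JointMeas 𝔖 a) (h' : JointMeas 𝔖 a') :
    JointMeas 𝔖 (fun p x => a p x + a' p x) := by
  refine measurable_of_eq (Measurable.add h h') fun s => ?_
  by_cases hs : s.2 ∈ 𝔖.𝒳 <;> simp [hs]

lemma JointMeas.inv {a : P → Cov dU dZ → ℝ} (h : JointMeas 𝔖 a) :
    JointMeas 𝔖 (fun p x => (a p x)⁻¹) := by
  refine measurable_of_eq (Measurable.inv h) fun s => ?_
  by_cases hs : s.2 ∈ 𝔖.𝒳 <;> simp [hs]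

lemma jointMeas_const (h : RegularModel 𝔖 f θ₀ c C) (r : ℝ) :
    JointMeas 𝔖 (fun (_ : P) (_ : Cov dU dZ) => r) :=
  (measurable_const.indicator h.measurableSet_𝒳).comp measurable_snd

lemma JointMeas.congr {a a' : P → Cov dU dZ → ℝ} (h : JointMeas 𝔖 a)
    (haa : ∀ p x, a' p x = a p x) : JointMeas 𝔖 a' := by
  have : a' = a := by funext p x; exact haa p x
  rwa [this]

lemma jointMeas_condE (h : RegularModel 𝔖 f θ₀ c C) {t : Fin 2} {g : P → Nuis dU dZ}
    (hg : ∀ t, Measurable fun r : P × ℝ × Cov dU dZ => g r.1 t r.2.1 r.2.2)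
    {q : P → ℝ × Cov dU dZ → ℝ}
    (hq : Measurable fun r : P × ℝ × Cov dU dZ => (𝔖.rangeYX t).indicator (q r.1) r.2) :
    JointMeas 𝔖 fun p x => 𝔖.condE (g p) t (fun y => q p (y, x)) x := by
  have := h.finite t
  have h1 : Measurable (Function.uncurry fun (s : P × Cov dU dZ) (y : ℝ) =>
      (𝔖.rangeYX t).indicator (q s.1) (y, s.2) * g s.1 t y s.2) := by
    have h2 : Measurable fun r : (P × Cov dU dZ) × ℝ =>
        ((r.1.1, (r.2, r.1.2)) : P × ℝ × Cov dU dZ) := by fun_prop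
    exact (hq.comp h2).mul ((hg t).comp h2)
  have h3 := (h1.stronglyMeasurable.integral_prod_right
    (ν := (𝔖.ν t).restrict (𝔖.𝒴 t))).measurable
  have h4 := h3.indicator (measurable_snd h.measurableSet_𝒳)
  refine measurable_of_eq h4 fun s => ?_
  by_cases hs : s.2 ∈ 𝔖.𝒳
  · rw [Set.indicator_of_mem hs, Set.indicator_of_mem (by exact hs)]
    refine setIntegral_congr_fun (h.measurableSet_𝒴 t) fun y hy => ?_
    simp only
    rw [Set.indicator_of_mem (show (y, s.2) ∈ 𝔖.rangeYX t from ⟨hy, hs⟩)]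
  · rw [Set.indicator_of_notMem hs, Set.indicator_of_notMem (by exact hs)]

/-- `π` is a Carathéodory function on `Θ`, hence jointly measurable. -/
lemma measurable_π_joint (h : RegularModel 𝔖 f θ₀ c C) {θ : P → EuclideanSpace ℝ (Fin d)}
    (hθ : Measurable θ) (hθΘ : ∀ p, θ p ∈ 𝔖.Θ) :
    Measurable fun r : P × ℝ × Cov dU dZ =>
      (𝔖.rangeYX 0).indicator (fun s => 𝔖.π s.1 s.2.1 (θ r.1)) r.2 := by
  obtain ⟨D, hD, hj⟩ := h.jet_π
  have h1 : Measurable (Function.uncurry fun (θ : 𝔖.Θ) (s : ℝ × Cov dU dZ) =>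
      (𝔖.rangeYX 0).indicator (fun s => 𝔖.π s.1 s.2.1 (θ : EuclideanSpace ℝ (Fin d))) s) := by
    refine measurable_uncurry_of_continuous_of_measurable (fun s => ?_) fun θ =>
      (h.measurable_π' _).indicator (h.measurableSet_rangeYX 0)
    by_cases hs : s ∈ 𝔖.rangeYX 0
    · simp only [Set.indicator_of_mem hs]
      have : LipschitzWith D.toNNReal (fun θ : 𝔖.Θ => 𝔖.π s.1 s.2.1 θ) :=
        LipschitzWith.of_dist_le_mul fun θ θ' => by
          rw [Real.dist_eq, Subtype.dist_eq, dist_eq_norm, Real.coe_toNNReal _ hD]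
          exact hj.lip s hs θ θ.2 θ' θ'.2
      exact this.continuous
    · simp only [Set.indicator_of_notMem hs]
      exact continuous_const
  exact h1.comp (((hθ.comp measurable_fst).subtype_mk (h := fun r => hθΘ r.1)).prodMk
    measurable_snd)

variable {g : P → Nuis dU dZ} {θ : P → EuclideanSpace ℝ (Fin d)}

lemma jointMeas_condE_π (h : RegularModel 𝔖 f θ₀ c C)
    (hg : ∀ t, Measurable fun r : P × ℝ × Cov dU dZ => g r.1 t r.2.1 r.2.2)
    (hθ : Measurable θ) (hθΘ : ∀ p, θ p ∈ 𝔖.Θ) (φ : ℝ → ℝ → ℝ)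
    (hφ : Measurable (Function.uncurry φ)) :
    JointMeas 𝔖 fun p x => 𝔖.condE (g p) 0 (fun y => φ (𝔖.π y x.1 (θ p)) y) x := by
  refine h.jointMeas_condE hg (q := fun p r => φ (𝔖.π r.1 r.2.1 (θ p)) r.1) ?_
  have h1 := (hφ.comp ((h.measurable_π_joint hθ hθΘ).prodMk
    (measurable_fst.comp measurable_snd))).indicator
    (measurable_snd (h.measurableSet_rangeYX 0) : MeasurableSet
      (Prod.snd ⁻¹' 𝔖.rangeYX 0 : Set (P × ℝ × Cov dU dZ)))
  refine measurable_of_eq h1 fun r => ?_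
  by_cases hr : r.2 ∈ 𝔖.rangeYX 0
  · rw [Set.indicator_of_mem (by exact hr), Set.indicator_of_mem hr]
    simp [Set.indicator_of_mem hr]
  · rw [Set.indicator_of_notMem (by exact hr), Set.indicator_of_notMem hr]

lemma jointMeas_one_sub_w (h : RegularModel 𝔖 f θ₀ c C)
    (hg : ∀ t, Measurable fun r : P × ℝ × Cov dU dZ => g r.1 t r.2.1 r.2.2)
    (hθ : Measurable θ) (hθΘ : ∀ p, θ p ∈ 𝔖.Θ) :
    JointMeas 𝔖 fun p x => 1 - 𝔖.w (g p) (θ p) x :=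
  (h.jointMeas_condE_π hg hθ hθΘ (fun π _ => (1 - π)⁻¹) (by fun_prop)).inv.congr
    fun p x => by simp only [w]; ring

lemma jointMeas_w (h : RegularModel 𝔖 f θ₀ c C)
    (hg : ∀ t, Measurable fun r : P × ℝ × Cov dU dZ => g r.1 t r.2.1 r.2.2)
    (hθ : Measurable θ) (hθΘ : ∀ p, θ p ∈ 𝔖.Θ) :
    JointMeas 𝔖 fun p x => 𝔖.w (g p) (θ p) x :=
  ((h.jointMeas_const 1).add ((h.jointMeas_const (-1)).mul
    (h.jointMeas_one_sub_w hg hθ hθΘ))).congr fun p x => by ring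

lemma jointMeas_B (h : RegularModel 𝔖 f θ₀ c C)
    (hg : ∀ t, Measurable fun r : P × ℝ × Cov dU dZ => g r.1 t r.2.1 r.2.2)
    (hθ : Measurable θ) (hθΘ : ∀ p, θ p ∈ 𝔖.Θ) :
    JointMeas 𝔖 fun p x => 𝔖.B (g p) (θ p) x :=
  (h.jointMeas_one_sub_w hg hθ hθΘ).mul
    (h.jointMeas_condE_π hg hθ hθΘ (fun π _ => ((1 - π) ^ 2)⁻¹ * π) (by fun_prop))

lemma jointMeas_K (h : RegularModel 𝔖 f θ₀ c C)
    (hg : ∀ t, Measurable fun r : P × ℝ × Cov dU dZ => g r.1 t r.2.1 r.2.2)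
    (hθ : Measurable θ) (hθΘ : ∀ p, θ p ∈ 𝔖.Θ) :
    JointMeas 𝔖 fun p x => 𝔖.K (g p) (θ p) x :=
  ((h.jointMeas_w hg hθ hθΘ).mul (h.jointMeas_condE hg (q := fun _ r => r.1)
    ((measurable_fst.indicator (h.measurableSet_rangeYX 1)).comp measurable_snd))).add
    ((h.jointMeas_one_sub_w hg hθ hθΘ).mul
    (h.jointMeas_condE_π hg hθ hθΘ (fun π y => π ^ 2 / (1 - π) ^ 2 * y) (by fun_prop)))

lemma jointMeas_w_div_B (h : RegularModel 𝔖 f θ₀ c C)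
    (hg : ∀ t, Measurable fun r : P × ℝ × Cov dU dZ => g r.1 t r.2.1 r.2.2)
    (hθ : Measurable θ) (hθΘ : ∀ p, θ p ∈ 𝔖.Θ) :
    JointMeas 𝔖 fun p x => 𝔖.w (g p) (θ p) x / 𝔖.B (g p) (θ p) x :=
  ((h.jointMeas_w hg hθ hθΘ).mul (h.jointMeas_B hg hθ hθΘ).inv).congr
    fun p x => div_eq_mul_inv _ _

lemma jointMeas_ratioV (h : RegularModel 𝔖 f θ₀ c C)
    (hg : ∀ t, Measurable fun r : P × ℝ × Cov dU dZ => g r.1 t r.2.1 r.2.2)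
    (hθ : Measurable θ) (hθΘ : ∀ p, θ p ∈ 𝔖.Θ) (Δ : ℝ) :
    JointMeas 𝔖 fun p x => 𝔖.ratioV Δ (g p) (θ p) x :=
  (((h.jointMeas_B hg hθ hθΘ).inv.mul (h.jointMeas_K hg hθ hθΘ)).add
    ((h.jointMeas_const (-Δ)).mul (h.jointMeas_w_div_B hg hθ hθΘ))).congr
    fun _ _ => by unfold ratioV; ring

lemma jointMeas_A_mean (h : RegularModel 𝔖 f θ₀ c C)
    (hg : ∀ t, Measurable fun r : P × ℝ × Cov dU dZ => g r.1 t r.2.1 r.2.2)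
    {θ : EuclideanSpace ℝ (Fin d)} (hθ : θ ∈ 𝔖.Θ) (j : Fin d) :
    JointMeas 𝔖 fun p x => 𝔖.condE (g p) 0
      (fun y => ((1 - 𝔖.π y x.1 θ) ^ 2)⁻¹ * 𝔖.πdot y x.1 θ j) x :=
  h.jointMeas_condE hg (q := fun _ r => ((1 - 𝔖.π r.1 r.2.1 θ) ^ 2)⁻¹ * 𝔖.πdot r.1 r.2.1 θ j)
    ((h.measurable_score_integrand hθ j).comp measurable_snd)

lemma jointMeas_A (h : RegularModel 𝔖 f θ₀ c C)
    (hg : ∀ t, Measurable fun r : P × ℝ × Cov dU dZ => g r.1 t r.2.1 r.2.2)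
    {θ : EuclideanSpace ℝ (Fin d)} (hθ : θ ∈ 𝔖.Θ) (j : Fin d) :
    JointMeas 𝔖 fun p x => 𝔖.A (g p) θ x j :=
  (h.jointMeas_one_sub_w hg (θ := fun _ => θ) measurable_const (fun _ => hθ)).mul
    (h.jointMeas_A_mean hg hθ j)

lemma jointMeas_ratioA (h : RegularModel 𝔖 f θ₀ c C)
    (hg : ∀ t, Measurable fun r : P × ℝ × Cov dU dZ => g r.1 t r.2.1 r.2.2)
    {θ : EuclideanSpace ℝ (Fin d)} (hθ : θ ∈ 𝔖.Θ) (j : Fin d) :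
    JointMeas 𝔖 fun p x => 𝔖.ratioA j (g p) θ x :=
  ((h.jointMeas_A_mean hg hθ j).mul (h.jointMeas_condE_π hg (θ := fun _ => θ) measurable_const
    (fun _ => hθ) (fun π _ => ((1 - π) ^ 2)⁻¹ * π) (by fun_prop)).inv).congr
    fun p x => div_eq_mul_inv _ _

/-- For the true densities: measurability in `x` alone. -/
lemma JointMeas.measurable {a : Unit → Cov dU dZ → ℝ} (h : JointMeas 𝔖 a) :
    Measurable (𝔖.𝒳.indicator (a ())) :=
  Measurable.comp h (measurable_const.prodMk measurable_id : Measurable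
    fun x : Cov dU dZ => (((), x) : Unit × Cov dU dZ))

lemma measurable_tval : Measurable tval := measurable_of_countable _

lemma measurable_resid (h : RegularModel 𝔖 f θ₀ c C) (θ : EuclideanSpace ℝ (Fin d)) :
    Measurable (𝔖.resid θ) := by
  have h1 : Measurable fun o : Obs dU dZ => 𝔖.π o.2.1 o.2.2.1 θ :=
    (h.measurable_π' θ).comp measurable_snd
  have h2 : Measurable fun o : Obs dU dZ => tval o.1 := measurable_tval.comp measurable_fst
  unfold resid
  fun_prop

lemma measurable_altNum (h : RegularModel 𝔖 f θ₀ c C) (θ : EuclideanSpace ℝ (Fin d)) :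
    Measurable (𝔖.altNum θ) := by
  have : 𝔖.altNum θ = fun o => 𝔖.resid θ o * o.2.1 := funext fun o => altNum_eq θ o
  rw [this]
  exact (h.measurable_resid θ).mul (measurable_fst.comp measurable_snd)

lemma measurableSet_goodX (h : RegularModel 𝔖 f θ₀ c C) : MeasurableSet (goodX 𝔖 f) := by
  have h1 : goodX 𝔖 f = 𝔖.𝒳 ∩ ⋂ t, {x | ∫ y in 𝔖.𝒴 t, f t y x ∂(𝔖.ν t) = 1} := by
    ext x; simp only [goodX, Set.mem_inter_iff, Set.mem_iInter, Set.mem_ofPred_eq]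
  rw [h1]
  refine h.measurableSet_𝒳.inter (MeasurableSet.iInter fun t => ?_)
  have := h.finite t
  have h2 : Measurable (Function.uncurry fun (x : Cov dU dZ) (y : ℝ) => f t y x) :=
    (h.measurable_f t).comp measurable_swap
  exact (h2.stronglyMeasurable.integral_prod_right
    (ν := (𝔖.ν t).restrict (𝔖.𝒴 t))).measurable (measurableSet_singleton 1)

lemma measurableSet_goodObs (h : RegularModel 𝔖 f θ₀ c C) : MeasurableSet (goodObs 𝔖 f) := by
  have h1 : goodObs 𝔖 f = ⋃ t : Fin 2, {t} ×ˢ (𝔖.𝒴 t ×ˢ goodX 𝔖 f) := by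
    ext ⟨t, y, x⟩; simp [goodObs]
  rw [h1]
  exact MeasurableSet.iUnion fun t => (measurableSet_singleton t).prod
    ((h.measurableSet_𝒴 t).prod h.measurableSet_goodX)

/-- Joint measurability of `resid` on the range of the observations. -/
lemma measurable_resid_joint (h : RegularModel 𝔖 f θ₀ c C) (hθ : Measurable θ)
    (hθΘ : ∀ p, θ p ∈ 𝔖.Θ) :
    Measurable fun r : P × Obs dU dZ => (goodObs 𝔖 f).indicator (𝔖.resid (θ r.1)) r.2 := by
  have h1 : Measurable fun r : P × Obs dU dZ =>
      (𝔖.rangeYX 0).indicator (fun s => 𝔖.π s.1 s.2.1 (θ r.1)) r.2.2 :=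
    (h.measurable_π_joint hθ hθΘ).comp
      (measurable_fst.prodMk (measurable_snd.comp measurable_snd))
  have h2 : Measurable fun r : P × Obs dU dZ => tval r.2.1 :=
    measurable_tval.comp (measurable_fst.comp measurable_snd)
  have h3 : Measurable fun r : P × Obs dU dZ => tval r.2.1 - (1 - tval r.2.1) *
      ((𝔖.rangeYX 0).indicator (fun s => 𝔖.π s.1 s.2.1 (θ r.1)) r.2.2 /
      (1 - (𝔖.rangeYX 0).indicator (fun s => 𝔖.π s.1 s.2.1 (θ r.1)) r.2.2)) := by fun_prop
  refine measurable_of_eq (h3.indicator (measurable_snd h.measurableSet_goodObs)) fun r => ?_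
  obtain ⟨p, t, y, x⟩ := r
  by_cases hr : ((t, y, x) : Obs dU dZ) ∈ goodObs 𝔖 f
  · rw [Set.indicator_of_mem (by exact hr), Set.indicator_of_mem hr]
    obtain rfl | rfl := fin_two_eq t
    · simp only [resid]
      rw [Set.indicator_of_mem (show (y, x) ∈ 𝔖.rangeYX 0 from ⟨hr.1, hr.2.1⟩)]
    · simp [resid]
  · rw [Set.indicator_of_notMem (by exact hr), Set.indicator_of_notMem hr]

end Measurability

end RegularModel
end ATTSetup

/-! ### The law of the observations -/

namespace ATTSetup

variable {d dU dZ : ℕ} {𝔖 : ATTSetup d dU dZ} {f : Fin 2 → ℝ → Cov dU dZ → ℝ}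
  {θ₀ : EuclideanSpace ℝ (Fin d)} {c C : ℝ}

/-- The covariate values at which the densities of the parameter `q` integrate to one. -/
def paramX (𝔖 : ATTSetup d dU dZ) (q : Param d dU dZ) : Set (Cov dU dZ) :=
  {x | x ∈ 𝔖.𝒳 ∧ ∀ t, ∫⁻ y in 𝔖.𝒴 t, ENNReal.ofReal (q.f t y x) ∂(𝔖.ν t) = 1}

/-- The conditional probability of `T = t` given `X = x`. -/
noncomputable def wt (𝔖 : ATTSetup d dU dZ) (q : Param d dU dZ) (t : Fin 2) (x : Cov dU dZ) : ℝ :=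
  if t = 1 then 𝔖.w q.f q.θ x else 1 - 𝔖.w q.f q.θ x

/-- The range of the observations. -/
def obsRange (𝔖 : ATTSetup d dU dZ) : Set (Obs dU dZ) := {o | o.2.1 ∈ 𝔖.𝒴 o.1 ∧ o.2.2 ∈ 𝔖.𝒳}

lemma abs_tval_le (t : Fin 2) : |tval t| ≤ 1 := by
  obtain rfl | rfl := fin_two_eq t <;> simp

section Law

variable {q : Param d dU dZ}

lemma IsParam.ae_paramX (hq : 𝔖.IsParam q) : ∀ᵐ x ∂q.g, x ∈ paramX 𝔖 q := by
  filter_upwards [hq.ae_mem, ae_all_iff.2 hq.f_density] with x hx hx'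
  exact ⟨hx, hx'⟩

namespace RegularModel

lemma measurable_w (h : RegularModel 𝔖 f θ₀ c C) (hq : 𝔖.IsParam q) :
    Measurable (𝔖.w q.f q.θ) := by
  have := h.finite 0
  have h1 : Measurable (Function.uncurry fun (x : Cov dU dZ) (y : ℝ) =>
      (1 - 𝔖.π y x.1 q.θ)⁻¹ * q.f 0 y x) := by
    have h2 := ((measurable_const (a := (1 : ℝ))).sub (h.measurable_π' q.θ)).inv.mul
      (hq.measurable_f 0)
    exact h2.comp measurable_swap
  exact measurable_const.sub (h1.stronglyMeasurable.integral_prod_right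
    (ν := (𝔖.ν 0).restrict (𝔖.𝒴 0))).measurable.inv

lemma measurable_wt (h : RegularModel 𝔖 f θ₀ c C) (hq : 𝔖.IsParam q) (t : Fin 2) :
    Measurable (wt 𝔖 q t) := by
  obtain rfl | rfl := fin_two_eq t
  · exact measurable_of_eq ((measurable_const (a := (1 : ℝ))).sub (h.measurable_w hq))
      fun x => by simp [wt]
  · exact measurable_of_eq (h.measurable_w hq) fun x => by simp [wt]

lemma param_integrable (h : RegularModel 𝔖 f θ₀ c C) (hq : 𝔖.IsParam q) {x : Cov dU dZ}
    (hx : x ∈ paramX 𝔖 q) (t : Fin 2) :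
    Integrable (fun y => q.f t y x) ((𝔖.ν t).restrict (𝔖.𝒴 t)) ∧
      ∫ y in 𝔖.𝒴 t, q.f t y x ∂(𝔖.ν t) = 1 := by
  have hm : Measurable fun y => q.f t y x :=
    (hq.measurable_f t).comp (measurable_id.prodMk measurable_const)
  have h0 : 0 ≤ᵐ[(𝔖.ν t).restrict (𝔖.𝒴 t)] fun y => q.f t y x := by
    filter_upwards [ae_restrict_mem (h.measurableSet_𝒴 t)] with y hy
    exact hq.f_nonneg t y hy x hx.1
  constructor
  · refine (lintegral_ofReal_ne_top_iff_integrable hm.aestronglyMeasurable h0).1 ?_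
    rw [hx.2 t]; exact ENNReal.one_ne_top
  · rw [integral_eq_lintegral_of_nonneg_ae h0 hm.aestronglyMeasurable, hx.2 t, ENNReal.toReal_one]

lemma param_integrable_mul (h : RegularModel 𝔖 f θ₀ c C) (hq : 𝔖.IsParam q) {x : Cov dU dZ}
    (hx : x ∈ paramX 𝔖 q) {t : Fin 2} {k : ℝ → ℝ}
    (hk : AEStronglyMeasurable k ((𝔖.ν t).restrict (𝔖.𝒴 t))) {D : ℝ} (hD : ∀ y ∈ 𝔖.𝒴 t, |k y| ≤ D) :
    Integrable (fun y => k y * q.f t y x) ((𝔖.ν t).restrict (𝔖.𝒴 t)) := by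
  refine (h.param_integrable hq hx t).1.bdd_mul (c := D) hk ?_
  filter_upwards [ae_restrict_mem (h.measurableSet_𝒴 t)] with y hy using hD y hy

lemma measurable_π_section (h : RegularModel 𝔖 f θ₀ c C) (x : Cov dU dZ)
    (θ : EuclideanSpace ℝ (Fin d)) : Measurable fun y => 𝔖.π y x.1 θ :=
  (h.measurable_π θ).comp (measurable_id.prodMk measurable_const)

/-- `{1 - w(x)}⁻¹ ≥ 1` is the conditional mean of `{1 - π}⁻¹`, and that of the odds is one less. -/
lemma param_odds (h : RegularModel 𝔖 f θ₀ c C) (hq : 𝔖.IsParam q) {x : Cov dU dZ}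
    (hx : x ∈ paramX 𝔖 q) :
    0 ≤ 𝔖.w q.f q.θ x ∧ 0 < 1 - 𝔖.w q.f q.θ x ∧
      (1 - 𝔖.w q.f q.θ x) * 𝔖.condE q.f 0 (fun y => (1 - 𝔖.π y x.1 q.θ)⁻¹) x = 1 ∧
      (1 - 𝔖.w q.f q.θ x) * 𝔖.condE q.f 0 (fun y => 𝔖.π y x.1 q.θ / (1 - 𝔖.π y x.1 q.θ)) x =
        𝔖.w q.f q.θ x := by
  -- `e ≥ 1`, since `(1 - π)⁻¹ ≥ 1`; the odds are `(1 - π)⁻¹ - 1`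
  set e := 𝔖.condE q.f 0 (fun y => (1 - 𝔖.π y x.1 q.θ)⁻¹) x with he
  have hw : 1 - 𝔖.w q.f q.θ x = e⁻¹ := by simp only [w]; ring
  obtain ⟨hi, h1⟩ := h.param_integrable hq hx 0
  have hbd : ∀ y ∈ 𝔖.𝒴 0, 1 ≤ (1 - 𝔖.π y x.1 q.θ)⁻¹ ∧ (1 - 𝔖.π y x.1 q.θ)⁻¹ ≤ c⁻¹ :=
    fun y hy => by
      obtain ⟨h2, h3, -⟩ := h.one_sub_pi_bounds (r := (y, x)) ⟨hy, hx.1⟩ hq.theta_mem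
      exact ⟨(one_le_inv₀ (h.c_pos.trans_le h2)).2 h3, inv_anti₀ h.c_pos h2⟩
  have hint : Integrable (fun y => (1 - 𝔖.π y x.1 q.θ)⁻¹ * q.f 0 y x)
      ((𝔖.ν 0).restrict (𝔖.𝒴 0)) :=
    h.param_integrable_mul hq hx (((measurable_const (a := (1 : ℝ))).sub
      (h.measurable_π_section x q.θ)).inv.aestronglyMeasurable) (D := c⁻¹) fun y hy => by
        rw [abs_of_nonneg (zero_le_one.trans (hbd y hy).1)]; exact (hbd y hy).2
  have he1 : 1 ≤ e := by
    rw [← h1]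
    refine setIntegral_mono_on hi hint (h.measurableSet_𝒴 0) fun y hy => ?_
    exact le_mul_of_one_le_left (hq.f_nonneg 0 y hy x hx.1) (hbd y hy).1
  have he0 : e ≠ 0 := by positivity
  have hodds : 𝔖.condE q.f 0 (fun y => 𝔖.π y x.1 q.θ / (1 - 𝔖.π y x.1 q.θ)) x = e - 1 := by
    have h4 : e - 1 = ∫ y in 𝔖.𝒴 0, ((1 - 𝔖.π y x.1 q.θ)⁻¹ * q.f 0 y x - q.f 0 y x) ∂(𝔖.ν 0) := by
      rw [integral_sub hint hi, h1]; rfl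
    rw [h4]
    refine setIntegral_congr_fun (h.measurableSet_𝒴 0) fun y hy => ?_
    have h2 := h.c_pos.trans_le
      (h.one_sub_pi_bounds (r := (y, x)) ⟨hy, hx.1⟩ hq.theta_mem).1
    have h3 := h2.ne'
    simp only at h3 ⊢
    field_simp
    ring
  refine ⟨?_, ?_, ?_, ?_⟩
  · have : e⁻¹ ≤ 1 := inv_le_one_of_one_le₀ he1
    linarith
  · rw [hw]; positivity
  · rw [hw, inv_mul_cancel₀ he0]
  · rw [hodds, hw, mul_sub, inv_mul_cancel₀ he0, ← hw]; ring

lemma wt_nonneg (h : RegularModel 𝔖 f θ₀ c C) (hq : 𝔖.IsParam q) {x : Cov dU dZ}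
    (hx : x ∈ paramX 𝔖 q) (t : Fin 2) : 0 ≤ wt 𝔖 q t x := by
  obtain ⟨h1, h2, -⟩ := h.param_odds hq hx
  unfold wt; split_ifs
  exacts [h1, h2.le]

lemma measurable_lawDensity (h : RegularModel 𝔖 f θ₀ c C) (hq : 𝔖.IsParam q) (t : Fin 2) :
    Measurable fun r : ℝ × Cov dU dZ => wt 𝔖 q t r.2 * q.f t r.1 r.2 :=
  ((h.measurable_wt hq t).comp measurable_snd).mul (hq.measurable_f t)

lemma lintegral_law (h : RegularModel 𝔖 f θ₀ c C) (hq : 𝔖.IsParam q) {G : Obs dU dZ → ℝ≥0∞}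
    (hG : Measurable G) : ∫⁻ o, G o ∂(𝔖.law q) = ∑ t : Fin 2, ∫⁻ r,
      ENNReal.ofReal (wt 𝔖 q t r.2 * q.f t r.1 r.2) * G (t, r)
        ∂(((𝔖.ν t).restrict (𝔖.𝒴 t)).prod q.g) := by
  unfold law
  rw [lintegral_finsetSum_measure]
  refine Finset.sum_congr rfl fun t _ => ?_
  rw [lintegral_map hG measurable_prodMk_left]
  exact lintegral_withDensity_eq_lintegral_mul _ (h.measurable_lawDensity hq t).ennreal_ofReal
    (hG.comp measurable_prodMk_left)

lemma lintegral_law_density (h : RegularModel 𝔖 f θ₀ c C) (hq : 𝔖.IsParam q) (t : Fin 2) :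
    ∫⁻ r, ENNReal.ofReal (wt 𝔖 q t r.2 * q.f t r.1 r.2)
        ∂(((𝔖.ν t).restrict (𝔖.𝒴 t)).prod q.g) = ∫⁻ x, ENNReal.ofReal (wt 𝔖 q t x) ∂q.g := by
  have := h.finite t
  have := hq.prob
  rw [lintegral_prod_symm _ (h.measurable_lawDensity hq t).ennreal_ofReal.aemeasurable]
  refine lintegral_congr_ae ?_
  filter_upwards [hq.ae_paramX] with x hx
  simp_rw [ENNReal.ofReal_mul (h.wt_nonneg hq hx t)]
  rw [lintegral_const_mul', hx.2 t, mul_one]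
  exact ENNReal.ofReal_ne_top

lemma isProbabilityMeasure_law (h : RegularModel 𝔖 f θ₀ c C) (hq : 𝔖.IsParam q) :
    IsProbabilityMeasure (𝔖.law q) := by
  have := hq.prob
  constructor
  rw [← lintegral_one, h.lintegral_law hq measurable_const]
  simp_rw [mul_one, h.lintegral_law_density hq]
  rw [Fin.sum_univ_two, ← lintegral_add_left (h.measurable_wt hq 0).ennreal_ofReal]
  calc _ = ∫⁻ _, 1 ∂q.g := by
        refine lintegral_congr_ae ?_
        filter_upwards [hq.ae_paramX] with x hx
        rw [← ENNReal.ofReal_add (h.wt_nonneg hq hx 0) (h.wt_nonneg hq hx 1)]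
        simp [wt]
    _ = 1 := by simp

lemma ae_law (h : RegularModel 𝔖 f θ₀ c C) {p : Cov dU dZ → Prop}
    (hp : ∀ᵐ x ∂q.g, p x) (hq : 𝔖.IsParam q) :
    ∀ᵐ o ∂(𝔖.law q), o.2.1 ∈ 𝔖.𝒴 o.1 ∧ p o.2.2 := by
  have := hq.prob
  unfold law
  rw [ae_finsetSum_measure_iff]
  intro t _
  have := h.finite t
  rw [(measurableEmbedding_prodMk_left t).ae_map_iff]
  refine (withDensity_absolutelyContinuous _ _).ae_le ?_
  filter_upwards [Measure.quasiMeasurePreserving_fst.ae (ae_restrict_mem (h.measurableSet_𝒴 t)),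
    Measure.quasiMeasurePreserving_snd.ae hp] with r h1 h2
  exact ⟨h1, h2⟩

lemma ae_law_range (h : RegularModel 𝔖 f θ₀ c C) (hq : 𝔖.IsParam q) :
    ∀ᵐ o ∂(𝔖.law q), o ∈ obsRange 𝔖 := h.ae_law hq.ae_mem hq

lemma integrable_law (h : RegularModel 𝔖 f θ₀ c C) (hq : 𝔖.IsParam q) {k : Obs dU dZ → ℝ}
    (hk : Measurable k) {D : ℝ} (hD : ∀ o ∈ obsRange 𝔖, |k o| ≤ D) :
    Integrable k (𝔖.law q) := by
  have := h.isProbabilityMeasure_law hq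
  refine Integrable.of_bound hk.aestronglyMeasurable D ?_
  filter_upwards [h.ae_law_range hq] with o ho using hD o ho

/-- Expectations under the law of the observations. -/
lemma integral_law (h : RegularModel 𝔖 f θ₀ c C) (hq : 𝔖.IsParam q) {k : Obs dU dZ → ℝ}
    (hk : Measurable k) {D : ℝ} (hD : ∀ o ∈ obsRange 𝔖, |k o| ≤ D) :
    ∫ o, k o ∂(𝔖.law q) = ∫ x, (𝔖.w q.f q.θ x * 𝔖.condE q.f 1 (fun y => k (1, y, x)) x +
      (1 - 𝔖.w q.f q.θ x) * 𝔖.condE q.f 0 (fun y => k (0, y, x)) x) ∂q.g := by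
  have := hq.prob
  have hi := h.integrable_law hq hk hD
  have hkt : ∀ t, Measurable fun r : ℝ × Cov dU dZ => k (t, r) :=
    fun t => hk.comp measurable_prodMk_left
  have hdm := fun t => (h.measurable_lawDensity hq t).ennreal_ofReal
  have hdens : ∀ t, ∀ᵐ r ∂(((𝔖.ν t).restrict (𝔖.𝒴 t)).prod q.g),
      0 ≤ wt 𝔖 q t r.2 * q.f t r.1 r.2 := fun t => by
    have := h.finite t
    filter_upwards [Measure.quasiMeasurePreserving_fst.ae (ae_restrict_mem (h.measurableSet_𝒴 t)),
      Measure.quasiMeasurePreserving_snd.ae hq.ae_paramX] with r h1 h2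
    exact mul_nonneg (h.wt_nonneg hq h2 t) (hq.f_nonneg t _ h1 _ h2.1)
  have hsum : Integrable k (∑ t : Fin 2, ((((𝔖.ν t).restrict (𝔖.𝒴 t)).prod q.g).withDensity
      (fun r => ENNReal.ofReal (wt 𝔖 q t r.2 * q.f t r.1 r.2))).map
        (fun r => ((t, r) : Obs dU dZ))) := hi
  rw [integrable_finsetSum_measure] at hsum
  have hit : ∀ t, Integrable (fun r : ℝ × Cov dU dZ =>
      (wt 𝔖 q t r.2 * q.f t r.1 r.2) * k (t, r)) (((𝔖.ν t).restrict (𝔖.𝒴 t)).prod q.g) := by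
    intro t
    have h1 := (integrable_map_measure hk.aestronglyMeasurable
      measurable_prodMk_left.aemeasurable).1 (hsum t (Finset.mem_univ t))
    rw [integrable_withDensity_iff_integrable_smul' (hdm t)
      (ae_of_all _ fun _ => ENNReal.ofReal_lt_top)] at h1
    refine h1.congr ?_
    filter_upwards [hdens t] with r hr
    rw [ENNReal.toReal_ofReal hr]
    rfl
  -- the contribution of the arm `t`, by Fubini
  have hterm : ∀ t, ∫ o, k o ∂((((𝔖.ν t).restrict (𝔖.𝒴 t)).prod q.g).withDensity
      (fun r => ENNReal.ofReal (wt 𝔖 q t r.2 * q.f t r.1 r.2))).map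
        (fun r => ((t, r) : Obs dU dZ)) =
      ∫ x, wt 𝔖 q t x * 𝔖.condE q.f t (fun y => k (t, y, x)) x ∂q.g := by
    intro t
    have := h.finite t
    rw [integral_map measurable_prodMk_left.aemeasurable hk.aestronglyMeasurable,
      integral_withDensity_eq_integral_toReal_smul (hdm t)
      (ae_of_all _ fun _ => ENNReal.ofReal_lt_top)]
    calc _ = ∫ r, (wt 𝔖 q t r.2 * q.f t r.1 r.2) * k (t, r)
          ∂(((𝔖.ν t).restrict (𝔖.𝒴 t)).prod q.g) := by
          refine integral_congr_ae ?_
          filter_upwards [hdens t] with r hr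
          rw [ENNReal.toReal_ofReal hr, smul_eq_mul]
      _ = _ := by
          rw [integral_prod_symm _ (hit t)]
          refine integral_congr_ae (ae_of_all _ fun x => ?_)
          simp only [condE]
          rw [← integral_const_mul]
          refine integral_congr_ae (ae_of_all _ fun y => ?_)
          simp only
          ring
  have hix : ∀ t, Integrable (fun x => wt 𝔖 q t x * 𝔖.condE q.f t (fun y => k (t, y, x)) x) q.g := by
    intro t
    have := h.finite t
    refine (hit t).integral_prod_right.congr (ae_of_all _ fun x => ?_)
    simp only [condE]
    rw [← integral_const_mul]
    refine integral_congr_ae (ae_of_all _ fun y => ?_)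
    simp only
    ring
  have hlaw : 𝔖.law q = ∑ t : Fin 2, ((((𝔖.ν t).restrict (𝔖.𝒴 t)).prod q.g).withDensity
      (fun r => ENNReal.ofReal (wt 𝔖 q t r.2 * q.f t r.1 r.2))).map
        (fun r => ((t, r) : Obs dU dZ)) := rfl
  rw [hlaw, integral_finsetSum_measure hsum, Fin.sum_univ_two, hterm, hterm,
    ← integral_add (hix 0) (hix 1)]
  refine integral_congr_ae (ae_of_all _ fun x => ?_)
  simp only [wt, zero_ne_one, if_false, if_true]
  ring

lemma abs_resid_le (h : RegularModel 𝔖 f θ₀ c C) {θ : EuclideanSpace ℝ (Fin d)} (hθ : θ ∈ 𝔖.Θ)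
    {o : Obs dU dZ} (ho : o ∈ obsRange 𝔖) : |𝔖.resid θ o| ≤ 1 + c⁻¹ := by
  have hc := h.c_pos
  obtain ⟨t, y, x⟩ := o
  obtain rfl | rfl := fin_two_eq t
  · obtain ⟨h1, h2, h3⟩ := h.one_sub_pi_bounds (r := (y, x)) ho hθ
    have h4 := hc.trans_le h1
    simp only at h1 h2 h3 h4
    have h5 : 0 ≤ 𝔖.π y x.1 θ := hc.le.trans h3
    simp only [resid, tval_zero, sub_zero, one_mul, zero_sub, abs_neg]
    rw [abs_of_nonneg (by positivity), div_le_iff₀ h4]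
    have h6 : 1 ≤ c⁻¹ * (1 - 𝔖.π y x.1 θ) := by
      rw [inv_mul_eq_div, one_le_div hc]; exact h1
    nlinarith
  · simp only [resid, tval_one, sub_self, zero_mul, sub_zero, abs_one]
    have : 0 < c⁻¹ := by positivity
    linarith

lemma abs_altNum_le (h : RegularModel 𝔖 f θ₀ c C) {θ : EuclideanSpace ℝ (Fin d)} (hθ : θ ∈ 𝔖.Θ)
    {o : Obs dU dZ} (ho : o ∈ obsRange 𝔖) : |𝔖.altNum θ o| ≤ (1 + c⁻¹) * C := by
  rw [altNum_eq, abs_mul]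
  have := h.c_pos
  exact mul_le_mul (h.abs_resid_le hθ ho) (h.outcome_le _ _ ho.1) (abs_nonneg _) (by positivity)

/-- The conditional mean of `resid` given the covariates vanishes in every model of the family. -/
lemma integral_law_resid_mul (h : RegularModel 𝔖 f θ₀ c C) (hq : 𝔖.IsParam q)
    {φ : Cov dU dZ → ℝ} (hφ : Measurable φ) {D : ℝ} (hD : ∀ x ∈ 𝔖.𝒳, |φ x| ≤ D) :
    ∫ o, 𝔖.resid q.θ o * φ o.2.2 ∂(𝔖.law q) = 0 := by
  have hc := h.c_pos
  rw [h.integral_law hq (k := fun o => 𝔖.resid q.θ o * φ o.2.2) ((h.measurable_resid q.θ).mul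
    (hφ.comp (measurable_snd.comp measurable_snd))) (D := (1 + c⁻¹) * D) fun o ho => by
      rw [abs_mul]
      exact mul_le_mul (h.abs_resid_le hq.theta_mem ho) (hD _ ho.2) (abs_nonneg _) (by positivity)]
  rw [integral_eq_zero_of_ae]
  filter_upwards [hq.ae_paramX] with x hx
  obtain ⟨-, -, -, h1⟩ := h.param_odds hq hx
  -- the residual is `1` in the treatment arm and minus the odds in the control arm, whose mean is
  -- `w / (1 - w)`
  have e1 : 𝔖.condE q.f 1 (fun y => 𝔖.resid q.θ (1, y, x) * φ x) x = φ x := by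
    have : ∀ y, 𝔖.resid q.θ (1, y, x) * φ x * q.f 1 y x = φ x * q.f 1 y x := fun y => by
      simp [resid]
    simp only [condE, this]
    rw [integral_const_mul, (h.param_integrable hq hx 1).2, mul_one]
  have e0 : 𝔖.condE q.f 0 (fun y => 𝔖.resid q.θ (0, y, x) * φ x) x =
      -(φ x * 𝔖.condE q.f 0 (fun y => 𝔖.π y x.1 q.θ / (1 - 𝔖.π y x.1 q.θ)) x) := by
    simp only [condE]
    rw [← integral_const_mul, ← integral_neg]
    refine integral_congr_ae (ae_of_all _ fun y => ?_)
    simp only [resid, tval_zero]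
    ring
  simp only [e1, e0, Pi.zero_apply]
  linear_combination (-φ x) * h1

lemma att_eq (h : RegularModel 𝔖 f θ₀ c C) (hq : 𝔖.IsParam q) :
    𝔖.att q = (∫ o, 𝔖.altNum q.θ o ∂(𝔖.law q)) / ∫ o, tval o.1 ∂(𝔖.law q) := by
  rw [h.integral_law hq (h.measurable_altNum q.θ) fun o ho => h.abs_altNum_le hq.theta_mem ho,
    h.integral_law hq (k := fun o => tval o.1) (measurable_tval.comp measurable_fst) (D := 1)
      fun o _ => abs_tval_le o.1]
  unfold att
  congr 1
  · refine integral_congr_ae (ae_of_all _ fun x => ?_)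
    simp only [altNum, tval_one, tval_zero, condE, sub_self, zero_mul, sub_zero, one_mul,
      zero_sub, neg_mul, integral_neg]
    ring
  · refine integral_congr_ae ?_
    filter_upwards [hq.ae_paramX] with x hx
    simp only [tval_one, tval_zero, condE, one_mul, zero_mul, integral_zero, mul_zero, add_zero]
    rw [(h.param_integrable hq hx 1).2, mul_one]

end RegularModel
end Law
end ATTSetup

/-! ### The sample and the regular model -/

namespace ATTSetup

variable {d dU dZ : ℕ} {𝔖 : ATTSetup d dU dZ} {f : Fin 2 → ℝ → Cov dU dZ → ℝ}
  {θ₀ : EuclideanSpace ℝ (Fin d)} {c C : ℝ}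
  {Ω : Type*} [MeasurableSpace Ω] {μ : Measure Ω} [IsProbabilityMeasure μ]
  {T : ℕ → Ω → Fin 2} {Y : Fin 2 → ℕ → Ω → ℝ} {X : ℕ → Ω → Cov dU dZ}

namespace IsSample

/-- The law of the covariates in the treatment arm `t`. -/
noncomputable def lawX (μ : Measure Ω) (T : ℕ → Ω → Fin 2) (X : ℕ → Ω → Cov dU dZ)
    (t : Fin 2) : Measure (Cov dU dZ) := (μ.restrict {ω | T 0 ω = t}).map (X 0)

lemma measurable_tval_T (hs : 𝔖.IsSample f θ₀ μ T Y X) : Measurable fun ω => tval (T 0 ω) :=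
  (measurable_of_countable tval).comp (hs.measurable_T 0)

lemma measurable_YX (hs : 𝔖.IsSample f θ₀ μ T Y X) (t : Fin 2) :
    Measurable fun ω => (Y t 0 ω, X 0 ω) := (hs.measurable_Y t 0).prodMk (hs.measurable_X 0)

lemma measurableSet_arm (hs : 𝔖.IsSample f θ₀ μ T Y X) (t : Fin 2) :
    MeasurableSet {ω | T 0 ω = t} := hs.measurable_T 0 (measurableSet_singleton t)

/-- `E{T k(Y₀, X)} = E{π(Y₀, U) k(Y₀, X)}`. -/
lemma integral_tval_mul (hs : 𝔖.IsSample f θ₀ μ T Y X) {k : ℝ × Cov dU dZ → ℝ}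
    (hk : Measurable k) {D : ℝ} (hD : ∀ᵐ ω ∂μ, |k (Y 0 0 ω, X 0 ω)| ≤ D) :
    ∫ ω, tval (T 0 ω) * k (Y 0 0 ω, X 0 ω) ∂μ =
      ∫ ω, 𝔖.π (Y 0 0 ω) (X 0 ω).1 θ₀ * k (Y 0 0 ω, X 0 ω) ∂μ := by
  have hle := (hs.measurable_YX 0).comap_le
  have hkm : StronglyMeasurable[MeasurableSpace.comap (fun ω => (Y 0 0 ω, X 0 ω)) inferInstance]
      fun ω => k (Y 0 0 ω, X 0 ω) :=
    (hk.comp (comap_measurable _)).stronglyMeasurable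
  have hTi : Integrable (fun ω => tval (T 0 ω)) μ :=
    Integrable.of_bound hs.measurable_tval_T.aestronglyMeasurable 1
      (ae_of_all _ fun ω => abs_tval_le _)
  have hki : Integrable (fun ω => tval (T 0 ω) * k (Y 0 0 ω, X 0 ω)) μ :=
    hTi.mul_bdd (c := D) (hk.comp (hs.measurable_YX 0)).aestronglyMeasurable hD
  rw [← integral_condExp hle]
  refine integral_congr_ae ?_
  have h1 := condExp_mul_of_stronglyMeasurable_right (μ := μ) hkm hki hTi
  filter_upwards [h1, hs.treatment] with ω h2 h3
  refine h2.trans ?_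
  rw [Pi.mul_apply, h3]

/-- `E{(1 - T) k(Y₀, X)} = E[{1 - π(Y₀, U)} k(Y₀, X)]`. -/
lemma integral_one_sub_tval_mul (hs : 𝔖.IsSample f θ₀ μ T Y X) {k : ℝ × Cov dU dZ → ℝ}
    (hk : Measurable k) {D : ℝ} (hD : ∀ᵐ ω ∂μ, |k (Y 0 0 ω, X 0 ω)| ≤ D)
    {D' : ℝ} (hπ : ∀ᵐ ω ∂μ, |𝔖.π (Y 0 0 ω) (X 0 ω).1 θ₀| ≤ D') :
    ∫ ω, (1 - tval (T 0 ω)) * k (Y 0 0 ω, X 0 ω) ∂μ =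
      ∫ ω, (1 - 𝔖.π (Y 0 0 ω) (X 0 ω).1 θ₀) * k (Y 0 0 ω, X 0 ω) ∂μ := by
  have hkm := hk.comp (hs.measurable_YX 0)
  have hki : Integrable (fun ω => k (Y 0 0 ω, X 0 ω)) μ :=
    Integrable.of_bound hkm.aestronglyMeasurable D hD
  have h1 : Integrable (fun ω => tval (T 0 ω) * k (Y 0 0 ω, X 0 ω)) μ :=
    hki.bdd_mul (c := 1) hs.measurable_tval_T.aestronglyMeasurable
      (ae_of_all _ fun ω => abs_tval_le _)
  have hπm : Measurable fun ω => 𝔖.π (Y 0 0 ω) (X 0 ω).1 θ₀ :=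
    (hs.measurable_π θ₀).comp ((hs.measurable_Y 0 0).prodMk
      (measurable_fst.comp (hs.measurable_X 0)))
  have h2 : Integrable (fun ω => 𝔖.π (Y 0 0 ω) (X 0 ω).1 θ₀ * k (Y 0 0 ω, X 0 ω)) μ :=
    hki.bdd_mul (c := D') hπm.aestronglyMeasurable hπ
  simp_rw [sub_mul, one_mul]
  rw [integral_sub hki h1, integral_sub hki h2, hs.integral_tval_mul hk hD]

lemma ae_overlap (hs : 𝔖.IsSample f θ₀ μ T Y X)
    (hov : ∀ y ∈ 𝔖.𝒴 0, ∀ x ∈ 𝔖.𝒳, c < 𝔖.π y x.1 θ₀ ∧ 𝔖.π y x.1 θ₀ < 1 - c) :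
    ∀ᵐ ω ∂μ, c < 𝔖.π (Y 0 0 ω) (X 0 ω).1 θ₀ ∧ 𝔖.π (Y 0 0 ω) (X 0 ω).1 θ₀ < 1 - c := by
  filter_upwards [hs.ae_mem_𝒴 0, hs.ae_mem_𝒳] with ω h1 h2 using hov _ h1 _ h2

/-- By overlap, the two arms dominate the law of the covariates. -/
lemma absolutelyContinuous_lawX (hs : 𝔖.IsSample f θ₀ μ T Y X) (hc : 0 < c)
    (hov : ∀ y ∈ 𝔖.𝒴 0, ∀ x ∈ 𝔖.𝒳, c < 𝔖.π y x.1 θ₀ ∧ 𝔖.π y x.1 θ₀ < 1 - c) (t : Fin 2) :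
    μ.map (X 0) ≪ lawX μ T X t := by
  refine Measure.AbsolutelyContinuous.mk fun A hA h0 => ?_
  rw [lawX, Measure.map_apply (hs.measurable_X 0) hA,
    Measure.restrict_apply (hs.measurable_X 0 hA)] at h0
  rw [Measure.map_apply (hs.measurable_X 0) hA]
  have hae := hs.ae_overlap hov
  have hAX := hs.measurable_X 0 hA
  set k : ℝ × Cov dU dZ → ℝ := fun r => A.indicator 1 r.2 with hk
  have hkm : Measurable k := (measurable_one.indicator hA).comp measurable_snd
  have hk1 : ∀ r, 0 ≤ k r ∧ k r ≤ 1 := fun r => by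
    by_cases hr : r.2 ∈ A <;> simp [hk, hr]
  have hD : ∀ᵐ ω ∂μ, |k (Y 0 0 ω, X 0 ω)| ≤ 1 := ae_of_all _ fun ω => by
    rw [abs_of_nonneg (hk1 _).1]; exact (hk1 _).2
  -- the indicator of `X ∈ A` vanishes almost everywhere on the arm
  have hzero : ∀ᵐ ω ∂μ, T 0 ω = t → k (Y 0 0 ω, X 0 ω) = 0 := by
    have : ∀ᵐ ω ∂μ, ω ∉ X 0 ⁻¹' A ∩ {ω | T 0 ω = t} := measure_eq_zero_iff_ae_notMem.1 h0
    filter_upwards [this] with ω hω hT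
    have : X 0 ω ∉ A := fun h => hω ⟨h, hT⟩
    simp [hk, this]
  -- given `(Y₀, X)`, the arm has a probability `ρ` that is bounded away from zero
  have hfin : ∀ (ρ : Ω → ℝ), Measurable ρ → (∀ᵐ ω ∂μ, c ≤ ρ ω ∧ ρ ω ≤ 1) →
      ∫ ω, ρ ω * k (Y 0 0 ω, X 0 ω) ∂μ = 0 → μ (X 0 ⁻¹' A) = 0 := by
    intro ρ hρ hb hint
    have hkm' := hkm.comp (hs.measurable_YX 0)
    have hi : Integrable (fun ω => ρ ω * k (Y 0 0 ω, X 0 ω)) μ := by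
      refine Integrable.of_bound (hρ.mul hkm').aestronglyMeasurable 1 ?_
      filter_upwards [hb] with ω h1
      rw [norm_mul, Real.norm_of_nonneg (hc.le.trans h1.1), Real.norm_of_nonneg (hk1 _).1]
      exact mul_le_one₀ h1.2 (hk1 _).1 (hk1 _).2
    have h2 := (integral_eq_zero_iff_of_nonneg_ae (by
      filter_upwards [hb] with ω h1
      exact mul_nonneg (hc.le.trans h1.1) (hk1 _).1) hi).1 hint
    rw [measure_eq_zero_iff_ae_notMem]
    filter_upwards [h2, hb] with ω h3 h4 h5
    have h6 : X 0 ω ∈ A := h5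
    simp only [hk, Set.indicator_of_mem h6, Pi.one_apply, mul_one, Pi.zero_apply] at h3
    linarith
  have hπm : Measurable fun ω => 𝔖.π (Y 0 0 ω) (X 0 ω).1 θ₀ :=
    (hs.measurable_π θ₀).comp ((hs.measurable_Y 0 0).prodMk
      (measurable_fst.comp (hs.measurable_X 0)))
  obtain rfl | rfl := fin_two_eq t
  · refine hfin (fun ω => 1 - 𝔖.π (Y 0 0 ω) (X 0 ω).1 θ₀) (measurable_const.sub hπm) ?_ ?_
    · filter_upwards [hae] with ω h1
      constructor <;> linarith
    · rw [← hs.integral_one_sub_tval_mul hkm hD (D' := 1) (by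
        filter_upwards [hae] with ω h1
        rw [abs_le]; constructor <;> linarith)]
      refine integral_eq_zero_of_ae ?_
      filter_upwards [hzero] with ω h1
      obtain h2 | h2 := fin_two_eq (T 0 ω)
      · simp [h1 h2]
      · simp [h2]
  · refine hfin (fun ω => 𝔖.π (Y 0 0 ω) (X 0 ω).1 θ₀) hπm ?_ ?_
    · filter_upwards [hae] with ω h1
      constructor <;> linarith
    · rw [← hs.integral_tval_mul hkm hD]
      refine integral_eq_zero_of_ae ?_
      filter_upwards [hzero] with ω h1
      obtain h2 | h2 := fin_two_eq (T 0 ω)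
      · simp [h2]
      · simp [h1 h2]

/-- `f t` integrates to one at almost all covariate values of the arm `t`. -/
lemma density_lawX (hs : 𝔖.IsSample f θ₀ μ T Y X) (t : Fin 2) :
    ∀ᵐ x ∂(lawX μ T X t), ∫⁻ y in 𝔖.𝒴 t, ENNReal.ofReal (f t y x) ∂(𝔖.ν t) = 1 := by
  have := hs.sigmaFinite t
  have hfm := (hs.measurable_f t).ennreal_ofReal
  have hφ : Measurable fun x => ∫⁻ y in 𝔖.𝒴 t, ENNReal.ofReal (f t y x) ∂(𝔖.ν t) :=
    Measurable.lintegral_prod_left hfm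
  have hfin : IsFiniteMeasure (lawX μ T X t) := by unfold lawX; infer_instance
  -- integrating out the outcome does not change the law of the covariates in the arm
  have key : (lawX μ T X t).withDensity
      (fun x => ∫⁻ y in 𝔖.𝒴 t, ENNReal.ofReal (f t y x) ∂(𝔖.ν t)) = (lawX μ T X t).withDensity 1 := by
    rw [withDensity_one]
    ext A hA
    have h1 := congrArg (fun ρ => ρ (Prod.snd ⁻¹' A)) (hs.density t)
    rw [Measure.map_apply (hs.measurable_YX t) (measurable_snd hA),
      withDensity_apply _ (measurable_snd hA), ← lintegral_indicator (measurable_snd hA),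
      lintegral_prod_symm _ (hfm.indicator (measurable_snd hA)).aemeasurable] at h1
    rw [withDensity_apply _ hA, ← lintegral_indicator hA, lawX,
      Measure.map_apply (hs.measurable_X 0) hA]
    refine Eq.trans ?_ h1.symm
    refine lintegral_congr fun x => ?_
    by_cases hx : x ∈ A
    · rw [Set.indicator_of_mem hx]
      refine lintegral_congr fun y => ?_
      rw [Set.indicator_of_mem (by exact hx)]
    · rw [Set.indicator_of_notMem hx, eq_comm]
      refine (lintegral_congr fun y => ?_).trans lintegral_zero
      rw [Set.indicator_of_notMem (by exact hx)]
  refine (withDensity_eq_iff hφ.aemeasurable aemeasurable_const ?_).1 key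
  rw [← setLIntegral_univ, ← withDensity_apply _ MeasurableSet.univ, key]
  simp [withDensity_one]

/-- The assumptions provide the analytic conditions. The dominating measures are finite on the
ranges because the densities are bounded away from zero. -/
lemma exists_regularModel (hs : 𝔖.IsSample f θ₀ μ T Y X) (hr : 𝔖.Regularity f θ₀ μ T Y X) :
    ∃ c C, RegularModel 𝔖 f θ₀ c C := by
  obtain ⟨c₁, hc₁, hov⟩ := hr.overlap
  obtain ⟨c₂, hc₂, C₂, hf⟩ := hr.density_bounds
  obtain ⟨C₁, hC₁⟩ := hr.bounded
  have hθ := interior_subset hr.interior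
  have hfin : ∀ t, IsFiniteMeasure ((𝔖.ν t).restrict (𝔖.𝒴 t)) := by
    intro t
    have hac := hs.absolutelyContinuous_lawX hc₁ (fun y hy x hx => hov y hy x hx θ₀ hθ) t
    have hP := Measure.isProbabilityMeasure_map (μ := μ) (hs.measurable_X 0).aemeasurable
    have h1 : ∀ᵐ x ∂(μ.map (X 0)), x ∈ 𝔖.𝒳 :=
      (ae_map_iff (hs.measurable_X 0).aemeasurable hs.measurableSet_𝒳).2 hs.ae_mem_𝒳
    obtain ⟨x, hx, hx1⟩ := (h1.and (hac.ae_le (hs.density_lawX t))).exists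
    constructor
    rw [Measure.restrict_apply_univ]
    -- a density that is at least `c₂` on a set of infinite measure cannot integrate to one
    by_contra hcon
    rw [not_lt, top_le_iff] at hcon
    have h2 : ∫⁻ y in 𝔖.𝒴 t, ENNReal.ofReal c₂ ∂(𝔖.ν t) ≤
        ∫⁻ y in 𝔖.𝒴 t, ENNReal.ofReal (f t y x) ∂(𝔖.ν t) :=
      setLIntegral_mono' (hs.measurableSet_𝒴 t) fun y hy =>
        ENNReal.ofReal_le_ofReal (hf t y hy x hx).1
    rw [hx1, setLIntegral_const, hcon, ENNReal.mul_top (by simpa using hc₂)] at h2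
    simp at h2
  refine ⟨min c₁ c₂, max (max C₁ C₂) 0, ⟨hr.compact, hr.interior, hs.measurableSet_𝒴,
    hs.measurableSet_𝒳, hs.measurable_π, hs.measurable_f, hfin, lt_min hc₁ hc₂,
    le_max_right _ _, fun y hy x hx θ' hθ' => ?_, hr.smooth, fun t y hy => ?_,
    fun t y hy x hx => ?_⟩⟩
  · obtain ⟨h1, h2⟩ := hov y hy x hx θ' hθ'
    have := min_le_left c₁ c₂
    constructor <;> linarith
  · exact (hC₁ t y hy).trans ((le_max_left _ _).trans (le_max_left _ _))
  · exact ⟨(min_le_right _ _).trans (hf t y hy x hx).1,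
      (hf t y hy x hx).2.trans ((le_max_right _ _).trans (le_max_left _ _))⟩

/-- The true parameter belongs to the model. -/
lemma isParam (hs : 𝔖.IsSample f θ₀ μ T Y X) (h : RegularModel 𝔖 f θ₀ c C) :
    𝔖.IsParam ⟨θ₀, f, μ.map (X 0)⟩ where
  theta_mem := h.theta_mem
  measurable_f := h.measurable_f
  f_nonneg t y hy x hx := h.c_pos.le.trans (h.density_bounds t y hy x hx).1
  prob := Measure.isProbabilityMeasure_map (hs.measurable_X 0).aemeasurable
  ae_mem := (ae_map_iff (hs.measurable_X 0).aemeasurable hs.measurableSet_𝒳).2 hs.ae_mem_𝒳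
  f_density t := (hs.absolutelyContinuous_lawX h.c_pos
    (fun y hy x hx => h.overlap y hy x hx θ₀ h.theta_mem) t).ae_le (hs.density_lawX t)

lemma absolutelyContinuous_lawX' (hs : 𝔖.IsSample f θ₀ μ T Y X) (t : Fin 2) :
    lawX μ T X t ≪ μ.map (X 0) :=
  Measure.AbsolutelyContinuous.map (Measure.absolutelyContinuous_of_le Measure.restrict_le_self)
    (hs.measurable_X 0)

/-- Expectations over an arm through the conditional density. -/
lemma setIntegral_arm (hs : 𝔖.IsSample f θ₀ μ T Y X) (h : RegularModel 𝔖 f θ₀ c C) (t : Fin 2)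
    {k : ℝ × Cov dU dZ → ℝ} (hk : Measurable k) {D : ℝ} (hD : ∀ r ∈ 𝔖.rangeYX t, |k r| ≤ D) :
    ∫ ω in {ω | T 0 ω = t}, k (Y t 0 ω, X 0 ω) ∂μ =
      ∫ x, 𝔖.condE f t (fun y => k (y, x)) x ∂(lawX μ T X t) := by
  have := h.finite t
  have hfin : IsFiniteMeasure (lawX μ T X t) := by unfold lawX; infer_instance
  have h1 : ∫ ω in {ω | T 0 ω = t}, k (Y t 0 ω, X 0 ω) ∂μ = ∫ r, k r
      ∂((μ.restrict {ω | T 0 ω = t}).map (fun ω => (Y t 0 ω, X 0 ω))) :=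
    (integral_map (hs.measurable_YX t).aemeasurable hk.aestronglyMeasurable).symm
  have hae : ∀ᵐ r ∂(((𝔖.ν t).restrict (𝔖.𝒴 t)).prod (lawX μ T X t)), r ∈ 𝔖.rangeYX t := by
    filter_upwards [Measure.quasiMeasurePreserving_fst.ae (ae_restrict_mem (h.measurableSet_𝒴 t)),
      Measure.quasiMeasurePreserving_snd.ae ((hs.absolutelyContinuous_lawX' t).ae_le
        (hs.isParam h).ae_mem)] with r h1 h2
    exact ⟨h1, h2⟩
  rw [h1, hs.density t, integral_withDensity_eq_integral_toReal_smul
    (hs.measurable_f t).ennreal_ofReal (ae_of_all _ fun _ => ENNReal.ofReal_lt_top)]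
  change ∫ r, _ ∂(((𝔖.ν t).restrict (𝔖.𝒴 t)).prod (lawX μ T X t)) = _
  have h2 : ∫ r, (ENNReal.ofReal (f t r.1 r.2)).toReal • k r
      ∂(((𝔖.ν t).restrict (𝔖.𝒴 t)).prod (lawX μ T X t)) = ∫ r, k r * f t r.1 r.2
      ∂(((𝔖.ν t).restrict (𝔖.𝒴 t)).prod (lawX μ T X t)) := by
    refine integral_congr_ae ?_
    filter_upwards [hae] with r hr
    rw [ENNReal.toReal_ofReal (h.c_pos.le.trans (h.density_bounds t _ hr.1 _ hr.2).1),
      smul_eq_mul, mul_comm]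
  rw [h2, integral_prod_symm]
  · rfl
  · refine Integrable.of_bound (hk.mul (hs.measurable_f t)).aestronglyMeasurable (D * C) ?_
    filter_upwards [hae] with r hr
    rw [norm_mul]
    have h3 := h.density_bounds t _ hr.1 _ hr.2
    refine mul_le_mul (hD r hr) ?_ (norm_nonneg _) ((abs_nonneg _).trans (hD r hr))
    rw [Real.norm_of_nonneg (h.c_pos.le.trans h3.1)]
    exact h3.2

end IsSample
end ATTSetup

/-! ### Conditional means given the covariates -/

namespace ATTSetup

variable {d dU dZ : ℕ} {𝔖 : ATTSetup d dU dZ} {f : Fin 2 → ℝ → Cov dU dZ → ℝ}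
  {θ₀ : EuclideanSpace ℝ (Fin d)} {c C : ℝ}

/-- A function of the observation that is measurable and bounded on `goodObs 𝔖 f`. -/
def BddObs (𝔖 : ATTSetup d dU dZ) (f : Nuis dU dZ) (k : Obs dU dZ → ℝ) : Prop :=
  Measurable ((goodObs 𝔖 f).indicator k) ∧ ∃ D, 0 ≤ D ∧ ∀ o ∈ goodObs 𝔖 f, |k o| ≤ D

/-- The conditional mean of `k(W)` given `X = x` under `(θ₀, f)`. -/
noncomputable def condMean (𝔖 : ATTSetup d dU dZ) (f : Nuis dU dZ) (θ₀ : EuclideanSpace ℝ (Fin d))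
    (k : Obs dU dZ → ℝ) (x : Cov dU dZ) : ℝ :=
  𝔖.w f θ₀ x * 𝔖.condE f 1 (fun y => k (1, y, x)) x +
    (1 - 𝔖.w f θ₀ x) * 𝔖.condE f 0 (fun y => k (0, y, x)) x

namespace BddObs

variable {k k' : Obs dU dZ → ℝ}

lemma congr (hk : BddObs 𝔖 f k) (e : ∀ o ∈ goodObs 𝔖 f, k' o = k o) : BddObs 𝔖 f k' := by
  obtain ⟨hm, D, hD, hb⟩ := hk
  refine ⟨?_, D, hD, fun o ho => by rw [e o ho]; exact hb o ho⟩
  rwa [Set.indicator_congr e]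

lemma add (hk : BddObs 𝔖 f k) (hk' : BddObs 𝔖 f k') : BddObs 𝔖 f (fun o => k o + k' o) := by
  obtain ⟨hm, D, hD, hb⟩ := hk
  obtain ⟨hm', D', hD', hb'⟩ := hk'
  refine ⟨?_, D + D', add_nonneg hD hD', fun o ho =>
    (abs_add_le _ _).trans (add_le_add (hb o ho) (hb' o ho))⟩
  exact measurable_of_eq (hm.add hm') fun o => (congrFun (Set.indicator_add _ k k') o).symm

lemma mul (hk : BddObs 𝔖 f k) (hk' : BddObs 𝔖 f k') : BddObs 𝔖 f (fun o => k o * k' o) := by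
  obtain ⟨hm, D, hD, hb⟩ := hk
  obtain ⟨hm', D', hD', hb'⟩ := hk'
  refine ⟨?_, D * D', mul_nonneg hD hD', fun o ho => by
    rw [abs_mul]; exact mul_le_mul (hb o ho) (hb' o ho) (abs_nonneg _) hD⟩
  exact measurable_of_eq (hm.mul hm') fun o => (congrFun (Set.indicator_mul _ k k') o).symm

lemma of_measurable (h : RegularModel 𝔖 f θ₀ c C) (hk : Measurable k) {D : ℝ}
    (hD : ∀ o ∈ goodObs 𝔖 f, |k o| ≤ D) : BddObs 𝔖 f k :=
  ⟨hk.indicator h.measurableSet_goodObs, max D 0, le_max_right _ _,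
    fun o ho => (hD o ho).trans (le_max_left _ _)⟩

lemma const (h : RegularModel 𝔖 f θ₀ c C) (r : ℝ) : BddObs 𝔖 f fun _ => r :=
  of_measurable h measurable_const (D := |r|) fun _ _ => le_rfl

lemma const_mul (h : RegularModel 𝔖 f θ₀ c C) (r : ℝ) (hk : BddObs 𝔖 f k) :
    BddObs 𝔖 f (fun o => r * k o) := (const h r).mul hk

lemma sub (h : RegularModel 𝔖 f θ₀ c C) (hk : BddObs 𝔖 f k) (hk' : BddObs 𝔖 f k') :
    BddObs 𝔖 f (fun o => k o - k' o) :=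
  (hk.add (const_mul h (-1) hk')).congr fun o _ => by ring

lemma sum (h : RegularModel 𝔖 f θ₀ c C) {ι : Type*} (s : Finset ι) {k : ι → Obs dU dZ → ℝ}
    (hk : ∀ i ∈ s, BddObs 𝔖 f (k i)) : BddObs 𝔖 f (fun o => ∑ i ∈ s, k i o) := by
  classical
  induction s using Finset.induction_on with
  | empty => simpa using const h 0
  | insert i s hi ih =>
    refine ((hk i (Finset.mem_insert_self _ _)).add
      (ih fun j hj => hk j (Finset.mem_insert_of_mem hj))).congr fun o _ => ?_
    rw [Finset.sum_insert hi]

/-- A bounded measurable function that agrees with `k` on `goodObs`. -/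
lemma exists_measurable (hk : BddObs 𝔖 f k) : ∃ k', Measurable k' ∧
    (∃ D, 0 ≤ D ∧ ∀ o, |k' o| ≤ D) ∧ ∀ o ∈ goodObs 𝔖 f, k' o = k o := by
  obtain ⟨hm, D, hD, hb⟩ := hk
  refine ⟨_, hm, ⟨D, hD, fun o => ?_⟩, fun o ho => Set.indicator_of_mem ho _⟩
  by_cases ho : o ∈ goodObs 𝔖 f
  · rw [Set.indicator_of_mem ho]; exact hb o ho
  · rw [Set.indicator_of_notMem ho, abs_zero]; exact hD

lemma of_cov (h : RegularModel 𝔖 f θ₀ c C)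
    {a : Nuis dU dZ → EuclideanSpace ℝ (Fin d) → Cov dU dZ → ℝ}
    {G : Cov dU dZ × Nuis dU dZ × ℝ → Fin d → ℝ} (ha : CovJet 𝔖 f θ₀ a G)
    {θ : EuclideanSpace ℝ (Fin d)} (hθ : θ ∈ 𝔖.Θ)
    (hm : RegularModel.JointMeas 𝔖 fun (_ : Unit) x => a f θ x) :
    BddObs 𝔖 f fun o => a f θ o.2.2 := by
  obtain ⟨D, hD, hb⟩ := ha
  refine ⟨?_, D, hD, fun o ho => hb.bdd (o.2.2, f, 0) ⟨ho.2, h.adm_self⟩ θ hθ⟩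
  refine measurable_of_eq ((hm.measurable.comp (measurable_snd.comp measurable_snd)).indicator
    h.measurableSet_goodObs) fun o => ?_
  by_cases ho : o ∈ goodObs 𝔖 f
  · rw [Set.indicator_of_mem ho, Set.indicator_of_mem ho]
    exact Set.indicator_of_mem ho.2.1 _
  · rw [Set.indicator_of_notMem ho, Set.indicator_of_notMem ho]

end BddObs

namespace RegularModel

variable {g : Measure (Cov dU dZ)}

lemma goodX_eq_paramX (h : RegularModel 𝔖 f θ₀ c C) : goodX 𝔖 f = paramX 𝔖 ⟨θ₀, f, g⟩ := by
  ext x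
  refine and_congr_right fun hx => forall_congr' fun t => ?_
  have := h.finite t
  have hm : AEStronglyMeasurable (fun y => f t y x) ((𝔖.ν t).restrict (𝔖.𝒴 t)) :=
    ((h.measurable_f t).comp (measurable_id.prodMk measurable_const)).aestronglyMeasurable
  have h0 : 0 ≤ᵐ[(𝔖.ν t).restrict (𝔖.𝒴 t)] fun y => f t y x := by
    filter_upwards [ae_restrict_mem (h.measurableSet_𝒴 t)] with y hy
    exact h.c_pos.le.trans (h.density_bounds t y hy x hx).1
  rw [integral_eq_lintegral_of_nonneg_ae h0 hm, ENNReal.toReal_eq_one_iff]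

lemma goodObs_subset : goodObs 𝔖 f ⊆ obsRange 𝔖 := fun _ ho => ⟨ho.1, ho.2.1⟩

lemma ae_law_goodObs (h : RegularModel 𝔖 f θ₀ c C) (hq : 𝔖.IsParam ⟨θ₀, f, g⟩) :
    ∀ᵐ o ∂(𝔖.law ⟨θ₀, f, g⟩), o ∈ goodObs 𝔖 f := by
  refine h.ae_law (p := fun x => x ∈ goodX 𝔖 f) ?_ hq
  rw [h.goodX_eq_paramX (g := g)]
  exact hq.ae_paramX

section Basic

lemma bddObs_resid (h : RegularModel 𝔖 f θ₀ c C) {θ : EuclideanSpace ℝ (Fin d)} (hθ : θ ∈ 𝔖.Θ) :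
    BddObs 𝔖 f (𝔖.resid θ) :=
  .of_measurable h (h.measurable_resid θ) fun _ ho => h.abs_resid_le hθ (goodObs_subset ho)

lemma bddObs_altNum (h : RegularModel 𝔖 f θ₀ c C) {θ : EuclideanSpace ℝ (Fin d)} (hθ : θ ∈ 𝔖.Θ) :
    BddObs 𝔖 f (𝔖.altNum θ) :=
  .of_measurable h (h.measurable_altNum θ) fun _ ho => h.abs_altNum_le hθ (goodObs_subset ho)

lemma bddObs_tval (h : RegularModel 𝔖 f θ₀ c C) : BddObs 𝔖 f fun o => tval o.1 :=
  .of_measurable h (measurable_tval.comp measurable_fst) fun _ _ => abs_tval_le _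

lemma bddObs_outcome (h : RegularModel 𝔖 f θ₀ c C) : BddObs 𝔖 f fun o => o.2.1 :=
  .of_measurable h (measurable_fst.comp measurable_snd) fun o ho => h.outcome_le o.1 _ ho.1

lemma bddObs_gradResid (h : RegularModel 𝔖 f θ₀ c C) (l : Fin d) :
    BddObs 𝔖 f fun o => 𝔖.gradResid θ₀ o l := by
  obtain ⟨D, hD, hb⟩ := h.obsJet_resid
  refine ⟨?_, D, hD, fun o ho => hb.grad_bdd (o, f, 0) ⟨ho, h.adm_self⟩ l⟩
  refine measurable_of_eq (((((measurable_const (a := (1 : ℝ))).sub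
    (measurable_tval.comp measurable_fst)).mul
      ((h.measurable_score_integrand h.theta_mem l).comp measurable_snd)).neg).indicator
        h.measurableSet_goodObs) fun o => ?_
  by_cases ho : o ∈ goodObs 𝔖 f
  · rw [Set.indicator_of_mem ho, Set.indicator_of_mem ho]
    obtain ⟨t, y, x⟩ := o
    obtain rfl | rfl := fin_two_eq t
    · have h1 : (y, x) ∈ 𝔖.rangeYX 0 := ⟨ho.1, ho.2.1⟩
      simp [gradResid, Set.indicator_of_mem h1]
    · simp [gradResid]
  · rw [Set.indicator_of_notMem ho, Set.indicator_of_notMem ho]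

lemma bddObs_ratioA (h : RegularModel 𝔖 f θ₀ c C) {θ : EuclideanSpace ℝ (Fin d)} (hθ : θ ∈ 𝔖.Θ)
    (j : Fin d) : BddObs 𝔖 f fun o => 𝔖.ratioA j f θ o.2.2 := by
  obtain ⟨G, hG⟩ := h.covJet_ratioA j
  exact .of_cov h hG hθ (h.jointMeas_ratioA (g := fun _ => f)
    (fun t => (h.measurable_f t).comp measurable_snd) hθ j)

lemma bddObs_A (h : RegularModel 𝔖 f θ₀ c C) {θ : EuclideanSpace ℝ (Fin d)} (hθ : θ ∈ 𝔖.Θ)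
    (j : Fin d) : BddObs 𝔖 f fun o => 𝔖.A f θ o.2.2 j := by
  obtain ⟨G, hG⟩ := h.covJet_A j
  exact .of_cov h hG hθ (h.jointMeas_A (g := fun _ => f)
    (fun t => (h.measurable_f t).comp measurable_snd) hθ j)

lemma bddObs_ratioV (h : RegularModel 𝔖 f θ₀ c C) {θ : EuclideanSpace ℝ (Fin d)} (hθ : θ ∈ 𝔖.Θ)
    (Δ : ℝ) : BddObs 𝔖 f fun o => 𝔖.ratioV Δ f θ o.2.2 := by
  obtain ⟨G, hG⟩ := h.covJet_ratioV Δ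
  exact .of_cov h hG hθ (h.jointMeas_ratioV (g := fun _ => f) (θ := fun _ => θ)
    (fun t => (h.measurable_f t).comp measurable_snd) measurable_const (fun _ => hθ) Δ)

lemma bddObs_Seff (h : RegularModel 𝔖 f θ₀ c C) {θ : EuclideanSpace ℝ (Fin d)} (hθ : θ ∈ 𝔖.Θ)
    (j : Fin d) : BddObs 𝔖 f fun o => 𝔖.Seff f θ o j :=
  (h.bddObs_resid hθ).mul (h.bddObs_ratioA hθ j)

end Basic

section CondMean

variable {k k' : Obs dU dZ → ℝ}

lemma integrable_bddObs (h : RegularModel 𝔖 f θ₀ c C) (hq : 𝔖.IsParam ⟨θ₀, f, g⟩)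
    (hk : BddObs 𝔖 f k) : Integrable k (𝔖.law ⟨θ₀, f, g⟩) := by
  obtain ⟨k', hm, ⟨D, -, hD⟩, he⟩ := hk.exists_measurable
  refine (h.integrable_law hq hm (D := D) fun o _ => hD o).congr ?_
  filter_upwards [h.ae_law_goodObs hq] with o ho using he o ho

/-- The tower property. -/
lemma integral_law_eq_condMean (h : RegularModel 𝔖 f θ₀ c C) (hq : 𝔖.IsParam ⟨θ₀, f, g⟩)
    (hk : BddObs 𝔖 f k) :
    ∫ o, k o ∂(𝔖.law ⟨θ₀, f, g⟩) = ∫ x, condMean 𝔖 f θ₀ k x ∂g := by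
  obtain ⟨k', hm, ⟨D, -, hD⟩, he⟩ := hk.exists_measurable
  have h1 : ∫ o, k o ∂(𝔖.law ⟨θ₀, f, g⟩) = ∫ o, k' o ∂(𝔖.law ⟨θ₀, f, g⟩) := by
    refine integral_congr_ae ?_
    filter_upwards [h.ae_law_goodObs hq] with o ho using (he o ho).symm
  rw [h1, h.integral_law hq hm (D := D) fun o _ => hD o]
  refine integral_congr_ae ?_
  filter_upwards [hq.ae_paramX] with x hx
  rw [← h.goodX_eq_paramX] at hx
  have h2 : ∀ t, 𝔖.condE f t (fun y => k' (t, y, x)) x = 𝔖.condE f t (fun y => k (t, y, x)) x :=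
    fun t => setIntegral_congr_fun (h.measurableSet_𝒴 t) fun y hy => by
      simp only [he (t, y, x) ⟨hy, hx⟩]
  simp only [condMean, h2]

lemma integrable_section (h : RegularModel 𝔖 f θ₀ c C) (hk : BddObs 𝔖 f k)
    {x : Cov dU dZ} (hx : x ∈ goodX 𝔖 f) (t : Fin 2) :
    Integrable (fun y => k (t, y, x) * f t y x) ((𝔖.ν t).restrict (𝔖.𝒴 t)) := by
  obtain ⟨k', hm, ⟨D, -, hD⟩, he⟩ := hk.exists_measurable
  have := h.integrable_mul_dens (t := t) (q := fun r => k' (t, r))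
    ((hm.comp measurable_prodMk_left).indicator (h.measurableSet_rangeYX t))
    (D := D) (fun r _ => hD _) hx.1 h.adm_self
  refine this.congr ?_
  filter_upwards [ae_restrict_mem (h.measurableSet_𝒴 t)] with y hy
  rw [he (t, y, x) ⟨hy, hx⟩]

lemma condE_add_bddObs (h : RegularModel 𝔖 f θ₀ c C) (hk : BddObs 𝔖 f k) (hk' : BddObs 𝔖 f k')
    {x : Cov dU dZ} (hx : x ∈ goodX 𝔖 f) (t : Fin 2) :
    𝔖.condE f t (fun y => k (t, y, x) + k' (t, y, x)) x =
      𝔖.condE f t (fun y => k (t, y, x)) x + 𝔖.condE f t (fun y => k' (t, y, x)) x := by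
  simp only [condE, add_mul]
  exact integral_add (h.integrable_section hk hx t) (h.integrable_section hk' hx t)

lemma condE_const_mul (r : ℝ) (q : ℝ → ℝ) (x : Cov dU dZ) (t : Fin 2) :
    𝔖.condE f t (fun y => r * q y) x = r * 𝔖.condE f t q x := by
  simp only [condE, mul_assoc]
  exact integral_const_mul _ _

lemma condE_const (r : ℝ) {x : Cov dU dZ} (hx : x ∈ goodX 𝔖 f) (t : Fin 2) :
    𝔖.condE f t (fun _ => r) x = r := by
  simp only [condE]
  rw [integral_const_mul, hx.2 t, mul_one]

lemma condE_congr (h : RegularModel 𝔖 f θ₀ c C) {t : Fin 2} {q q' : ℝ → ℝ}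
    (e : ∀ y ∈ 𝔖.𝒴 t, q y = q' y) (x : Cov dU dZ) : 𝔖.condE f t q x = 𝔖.condE f t q' x :=
  setIntegral_congr_fun (h.measurableSet_𝒴 t) fun y hy => by simp only [e y hy]

lemma condMean_add (h : RegularModel 𝔖 f θ₀ c C) (hk : BddObs 𝔖 f k) (hk' : BddObs 𝔖 f k')
    {x : Cov dU dZ} (hx : x ∈ goodX 𝔖 f) :
    condMean 𝔖 f θ₀ (fun o => k o + k' o) x = condMean 𝔖 f θ₀ k x + condMean 𝔖 f θ₀ k' x := by
  simp only [condMean, h.condE_add_bddObs hk hk' hx]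
  ring

/-- Functions of the covariates are constants for the conditional mean. -/
lemma condMean_cov_mul (a : Cov dU dZ → ℝ) (k : Obs dU dZ → ℝ) (x : Cov dU dZ) :
    condMean 𝔖 f θ₀ (fun o => a o.2.2 * k o) x = a x * condMean 𝔖 f θ₀ k x := by
  simp only [condMean, condE_const_mul]
  ring

lemma condMean_congr (h : RegularModel 𝔖 f θ₀ c C) {x : Cov dU dZ} (hx : x ∈ goodX 𝔖 f)
    (e : ∀ o ∈ goodObs 𝔖 f, k o = k' o) : condMean 𝔖 f θ₀ k x = condMean 𝔖 f θ₀ k' x := by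
  have h1 : ∀ t, 𝔖.condE f t (fun y => k (t, y, x)) x = 𝔖.condE f t (fun y => k' (t, y, x)) x :=
    fun t => h.condE_congr (fun y hy => e (t, y, x) ⟨hy, hx⟩) x
  simp only [condMean, h1]

lemma param_odds_goodX (h : RegularModel 𝔖 f θ₀ c C) (hq : 𝔖.IsParam ⟨θ₀, f, g⟩) {x : Cov dU dZ}
    (hx : x ∈ goodX 𝔖 f) :
    (1 - 𝔖.w f θ₀ x) * 𝔖.condE f 0 (fun y => 𝔖.π y x.1 θ₀ / (1 - 𝔖.π y x.1 θ₀)) x =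
        𝔖.w f θ₀ x := by
  rw [h.goodX_eq_paramX (g := g)] at hx
  exact (h.param_odds hq hx).2.2.2

lemma condMean_resid (h : RegularModel 𝔖 f θ₀ c C) (hq : 𝔖.IsParam ⟨θ₀, f, g⟩) {x : Cov dU dZ}
    (hx : x ∈ goodX 𝔖 f) : condMean 𝔖 f θ₀ (𝔖.resid θ₀) x = 0 := by
  have h1 := h.param_odds_goodX hq hx
  simp only [condMean, resid, tval_one, tval_zero, sub_self, zero_mul, sub_zero, one_mul,
    zero_sub, condE_const _ hx]
  have h2 := condE_const_mul (𝔖 := 𝔖) (f := f) (-1)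
    (fun y => 𝔖.π y x.1 θ₀ / (1 - 𝔖.π y x.1 θ₀)) x 0
  simp only [neg_one_mul] at h2
  rw [h2]
  linarith

lemma condMean_resid_mul_tval {x : Cov dU dZ} (hx : x ∈ goodX 𝔖 f) :
    condMean 𝔖 f θ₀ (fun o => 𝔖.resid θ₀ o * tval o.1) x = 𝔖.w f θ₀ x := by
  simp [condMean, condE_const _ hx, resid]

/-- `B(x)` is the conditional variance of `resid`. -/
lemma condMean_resid_sq (h : RegularModel 𝔖 f θ₀ c C) (hq : 𝔖.IsParam ⟨θ₀, f, g⟩) {x : Cov dU dZ}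
    (hx : x ∈ goodX 𝔖 f) :
    condMean 𝔖 f θ₀ (fun o => 𝔖.resid θ₀ o * 𝔖.resid θ₀ o) x = 𝔖.B f θ₀ x := by
  have h1 := h.param_odds_goodX hq hx
  have hR := h.bddObs_resid h.theta_mem
  have h2 := h.condE_add_bddObs (hR.const_mul h (-1)) (hR.mul hR) hx 0
  simp only [resid, tval_zero, sub_zero, one_mul, zero_sub, neg_mul_neg] at h2
  have h3 : 𝔖.condE f 0 (fun y => ((1 - 𝔖.π y x.1 θ₀) ^ 2)⁻¹ * 𝔖.π y x.1 θ₀) x = _ :=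
    (h.condE_congr (fun y hy => ?_) x).trans h2
  · simp only [condMean, resid, tval_one, tval_zero, sub_self, zero_mul, sub_zero, one_mul,
      zero_sub, neg_mul_neg, condE_const _ hx, B, h3]
    linarith
  · have h4 := h.c_pos.trans_le
      (h.one_sub_pi_bounds (r := (y, x)) ⟨hy, hx.1⟩ h.theta_mem).1
    have h5 := h4.ne'
    simp only at h5
    field_simp
    ring

lemma condMean_resid_mul_altNum (h : RegularModel 𝔖 f θ₀ c C) (x : Cov dU dZ) :
    condMean 𝔖 f θ₀ (fun o => 𝔖.resid θ₀ o * 𝔖.altNum θ₀ o) x = 𝔖.K f θ₀ x := by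
  have h3 : 𝔖.condE f 0 (fun y => 𝔖.resid θ₀ (0, y, x) * 𝔖.altNum θ₀ (0, y, x)) x =
      𝔖.condE f 0 (fun y => (𝔖.π y x.1 θ₀) ^ 2 / (1 - 𝔖.π y x.1 θ₀) ^ 2 * y) x := by
    refine h.condE_congr (fun y hy => ?_) x
    rw [altNum_eq]
    simp only [resid, tval_zero, sub_zero, one_mul, zero_sub, ← div_pow]
    ring
  have h4 : ∀ y, 𝔖.resid θ₀ (1, y, x) * 𝔖.altNum θ₀ (1, y, x) = y := fun y => by
    simp [altNum, resid]
  simp only [condMean, h3, h4, K]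

lemma condMean_gradResid (l : Fin d) (x : Cov dU dZ) :
    condMean 𝔖 f θ₀ (fun o => 𝔖.gradResid θ₀ o l) x = -𝔖.A f θ₀ x l := by
  have h1 := condE_const_mul (𝔖 := 𝔖) (f := f) (-1)
    (fun y => ((1 - 𝔖.π y x.1 θ₀) ^ 2)⁻¹ * 𝔖.πdot y x.1 θ₀ l) x 0
  simp only [neg_one_mul] at h1
  simp only [condMean, gradResid, tval_one, tval_zero, sub_self, zero_mul, sub_zero, one_mul,
    neg_zero, h1, A]
  simp [condE]

end CondMean

end RegularModel
end ATTSetup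

/-! ### Identification from the observed data -/

namespace ATTSetup

variable {d dU dZ : ℕ} {𝔖 : ATTSetup d dU dZ} {f : Fin 2 → ℝ → Cov dU dZ → ℝ}
  {θ₀ : EuclideanSpace ℝ (Fin d)} {c C : ℝ}
  {Ω : Type*} [MeasurableSpace Ω] {μ : Measure Ω} [IsProbabilityMeasure μ]
  {T : ℕ → Ω → Fin 2} {Y : Fin 2 → ℕ → Ω → ℝ} {X : ℕ → Ω → Cov dU dZ}

namespace IsSample

lemma measurable_obs (hs : 𝔖.IsSample f θ₀ μ T Y X) (i : ℕ) : Measurable (obs T Y X i) := by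
  refine (hs.measurable_T i).prodMk (Measurable.prodMk ?_ (hs.measurable_X i))
  have : ∀ ω, (if T i ω = 1 then Y 1 i ω else Y 0 i ω) = Y (T i ω) i ω := fun ω => by
    obtain h | h := fin_two_eq (T i ω) <;> simp [h]
  exact measurable_of_eq (Measurable.ite (hs.measurable_T i (measurableSet_singleton 1))
    (hs.measurable_Y 1 i) (hs.measurable_Y 0 i)) this

/-- An expectation is the sum of those over the two arms. -/
lemma integral_eq_add_arms (hs : 𝔖.IsSample f θ₀ μ T Y X) {k : Ω → ℝ} (hk : Integrable k μ) :
    ∫ ω, k ω ∂μ = ∫ ω in {ω | T 0 ω = 1}, k ω ∂μ + ∫ ω in {ω | T 0 ω = 0}, k ω ∂μ := by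
  have h1 : {ω | T 0 ω = 0} = {ω | T 0 ω = 1}ᶜ := by
    ext ω
    obtain h | h := fin_two_eq (T 0 ω) <;> simp [h]
  rw [h1, integral_add_compl (hs.measurableSet_arm 1) hk]

lemma ae_goodX (hs : 𝔖.IsSample f θ₀ μ T Y X) (h : RegularModel 𝔖 f θ₀ c C) :
    ∀ᵐ ω ∂μ, X 0 ω ∈ goodX 𝔖 f := by
  have h1 := (hs.isParam h).ae_paramX
  rw [← h.goodX_eq_paramX] at h1
  exact (ae_map_iff (hs.measurable_X 0).aemeasurable h.measurableSet_goodX).1 h1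

/-- In the control arm the law of the covariates has density `1 - w`. -/
lemma setIntegral_control (hs : 𝔖.IsSample f θ₀ μ T Y X) (h : RegularModel 𝔖 f θ₀ c C)
    {a : Cov dU dZ → ℝ} (ha : Measurable a) {D : ℝ} (hD : ∀ x, |a x| ≤ D) :
    ∫ x, (1 - 𝔖.w f θ₀ x) * a x ∂(μ.map (X 0)) = ∫ x, a x ∂(lawX μ T X 0) := by
  have hq := hs.isParam h
  have hwm := h.measurable_w hq
  simp only at hwm
  have hD0 : 0 ≤ D := (abs_nonneg _).trans (hD 0)
  -- the test function `(1 - π)⁻¹ (1 - w) a` is used: conditioning on `(Y₀, X)` cancels the first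
  -- factor, and conditioning on `X` in the control arm cancels the first two
  set b : Cov dU dZ → ℝ := (goodX 𝔖 f).indicator fun x => (1 - 𝔖.w f θ₀ x) * a x with hb
  have hbm : Measurable b := ((measurable_const.sub hwm).mul ha).indicator h.measurableSet_goodX
  have hodds : ∀ x ∈ goodX 𝔖 f, 0 ≤ 𝔖.w f θ₀ x ∧ 0 < 1 - 𝔖.w f θ₀ x ∧
      (1 - 𝔖.w f θ₀ x) * 𝔖.condE f 0 (fun y => (1 - 𝔖.π y x.1 θ₀)⁻¹) x = 1 := fun x hx => by
    rw [h.goodX_eq_paramX (g := μ.map (X 0))] at hx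
    have := h.param_odds hq hx
    exact ⟨this.1, this.2.1, this.2.2.1⟩
  have hbD : ∀ x, |b x| ≤ D := fun x => by
    by_cases hx : x ∈ goodX 𝔖 f
    · obtain ⟨h1, h2, -⟩ := hodds x hx
      rw [hb, Set.indicator_of_mem hx, abs_mul, abs_of_pos h2]
      have := mul_le_mul (show 1 - 𝔖.w f θ₀ x ≤ 1 by linarith) (hD x) (abs_nonneg _) zero_le_one
      linarith
    · rw [hb, Set.indicator_of_notMem hx, abs_zero]; exact hD0
  set k : ℝ × Cov dU dZ → ℝ := fun r => (1 - 𝔖.π r.1 r.2.1 θ₀)⁻¹ * b r.2 with hk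
  have hkm : Measurable k :=
    (measurable_const.sub (h.measurable_π' θ₀)).inv.mul (hbm.comp measurable_snd)
  have hkD : ∀ r ∈ 𝔖.rangeYX 0, |k r| ≤ c⁻¹ * D := fun r hr => by
    obtain ⟨h1, -⟩ := h.one_sub_pi_bounds hr h.theta_mem
    have h2 := h.c_pos.trans_le h1
    rw [hk, abs_mul, abs_inv, abs_of_pos h2]
    exact mul_le_mul (inv_anti₀ h.c_pos h1) (hbD _) (abs_nonneg _) (inv_nonneg.2 h.c_pos.le)
  have hae := hs.ae_overlap (c := c) fun y hy x hx => h.overlap y hy x hx θ₀ h.theta_mem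
  have hc := h.c_pos
  have e1 : ∫ x, (1 - 𝔖.w f θ₀ x) * a x ∂(μ.map (X 0)) =
      ∫ ω, (1 - 𝔖.π (Y 0 0 ω) (X 0 ω).1 θ₀) * k (Y 0 0 ω, X 0 ω) ∂μ := by
    have hm1 : Measurable fun x => (1 - 𝔖.w f θ₀ x) * a x := (measurable_const.sub hwm).mul ha
    rw [integral_map (hs.measurable_X 0).aemeasurable hm1.aestronglyMeasurable]
    refine integral_congr_ae ?_
    filter_upwards [hs.ae_goodX h, hae] with ω h1 h2
    have h3 : 1 - 𝔖.π (Y 0 0 ω) (X 0 ω).1 θ₀ ≠ 0 := by linarith [h2.2]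
    simp only [hk, hb, Set.indicator_of_mem h1]
    rw [mul_inv_cancel_left₀ h3]
  have e2 : ∫ ω, (1 - tval (T 0 ω)) * k (Y 0 0 ω, X 0 ω) ∂μ =
      ∫ ω in {ω | T 0 ω = 0}, k (Y 0 0 ω, X 0 ω) ∂μ := by
    rw [← integral_indicator (hs.measurableSet_arm 0)]
    refine integral_congr_ae (ae_of_all _ fun ω => ?_)
    obtain h1 | h1 := fin_two_eq (T 0 ω) <;> simp [h1]
  rw [e1, ← hs.integral_one_sub_tval_mul hkm (D := c⁻¹ * D) (by
    filter_upwards [hs.ae_mem_𝒴 0, hs.ae_mem_𝒳] with ω h1 h2 using hkD _ ⟨h1, h2⟩) (D' := 1) (by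
    filter_upwards [hae] with ω h1
    rw [abs_le]; constructor <;> linarith), e2, hs.setIntegral_arm h 0 hkm hkD]
  refine integral_congr_ae ?_
  have h1 : ∀ᵐ x ∂(lawX μ T X 0), x ∈ goodX 𝔖 f := by
    have := hq.ae_paramX
    rw [← h.goodX_eq_paramX] at this
    exact (hs.absolutelyContinuous_lawX' 0).ae_le this
  filter_upwards [h1] with x hx
  have h2 : 𝔖.condE f 0 (fun y => k (y, x)) x =
      b x * 𝔖.condE f 0 (fun y => (1 - 𝔖.π y x.1 θ₀)⁻¹) x := by
    rw [← RegularModel.condE_const_mul]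
    simp only [hk, mul_comm]
  rw [h2, hb, Set.indicator_of_mem hx, mul_right_comm, (hodds x hx).2.2, one_mul]

/-- The law of an observation is the law in the semiparametric model at the true parameter. -/
lemma map_obs (hs : 𝔖.IsSample f θ₀ μ T Y X) (h : RegularModel 𝔖 f θ₀ c C) :
    μ.map (obs T Y X 0) = 𝔖.law ⟨θ₀, f, μ.map (X 0)⟩ := by
  have hq := hs.isParam h
  have hP := h.isProbabilityMeasure_law hq
  have hP' := Measure.isProbabilityMeasure_map (μ := μ) (hs.measurable_obs 0).aemeasurable
  have hPX := Measure.isProbabilityMeasure_map (μ := μ) (hs.measurable_X 0).aemeasurable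
  have hwm := h.measurable_w hq
  simp only at hwm
  have key : ∀ k : Obs dU dZ → ℝ, Measurable k → (∀ o, |k o| ≤ 1) →
      ∫ o, k o ∂(μ.map (obs T Y X 0)) = ∫ o, k o ∂(𝔖.law ⟨θ₀, f, μ.map (X 0)⟩) := by
    intro k hk hk1
    have hki : Integrable (fun ω => k (obs T Y X 0 ω)) μ :=
      Integrable.of_bound (hk.comp (hs.measurable_obs 0)).aestronglyMeasurable 1
        (ae_of_all _ fun ω => hk1 _)
    -- the conditional means given the covariates in the two arms, made bounded everywhere
    set m : Fin 2 → Cov dU dZ → ℝ := fun t =>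
      (goodX 𝔖 f).indicator fun x => 𝔖.condE f t (fun y => k (t, y, x)) x with hm
    have hmm : ∀ t, Measurable (m t) := fun t => by
      have := h.finite t
      have h1 : Measurable (Function.uncurry fun (x : Cov dU dZ) (y : ℝ) =>
          k (t, y, x) * f t y x) :=
        ((hk.comp measurable_prodMk_left).mul (h.measurable_f t)).comp measurable_swap
      exact (h1.stronglyMeasurable.integral_prod_right
        (ν := (𝔖.ν t).restrict (𝔖.𝒴 t))).measurable.indicator h.measurableSet_goodX
    obtain ⟨D, hD⟩ : ∃ D, ∀ t x, |m t x| ≤ D := by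
      have h1 : ∀ t, ∀ x, |m t x| ≤ C * (𝔖.ν t).real (𝔖.𝒴 t) := fun t x => by
        have h0 : 0 ≤ C * (𝔖.ν t).real (𝔖.𝒴 t) := mul_nonneg h.C_nonneg measureReal_nonneg
        by_cases hx : x ∈ goodX 𝔖 f
        · rw [hm]
          simp only [Set.indicator_of_mem hx]
          refine h.abs_setIntegral_le fun y hy => ?_
          have h2 := h.density_bounds t y hy x hx.1
          rw [abs_mul, abs_of_nonneg (h.c_pos.le.trans h2.1)]
          exact (mul_le_of_le_one_left (h.c_pos.le.trans h2.1) (hk1 _)).trans h2.2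
        · rw [hm]; simp only [Set.indicator_of_notMem hx, abs_zero]; exact h0
      refine ⟨max (C * (𝔖.ν 0).real (𝔖.𝒴 0)) (C * (𝔖.ν 1).real (𝔖.𝒴 1)), fun t x => ?_⟩
      obtain rfl | rfl := fin_two_eq t
      · exact (h1 0 x).trans (le_max_left _ _)
      · exact (h1 1 x).trans (le_max_right _ _)
    have hgood : ∀ᵐ x ∂(μ.map (X 0)), x ∈ goodX 𝔖 f := by
      have := hq.ae_paramX
      rwa [← h.goodX_eq_paramX] at this
    -- each arm contributes the mean of its conditional mean
    have harm : ∀ t, ∫ ω in {ω | T 0 ω = t}, k (obs T Y X 0 ω) ∂μ =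
        ∫ x, m t x ∂(lawX μ T X t) := fun t => by
      have h1 : ∫ ω in {ω | T 0 ω = t}, k (obs T Y X 0 ω) ∂μ =
          ∫ ω in {ω | T 0 ω = t}, k (t, Y t 0 ω, X 0 ω) ∂μ := by
        refine setIntegral_congr_fun (hs.measurableSet_arm t) fun ω hω => ?_
        have : T 0 ω = t := hω
        simp only [obs, this]
      rw [h1, hs.setIntegral_arm h t (k := fun r => k (t, r)) (hk.comp measurable_prodMk_left)
        (D := 1) fun r _ => hk1 _]
      refine integral_congr_ae ?_
      filter_upwards [(hs.absolutelyContinuous_lawX' t).ae_le hgood] with x hx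
      simp only [hm, Set.indicator_of_mem hx]
    have hmi : ∀ t, Integrable (m t) (μ.map (X 0)) := fun t =>
      Integrable.of_bound (hmm t).aestronglyMeasurable D (ae_of_all _ (hD t))
    have hwb : ∀ᵐ x ∂(μ.map (X 0)), ‖𝔖.w f θ₀ x‖ ≤ 1 := by
      filter_upwards [hq.ae_paramX] with x hx
      obtain ⟨h1, h2, -⟩ := h.param_odds hq hx
      simp only at h1 h2
      rw [Real.norm_of_nonneg h1]; linarith
    have hwi : ∀ t, Integrable (fun x => 𝔖.w f θ₀ x * m t x) (μ.map (X 0)) := fun t =>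
      (hmi t).bdd_mul hwm.aestronglyMeasurable hwb
    have h1w : ∀ t, ∫ x, (1 - 𝔖.w f θ₀ x) * m t x ∂(μ.map (X 0)) =
        ∫ x, m t x ∂(μ.map (X 0)) - ∫ x, 𝔖.w f θ₀ x * m t x ∂(μ.map (X 0)) := fun t => by
      rw [← integral_sub (hmi t) (hwi t)]
      simp only [sub_mul, one_mul]
    -- in the treatment arm the law of the covariates has density `w`
    have htr : ∫ x, m 1 x ∂(lawX μ T X 1) = ∫ x, 𝔖.w f θ₀ x * m 1 x ∂(μ.map (X 0)) := by
      have h2 := hs.setIntegral_control h (hmm 1) (hD 1)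
      have h3 := hs.integral_eq_add_arms (k := fun ω => m 1 (X 0 ω))
        (Integrable.of_bound ((hmm 1).comp (hs.measurable_X 0)).aestronglyMeasurable D
          (ae_of_all _ fun ω => hD 1 _))
      have h4 : ∀ t, ∫ x, m 1 x ∂(lawX μ T X t) = ∫ ω in {ω | T 0 ω = t}, m 1 (X 0 ω) ∂μ :=
        fun t => integral_map (hs.measurable_X 0).aemeasurable (hmm 1).aestronglyMeasurable
      rw [← integral_map (hs.measurable_X 0).aemeasurable (hmm 1).aestronglyMeasurable] at h3
      rw [h1w 1, h4 0] at h2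
      rw [h4 1]
      linarith
    rw [integral_map (hs.measurable_obs 0).aemeasurable hk.aestronglyMeasurable,
      hs.integral_eq_add_arms hki, harm, harm, htr, ← hs.setIntegral_control h (hmm 0) (hD 0),
      h.integral_law hq hk (D := 1) (fun o _ => hk1 o), ← integral_add (hwi 1)]
    · refine integral_congr_ae ?_
      filter_upwards [hgood] with x hx
      simp only [hm, Set.indicator_of_mem hx]
    · refine ((hmi 0).sub (hwi 0)).congr (ae_of_all _ fun x => ?_)
      simp only [Pi.sub_apply]; ring
  -- bounded functions determine the law
  refine Measure.ext fun A hA => ?_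
  have h1 := key (A.indicator 1) (measurable_one.indicator hA) fun o => by
    by_cases ho : o ∈ A <;> simp [ho]
  rw [integral_indicator_one hA, integral_indicator_one hA] at h1
  exact (measureReal_eq_measureReal_iff).1 h1

/-- The expected derivative of the outcome-weighted residual. -/
lemma integral_outcome_gradResid (hs : 𝔖.IsSample f θ₀ μ T Y X) (h : RegularModel 𝔖 f θ₀ c C)
    (l : Fin d) : ∫ o, o.2.1 * 𝔖.gradResid θ₀ o l ∂(𝔖.law ⟨θ₀, f, μ.map (X 0)⟩) =
      -𝔖.Q μ (Y 0 0) (X 0) θ₀ l := by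
  set k : ℝ × Cov dU dZ → ℝ := fun r => (𝔖.rangeYX 0).indicator (fun r =>
    ((1 - 𝔖.π r.1 r.2.1 θ₀) ^ 2)⁻¹ * 𝔖.πdot r.1 r.2.1 θ₀ l) r * r.1 with hk
  have hkm : Measurable k := (h.measurable_score_integrand h.theta_mem l).mul measurable_fst
  obtain ⟨D, hD, hb⟩ := h.jet_odds
  have hkD : ∀ r ∈ 𝔖.rangeYX 0, |k r| ≤ D * C := fun r hr => by
    rw [hk]
    simp only [Set.indicator_of_mem hr]
    rw [abs_mul]
    exact mul_le_mul (hb.grad_bdd r hr l) (h.outcome_le 0 _ hr.1) (abs_nonneg _) hD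
  have hae := hs.ae_overlap (c := c) fun y hy x hx => h.overlap y hy x hx θ₀ h.theta_mem
  have hc := h.c_pos
  have hbo := h.bddObs_outcome.mul (h.bddObs_gradResid l)
  have hrange : ∀ᵐ ω ∂μ, (Y 0 0 ω, X 0 ω) ∈ 𝔖.rangeYX 0 := by
    filter_upwards [hs.ae_mem_𝒴 0, hs.ae_mem_𝒳] with ω h1 h2 using ⟨h1, h2⟩
  have h1 := hs.integral_one_sub_tval_mul hkm (D := D * C) (by
    filter_upwards [hrange] with ω h1 using hkD _ h1) (D' := 1) (by
    filter_upwards [hae] with ω h1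
    rw [abs_le]; constructor <;> linarith)
  -- `(1 - T)` has conditional mean `1 - π` given `(Y₀, X)`, which cancels one of the two factors
  -- `(1 - π)⁻¹` in the gradient of the odds
  have h2 : 𝔖.Q μ (Y 0 0) (X 0) θ₀ l =
      ∫ ω, (1 - 𝔖.π (Y 0 0 ω) (X 0 ω).1 θ₀) * k (Y 0 0 ω, X 0 ω) ∂μ := by
    refine integral_congr_ae ?_
    filter_upwards [hrange, hae] with ω h2 h3
    have h4 : 1 - 𝔖.π (Y 0 0 ω) (X 0 ω).1 θ₀ ≠ 0 := by linarith [h3.2]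
    simp only [hk, Set.indicator_of_mem h2]
    field_simp
  have h3 := h.integrable_bddObs (hs.isParam h) hbo
  have h4 := hs.map_obs h
  rw [← h4] at h3 ⊢
  rw [integral_map (hs.measurable_obs 0).aemeasurable h3.aestronglyMeasurable, h2, ← h1,
    ← integral_neg]
  refine integral_congr_ae ?_
  filter_upwards [hrange] with ω h2
  simp only [hk, Set.indicator_of_mem h2]
  obtain h3 | h3 := fin_two_eq (T 0 ω)
  · simp only [obs, gradResid, h3, tval_zero]; ring
  · simp only [obs, gradResid, h3, tval_one]; ring

lemma integral_tval_law (hs : 𝔖.IsSample f θ₀ μ T Y X) (h : RegularModel 𝔖 f θ₀ c C) :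
    ∫ o, tval o.1 ∂(𝔖.law ⟨θ₀, f, μ.map (X 0)⟩) = p μ T := by
  have hm : Measurable fun o : Obs dU dZ => tval o.1 :=
    (measurable_of_countable tval).comp measurable_fst
  rw [← hs.map_obs h, integral_map (hs.measurable_obs 0).aemeasurable hm.aestronglyMeasurable, p,
    ← integral_indicator_one (hs.measurableSet_arm 1)]
  refine integral_congr_ae (ae_of_all _ fun ω => ?_)
  obtain h1 | h1 := fin_two_eq (T 0 ω) <;> simp [obs, h1]

lemma p_pos (hs : 𝔖.IsSample f θ₀ μ T Y X) (h : RegularModel 𝔖 f θ₀ c C) : 0 < p μ T := by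
  have hac := hs.absolutelyContinuous_lawX h.c_pos
    (fun y hy x hx => h.overlap y hy x hx θ₀ h.theta_mem) 1
  have hP := Measure.isProbabilityMeasure_map (μ := μ) (hs.measurable_X 0).aemeasurable
  refine ENNReal.toReal_pos (fun h0 => ?_) (measure_ne_top _ _)
  have h1 : lawX μ T X 1 Set.univ = 0 := by
    rw [lawX, Measure.map_apply (hs.measurable_X 0) MeasurableSet.univ, Set.preimage_univ,
      Measure.restrict_apply_univ, h0]
  have h2 := hac h1
  rw [measure_univ] at h2
  exact one_ne_zero h2

/-- The weighted outcome identifies the treatment effect on the treated. -/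
lemma integral_altNum_law (hs : 𝔖.IsSample f θ₀ μ T Y X) (h : RegularModel 𝔖 f θ₀ c C) :
    ∫ o, 𝔖.altNum θ₀ o ∂(𝔖.law ⟨θ₀, f, μ.map (X 0)⟩) = p μ T * Δtrue μ T Y := by
  have hc := h.c_pos
  have hp := hs.p_pos h
  have hae := hs.ae_overlap (c := c) fun y hy x hx => h.overlap y hy x hx θ₀ h.theta_mem
  have hY : ∀ t, Integrable (Y t 0) μ := fun t =>
    Integrable.of_bound (hs.measurable_Y t 0).aestronglyMeasurable C (by
      filter_upwards [hs.ae_mem_𝒴 t] with ω h1 using h.outcome_le t _ h1)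
  have hTY : ∀ t, Integrable (fun ω => tval (T 0 ω) * Y t 0 ω) μ := fun t =>
    (hY t).bdd_mul (c := 1) hs.measurable_tval_T.aestronglyMeasurable
      (ae_of_all _ fun ω => abs_tval_le _)
  -- inverse weighting by the odds turns the untreated into the counterfactual of the treated:
  -- `E{(1 - T) Y₀ π / (1 - π)} = E(π Y₀) = E(T Y₀)`
  set k : ℝ × Cov dU dZ → ℝ := fun r => 𝔖.π r.1 r.2.1 θ₀ / (1 - 𝔖.π r.1 r.2.1 θ₀) * r.1 with hk
  have hkm : Measurable k := ((h.measurable_π' θ₀).div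
    (measurable_const.sub (h.measurable_π' θ₀))).mul measurable_fst
  have hkD : ∀ᵐ ω ∂μ, |k (Y 0 0 ω, X 0 ω)| ≤ c⁻¹ * C := by
    filter_upwards [hs.ae_mem_𝒴 0, hs.ae_mem_𝒳] with ω h1 h2
    obtain ⟨h3, h4, h5⟩ := h.one_sub_pi_bounds (r := (Y 0 0 ω, X 0 ω)) ⟨h1, h2⟩ h.theta_mem
    simp only at h3 h4 h5
    have h6 : 0 < 𝔖.π (Y 0 0 ω) (X 0 ω).1 θ₀ := hc.trans_le h5
    have h7 := hc.trans_le h3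
    rw [hk, abs_mul, abs_div, abs_of_pos h6, abs_of_pos h7]
    refine mul_le_mul ?_ (h.outcome_le 0 _ h1) (abs_nonneg _) (inv_nonneg.2 hc.le)
    rw [div_eq_mul_inv]
    have h8 := inv_anti₀ hc h3
    have h9 : 0 ≤ (1 - 𝔖.π (Y 0 0 ω) (X 0 ω).1 θ₀)⁻¹ := by positivity
    nlinarith
  have h1 := hs.integral_one_sub_tval_mul hkm hkD (D' := 1) (by
    filter_upwards [hae] with ω h1
    rw [abs_le]; constructor <;> linarith)
  have h2 := hs.integral_tval_mul (k := Prod.fst) measurable_fst (D := C) (by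
    filter_upwards [hs.ae_mem_𝒴 0] with ω h1 using h.outcome_le 0 _ h1)
  have h3 : ∫ ω, (1 - 𝔖.π (Y 0 0 ω) (X 0 ω).1 θ₀) * k (Y 0 0 ω, X 0 ω) ∂μ =
      ∫ ω, 𝔖.π (Y 0 0 ω) (X 0 ω).1 θ₀ * Y 0 0 ω ∂μ := by
    refine integral_congr_ae ?_
    filter_upwards [hae] with ω h3
    have h4 : 1 - 𝔖.π (Y 0 0 ω) (X 0 ω).1 θ₀ ≠ 0 := by linarith [h3.2]
    simp only [hk]
    field_simp
  have h4 : Integrable (fun ω => (1 - tval (T 0 ω)) * k (Y 0 0 ω, X 0 ω)) μ := by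
    have hki : Integrable (fun ω => k (Y 0 0 ω, X 0 ω)) μ :=
      Integrable.of_bound (hkm.comp (hs.measurable_YX 0)).aestronglyMeasurable _ hkD
    refine hki.bdd_mul (c := 2) (measurable_const.sub hs.measurable_tval_T).aestronglyMeasurable
      (ae_of_all _ fun ω => ?_)
    obtain h1 | h1 := fin_two_eq (T 0 ω) <;> simp [h1]
  have h5 : ∫ ω in {ω | T 0 ω = 1}, (Y 1 0 ω - Y 0 0 ω) ∂μ =
      ∫ ω, tval (T 0 ω) * Y 1 0 ω ∂μ - ∫ ω, tval (T 0 ω) * Y 0 0 ω ∂μ := by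
    rw [← integral_sub (hTY 1) (hTY 0), ← integral_indicator (hs.measurableSet_arm 1)]
    refine integral_congr_ae (ae_of_all _ fun ω => ?_)
    obtain h1 | h1 := fin_two_eq (T 0 ω) <;> simp [h1]
  rw [Δtrue, mul_div_cancel₀ _ hp.ne', h5, h2]
  simp only
  rw [← h3, ← h1, ← integral_sub (hTY 1) h4, ← hs.map_obs h,
    integral_map (hs.measurable_obs 0).aemeasurable (h.measurable_altNum θ₀).aestronglyMeasurable]
  refine integral_congr_ae (ae_of_all _ fun ω => ?_)
  obtain h1 | h1 := fin_two_eq (T 0 ω) <;> simp [obs, altNum, hk, h1]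

end IsSample

namespace RegularModel

variable {g : Measure (Cov dU dZ)}

lemma one_sub_w_pos (h : RegularModel 𝔖 f θ₀ c C) {x : Cov dU dZ} (hx : x ∈ goodX 𝔖 f) :
    0 < 1 - 𝔖.w f θ₀ x := by
  obtain ⟨m, hm, hw⟩ := h.exists_le_one_sub_w
  exact hm.trans_le (hw (x, f, 0) ⟨hx, h.adm_self⟩ θ₀ h.theta_mem)

lemma B_pos (h : RegularModel 𝔖 f θ₀ c C) {x : Cov dU dZ} (hx : x ∈ goodX 𝔖 f) :
    0 < 𝔖.B f θ₀ x := by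
  obtain ⟨m, hm, hw⟩ := h.exists_le_B
  exact hm.trans_le (hw (x, f, 0) ⟨hx, h.adm_self⟩ θ₀ h.theta_mem)

lemma ratioA_eq (h : RegularModel 𝔖 f θ₀ c C) {x : Cov dU dZ} (hx : x ∈ goodX 𝔖 f) (j : Fin d) :
    𝔖.ratioA j f θ₀ x = (𝔖.B f θ₀ x)⁻¹ * 𝔖.A f θ₀ x j := by
  rw [A, B, inv_mul_eq_div, mul_div_mul_left _ _ (h.one_sub_w_pos hx).ne', ratioA]

lemma B_mul_ratioA (h : RegularModel 𝔖 f θ₀ c C) {x : Cov dU dZ} (hx : x ∈ goodX 𝔖 f)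
    (j : Fin d) : 𝔖.B f θ₀ x * 𝔖.ratioA j f θ₀ x = 𝔖.A f θ₀ x j := by
  rw [h.ratioA_eq hx, mul_inv_cancel_left₀ (h.B_pos hx).ne']

lemma B_mul_ratioV (h : RegularModel 𝔖 f θ₀ c C) (Δ : ℝ) {x : Cov dU dZ} (hx : x ∈ goodX 𝔖 f) :
    𝔖.B f θ₀ x * 𝔖.ratioV Δ f θ₀ x = 𝔖.V f θ₀ Δ x := by
  have := (h.B_pos hx).ne'
  rw [ratioV, V]
  field_simp

lemma ae_goodX (h : RegularModel 𝔖 f θ₀ c C) (hq : 𝔖.IsParam ⟨θ₀, f, g⟩) :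
    ∀ᵐ x ∂g, x ∈ goodX 𝔖 f := by
  have := hq.ae_paramX
  rwa [← h.goodX_eq_paramX] at this

lemma integral_law_cov (h : RegularModel 𝔖 f θ₀ c C) (hq : 𝔖.IsParam ⟨θ₀, f, g⟩)
    {a : Cov dU dZ → ℝ} (ha : BddObs 𝔖 f fun o => a o.2.2) :
    ∫ o, a o.2.2 ∂(𝔖.law ⟨θ₀, f, g⟩) = ∫ x, a x ∂g := by
  rw [h.integral_law_eq_condMean hq ha]
  refine integral_congr_ae ?_
  filter_upwards [h.ae_goodX hq] with x hx
  simp only [condMean, condE_const _ hx]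
  ring

/-- The tower property for a product with a function of the covariates. -/
lemma integral_law_cov_mul (h : RegularModel 𝔖 f θ₀ c C) (hq : 𝔖.IsParam ⟨θ₀, f, g⟩)
    {a b : Cov dU dZ → ℝ} {k : Obs dU dZ → ℝ} (ha : BddObs 𝔖 f fun o => a o.2.2)
    (hb : BddObs 𝔖 f fun o => b o.2.2) (hk : BddObs 𝔖 f k)
    (hkb : ∀ x ∈ goodX 𝔖 f, condMean 𝔖 f θ₀ k x = b x) :
    ∫ o, a o.2.2 * k o ∂(𝔖.law ⟨θ₀, f, g⟩) = ∫ o, a o.2.2 * b o.2.2 ∂(𝔖.law ⟨θ₀, f, g⟩) := by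
  rw [h.integral_law_eq_condMean hq (ha.mul hk),
    h.integral_law_cov hq (a := fun x => a x * b x) (ha.mul hb)]
  refine integral_congr_ae ?_
  filter_upwards [h.ae_goodX hq] with x hx
  rw [condMean_cov_mul, hkb x hx]

lemma M_eq (h : RegularModel 𝔖 f θ₀ c C) (hq : 𝔖.IsParam ⟨θ₀, f, g⟩) (i j : Fin d) :
    𝔖.M f θ₀ g i j = ∫ o, 𝔖.ratioA i f θ₀ o.2.2 * 𝔖.A f θ₀ o.2.2 j ∂(𝔖.law ⟨θ₀, f, g⟩) := by
  rw [h.integral_law_cov hq (a := fun x => 𝔖.ratioA i f θ₀ x * 𝔖.A f θ₀ x j)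
    ((h.bddObs_ratioA h.theta_mem i).mul (h.bddObs_A h.theta_mem j))]
  refine integral_congr_ae ?_
  filter_upwards [h.ae_goodX hq] with x hx
  rw [h.ratioA_eq hx, mul_assoc]

lemma D_eq (h : RegularModel 𝔖 f θ₀ c C) (hq : 𝔖.IsParam ⟨θ₀, f, g⟩) (Δ : ℝ) (j : Fin d) :
    𝔖.D f θ₀ g Δ j = ∫ o, 𝔖.ratioV Δ f θ₀ o.2.2 * 𝔖.A f θ₀ o.2.2 j ∂(𝔖.law ⟨θ₀, f, g⟩) := by
  rw [h.integral_law_cov hq (a := fun x => 𝔖.ratioV Δ f θ₀ x * 𝔖.A f θ₀ x j)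
    ((h.bddObs_ratioV h.theta_mem Δ).mul (h.bddObs_A h.theta_mem j))]
  refine integral_congr_ae ?_
  filter_upwards [h.ae_goodX hq] with x hx
  rw [← h.B_mul_ratioV Δ hx, inv_mul_cancel_left₀ (h.B_pos hx).ne']

lemma M_symm (i j : Fin d) : 𝔖.M f θ₀ g i j = 𝔖.M f θ₀ g j i := by
  simp only [M, Matrix.of_apply, mul_comm (𝔖.A f θ₀ _ i)]

lemma integral_cov_mul_resid (h : RegularModel 𝔖 f θ₀ c C) (hq : 𝔖.IsParam ⟨θ₀, f, g⟩)
    {a : Cov dU dZ → ℝ} (ha : BddObs 𝔖 f fun o => a o.2.2) :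
    ∫ o, a o.2.2 * 𝔖.resid θ₀ o ∂(𝔖.law ⟨θ₀, f, g⟩) = 0 := by
  rw [h.integral_law_cov_mul hq (b := fun _ => 0) ha (.const h 0) (h.bddObs_resid h.theta_mem)
    fun x hx => h.condMean_resid hq hx]
  simp

lemma integral_cov_mul_gradResid (h : RegularModel 𝔖 f θ₀ c C) (hq : 𝔖.IsParam ⟨θ₀, f, g⟩)
    {a : Cov dU dZ → ℝ} (ha : BddObs 𝔖 f fun o => a o.2.2) (l : Fin d) :
    ∫ o, a o.2.2 * 𝔖.gradResid θ₀ o l ∂(𝔖.law ⟨θ₀, f, g⟩) =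
      -∫ o, a o.2.2 * 𝔖.A f θ₀ o.2.2 l ∂(𝔖.law ⟨θ₀, f, g⟩) := by
  rw [h.integral_law_cov_mul hq (b := fun x => -𝔖.A f θ₀ x l) ha
    (((h.bddObs_A h.theta_mem l).const_mul h (-1)).congr fun o _ => by ring)
    (h.bddObs_gradResid l) fun x hx => condMean_gradResid l x, ← integral_neg]
  simp only [mul_neg]

/-- The efficient influence function for known `θ`, up to the factor `p⁻¹`. -/
noncomputable def effCore (𝔖 : ATTSetup d dU dZ) (f : Nuis dU dZ) (θ₀ : EuclideanSpace ℝ (Fin d))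
    (Δ : ℝ) (o : Obs dU dZ) : ℝ :=
  𝔖.altNum θ₀ o - tval o.1 * Δ - 𝔖.resid θ₀ o * 𝔖.ratioV Δ f θ₀ o.2.2

lemma bddObs_effCore (h : RegularModel 𝔖 f θ₀ c C) (Δ : ℝ) : BddObs 𝔖 f (effCore 𝔖 f θ₀ Δ) :=
  (((h.bddObs_altNum h.theta_mem).sub h
    ((h.bddObs_tval.const_mul h Δ).congr fun _ _ => mul_comm _ _)).sub h
    ((h.bddObs_resid h.theta_mem).mul (h.bddObs_ratioV h.theta_mem Δ)))

/-- The efficient influence function for known `θ` is conditionally uncorrelated with `resid`, since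
the ratio `V / B` is the coefficient of the conditional projection on `resid`. -/
lemma condMean_resid_mul_effCore (h : RegularModel 𝔖 f θ₀ c C) (hq : 𝔖.IsParam ⟨θ₀, f, g⟩)
    {x : Cov dU dZ} (hx : x ∈ goodX 𝔖 f) (Δ : ℝ) :
    condMean 𝔖 f θ₀ (fun o => 𝔖.resid θ₀ o * effCore 𝔖 f θ₀ Δ o) x = 0 := by
  have hR := h.bddObs_resid h.theta_mem
  have hV := h.bddObs_ratioV h.theta_mem Δ
  have hA := h.bddObs_altNum h.theta_mem
  have e : (fun o => 𝔖.resid θ₀ o * effCore 𝔖 f θ₀ Δ o) = fun o =>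
      (𝔖.resid θ₀ o * 𝔖.altNum θ₀ o + -Δ * (𝔖.resid θ₀ o * tval o.1)) +
        -𝔖.ratioV Δ f θ₀ o.2.2 * (𝔖.resid θ₀ o * 𝔖.resid θ₀ o) := by
    funext o; simp only [effCore]; ring
  have hV' : BddObs 𝔖 f fun o => -𝔖.ratioV Δ f θ₀ o.2.2 :=
    (hV.const_mul h (-1)).congr fun o _ => by ring
  rw [e, h.condMean_add ((hR.mul hA).add ((hR.mul h.bddObs_tval).const_mul h (-Δ)))
    (hV'.mul (hR.mul hR)) hx, h.condMean_add (hR.mul hA)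
    ((hR.mul h.bddObs_tval).const_mul h (-Δ)) hx, h.condMean_resid_mul_altNum,
    condMean_cov_mul (fun _ => -Δ), condMean_resid_mul_tval hx,
    condMean_cov_mul (fun x => -𝔖.ratioV Δ f θ₀ x), h.condMean_resid_sq hq hx]
  have := h.B_mul_ratioV Δ hx
  simp only [V] at this
  linarith

end RegularModel
end ATTSetup

/-! ### The influence functions -/

namespace ATTSetup

variable {d dU dZ : ℕ} {𝔖 : ATTSetup d dU dZ} {f : Fin 2 → ℝ → Cov dU dZ → ℝ}
  {θ₀ : EuclideanSpace ℝ (Fin d)} {c C : ℝ} {g : Measure (Cov dU dZ)}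

namespace RegularModel

/-- The coefficient vector `M⁻¹ (D - Q)` of the efficient score in the efficient influence function
(up to the factor `p⁻¹`). -/
noncomputable def effCoef (𝔖 : ATTSetup d dU dZ) (f : Nuis dU dZ) (θ₀ : EuclideanSpace ℝ (Fin d))
    (g : Measure (Cov dU dZ)) (q : Fin d → ℝ) (Δ : ℝ) : Fin d → ℝ :=
  (𝔖.M f θ₀ g)⁻¹ *ᵥ (𝔖.D f θ₀ g Δ - q)

lemma φeff_eq (q : Fin d → ℝ) (p Δ : ℝ) (o : Obs dU dZ) :
    𝔖.φeff f θ₀ g q p Δ o = p⁻¹ * (effCore 𝔖 f θ₀ Δ o +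
      ∑ j, effCoef 𝔖 f θ₀ g q Δ j * 𝔖.Seff f θ₀ o j) := by
  rw [φeff, φ, effNum_sub_mul_effDen, effCore, effCoef, smul_dotProduct, mul_add]
  rfl

lemma transpose_M : (𝔖.M f θ₀ g)ᵀ = 𝔖.M f θ₀ g := Matrix.ext fun i j => M_symm j i

lemma ψalt_eq (q : Fin d → ℝ) (p Δ : ℝ) (o : Obs dU dZ) :
    𝔖.φalt p Δ θ₀ o - p⁻¹ * (q ⬝ᵥ ((𝔖.M f θ₀ g)⁻¹ *ᵥ 𝔖.Seff f θ₀ o)) =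
      p⁻¹ * (𝔖.altNum θ₀ o - tval o.1 * Δ - ∑ j, ((𝔖.M f θ₀ g)⁻¹ *ᵥ q) j * 𝔖.Seff f θ₀ o j) := by
  have h1 : q ⬝ᵥ ((𝔖.M f θ₀ g)⁻¹ *ᵥ 𝔖.Seff f θ₀ o) = ((𝔖.M f θ₀ g)⁻¹ *ᵥ q) ⬝ᵥ 𝔖.Seff f θ₀ o := by
    rw [Matrix.dotProduct_mulVec, ← Matrix.mulVec_transpose, Matrix.transpose_nonsing_inv,
      transpose_M]
  rw [φalt, h1, ← mul_sub]
  rfl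

lemma bddObs_sum_Seff (h : RegularModel 𝔖 f θ₀ c C) (v : Fin d → ℝ) :
    BddObs 𝔖 f fun o => ∑ j, v j * 𝔖.Seff f θ₀ o j :=
  .sum h _ fun j _ => (h.bddObs_Seff h.theta_mem j).const_mul h (v j)

lemma bddObs_sum_A (h : RegularModel 𝔖 f θ₀ c C) (v : Fin d → ℝ) :
    BddObs 𝔖 f fun o => ∑ j, v j * 𝔖.A f θ₀ o.2.2 j :=
  .sum h _ fun j _ => (h.bddObs_A h.theta_mem j).const_mul h (v j)

lemma bddObs_φeff (h : RegularModel 𝔖 f θ₀ c C) (q : Fin d → ℝ) (p Δ : ℝ) :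
    BddObs 𝔖 f (𝔖.φeff f θ₀ g q p Δ) :=
  (((h.bddObs_effCore Δ).add (h.bddObs_sum_Seff (effCoef 𝔖 f θ₀ g q Δ))).const_mul h p⁻¹).congr
    fun o _ => φeff_eq q p Δ o

lemma bddObs_ψalt (h : RegularModel 𝔖 f θ₀ c C) (q : Fin d → ℝ) (p Δ : ℝ) :
    BddObs 𝔖 f fun o => 𝔖.φalt p Δ θ₀ o - p⁻¹ * (q ⬝ᵥ ((𝔖.M f θ₀ g)⁻¹ *ᵥ 𝔖.Seff f θ₀ o)) :=
  ((((h.bddObs_altNum h.theta_mem).sub h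
    ((h.bddObs_tval.const_mul h Δ).congr fun _ _ => mul_comm _ _)).sub h
      (h.bddObs_sum_Seff ((𝔖.M f θ₀ g)⁻¹ *ᵥ q))).const_mul h p⁻¹).congr
    fun o _ => ψalt_eq q p Δ o

lemma integral_resid_mul_cov (h : RegularModel 𝔖 f θ₀ c C) (hq : 𝔖.IsParam ⟨θ₀, f, g⟩)
    {a : Cov dU dZ → ℝ} (ha : BddObs 𝔖 f fun o => a o.2.2) :
    ∫ o, 𝔖.resid θ₀ o * a o.2.2 ∂(𝔖.law ⟨θ₀, f, g⟩) = 0 := by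
  simp_rw [mul_comm (𝔖.resid θ₀ _)]
  exact h.integral_cov_mul_resid hq ha

lemma integral_sum_Seff (h : RegularModel 𝔖 f θ₀ c C) (hq : 𝔖.IsParam ⟨θ₀, f, g⟩)
    (v : Fin d → ℝ) : ∫ o, ∑ j, v j * 𝔖.Seff f θ₀ o j ∂(𝔖.law ⟨θ₀, f, g⟩) = 0 := by
  rw [integral_finsetSum _ fun j _ =>
    h.integrable_bddObs hq ((h.bddObs_Seff h.theta_mem j).const_mul h (v j))]
  refine Finset.sum_eq_zero fun j _ => ?_
  rw [integral_const_mul]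
  simp only [Seff_eq]
  rw [h.integral_resid_mul_cov hq (h.bddObs_ratioA h.theta_mem j), mul_zero]

variable {p Δ : ℝ}

lemma integral_alt_sub (h : RegularModel 𝔖 f θ₀ c C) (hq : 𝔖.IsParam ⟨θ₀, f, g⟩)
    (hp : ∫ o, tval o.1 ∂(𝔖.law ⟨θ₀, f, g⟩) = p)
    (hΔ : ∫ o, 𝔖.altNum θ₀ o ∂(𝔖.law ⟨θ₀, f, g⟩) = p * Δ) :
    ∫ o, (𝔖.altNum θ₀ o - tval o.1 * Δ) ∂(𝔖.law ⟨θ₀, f, g⟩) = 0 := by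
  rw [integral_sub (h.integrable_bddObs hq (h.bddObs_altNum h.theta_mem))
    ((h.integrable_bddObs hq h.bddObs_tval).mul_const Δ), integral_mul_const, hp, hΔ, sub_self]

lemma integral_φeff (h : RegularModel 𝔖 f θ₀ c C) (hq : 𝔖.IsParam ⟨θ₀, f, g⟩)
    (hp : ∫ o, tval o.1 ∂(𝔖.law ⟨θ₀, f, g⟩) = p)
    (hΔ : ∫ o, 𝔖.altNum θ₀ o ∂(𝔖.law ⟨θ₀, f, g⟩) = p * Δ) (q : Fin d → ℝ) :
    ∫ o, 𝔖.φeff f θ₀ g q p Δ o ∂(𝔖.law ⟨θ₀, f, g⟩) = 0 := by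
  simp_rw [φeff_eq]
  have hb : BddObs 𝔖 f fun o => 𝔖.altNum θ₀ o - tval o.1 * Δ :=
    (h.bddObs_altNum h.theta_mem).sub h
      ((h.bddObs_tval.const_mul h Δ).congr fun _ _ => mul_comm _ _)
  rw [integral_const_mul, integral_add (h.integrable_bddObs hq (h.bddObs_effCore Δ))
    (h.integrable_bddObs hq (h.bddObs_sum_Seff _)), h.integral_sum_Seff hq]
  simp only [effCore]
  rw [integral_sub (h.integrable_bddObs hq hb) (h.integrable_bddObs hq
    ((h.bddObs_resid h.theta_mem).mul (h.bddObs_ratioV h.theta_mem Δ))),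
    h.integral_alt_sub hq hp hΔ, h.integral_resid_mul_cov hq (h.bddObs_ratioV h.theta_mem Δ)]
  simp

lemma integral_ψalt (h : RegularModel 𝔖 f θ₀ c C) (hq : 𝔖.IsParam ⟨θ₀, f, g⟩)
    (hp : ∫ o, tval o.1 ∂(𝔖.law ⟨θ₀, f, g⟩) = p)
    (hΔ : ∫ o, 𝔖.altNum θ₀ o ∂(𝔖.law ⟨θ₀, f, g⟩) = p * Δ) (q : Fin d → ℝ) :
    ∫ o, (𝔖.φalt p Δ θ₀ o - p⁻¹ * (q ⬝ᵥ ((𝔖.M f θ₀ g)⁻¹ *ᵥ 𝔖.Seff f θ₀ o)))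
      ∂(𝔖.law ⟨θ₀, f, g⟩) = 0 := by
  simp_rw [ψalt_eq]
  have hb : BddObs 𝔖 f fun o => 𝔖.altNum θ₀ o - tval o.1 * Δ :=
    (h.bddObs_altNum h.theta_mem).sub h
      ((h.bddObs_tval.const_mul h Δ).congr fun _ _ => mul_comm _ _)
  rw [integral_const_mul, integral_sub (h.integrable_bddObs hq hb)
    (h.integrable_bddObs hq (h.bddObs_sum_Seff _)), h.integral_sum_Seff hq,
    h.integral_alt_sub hq hp hΔ]
  simp

/-- The conditional covariance of `resid` and the efficient influence function. -/
lemma condMean_resid_mul_φeff (h : RegularModel 𝔖 f θ₀ c C) (hq : 𝔖.IsParam ⟨θ₀, f, g⟩)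
    {x : Cov dU dZ} (hx : x ∈ goodX 𝔖 f) (q : Fin d → ℝ) (p Δ : ℝ) :
    condMean 𝔖 f θ₀ (fun o => 𝔖.resid θ₀ o * 𝔖.φeff f θ₀ g q p Δ o) x =
      p⁻¹ * ∑ j, effCoef 𝔖 f θ₀ g q Δ j * 𝔖.A f θ₀ x j := by
  have hR := h.bddObs_resid h.theta_mem
  have e : (fun o => 𝔖.resid θ₀ o * 𝔖.φeff f θ₀ g q p Δ o) = fun o =>
      p⁻¹ * (𝔖.resid θ₀ o * effCore 𝔖 f θ₀ Δ o +
        𝔖.resid θ₀ o * ∑ j, effCoef 𝔖 f θ₀ g q Δ j * 𝔖.Seff f θ₀ o j) := by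
    funext o; rw [φeff_eq]; ring
  have e2 : (fun o => 𝔖.resid θ₀ o * ∑ j, effCoef 𝔖 f θ₀ g q Δ j * 𝔖.Seff f θ₀ o j) = fun o =>
      (∑ j, effCoef 𝔖 f θ₀ g q Δ j * 𝔖.ratioA j f θ₀ o.2.2) * (𝔖.resid θ₀ o * 𝔖.resid θ₀ o) := by
    funext o
    rw [Finset.mul_sum, Finset.sum_mul]
    refine Finset.sum_congr rfl fun j _ => ?_
    rw [Seff_eq]; ring
  rw [e, condMean_cov_mul (fun _ => p⁻¹), h.condMean_add (hR.mul (h.bddObs_effCore Δ))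
    (hR.mul (h.bddObs_sum_Seff _)) hx, h.condMean_resid_mul_effCore hq hx, zero_add, e2,
    condMean_cov_mul (fun x => ∑ j, effCoef 𝔖 f θ₀ g q Δ j * 𝔖.ratioA j f θ₀ x),
    h.condMean_resid_sq hq hx, Finset.sum_mul]
  congr 1
  refine Finset.sum_congr rfl fun j _ => ?_
  rw [← h.B_mul_ratioA hx]; ring

lemma integral_cov_mul_sum_A (h : RegularModel 𝔖 f θ₀ c C) (hq : 𝔖.IsParam ⟨θ₀, f, g⟩)
    {a : Cov dU dZ → ℝ} (ha : BddObs 𝔖 f fun o => a o.2.2) (v : Fin d → ℝ) :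
    ∫ o, a o.2.2 * ∑ j, v j * 𝔖.A f θ₀ o.2.2 j ∂(𝔖.law ⟨θ₀, f, g⟩) =
      ∑ j, v j * ∫ o, a o.2.2 * 𝔖.A f θ₀ o.2.2 j ∂(𝔖.law ⟨θ₀, f, g⟩) := by
  simp_rw [Finset.mul_sum, mul_left_comm (a _), ← integral_const_mul]
  exact integral_finsetSum _ fun j _ =>
    h.integrable_bddObs hq ((ha.mul (h.bddObs_A h.theta_mem j)).const_mul h (v j))

/-- The two influence functions differ by `p⁻¹ R b(X)`, where `R` is the residual and `b` is the
residual of the `B`-weighted regression of `V / B` on the `A j / B`. The conditional covariance of `R`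
and `φeff` is a combination of the `A j`, to which `b` is orthogonal, so that the difference is
uncorrelated with `φeff`. -/
lemma integral_φeff_sq_le (h : RegularModel 𝔖 f θ₀ c C) (hq : 𝔖.IsParam ⟨θ₀, f, g⟩)
    (hM : IsUnit (𝔖.M f θ₀ g).det) (q : Fin d → ℝ) (p Δ : ℝ) :
    ∫ o, 𝔖.φeff f θ₀ g q p Δ o ^ 2 ∂(𝔖.law ⟨θ₀, f, g⟩) ≤
      ∫ o, (𝔖.φalt p Δ θ₀ o - p⁻¹ * (q ⬝ᵥ ((𝔖.M f θ₀ g)⁻¹ *ᵥ 𝔖.Seff f θ₀ o))) ^ 2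
        ∂(𝔖.law ⟨θ₀, f, g⟩) := by
  set D := 𝔖.D f θ₀ g Δ with hD
  set Mi := (𝔖.M f θ₀ g)⁻¹ with hMi
  set b : Cov dU dZ → ℝ := fun x => 𝔖.ratioV Δ f θ₀ x - ∑ j, (Mi *ᵥ D) j * 𝔖.ratioA j f θ₀ x with hb
  have hbb : BddObs 𝔖 f fun o => b o.2.2 := (h.bddObs_ratioV h.theta_mem Δ).sub h
    (.sum h _ fun j _ => (h.bddObs_ratioA h.theta_mem j).const_mul h _)
  have hR := h.bddObs_resid h.theta_mem
  have hφ := h.bddObs_φeff (g := g) q p Δ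
  -- the normal equations `D = M (M⁻¹ D)`
  have hbA : ∀ l, ∫ o, b o.2.2 * 𝔖.A f θ₀ o.2.2 l ∂(𝔖.law ⟨θ₀, f, g⟩) = 0 := fun l => by
    simp only [hb, sub_mul, Finset.sum_mul, mul_assoc]
    have hi : ∀ j, BddObs 𝔖 f fun o =>
        (Mi *ᵥ D) j * (𝔖.ratioA j f θ₀ o.2.2 * 𝔖.A f θ₀ o.2.2 l) := fun j =>
      ((h.bddObs_ratioA h.theta_mem j).mul (h.bddObs_A h.theta_mem l)).const_mul h _
    rw [integral_sub (h.integrable_bddObs hq ((h.bddObs_ratioV h.theta_mem Δ).mul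
      (h.bddObs_A h.theta_mem l))) (h.integrable_bddObs hq (.sum h _ fun j _ => hi j)),
      integral_finsetSum _ fun j _ => h.integrable_bddObs hq (hi j), ← h.D_eq hq]
    simp_rw [integral_const_mul, ← h.M_eq hq, M_symm _ l, mul_comm ((Mi *ᵥ D) _)]
    change D l - (𝔖.M f θ₀ g *ᵥ (Mi *ᵥ D)) l = 0
    rw [Matrix.mulVec_mulVec, hMi, Matrix.mul_nonsing_inv _ hM, Matrix.one_mulVec, sub_self]
  have hcross : ∫ o, b o.2.2 * (𝔖.resid θ₀ o * 𝔖.φeff f θ₀ g q p Δ o) ∂(𝔖.law ⟨θ₀, f, g⟩) = 0 := by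
    rw [h.integral_law_cov_mul hq hbb ((h.bddObs_sum_A (effCoef 𝔖 f θ₀ g q Δ)).const_mul h p⁻¹)
      (b := fun x => p⁻¹ * ∑ j, effCoef 𝔖 f θ₀ g q Δ j * 𝔖.A f θ₀ x j)
      (hR.mul hφ) fun x hx => h.condMean_resid_mul_φeff hq hx q p Δ]
    simp_rw [mul_left_comm (b _), integral_const_mul]
    rw [h.integral_cov_mul_sum_A hq hbb]
    simp [hbA]
  have e : ∀ o, (𝔖.φalt p Δ θ₀ o - p⁻¹ * (q ⬝ᵥ (Mi *ᵥ 𝔖.Seff f θ₀ o))) ^ 2 =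
      𝔖.φeff f θ₀ g q p Δ o ^ 2 + (2 * p⁻¹) * (b o.2.2 * (𝔖.resid θ₀ o * 𝔖.φeff f θ₀ g q p Δ o)) +
        (p⁻¹ * (𝔖.resid θ₀ o * b o.2.2)) ^ 2 := fun o => by
    have e1 : 𝔖.φalt p Δ θ₀ o - p⁻¹ * (q ⬝ᵥ (Mi *ᵥ 𝔖.Seff f θ₀ o)) =
        𝔖.φeff f θ₀ g q p Δ o + p⁻¹ * (𝔖.resid θ₀ o * b o.2.2) := by
      rw [hMi, ψalt_eq, φeff_eq, ← mul_add]
      congr 1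
      have e2 : ∀ j, effCoef 𝔖 f θ₀ g q Δ j = (Mi *ᵥ D) j - (Mi *ᵥ q) j := fun j => by
        rw [effCoef, Matrix.mulVec_sub]; rfl
      simp only [effCore, e2, hb, sub_mul, mul_sub, Finset.sum_sub_distrib, Finset.mul_sum, Seff_eq]
      have e3 : ∀ j, 𝔖.resid θ₀ o * ((Mi *ᵥ D) j * 𝔖.ratioA j f θ₀ o.2.2) =
          (Mi *ᵥ D) j * (𝔖.resid θ₀ o * 𝔖.ratioA j f θ₀ o.2.2) := fun j => by ring
      simp only [e3]
      ring
    rw [e1]; ring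
  simp_rw [e]
  have hb1 : BddObs 𝔖 f fun o => 𝔖.φeff f θ₀ g q p Δ o ^ 2 := (hφ.mul hφ).congr fun o _ => sq _
  have hb2 := (hbb.mul (hR.mul hφ)).const_mul h (2 * p⁻¹)
  have hb3 : BddObs 𝔖 f fun o => (p⁻¹ * (𝔖.resid θ₀ o * b o.2.2)) ^ 2 :=
    (((hR.mul hbb).const_mul h p⁻¹).mul ((hR.mul hbb).const_mul h p⁻¹)).congr fun o _ => sq _
  rw [integral_add (h.integrable_bddObs hq (hb1.add hb2)) (h.integrable_bddObs hq hb3),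
    integral_add (h.integrable_bddObs hq hb1) (h.integrable_bddObs hq hb2), integral_const_mul,
    hcross, mul_zero, add_zero]
  exact le_add_of_nonneg_right (integral_nonneg fun o => sq_nonneg _)

end RegularModel
end ATTSetup

/-! ### Differentiability in quadratic mean -/

namespace ATTSetup

section QuadraticMean

variable {α : Type*} [MeasurableSpace α]

/-- A quantitative form of the differentiability of expectations under differentiability in
quadratic mean. With `u = √(dP/dν)`, `v = √(dQ/dν)` and `e = (u - v)/h - s v/2` the difference
quotient of `a (u² - v²)` differs from `a s v²` by `a {h (e + s v/2)² + 2 v e}`. -/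
lemma abs_diffQuotient_sub_le {P Q : Measure α} [IsProbabilityMeasure P] [IsProbabilityMeasure Q]
    {s a : α → ℝ} (hs : MemLp s 2 Q) (ha : Measurable a) {D : ℝ} (hD : ∀ o, |a o| ≤ D) {h η : ℝ}
    (hh : h ≠ 0) (hη : 0 < η)
    (hI : ∫⁻ o, ENNReal.ofReal (((√(P.rnDeriv (P + Q) o).toReal - √(Q.rnDeriv (P + Q) o).toReal) / h -
          s o * √(Q.rnDeriv (P + Q) o).toReal / 2) ^ 2) ∂(P + Q) ≠ ⊤) :
    |h⁻¹ * (∫ o, a o ∂P - ∫ o, a o ∂Q) - ∫ o, a o * s o ∂Q| ≤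
      D * ((2 * |h| + η⁻¹) * (∫⁻ o, ENNReal.ofReal (((√(P.rnDeriv (P + Q) o).toReal -
          √(Q.rnDeriv (P + Q) o).toReal) / h -
          s o * √(Q.rnDeriv (P + Q) o).toReal / 2) ^ 2) ∂(P + Q)).toReal +
        |h| / 2 * ∫ o, s o ^ 2 ∂Q + η) := by
  set ν := P + Q with hν
  have hPν : P ≪ ν := Measure.absolutelyContinuous_of_le (Measure.le_add_right le_rfl)
  have hQν : Q ≪ ν := Measure.absolutelyContinuous_of_le (Measure.le_add_left le_rfl)
  set u : α → ℝ := fun o => √(P.rnDeriv ν o).toReal with hu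
  set v : α → ℝ := fun o => √(Q.rnDeriv ν o).toReal with hv
  have hum : Measurable u := (Measure.measurable_rnDeriv P ν).ennreal_toReal.sqrt
  have hvm : Measurable v := (Measure.measurable_rnDeriv Q ν).ennreal_toReal.sqrt
  have hu2 : ∀ o, (P.rnDeriv ν o).toReal = u o ^ 2 := fun o =>
    (Real.sq_sqrt ENNReal.toReal_nonneg).symm
  have hv2 : ∀ o, (Q.rnDeriv ν o).toReal = v o ^ 2 := fun o =>
    (Real.sq_sqrt ENNReal.toReal_nonneg).symm
  -- the score only matters where `v ≠ 0`
  have hsv : AEStronglyMeasurable (fun o => s o * v o) ν := by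
    obtain ⟨s', hs', hss⟩ := hs.1.aemeasurable
    refine ⟨fun o => s' o * v o, (hs'.mul hvm).stronglyMeasurable, ?_⟩
    have h1 : ∀ᵐ o ∂(ν.withDensity (Q.rnDeriv ν)), s o = s' o := by
      rw [Measure.withDensity_rnDeriv_eq Q ν hQν]; exact hss
    rw [ae_withDensity_iff (Measure.measurable_rnDeriv Q ν)] at h1
    filter_upwards [h1] with o ho
    by_cases h0 : Q.rnDeriv ν o = 0
    · have : v o = 0 := by simp [hv, h0]
      simp [this]
    · rw [ho h0]
  set e : α → ℝ := fun o => (u o - v o) / h - s o * v o / 2 with he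
  have hem : AEStronglyMeasurable e ν :=
    ((hum.sub hvm).div_const h).aestronglyMeasurable.sub (by
      simpa only [div_eq_mul_inv] using hsv.mul_const (2 : ℝ)⁻¹)
  have he2 : Integrable (fun o => e o ^ 2) ν :=
    ⟨hem.pow 2, (hasFiniteIntegral_iff_ofReal (ae_of_all _ fun o => sq_nonneg _)).2 hI.lt_top⟩
  have hIe : (∫⁻ o, ENNReal.ofReal (e o ^ 2) ∂ν).toReal = ∫ o, e o ^ 2 ∂ν :=
    (integral_eq_lintegral_of_nonneg_ae (ae_of_all _ fun o => sq_nonneg _) he2.1).symm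
  have hPint : ∀ k : α → ℝ, ∫ o, k o ∂P = ∫ o, u o ^ 2 * k o ∂ν := fun k => by
    rw [← integral_rnDeriv_smul hPν]
    simp only [hu2, smul_eq_mul]
  have hQint : ∀ k : α → ℝ, ∫ o, k o ∂Q = ∫ o, v o ^ 2 * k o ∂ν := fun k => by
    rw [← integral_rnDeriv_smul hQν]
    simp only [hv2, smul_eq_mul]
  have hPi : ∀ k : α → ℝ, Integrable k P → Integrable (fun o => u o ^ 2 * k o) ν := fun k hk => by
    have := (integrable_rnDeriv_smul_iff hPν).2 hk
    simpa only [hu2, smul_eq_mul] using this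
  have hQi : ∀ k : α → ℝ, Integrable k Q → Integrable (fun o => v o ^ 2 * k o) ν := fun k hk => by
    have := (integrable_rnDeriv_smul_iff hQν).2 hk
    simpa only [hv2, smul_eq_mul] using this
  have haP : Integrable a P := Integrable.of_bound ha.aestronglyMeasurable D (ae_of_all _ hD)
  have haQ : Integrable a Q := Integrable.of_bound ha.aestronglyMeasurable D (ae_of_all _ hD)
  have hs1 : Integrable s Q := hs.integrable one_le_two
  have has : Integrable (fun o => a o * s o) Q :=
    hs1.bdd_mul ha.aestronglyMeasurable (ae_of_all _ hD)
  have hs2 : Integrable (fun o => s o ^ 2) Q := hs.integrable_sq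
  have hone : ∫ o, v o ^ 2 ∂ν = 1 := by
    have := hQint fun _ => 1
    simpa using this.symm
  have hv2i : Integrable (fun o => v o ^ 2) ν := by
    simpa using hQi (fun _ => 1) (integrable_const _)
  -- `u = v + h (e + s v / 2)`, hence `(u² - v²) / h = h (e + s v / 2)² + 2 v (e + s v / 2)`
  have key : h⁻¹ * (∫ o, a o ∂P - ∫ o, a o ∂Q) - ∫ o, a o * s o ∂Q =
      ∫ o, a o * (h * (e o + s o * v o / 2) ^ 2 + 2 * (v o * e o)) ∂ν := by
    have hi : Integrable (fun o => h⁻¹ * (u o ^ 2 * a o - v o ^ 2 * a o)) ν :=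
      ((hPi a haP).sub (hQi a haQ)).const_mul h⁻¹
    rw [hPint, hQint, hQint (fun o => a o * s o), ← integral_sub (hPi a haP) (hQi a haQ),
      ← integral_const_mul, ← integral_sub hi (hQi _ has)]
    refine integral_congr_ae (ae_of_all _ fun o => ?_)
    simp only [he]
    field_simp
    ring
  rw [key, hIe]
  have hb1 : Integrable (fun o => (2 * |h| + η⁻¹) * e o ^ 2 + |h| / 2 * (v o ^ 2 * s o ^ 2)) ν :=
    (he2.const_mul _).add ((hQi _ hs2).const_mul _)
  have hbi : Integrable (fun o => D * ((2 * |h| + η⁻¹) * e o ^ 2 +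
      |h| / 2 * (v o ^ 2 * s o ^ 2) + η * v o ^ 2)) ν :=
    (hb1.add (hv2i.const_mul _)).const_mul D
  have hle := norm_integral_le_of_norm_le (f := fun o => a o * (h * (e o + s o * v o / 2) ^ 2 +
    2 * (v o * e o))) hbi (ae_of_all _ fun o => ?_)
  · rw [Real.norm_eq_abs] at hle
    refine hle.trans (le_of_eq ?_)
    rw [integral_const_mul, integral_add hb1 (hv2i.const_mul _), integral_add (he2.const_mul _) ((hQi _ hs2).const_mul _),
      integral_const_mul, integral_const_mul, integral_const_mul, hone, mul_one,
      hQint fun o => s o ^ 2]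
  · rw [norm_mul, Real.norm_eq_abs, Real.norm_eq_abs]
    refine mul_le_mul (hD o) ?_ (abs_nonneg _) ((abs_nonneg _).trans (hD o))
    refine (abs_add_le _ _).trans ?_
    have h1 : |h * (e o + s o * v o / 2) ^ 2| ≤ 2 * |h| * e o ^ 2 + |h| / 2 * (v o ^ 2 * s o ^ 2) := by
      rw [abs_mul, abs_of_nonneg (sq_nonneg (e o + s o * v o / 2))]
      have h2 : (e o + s o * v o / 2) ^ 2 ≤ 2 * e o ^ 2 + (v o ^ 2 * s o ^ 2) / 2 := by
        nlinarith [sq_nonneg (e o - s o * v o / 2)]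
      nlinarith [mul_le_mul_of_nonneg_left h2 (abs_nonneg h)]
    -- Young's inequality with weight `η`, which is sent to zero after `h`
    have h3 : |2 * (v o * e o)| ≤ η⁻¹ * e o ^ 2 + η * v o ^ 2 := by
      have h4 : 0 ≤ η⁻¹ * (|e o| - η * |v o|) ^ 2 := by positivity
      have h5 : η⁻¹ * (|e o| - η * |v o|) ^ 2 =
          η⁻¹ * e o ^ 2 + η * v o ^ 2 - 2 * (|v o| * |e o|) := by
        rw [← sq_abs (e o), ← sq_abs (v o)]
        field_simp
        ring
      rw [abs_mul, abs_mul, abs_two]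
      linarith
    linarith

/-- Under differentiability in quadratic mean, expectations of bounded functions are
differentiable, and the derivative is the covariance with the score. -/
lemma hasDerivAt_integral_of_dqm {P : ℝ → Measure α} [IsProbabilityMeasure (P 0)]
    (hP : ∀ᶠ h in 𝓝 (0 : ℝ), IsProbabilityMeasure (P h)) {s a : α → ℝ} (hs : MemLp s 2 (P 0))
    (hdqm : Tendsto (fun h : ℝ => ∫⁻ o, ENNReal.ofReal
        (((√((P h).rnDeriv (P h + P 0) o).toReal - √((P 0).rnDeriv (P h + P 0) o).toReal) / h -
          s o * √((P 0).rnDeriv (P h + P 0) o).toReal / 2) ^ 2) ∂(P h + P 0)) (𝓝[≠] 0) (𝓝 0))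
    (ha : Measurable a) {D : ℝ} (hD : ∀ o, |a o| ≤ D) :
    HasDerivAt (fun h => ∫ o, a o ∂(P h)) (∫ o, a o * s o ∂(P 0)) 0 := by
  rw [hasDerivAt_iff_tendsto_slope, Metric.tendsto_nhds]
  intro ε hε
  obtain ⟨D', hD'0, hD'⟩ : ∃ D', 0 < D' ∧ ∀ o, |a o| ≤ D' :=
    ⟨max D 1, lt_max_of_lt_right one_pos, fun o => (hD o).trans (le_max_left _ _)⟩
  -- this choice of `η` makes the last term of the bound equal to `ε / 2`
  set η := ε / (2 * D') with hη
  have hη0 : 0 < η := by positivity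
  have hreal := (ENNReal.tendsto_toReal ENNReal.zero_ne_top).comp hdqm
  have habs : Tendsto (fun h : ℝ => |h|) (𝓝[≠] 0) (𝓝 0) := by
    have := (continuous_abs (G := ℝ)).tendsto 0
    rw [abs_zero] at this
    exact this.mono_left nhdsWithin_le_nhds
  have hlim := ((((habs.const_mul 2).add_const η⁻¹).mul hreal).add
    ((habs.div_const 2).mul_const (∫ o, s o ^ 2 ∂(P 0)))).const_mul D'
  simp only [ENNReal.toReal_zero, mul_zero, zero_div, zero_mul, add_zero] at hlim
  have hsmall := hlim.eventually_lt_const (half_pos hε)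
  filter_upwards [hsmall, hdqm.eventually_lt_const ENNReal.zero_lt_top, self_mem_nhdsWithin,
    nhdsWithin_le_nhds hP] with h h1 h2 h3 h4
  have h5 := abs_diffQuotient_sub_le hs ha hD' h3 hη0 h2.ne
  rw [slope_def_field, sub_zero, div_eq_inv_mul, Real.dist_eq]
  refine h5.trans_lt ?_
  have h6 : D' * η = ε / 2 := by rw [hη]; field_simp
  rw [mul_add, h6]
  simp only [Function.comp_apply] at h1
  linarith

end QuadraticMean

end ATTSetup

/-! ### Derivatives along regular submodels -/

namespace ATTSetup

variable {d dU dZ : ℕ} {𝔖 : ATTSetup d dU dZ} {f : Fin 2 → ℝ → Cov dU dZ → ℝ}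
  {θ₀ : EuclideanSpace ℝ (Fin d)} {c C : ℝ} {g : Measure (Cov dU dZ)}

namespace RegularModel

lemma measurableSet_obsRange (h : RegularModel 𝔖 f θ₀ c C) : MeasurableSet (obsRange 𝔖) := by
  have h1 : obsRange 𝔖 = ⋃ t : Fin 2, {t} ×ˢ (𝔖.𝒴 t ×ˢ 𝔖.𝒳) := by
    ext ⟨t, y, x⟩; simp [obsRange]
  rw [h1]
  exact MeasurableSet.iUnion fun t => (measurableSet_singleton t).prod
    ((h.measurableSet_𝒴 t).prod h.measurableSet_𝒳)

/-- Second-order expansion of `resid` on the whole range of the observations. -/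
lemma exists_resid_expand (h : RegularModel 𝔖 f θ₀ c C) : ∃ L, 0 ≤ L ∧
    (∀ o ∈ obsRange 𝔖, ∀ l, |𝔖.gradResid θ₀ o l| ≤ L) ∧ ∀ o ∈ obsRange 𝔖, ∀ θ ∈ 𝔖.Θ,
      |𝔖.resid θ o - 𝔖.resid θ₀ o - ∑ l, 𝔖.gradResid θ₀ o l * (θ l - θ₀ l)| ≤
        L * ‖θ - θ₀‖ ^ 2 := by
  obtain ⟨L, hL, hb⟩ := h.jet_odds
  refine ⟨L, hL, ?_, ?_⟩
  · rintro ⟨t, y, x⟩ ho l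
    obtain rfl | rfl := fin_two_eq t
    · simpa [gradResid] using hb.grad_bdd (y, x) ho l
    · simpa [gradResid] using hL
  · rintro ⟨t, y, x⟩ ho θ hθ
    obtain rfl | rfl := fin_two_eq t
    · have := hb.expand (y, x) ho θ hθ
      rw [← abs_neg] at this
      refine (le_of_eq ?_).trans this
      congr 1
      simp only [resid, gradResid, tval_zero, sub_zero, one_mul, zero_sub, neg_mul,
        Finset.sum_neg_distrib]
      ring
    · simp only [resid, gradResid, tval_one, sub_self, zero_mul, neg_zero, Finset.sum_const_zero,
        abs_zero]
      positivity

lemma measurable_gradResid (h : RegularModel 𝔖 f θ₀ c C) (l : Fin d) :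
    Measurable ((obsRange 𝔖).indicator fun o => 𝔖.gradResid θ₀ o l) := by
  refine measurable_of_eq (((((measurable_const (a := (1 : ℝ))).sub
    (measurable_tval.comp measurable_fst)).mul
      ((h.measurable_score_integrand h.theta_mem l).comp measurable_snd)).neg).indicator
        h.measurableSet_obsRange) fun o => ?_
  by_cases ho : o ∈ obsRange 𝔖
  · rw [Set.indicator_of_mem ho, Set.indicator_of_mem ho]
    obtain ⟨t, y, x⟩ := o
    obtain rfl | rfl := fin_two_eq t
    · have h1 : (y, x) ∈ 𝔖.rangeYX 0 := ho
      simp [gradResid, Set.indicator_of_mem h1]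
    · simp [gradResid]
  · rw [Set.indicator_of_notMem ho, Set.indicator_of_notMem ho]

variable {γ : ℝ → Param d dU dZ} {s : Obs dU dZ → ℝ}

/-- Differentiability of expectations along a regular submodel. -/
lemma hasDerivAt_integral_submodel (h : RegularModel 𝔖 f θ₀ c C) (hq : 𝔖.IsParam ⟨θ₀, f, g⟩)
    (hγ : 𝔖.IsRegularSubmodel ⟨θ₀, f, g⟩ γ s) {a : Obs dU dZ → ℝ} (ha : Measurable a) {D : ℝ}
    (hD : ∀ o, |a o| ≤ D) :
    HasDerivAt (fun t => ∫ o, a o ∂(𝔖.law (γ t))) (∫ o, a o * s o ∂(𝔖.law ⟨θ₀, f, g⟩)) 0 := by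
  have hP := h.isProbabilityMeasure_law hq
  have e : 𝔖.law (γ 0) = 𝔖.law ⟨θ₀, f, g⟩ := by rw [hγ.at_zero]
  have hP0 : IsProbabilityMeasure (𝔖.law (γ 0)) := by rw [e]; exact hP
  have := hasDerivAt_integral_of_dqm (P := fun t => 𝔖.law (γ t)) (s := s)
    (hγ.mem.mono fun t ht => h.isProbabilityMeasure_law ht) (by simp only [e]; exact hγ.score_memLp)
    (by simp only [e]; exact hγ.dqm) ha hD
  rwa [e] at this

/-- The derivative of `t ↦ E_t{resid(θ_t) ψ}` along a regular submodel has one term for the change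
of the law and one for the change of `θ`. -/
lemma hasDerivAt_integral_resid_mul (h : RegularModel 𝔖 f θ₀ c C) (hq : 𝔖.IsParam ⟨θ₀, f, g⟩)
    (hγ : 𝔖.IsRegularSubmodel ⟨θ₀, f, g⟩ γ s) {ψ : Obs dU dZ → ℝ} (hψ : Measurable ψ) {D : ℝ}
    (hD : ∀ o, |ψ o| ≤ D) :
    HasDerivAt (fun t => ∫ o, 𝔖.resid (γ t).θ o * ψ o ∂(𝔖.law (γ t)))
      (∫ o, 𝔖.resid θ₀ o * ψ o * s o ∂(𝔖.law ⟨θ₀, f, g⟩) +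
        ∑ l, deriv (fun t => (γ t).θ) 0 l *
          ∫ o, 𝔖.gradResid θ₀ o l * ψ o ∂(𝔖.law ⟨θ₀, f, g⟩)) 0 := by
  obtain ⟨L, hL, hgb, hexp⟩ := h.exists_resid_expand
  have hD0 : 0 ≤ D := (abs_nonneg _).trans (hD (0, 0, 0))
  have hc := h.c_pos
  set R := obsRange 𝔖 with hR
  have hind : ∀ (k : Obs dU dZ → ℝ) (E : ℝ), 0 ≤ E → (∀ o ∈ R, |k o| ≤ E) →
      ∀ o, |R.indicator k o * ψ o| ≤ E * D := fun k E hE hk o => by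
    rw [abs_mul]
    refine mul_le_mul ?_ (hD o) (abs_nonneg _) hE
    by_cases ho : o ∈ R
    · rw [Set.indicator_of_mem ho]; exact hk o ho
    · rw [Set.indicator_of_notMem ho, abs_zero]; exact hE
  have hae : ∀ q, 𝔖.IsParam q → ∀ᵐ o ∂(𝔖.law q), o ∈ R := fun q hq => h.ae_law_range hq
  have hresm : Measurable fun o => R.indicator (𝔖.resid θ₀) o * ψ o :=
    ((h.measurable_resid θ₀).indicator h.measurableSet_obsRange).mul hψ
  have hgm : ∀ l, Measurable fun o => R.indicator (fun o => 𝔖.gradResid θ₀ o l) o * ψ o :=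
    fun l => (h.measurable_gradResid l).mul hψ
  have hresb := hind (𝔖.resid θ₀) (1 + c⁻¹) (by positivity) fun o ho => h.abs_resid_le h.theta_mem ho
  have hgrb := fun l => hind (fun o => 𝔖.gradResid θ₀ o l) L hL fun o ho => hgb o ho l
  -- the fixed functions `resid θ₀ ψ` and `gradResid θ₀ ψ` have differentiable expectations
  have d1 := h.hasDerivAt_integral_submodel hq hγ hresm hresb
  have d2 := fun l => h.hasDerivAt_integral_submodel hq hγ (hgm l) (hgrb l)
  have hθ := hγ.theta_diff.hasDerivAt
  have hθ0 : (γ 0).θ = θ₀ := by rw [hγ.at_zero]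
  have d3 : ∀ l, HasDerivAt (fun t => (γ t).θ l - θ₀ l) (deriv (fun t => (γ t).θ) 0 l) 0 :=
    fun l => (((EuclideanSpace.proj (𝕜 := ℝ) l).hasFDerivAt.comp_hasDerivAt (0 : ℝ) hθ)).sub_const _
  -- the remainder of the expansion of `resid` in `θ` is of second order, uniformly in the law
  set rem : ℝ → ℝ := fun t => ∫ o, 𝔖.resid (γ t).θ o * ψ o ∂(𝔖.law (γ t)) -
    (∫ o, R.indicator (𝔖.resid θ₀) o * ψ o ∂(𝔖.law (γ t)) + ∑ l, ((γ t).θ l - θ₀ l) *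
      ∫ o, R.indicator (fun o => 𝔖.gradResid θ₀ o l) o * ψ o ∂(𝔖.law (γ t))) with hrem
  have hremb : ∀ᶠ t in 𝓝 (0 : ℝ), |rem t| ≤ L * D * ‖(γ t).θ - θ₀‖ ^ 2 := by
    filter_upwards [hγ.mem] with t ht
    have hPt := h.isProbabilityMeasure_law ht
    have hi1 : Integrable (fun o => R.indicator (𝔖.resid θ₀) o * ψ o) (𝔖.law (γ t)) :=
      Integrable.of_bound hresm.aestronglyMeasurable _ (ae_of_all _ hresb)
    have hi2 : ∀ l, Integrable (fun o => R.indicator (fun o => 𝔖.gradResid θ₀ o l) o * ψ o)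
        (𝔖.law (γ t)) := fun l =>
      Integrable.of_bound (hgm l).aestronglyMeasurable _ (ae_of_all _ (hgrb l))
    have hi3 : Integrable (fun o => 𝔖.resid (γ t).θ o * ψ o) (𝔖.law (γ t)) :=
      h.integrable_law ht ((h.measurable_resid _).mul hψ) (D := (1 + c⁻¹) * D) fun o ho => by
        rw [abs_mul]
        exact mul_le_mul (h.abs_resid_le ht.theta_mem ho) (hD o) (abs_nonneg _) (by positivity)
    have e1 : rem t = ∫ o, (𝔖.resid (γ t).θ o * ψ o - (R.indicator (𝔖.resid θ₀) o * ψ o +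
        ∑ l, ((γ t).θ l - θ₀ l) * (R.indicator (fun o => 𝔖.gradResid θ₀ o l) o * ψ o)))
          ∂(𝔖.law (γ t)) := by
      have hi4 : Integrable (fun o => ∑ l, ((γ t).θ l - θ₀ l) *
          (R.indicator (fun o => 𝔖.gradResid θ₀ o l) o * ψ o)) (𝔖.law (γ t)) :=
        integrable_finsetSum _ fun l _ => (hi2 l).const_mul _
      have hi5 : Integrable (fun o => R.indicator (𝔖.resid θ₀) o * ψ o + ∑ l, ((γ t).θ l - θ₀ l) *
          (R.indicator (fun o => 𝔖.gradResid θ₀ o l) o * ψ o)) (𝔖.law (γ t)) := hi1.add hi4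
      rw [integral_sub hi3 hi5, integral_add hi1 hi4,
        integral_finsetSum _ fun l _ => (hi2 l).const_mul _]
      simp only [integral_const_mul, hrem]
    rw [e1]
    have := norm_integral_le_of_norm_le_const (μ := 𝔖.law (γ t))
      (f := fun o => 𝔖.resid (γ t).θ o * ψ o - (R.indicator (𝔖.resid θ₀) o * ψ o +
        ∑ l, ((γ t).θ l - θ₀ l) * (R.indicator (fun o => 𝔖.gradResid θ₀ o l) o * ψ o)))
      (C := L * D * ‖(γ t).θ - θ₀‖ ^ 2) (by
        filter_upwards [hae _ ht] with o ho
        have e2 : 𝔖.resid (γ t).θ o * ψ o - (R.indicator (𝔖.resid θ₀) o * ψ o +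
            ∑ l, ((γ t).θ l - θ₀ l) * (R.indicator (fun o => 𝔖.gradResid θ₀ o l) o * ψ o)) =
            (𝔖.resid (γ t).θ o - 𝔖.resid θ₀ o - ∑ l, 𝔖.gradResid θ₀ o l * ((γ t).θ l - θ₀ l)) *
              ψ o := by
          simp only [Set.indicator_of_mem ho, sub_mul, Finset.sum_mul]
          rw [sub_sub]
          congr 2
          exact Finset.sum_congr rfl fun l _ => by ring
        rw [e2, norm_mul, Real.norm_eq_abs, Real.norm_eq_abs, mul_right_comm]
        exact mul_le_mul (hexp o ho _ ht.theta_mem) (hD o) (abs_nonneg _) (by positivity))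
    simpa using this
  have d4 : HasDerivAt rem 0 0 := by
    have h1 : (fun t => (γ t).θ - θ₀) =O[𝓝 0] fun t : ℝ => t - 0 := by
      have := hθ.isBigO_sub
      simpa only [hθ0] using this
    have h2 : rem =O[𝓝 0] fun t : ℝ => (t - 0) ^ 2 := by
      refine Asymptotics.IsBigO.trans (Asymptotics.IsBigO.of_bound (L * D) ?_)
        (h1.norm_left.pow 2)
      filter_upwards [hremb] with t ht
      rw [Real.norm_eq_abs, norm_pow, norm_norm]
      exact ht
    have h3 : rem 0 = 0 := by
      have := hremb.self_of_nhds
      simp only [hθ0, sub_self, norm_zero] at this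
      simpa using this
    rw [hasDerivAt_iff_isLittleO]
    simp only [h3, sub_zero, smul_zero] at h2 ⊢
    refine h2.trans_isLittleO ?_
    simpa only [pow_one] using Asymptotics.isLittleO_pow_pow (𝕜 := ℝ) (m := 1) (n := 2) one_lt_two
  have d5 := (d1.add (HasDerivAt.fun_sum (u := Finset.univ) fun l _ => (d3 l).mul (d2 l))).add d4
  refine (d5.congr_deriv ?_).congr_of_eventuallyEq (Eventually.of_forall fun t => ?_)
  · have hPq := hae _ hq
    have e1 : ∀ (k k' : Obs dU dZ → ℝ), ∫ o, R.indicator k o * ψ o * k' o ∂(𝔖.law ⟨θ₀, f, g⟩) =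
        ∫ o, k o * ψ o * k' o ∂(𝔖.law ⟨θ₀, f, g⟩) := fun k k' => by
      refine integral_congr_ae ?_
      filter_upwards [hPq] with o ho
      rw [Set.indicator_of_mem ho]
    have e2 : ∀ (k : Obs dU dZ → ℝ), ∫ o, R.indicator k o * ψ o ∂(𝔖.law (γ 0)) =
        ∫ o, k o * ψ o ∂(𝔖.law ⟨θ₀, f, g⟩) := fun k => by
      rw [hγ.at_zero]
      refine integral_congr_ae ?_
      filter_upwards [hPq] with o ho
      rw [Set.indicator_of_mem ho]
    simp only [e1, e2, hθ0, sub_self, zero_mul, add_zero]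
  · simp only [hrem, Pi.add_apply, Pi.mul_apply]
    ring

/-- Expectations of `resid` times a function of the covariates stay zero along a submodel.
Differentiating this restriction gives the covariances of such products with the score: this is the
only information on the score that the derivative of the functional requires. -/
lemma integral_resid_mul_score (h : RegularModel 𝔖 f θ₀ c C) (hq : 𝔖.IsParam ⟨θ₀, f, g⟩)
    (hγ : 𝔖.IsRegularSubmodel ⟨θ₀, f, g⟩ γ s) {a : Cov dU dZ → ℝ}
    (ham : Measurable ((goodX 𝔖 f).indicator a)) (ha : BddObs 𝔖 f fun o => a o.2.2)
    {D : ℝ} (hD : ∀ x ∈ goodX 𝔖 f, |a x| ≤ D) :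
    ∫ o, 𝔖.resid θ₀ o * a o.2.2 * s o ∂(𝔖.law ⟨θ₀, f, g⟩) =
      ∑ l, deriv (fun t => (γ t).θ) 0 l *
        ∫ o, a o.2.2 * 𝔖.A f θ₀ o.2.2 l ∂(𝔖.law ⟨θ₀, f, g⟩) := by
  set φ := (goodX 𝔖 f).indicator a with hφ
  have hφD : ∀ x, |φ x| ≤ max D 0 := fun x => by
    by_cases hx : x ∈ goodX 𝔖 f
    · rw [hφ, Set.indicator_of_mem hx]; exact (hD x hx).trans (le_max_left _ _)
    · rw [hφ, Set.indicator_of_notMem hx, abs_zero]; exact le_max_right _ _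
  have d1 := h.hasDerivAt_integral_resid_mul hq hγ (ψ := fun o => φ o.2.2)
    (ham.comp (measurable_snd.comp measurable_snd)) fun o => hφD _
  have d2 : HasDerivAt (fun t => ∫ o, 𝔖.resid (γ t).θ o * φ o.2.2 ∂(𝔖.law (γ t))) 0 0 := by
    refine (hasDerivAt_const (0 : ℝ) (0 : ℝ)).congr_of_eventuallyEq ?_
    filter_upwards [hγ.mem] with t ht
    exact h.integral_law_resid_mul ht ham fun x _ => hφD x
  -- the derivative is computed in two ways, one of them being zero
  have h1 := d1.unique d2
  have h2 := h.ae_law_goodObs hq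
  have e1 : ∫ o, 𝔖.resid θ₀ o * φ o.2.2 * s o ∂(𝔖.law ⟨θ₀, f, g⟩) =
      ∫ o, 𝔖.resid θ₀ o * a o.2.2 * s o ∂(𝔖.law ⟨θ₀, f, g⟩) := by
    refine integral_congr_ae ?_
    filter_upwards [h2] with o ho
    rw [hφ, Set.indicator_of_mem ho.2]
  have e2 : ∀ l, ∫ o, 𝔖.gradResid θ₀ o l * φ o.2.2 ∂(𝔖.law ⟨θ₀, f, g⟩) =
      -∫ o, a o.2.2 * 𝔖.A f θ₀ o.2.2 l ∂(𝔖.law ⟨θ₀, f, g⟩) := fun l => by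
    rw [← h.integral_cov_mul_gradResid hq ha]
    refine integral_congr_ae ?_
    filter_upwards [h2] with o ho
    rw [hφ, Set.indicator_of_mem ho.2, mul_comm]
  simp only [e1, e2, mul_neg, Finset.sum_neg_distrib] at h1
  linarith

lemma measurable_goodX_indicator (h : RegularModel 𝔖 f θ₀ c C) {a : Cov dU dZ → ℝ}
    (ha : JointMeas 𝔖 fun (_ : Unit) x => a x) : Measurable ((goodX 𝔖 f).indicator a) := by
  refine measurable_of_eq (ha.measurable.indicator h.measurableSet_goodX) fun x => ?_
  by_cases hx : x ∈ goodX 𝔖 f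
  · rw [Set.indicator_of_mem hx, Set.indicator_of_mem hx]
    exact Set.indicator_of_mem hx.1 _
  · rw [Set.indicator_of_notMem hx, Set.indicator_of_notMem hx]

lemma integrable_bddObs_mul (h : RegularModel 𝔖 f θ₀ c C) (hq : 𝔖.IsParam ⟨θ₀, f, g⟩)
    {k : Obs dU dZ → ℝ} (hk : BddObs 𝔖 f k) (hs : Integrable s (𝔖.law ⟨θ₀, f, g⟩)) :
    Integrable (fun o => k o * s o) (𝔖.law ⟨θ₀, f, g⟩) := by
  have h1 := (h.integrable_bddObs hq hk).aestronglyMeasurable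
  obtain ⟨-, D, -, hD⟩ := hk
  refine hs.bdd_mul (c := D) h1 ?_
  filter_upwards [h.ae_law_goodObs hq] with o ho using hD o ho

variable {p Δ : ℝ}

/-- The efficient influence function is a gradient of the average treatment effect on the treated:
along every regular submodel its derivative is the covariance of the score with it. -/
lemma hasDerivAt_att (h : RegularModel 𝔖 f θ₀ c C) (hq : 𝔖.IsParam ⟨θ₀, f, g⟩)
    (hM : IsUnit (𝔖.M f θ₀ g).det) (hp0 : p ≠ 0)
    (hp : ∫ o, tval o.1 ∂(𝔖.law ⟨θ₀, f, g⟩) = p)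
    (hΔ : ∫ o, 𝔖.altNum θ₀ o ∂(𝔖.law ⟨θ₀, f, g⟩) = p * Δ) {q : Fin d → ℝ}
    (hQ : ∀ l, ∫ o, o.2.1 * 𝔖.gradResid θ₀ o l ∂(𝔖.law ⟨θ₀, f, g⟩) = -q l)
    (hγ : 𝔖.IsRegularSubmodel ⟨θ₀, f, g⟩ γ s) :
    HasDerivAt (fun t => 𝔖.att (γ t))
      (∫ o, 𝔖.φeff f θ₀ g q p Δ o * s o ∂(𝔖.law ⟨θ₀, f, g⟩)) 0 := by
  have hPr := h.isProbabilityMeasure_law hq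
  have hs1 : Integrable s (𝔖.law ⟨θ₀, f, g⟩) := hγ.score_memLp.integrable one_le_two
  set v := fun l => deriv (fun t => (γ t).θ) 0 l with hv
  have hint : ∀ k, BddObs 𝔖 f k → Integrable (fun o => k o * s o) (𝔖.law ⟨θ₀, f, g⟩) :=
    fun k hk => h.integrable_bddObs_mul hq hk hs1
  -- the numerator
  set ψ : Obs dU dZ → ℝ := (obsRange 𝔖).indicator fun o => o.2.1 with hψ
  have hψm : Measurable ψ :=
    (measurable_fst.comp measurable_snd).indicator h.measurableSet_obsRange
  have hψD : ∀ o, |ψ o| ≤ C := fun o => by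
    by_cases ho : o ∈ obsRange 𝔖
    · rw [hψ, Set.indicator_of_mem ho]; exact h.outcome_le _ _ ho.1
    · rw [hψ, Set.indicator_of_notMem ho, abs_zero]; exact h.C_nonneg
  have d1 := h.hasDerivAt_integral_resid_mul hq hγ hψm hψD
  have hgood := h.ae_law_range hq
  have e1 : ∫ o, 𝔖.resid θ₀ o * ψ o * s o ∂(𝔖.law ⟨θ₀, f, g⟩) = ∫ o, 𝔖.altNum θ₀ o * s o ∂(𝔖.law ⟨θ₀, f, g⟩) := by
    refine integral_congr_ae ?_
    filter_upwards [hgood] with o ho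
    rw [hψ, Set.indicator_of_mem ho, altNum_eq]
  have e2 : ∀ l, ∫ o, 𝔖.gradResid θ₀ o l * ψ o ∂(𝔖.law ⟨θ₀, f, g⟩) = -q l := fun l => by
    rw [← hQ l]
    refine integral_congr_ae ?_
    filter_upwards [hgood] with o ho
    rw [hψ, Set.indicator_of_mem ho, mul_comm]
  rw [e1] at d1
  simp only [e2, mul_neg, Finset.sum_neg_distrib] at d1
  -- the denominator
  have d2 := h.hasDerivAt_integral_submodel hq hγ (a := fun o => tval o.1)
    (measurable_tval.comp measurable_fst) fun o => abs_tval_le _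
  have hN0 : ∫ o, 𝔖.resid (γ 0).θ o * ψ o ∂(𝔖.law (γ 0)) = p * Δ := by
    rw [hγ.at_zero, ← hΔ]
    refine integral_congr_ae ?_
    filter_upwards [hgood] with o ho
    rw [hψ, Set.indicator_of_mem ho, altNum_eq]
  have hp' : ∫ o, tval o.1 ∂(𝔖.law (γ 0)) = p := by rw [hγ.at_zero, hp]
  have d3 := d1.div d2 (by rw [hp']; exact hp0)
  refine (d3.congr_of_eventuallyEq ?_).congr_deriv ?_
  · filter_upwards [hγ.mem] with t ht
    rw [h.att_eq ht, Pi.div_apply]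
    congr 1
    refine integral_congr_ae ?_
    filter_upwards [h.ae_law_range ht] with o ho
    rw [hψ, Set.indicator_of_mem ho, altNum_eq]
  -- the covariance of the score with `Seff` is `M` times the derivative of `θ`
  · have hA : ∀ j, ∫ o, 𝔖.Seff f θ₀ o j * s o ∂(𝔖.law ⟨θ₀, f, g⟩) = ∑ l, v l * 𝔖.M f θ₀ g j l := fun j => by
      obtain ⟨-, D, -, hD⟩ := h.bddObs_ratioA h.theta_mem j
      obtain ⟨G, E, -, hE⟩ := h.covJet_ratioA j
      simp only [Seff_eq]
      rw [h.integral_resid_mul_score hq hγ (h.measurable_goodX_indicator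
        (h.jointMeas_ratioA (g := fun _ => f) (fun t => (h.measurable_f t).comp measurable_snd)
          h.theta_mem j)) (h.bddObs_ratioA h.theta_mem j)
          (D := E) fun x hx => hE.bdd (x, f, 0) ⟨hx, h.adm_self⟩ θ₀ h.theta_mem]
      simp only [h.M_eq hq, hv]
    -- `V / B` as the function of the covariates
    have hV : ∫ o, 𝔖.resid θ₀ o * 𝔖.ratioV Δ f θ₀ o.2.2 * s o ∂(𝔖.law ⟨θ₀, f, g⟩) =
        ∑ l, v l * 𝔖.D f θ₀ g Δ l := by
      obtain ⟨G, E, -, hE⟩ := h.covJet_ratioV Δ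
      rw [h.integral_resid_mul_score hq hγ (h.measurable_goodX_indicator
        (h.jointMeas_ratioV (g := fun _ => f) (θ := fun _ => θ₀)
          (fun t => (h.measurable_f t).comp measurable_snd)
          measurable_const (fun _ => h.theta_mem) Δ)) (h.bddObs_ratioV h.theta_mem Δ)
          (D := E) fun x hx => hE.bdd (x, f, 0) ⟨hx, h.adm_self⟩ θ₀ h.theta_mem]
      simp only [h.D_eq hq, hv]
    set r := effCoef 𝔖 f θ₀ g q Δ with hr
    -- by the choice of the coefficients `r`, the contributions of the derivative of `θ` cancel
    have hsum : ∑ j, r j * ∑ l, v l * 𝔖.M f θ₀ g j l = ∑ l, v l * (𝔖.D f θ₀ g Δ l - q l) := by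
      have h1 : ∀ l, ∑ j, 𝔖.M f θ₀ g l j * r j = 𝔖.D f θ₀ g Δ l - q l := fun l => by
        change (𝔖.M f θ₀ g *ᵥ r) l = _
        rw [hr, effCoef, Matrix.mulVec_mulVec, Matrix.mul_nonsing_inv _ hM, Matrix.one_mulVec]
        rfl
      simp_rw [← h1, Finset.mul_sum]
      rw [Finset.sum_comm]
      refine Finset.sum_congr rfl fun l _ => Finset.sum_congr rfl fun j _ => ?_
      rw [M_symm j l]; ring
    have e3 : ∀ o, 𝔖.φeff f θ₀ g q p Δ o * s o = p⁻¹ * (𝔖.altNum θ₀ o * s o -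
        Δ * (tval o.1 * s o) - 𝔖.resid θ₀ o * 𝔖.ratioV Δ f θ₀ o.2.2 * s o +
          ∑ j, r j * (𝔖.Seff f θ₀ o j * s o)) := fun o => by
      rw [φeff_eq, effCore, mul_assoc, add_mul, Finset.sum_mul]
      simp only [mul_assoc, hr]
      ring
    have i1 := hint _ (h.bddObs_altNum h.theta_mem)
    have i2 := (hint _ h.bddObs_tval).const_mul Δ
    have i3 := hint _ ((h.bddObs_resid h.theta_mem).mul (h.bddObs_ratioV h.theta_mem Δ))
    have i4 : ∀ j, Integrable (fun o => r j * (𝔖.Seff f θ₀ o j * s o)) (𝔖.law ⟨θ₀, f, g⟩) := fun j =>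
      (hint _ (h.bddObs_Seff h.theta_mem j)).const_mul (r j)
    have i12 : Integrable (fun o => 𝔖.altNum θ₀ o * s o - Δ * (tval o.1 * s o))
        (𝔖.law ⟨θ₀, f, g⟩) := i1.sub i2
    have i123 : Integrable (fun o => 𝔖.altNum θ₀ o * s o - Δ * (tval o.1 * s o) -
        𝔖.resid θ₀ o * 𝔖.ratioV Δ f θ₀ o.2.2 * s o) (𝔖.law ⟨θ₀, f, g⟩) := i12.sub i3
    simp_rw [e3]
    rw [integral_const_mul, integral_add i123 (integrable_finsetSum _ fun j _ => i4 j),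
      integral_sub i12 i3, integral_sub i1 i2, integral_finsetSum _ fun j _ => i4 j, hV,
      integral_const_mul]
    simp_rw [integral_const_mul, hA]
    rw [hsum, hN0, hp']
    simp only [mul_sub, Finset.sum_sub_distrib, hv]
    field_simp
    ring

/-- The Cauchy–Schwarz inequality for the score and `φeff` bounds the Cramér–Rao bounds. -/
lemma cramerRao_le (h : RegularModel 𝔖 f θ₀ c C) (hq : 𝔖.IsParam ⟨θ₀, f, g⟩)
    (hM : IsUnit (𝔖.M f θ₀ g).det) (hp0 : p ≠ 0)
    (hp : ∫ o, tval o.1 ∂(𝔖.law ⟨θ₀, f, g⟩) = p)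
    (hΔ : ∫ o, 𝔖.altNum θ₀ o ∂(𝔖.law ⟨θ₀, f, g⟩) = p * Δ) {q : Fin d → ℝ}
    (hQ : ∀ l, ∫ o, o.2.1 * 𝔖.gradResid θ₀ o l ∂(𝔖.law ⟨θ₀, f, g⟩) = -q l)
    {b : ℝ} (hb : b ∈ 𝔖.cramerRaoBounds ⟨θ₀, f, g⟩) :
    b ≤ ∫ o, 𝔖.φeff f θ₀ g q p Δ o ^ 2 ∂(𝔖.law ⟨θ₀, f, g⟩) := by
  obtain ⟨γ, s, Δ', hγ, hd, rfl⟩ := hb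
  rw [hd.unique (h.hasDerivAt_att hq hM hp0 hp hΔ hQ hγ)]
  have hφ := h.bddObs_φeff (g := g) q p Δ
  have hPr := h.isProbabilityMeasure_law hq
  have hs1 : Integrable s (𝔖.law ⟨θ₀, f, g⟩) := hγ.score_memLp.integrable one_le_two
  have i1 := h.integrable_bddObs_mul hq hφ hs1
  have i2 := hγ.score_memLp.integrable_sq
  have i3 : Integrable (fun o => 𝔖.φeff f θ₀ g q p Δ o ^ 2) (𝔖.law ⟨θ₀, f, g⟩) :=
    h.integrable_bddObs hq ((hφ.mul hφ).congr fun o _ => sq _)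
  set S := ∫ o, s o ^ 2 ∂(𝔖.law ⟨θ₀, f, g⟩) with hS
  set E := ∫ o, 𝔖.φeff f θ₀ g q p Δ o * s o ∂(𝔖.law ⟨θ₀, f, g⟩) with hE
  -- a vanishing score gives the bound `0`, by the convention for division by zero
  obtain hS0 | hS0 := (show 0 ≤ S from integral_nonneg fun o => sq_nonneg _).eq_or_lt'
  · rw [hS0, div_zero]; exact integral_nonneg fun o => sq_nonneg _
  have h1 : 0 ≤ ∫ o, (𝔖.φeff f θ₀ g q p Δ o - E / S * s o) ^ 2 ∂(𝔖.law ⟨θ₀, f, g⟩) :=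
    integral_nonneg fun o => sq_nonneg _
  have e : ∀ o, (𝔖.φeff f θ₀ g q p Δ o - E / S * s o) ^ 2 = 𝔖.φeff f θ₀ g q p Δ o ^ 2 -
      2 * (E / S) * (𝔖.φeff f θ₀ g q p Δ o * s o) + (E / S) ^ 2 * s o ^ 2 := fun o => by ring
  have i4 : Integrable (fun o => 𝔖.φeff f θ₀ g q p Δ o ^ 2 -
      2 * (E / S) * (𝔖.φeff f θ₀ g q p Δ o * s o)) (𝔖.law ⟨θ₀, f, g⟩) := i3.sub (i1.const_mul _)
  simp_rw [e] at h1
  rw [integral_add i4 (i2.const_mul _), integral_sub i3 (i1.const_mul _), integral_const_mul,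
    integral_const_mul, ← hS, ← hE] at h1
  have e2 : E ^ 2 / S = 2 * (E / S) * E - (E / S) ^ 2 * S := by field_simp; ring
  linarith

end RegularModel
end ATTSetup

/-! ### Paths of densities -/

namespace ATTSetup

section Density

variable {α : Type*} [MeasurableSpace α]

/-- Hellinger-type integrals for a measure `Q` with a density `ρ` with respect to `P`. -/
lemma lintegral_dqm_withDensity {P : Measure α} [IsProbabilityMeasure P] {ρ : α → ℝ}
    (hρ : Measurable ρ) (h0 : ∀ o, 0 ≤ ρ o) {Q : Measure α} [IsFiniteMeasure Q]
    (hQ : Q = P.withDensity fun o => ENNReal.ofReal (ρ o)) (s : α → ℝ) (h : ℝ) :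
    ∫⁻ o, ENNReal.ofReal (((√(Q.rnDeriv (Q + P) o).toReal - √(P.rnDeriv (Q + P) o).toReal) / h -
        s o * √(P.rnDeriv (Q + P) o).toReal / 2) ^ 2) ∂(Q + P) =
      ∫⁻ o, ENNReal.ofReal (((√(ρ o) - 1) / h - s o / 2) ^ 2) ∂P := by
  have hm1 : Measurable fun o => ENNReal.ofReal (ρ o + 1) := (hρ.add_const 1).ennreal_ofReal
  have hν : Q + P = P.withDensity fun o => ENNReal.ofReal (ρ o + 1) := by
    have h1 : (fun o => ENNReal.ofReal (ρ o + 1)) = (fun o => ENNReal.ofReal (ρ o)) + 1 := by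
      funext o
      rw [Pi.add_apply, ENNReal.ofReal_add (h0 o) zero_le_one, ENNReal.ofReal_one]; rfl
    rw [h1, withDensity_add_left hρ.ennreal_ofReal, withDensity_one, hQ]
  set ν := Q + P with hνd
  -- densities with respect to `Q + P` are those with respect to `P`, divided by `ρ + 1`
  have hrep : ∀ k : α → ℝ, Measurable k → (∀ o, 0 ≤ k o) →
      ν.withDensity (fun o => ENNReal.ofReal (k o / (ρ o + 1))) =
        P.withDensity fun o => ENNReal.ofReal (k o) := fun k hk hk0 => by
    have hkm : Measurable fun o => ENNReal.ofReal (k o / (ρ o + 1)) :=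
      (hk.div (hρ.add_const 1)).ennreal_ofReal
    rw [hν, ← withDensity_mul _ hm1 hkm]
    congr 1
    funext o
    have h1 : 0 < ρ o + 1 := by linarith [h0 o]
    rw [Pi.mul_apply, ← ENNReal.ofReal_mul h1.le, mul_div_cancel₀ _ h1.ne']
  have hPd : P.rnDeriv ν =ᵐ[ν] fun o => ENNReal.ofReal (1 / (ρ o + 1)) := by
    have h1 := hrep (fun _ => 1) measurable_const fun _ => zero_le_one
    simp only [ENNReal.ofReal_one] at h1
    have h2 : P.withDensity (fun _ => (1 : ℝ≥0∞)) = P := withDensity_one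
    rw [h2] at h1
    have h3 := Measure.rnDeriv_withDensity ν (f := fun o => ENNReal.ofReal (1 / (ρ o + 1)))
      ((measurable_const.div (hρ.add_const 1)).ennreal_ofReal)
    rwa [h1] at h3
  have hQd : Q.rnDeriv ν =ᵐ[ν] fun o => ENNReal.ofReal (ρ o / (ρ o + 1)) := by
    have h1 := hrep ρ hρ h0
    rw [← hQ] at h1
    have h3 := Measure.rnDeriv_withDensity ν (f := fun o => ENNReal.ofReal (ρ o / (ρ o + 1)))
      ((hρ.div (hρ.add_const 1)).ennreal_ofReal)
    rwa [h1] at h3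
  have h1 : ∫⁻ o, ENNReal.ofReal (((√(Q.rnDeriv ν o).toReal - √(P.rnDeriv ν o).toReal) / h -
        s o * √(P.rnDeriv ν o).toReal / 2) ^ 2) ∂ν =
      ∫⁻ o, ENNReal.ofReal (((√(ρ o) - 1) / h - s o / 2) ^ 2 / (ρ o + 1)) ∂ν := by
    refine lintegral_congr_ae ?_
    filter_upwards [hPd, hQd] with o hP' hQ'
    have h2 : 0 < ρ o + 1 := by linarith [h0 o]
    rw [hP', hQ', ENNReal.toReal_ofReal (div_nonneg zero_le_one h2.le),
      ENNReal.toReal_ofReal (div_nonneg (h0 o) h2.le), Real.sqrt_div (h0 o),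
      Real.sqrt_div zero_le_one, Real.sqrt_one]
    congr 1
    have h3 : (√(ρ o + 1)) ^ 2 = ρ o + 1 := Real.sq_sqrt h2.le
    have e : (√(ρ o) / √(ρ o + 1) - 1 / √(ρ o + 1)) / h - s o * (1 / √(ρ o + 1)) / 2 =
        ((√(ρ o) - 1) / h - s o / 2) / √(ρ o + 1) := by ring
    rw [e, div_pow, h3]
  rw [h1, hν, lintegral_withDensity_eq_lintegral_mul_non_measurable₀ _ hm1.aemeasurable
    (ae_of_all _ fun _ => ENNReal.ofReal_lt_top)]
  refine lintegral_congr fun o => ?_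
  have h2 : 0 < ρ o + 1 := by linarith [h0 o]
  rw [Pi.mul_apply, ← ENNReal.ofReal_mul h2.le, mul_div_cancel₀ _ h2.ne']

lemma abs_sqrt_sub_le {x : ℝ} (hx : 0 ≤ x) : |√x - 1 - (x - 1) / 2| ≤ (x - 1) ^ 2 / 2 := by
  have h1 : (√x) ^ 2 = x := Real.sq_sqrt hx
  have h2 : √x - 1 - (x - 1) / 2 = -((√x - 1) ^ 2 / 2) := by linarith [h1, sq (√x - 1)]
  have h3 : (x - 1) ^ 2 = (√x - 1) ^ 2 * (√x + 1) ^ 2 := by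
    rw [← mul_pow, show (√x - 1) * (√x + 1) = (√x) ^ 2 - 1 by ring, h1]
  rw [h2, abs_neg, abs_of_nonneg (by positivity), h3]
  have h4 : 1 ≤ (√x + 1) ^ 2 := by nlinarith [Real.sqrt_nonneg x]
  have := mul_le_mul_of_nonneg_left h4 (sq_nonneg (√x - 1))
  linarith

/-- A path of densities with a uniform first-order expansion is differentiable in quadratic
mean. -/
lemma tendsto_dqm_of_expand {P : Measure α} [IsProbabilityMeasure P] {ρ : ℝ → α → ℝ}
    {Q : ℝ → Measure α} {s : α → ℝ} {D L : ℝ} (hs : ∀ o, |s o| ≤ D)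
    (hρ : ∀ᶠ h in 𝓝 (0 : ℝ), Measurable (ρ h) ∧ (∀ o, 0 ≤ ρ h o) ∧ IsFiniteMeasure (Q h) ∧
      (Q h = P.withDensity fun o => ENNReal.ofReal (ρ h o)) ∧
      ∀ᵐ o ∂P, |ρ h o - 1 - h * s o| ≤ L * h ^ 2) :
    Tendsto (fun h : ℝ => ∫⁻ o, ENNReal.ofReal
        (((√((Q h).rnDeriv (Q h + P) o).toReal - √(P.rnDeriv (Q h + P) o).toReal) / h -
          s o * √(P.rnDeriv (Q h + P) o).toReal / 2) ^ 2) ∂(Q h + P)) (𝓝[≠] 0) (𝓝 0) := by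
  obtain ⟨o₀⟩ : Nonempty α := nonempty_of_isProbabilityMeasure P
  have hD : 0 ≤ D := (abs_nonneg _).trans (hs o₀)
  set E := (D + |L|) ^ 2 / 2 + |L| / 2 with hE
  have hlim : Tendsto (fun h : ℝ => ENNReal.ofReal ((E * |h|) ^ 2)) (𝓝[≠] 0) (𝓝 0) := by
    have h1 : Continuous fun h : ℝ => ENNReal.ofReal ((E * |h|) ^ 2) :=
      ENNReal.continuous_ofReal.comp (by fun_prop)
    have h2 := h1.tendsto 0
    simp only [abs_zero, mul_zero, ne_eq, OfNat.ofNat_ne_zero, not_false_eq_true, zero_pow,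
      ENNReal.ofReal_zero] at h2
    exact h2.mono_left nhdsWithin_le_nhds
  refine tendsto_of_tendsto_of_tendsto_of_le_of_le' tendsto_const_nhds hlim
    (Eventually.of_forall fun _ => zero_le) ?_
  have hball : ∀ᶠ h in 𝓝 (0 : ℝ), |h| ≤ 1 := by
    filter_upwards [Metric.ball_mem_nhds (0 : ℝ) one_pos] with h hh
    rw [Metric.mem_ball, dist_zero_right] at hh
    exact hh.le
  filter_upwards [nhdsWithin_le_nhds hρ, nhdsWithin_le_nhds hball, self_mem_nhdsWithin]
    with h ⟨h1, h2, h3, h4, h5⟩ h6 h7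
  have h8 : 0 < |h| := abs_pos.2 h7
  rw [lintegral_dqm_withDensity h1 h2 h4]
  calc _ ≤ ∫⁻ _, ENNReal.ofReal ((E * |h|) ^ 2) ∂P := by
        refine lintegral_mono_ae ?_
        filter_upwards [h5] with o ho
        refine ENNReal.ofReal_le_ofReal (sq_le_sq.2 ?_)
        rw [abs_of_nonneg (show 0 ≤ E * |h| by positivity)]
        have hL : |ρ h o - 1 - h * s o| ≤ |L| * h ^ 2 :=
          ho.trans (mul_le_mul_of_nonneg_right (le_abs_self L) (sq_nonneg h))
        have e1 : |ρ h o - 1| ≤ (D + |L|) * |h| := by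
          have e2 : |h * s o| ≤ D * |h| := by
            rw [abs_mul, mul_comm]; exact mul_le_mul_of_nonneg_right (hs o) h8.le
          have e3 : |L| * h ^ 2 ≤ |L| * |h| := by
            refine mul_le_mul_of_nonneg_left ?_ (abs_nonneg L)
            rw [← sq_abs]; nlinarith
          have e4 := abs_add_le (ρ h o - 1 - h * s o) (h * s o)
          rw [sub_add_cancel] at e4
          linarith
        -- `√ρ - 1 = (ρ - 1) / 2 + O((ρ - 1)²)` and `ρ - 1 = h s + O(h²)`
        have e5 : |√(ρ h o) - 1 - h * s o / 2| ≤ E * h ^ 2 := by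
          have e6 := abs_add_le (√(ρ h o) - 1 - (ρ h o - 1) / 2) ((ρ h o - 1 - h * s o) / 2)
          have e7 := abs_sqrt_sub_le (h2 o)
          have e8 : (ρ h o - 1) ^ 2 ≤ (D + |L|) ^ 2 * h ^ 2 := by
            rw [← sq_abs (ρ h o - 1), ← sq_abs h, ← mul_pow]
            exact pow_le_pow_left₀ (abs_nonneg _) e1 2
          rw [abs_div, abs_two] at e6
          have e9 : √(ρ h o) - 1 - (ρ h o - 1) / 2 + (ρ h o - 1 - h * s o) / 2 =
              √(ρ h o) - 1 - h * s o / 2 := by ring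
          rw [e9] at e6
          have e10 : E * h ^ 2 = (D + |L|) ^ 2 * h ^ 2 / 2 + |L| * h ^ 2 / 2 := by rw [hE]; ring
          rw [e10]
          linarith
        have e11 : (√(ρ h o) - 1) / h - s o / 2 = (√(ρ h o) - 1 - h * s o / 2) / h := by
          have : h ≠ 0 := h7
          field_simp
        rw [e11, abs_div, div_le_iff₀ h8, mul_assoc, ← sq, sq_abs]
        exact e5
    _ = _ := by simp

end Density
end ATTSetup

/-! ### Tilted submodels -/

namespace ATTSetup

variable {d dU dZ : ℕ} {𝔖 : ATTSetup d dU dZ} {f : Fin 2 → ℝ → Cov dU dZ → ℝ}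
  {θ₀ : EuclideanSpace ℝ (Fin d)} {c C : ℝ} {g : Measure (Cov dU dZ)}

/-- The conditional mean of `φ(W)` given `X = x` and `T = t`, set to zero off `goodX`. -/
noncomputable def armMean (𝔖 : ATTSetup d dU dZ) (f : Nuis dU dZ) (φ : Obs dU dZ → ℝ) (t : Fin 2) :
    Cov dU dZ → ℝ :=
  (goodX 𝔖 f).indicator fun x => 𝔖.condE f t (fun y => φ (t, y, x)) x

/-- The component of `φ(W)` in the tangent space of the conditional density of `Y_t`. -/
noncomputable def armScore (𝔖 : ATTSetup d dU dZ) (f : Nuis dU dZ) (φ : Obs dU dZ → ℝ) (t : Fin 2)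
    (r : ℝ × Cov dU dZ) : ℝ :=
  (goodX 𝔖 f).indicator (fun x => φ (t, r.1, x) - armMean 𝔖 f φ t x) r.2

/-- The component of `φ(W)` in the tangent space of the law of the covariates. -/
noncomputable def covScore (𝔖 : ATTSetup d dU dZ) (f : Nuis dU dZ) (θ₀ : EuclideanSpace ℝ (Fin d))
    (φ : Obs dU dZ → ℝ) : Cov dU dZ → ℝ :=
  (goodX 𝔖 f).indicator fun x =>
    𝔖.w f θ₀ x * armMean 𝔖 f φ 1 x + (1 - 𝔖.w f θ₀ x) * armMean 𝔖 f φ 0 x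

/-- The submodel in the direction `φ`: the conditional densities and the law of the covariates are
tilted by the components of `φ`, and `θ` moves in the direction `v`. -/
noncomputable def tiltPath (𝔖 : ATTSetup d dU dZ) (f : Nuis dU dZ) (θ₀ : EuclideanSpace ℝ (Fin d))
    (g : Measure (Cov dU dZ)) (φ : Obs dU dZ → ℝ) (v : EuclideanSpace ℝ (Fin d)) (h : ℝ) :
    Param d dU dZ where
  θ := θ₀ + h • v
  f t y x := f t y x * (1 + h * armScore 𝔖 f φ t (y, x))
  g := g.withDensity fun x => ENNReal.ofReal (1 + h * covScore 𝔖 f θ₀ φ x)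

namespace RegularModel

/-- Products of first-order expansions. -/
lemma abs_mul_sub_expand_le {a b α β K h : ℝ} (hh : |h| ≤ 1) (hα : |α| ≤ K) (hβ : |β| ≤ K)
    (ha : |a - 1 - h * α| ≤ K * h ^ 2) (hb : |b - 1 - h * β| ≤ K * h ^ 2) :
    |a * b - 1 - h * (α + β)| ≤ (2 * K + 5 * K ^ 2) * h ^ 2 := by
  have hK : 0 ≤ K := (abs_nonneg _).trans hα
  have h0 := abs_nonneg h
  have h2 : h ^ 2 = |h| ^ 2 := (sq_abs h).symm
  -- The product of the two deviations is of second order, as each of them is of first order.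
  have e : a * b - 1 - h * (α + β) = (a - 1 - h * α) + (b - 1 - h * β) + (a - 1) * (b - 1) := by ring
  have h3 : ∀ {a α : ℝ}, |α| ≤ K → |a - 1 - h * α| ≤ K * h ^ 2 → |a - 1| ≤ 2 * K * |h| := by
    intro a α hα ha
    have h4 := abs_add_le (a - 1 - h * α) (h * α)
    rw [sub_add_cancel, abs_mul] at h4
    have h5 := mul_le_mul_of_nonneg_left hα h0
    have h6 : K * h ^ 2 ≤ K * |h| := by
      rw [h2]; refine mul_le_mul_of_nonneg_left ?_ hK; nlinarith
    linarith
  have h4 : |(a - 1) * (b - 1)| ≤ 4 * K ^ 2 * h ^ 2 := by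
    rw [abs_mul]
    refine (mul_le_mul (h3 hα ha) (h3 hβ hb) (abs_nonneg _) (by positivity)).trans (le_of_eq ?_)
    rw [h2]; ring
  rw [e]
  refine (abs_add_le _ _).trans ((add_le_add_left (abs_add_le _ _) _).trans ?_)
  have h5 : 0 ≤ K ^ 2 * h ^ 2 := by positivity
  linarith

section Tilt

variable {φ : Obs dU dZ → ℝ} {D : ℝ}

/-- Conditional means do not exceed bounds. -/
lemma abs_condE_le (h : RegularModel 𝔖 f θ₀ c C) {t : Fin 2} {k : ℝ → ℝ} {E : ℝ}
    (hE : ∀ y ∈ 𝔖.𝒴 t, |k y| ≤ E) {x : Cov dU dZ} (hx : x ∈ goodX 𝔖 f) :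
    |𝔖.condE f t k x| ≤ E := by
  have hi : Integrable (fun y => f t y x) ((𝔖.ν t).restrict (𝔖.𝒴 t)) := by
    by_contra hcon
    have := hx.2 t
    rw [integral_undef hcon] at this
    exact zero_ne_one this
  have h1 := norm_integral_le_of_norm_le (f := fun y => k y * f t y x) (hi.const_mul E) (by
    filter_upwards [ae_restrict_mem (h.measurableSet_𝒴 t)] with y hy
    have h2 := h.c_pos.le.trans (h.density_bounds t y hy x hx.1).1
    rw [norm_mul, Real.norm_of_nonneg h2]
    exact mul_le_mul_of_nonneg_right (hE y hy) h2)
  rwa [integral_const_mul, hx.2 t, mul_one] at h1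

lemma measurable_armMean (h : RegularModel 𝔖 f θ₀ c C) (hφ : Measurable φ) (t : Fin 2) :
    Measurable (armMean 𝔖 f φ t) := by
  have := h.finite t
  have h1 : Measurable (Function.uncurry fun (x : Cov dU dZ) (y : ℝ) =>
      φ (t, y, x) * f t y x) :=
    ((hφ.comp measurable_prodMk_left).mul (h.measurable_f t)).comp measurable_swap
  exact (h1.stronglyMeasurable.integral_prod_right
    (ν := (𝔖.ν t).restrict (𝔖.𝒴 t))).measurable.indicator h.measurableSet_goodX

lemma abs_armMean_le (h : RegularModel 𝔖 f θ₀ c C) (hD0 : 0 ≤ D) (hD : ∀ o, |φ o| ≤ D) (t : Fin 2)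
    (x : Cov dU dZ) : |armMean 𝔖 f φ t x| ≤ D := by
  by_cases hx : x ∈ goodX 𝔖 f
  · rw [armMean, Set.indicator_of_mem hx]; exact h.abs_condE_le (fun y _ => hD _) hx
  · rw [armMean, Set.indicator_of_notMem hx, abs_zero]; exact hD0

lemma measurable_armScore (h : RegularModel 𝔖 f θ₀ c C) (hφ : Measurable φ) (t : Fin 2) :
    Measurable (armScore 𝔖 f φ t) := by
  have h1 : Measurable fun r : ℝ × Cov dU dZ => φ (t, r) - armMean 𝔖 f φ t r.2 :=
    (hφ.comp measurable_prodMk_left).sub ((h.measurable_armMean hφ t).comp measurable_snd)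
  exact h1.indicator (measurable_snd h.measurableSet_goodX)

lemma abs_armScore_le (h : RegularModel 𝔖 f θ₀ c C) (hD0 : 0 ≤ D) (hD : ∀ o, |φ o| ≤ D)
    (t : Fin 2) (r : ℝ × Cov dU dZ) : |armScore 𝔖 f φ t r| ≤ 2 * D := by
  by_cases hx : r.2 ∈ goodX 𝔖 f
  · rw [armScore, Set.indicator_of_mem hx]
    have h1 := abs_sub (φ (t, r.1, r.2)) (armMean 𝔖 f φ t r.2)
    have h2 := hD (t, r.1, r.2)
    have h3 := h.abs_armMean_le hD0 hD t r.2
    linarith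
  · rw [armScore, Set.indicator_of_notMem hx, abs_zero]; positivity

lemma w_bounds (h : RegularModel 𝔖 f θ₀ c C) (hq : 𝔖.IsParam ⟨θ₀, f, g⟩) {x : Cov dU dZ}
    (hx : x ∈ goodX 𝔖 f) : 0 ≤ 𝔖.w f θ₀ x ∧ 0 < 1 - 𝔖.w f θ₀ x ∧
      (1 - 𝔖.w f θ₀ x) * 𝔖.condE f 0 (fun y => (1 - 𝔖.π y x.1 θ₀)⁻¹) x = 1 := by
  rw [h.goodX_eq_paramX (g := g)] at hx
  have := h.param_odds hq hx
  exact ⟨this.1, this.2.1, this.2.2.1⟩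

lemma measurable_covScore (h : RegularModel 𝔖 f θ₀ c C) (hq : 𝔖.IsParam ⟨θ₀, f, g⟩)
    (hφ : Measurable φ) : Measurable (covScore 𝔖 f θ₀ φ) := by
  have hw : Measurable (𝔖.w f θ₀) := h.measurable_w hq
  exact ((hw.mul (h.measurable_armMean hφ 1)).add
    ((measurable_const.sub hw).mul (h.measurable_armMean hφ 0))).indicator h.measurableSet_goodX

lemma abs_covScore_le (h : RegularModel 𝔖 f θ₀ c C) (hq : 𝔖.IsParam ⟨θ₀, f, g⟩) (hD0 : 0 ≤ D)
    (hD : ∀ o, |φ o| ≤ D) (x : Cov dU dZ) : |covScore 𝔖 f θ₀ φ x| ≤ D := by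
  by_cases hx : x ∈ goodX 𝔖 f
  · rw [covScore, Set.indicator_of_mem hx]
    obtain ⟨h1, h2, -⟩ := h.w_bounds hq hx
    have h3 := abs_le.1 (h.abs_armMean_le hD0 hD 1 x)
    have h4 := abs_le.1 (h.abs_armMean_le hD0 hD 0 x)
    rw [abs_le]
    constructor <;> nlinarith [mul_nonneg h1 (sub_nonneg.2 h3.1), mul_nonneg h1 (sub_nonneg.2 h3.2),
      mul_nonneg h2.le (sub_nonneg.2 h4.1), mul_nonneg h2.le (sub_nonneg.2 h4.2)]
  · rw [covScore, Set.indicator_of_notMem hx, abs_zero]; exact hD0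

lemma bddObs_of_bdd (h : RegularModel 𝔖 f θ₀ c C) (hφ : Measurable φ) (hD : ∀ o, |φ o| ≤ D) :
    BddObs 𝔖 f φ := .of_measurable h hφ fun o _ => hD o

lemma bddObs_armScore (h : RegularModel 𝔖 f θ₀ c C) (hφ : Measurable φ) (hD0 : 0 ≤ D)
    (hD : ∀ o, |φ o| ≤ D) (t : Fin 2) : BddObs 𝔖 f fun o => armScore 𝔖 f φ t o.2 :=
  .of_measurable h ((h.measurable_armScore hφ t).comp measurable_snd)
    fun o _ => h.abs_armScore_le hD0 hD t o.2

/-- The conditional mean of a product with the arm score is the conditional covariance with `φ` in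
the arm. -/
lemma condE_armScore (h : RegularModel 𝔖 f θ₀ c C) (hφ : Measurable φ)
    (hD : ∀ o, |φ o| ≤ D) {x : Cov dU dZ} (hx : x ∈ goodX 𝔖 f) (t : Fin 2) (k : Obs dU dZ → ℝ)
    (hk : BddObs 𝔖 f k) : 𝔖.condE f t (fun y => k (t, y, x) * armScore 𝔖 f φ t (y, x)) x =
      𝔖.condE f t (fun y => k (t, y, x) * φ (t, y, x)) x -
        armMean 𝔖 f φ t x * 𝔖.condE f t (fun y => k (t, y, x)) x := by
  have e : ∀ y, k (t, y, x) * armScore 𝔖 f φ t (y, x) =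
      k (t, y, x) * φ (t, y, x) + -armMean 𝔖 f φ t x * k (t, y, x) := fun y => by
    rw [armScore, Set.indicator_of_mem hx]; ring
  simp_rw [e]
  rw [h.condE_add_bddObs (k := fun o => k o * φ o) (k' := fun o => -armMean 𝔖 f φ t x * k o)
    (hk.mul (h.bddObs_of_bdd hφ hD)) (hk.const_mul h _) hx, condE_const_mul]
  ring

/-- The tilted densities remain densities. -/
lemma goodX_subset_paramX_tiltPath (h : RegularModel 𝔖 f θ₀ c C)
    (hφ : Measurable φ) (hD0 : 0 ≤ D) (hD : ∀ o, |φ o| ≤ D) (v : EuclideanSpace ℝ (Fin d)) {r : ℝ}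
    (hr : |r| * (2 * D) ≤ 1) : goodX 𝔖 f ⊆ paramX 𝔖 (tiltPath 𝔖 f θ₀ g φ v r) := by
  intro x hx
  refine ⟨hx.1, fun t => ?_⟩
  have h1 : 𝔖.condE f t (fun y => 1 + r * armScore 𝔖 f φ t (y, x)) x = 1 := by
    rw [h.condE_add_bddObs (k := fun _ => 1) (k' := fun o => r * armScore 𝔖 f φ t o.2)
      (.const h 1) ((h.bddObs_armScore hφ hD0 hD t).const_mul h r) hx, condE_const _ hx,
      condE_const_mul]
    have h2 := h.condE_armScore hφ hD hx t (fun _ => 1) (.const h 1)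
    simp only [one_mul, condE_const _ hx, mul_one] at h2
    rw [h2, armMean, Set.indicator_of_mem hx]
    ring
  have hb : BddObs 𝔖 f fun o => 1 + r * armScore 𝔖 f φ t o.2 :=
    (BddObs.const h 1).add ((h.bddObs_armScore hφ hD0 hD t).const_mul h r)
  have hi := h.integrable_section hb hx t
  have hpos : ∀ y, 0 ≤ 1 + r * armScore 𝔖 f φ t (y, x) := fun y => by
    have h3 := h.abs_armScore_le hD0 hD t (y, x)
    have h4 : |r * armScore 𝔖 f φ t (y, x)| ≤ 1 := by
      rw [abs_mul]; exact (mul_le_mul_of_nonneg_left h3 (abs_nonneg _)).trans hr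
    linarith [(abs_le.1 h4).1]
  change ∫⁻ y in 𝔖.𝒴 t, ENNReal.ofReal (f t y x * (1 + r * armScore 𝔖 f φ t (y, x))) ∂(𝔖.ν t) = 1
  simp_rw [mul_comm (f t _ x)]
  rw [← ofReal_integral_eq_lintegral_ofReal hi]
  · change ENNReal.ofReal (𝔖.condE f t (fun y => 1 + r * armScore 𝔖 f φ t (y, x)) x) = 1
    rw [h1, ENNReal.ofReal_one]
  · filter_upwards [ae_restrict_mem (h.measurableSet_𝒴 t)] with y hy
    exact mul_nonneg (hpos y) (h.c_pos.le.trans (h.density_bounds t y hy x hx.1).1)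

lemma condMean_eq_covScore {x : Cov dU dZ} (hx : x ∈ goodX 𝔖 f) :
    condMean 𝔖 f θ₀ φ x = covScore 𝔖 f θ₀ φ x := by
  rw [covScore, Set.indicator_of_mem hx, armMean, armMean, Set.indicator_of_mem hx,
    Set.indicator_of_mem hx]
  rfl

/-- For small `r` the tilted path stays in the model. The condition `|r| * (2 * D) ≤ 1` keeps the
tilting factors nonnegative; the total masses are kept because the components of `φ` are centred,
the one of the covariates because `φ` has mean zero. -/
lemma isParam_tiltPath (h : RegularModel 𝔖 f θ₀ c C) (hq : 𝔖.IsParam ⟨θ₀, f, g⟩)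
    (hφ : Measurable φ) (hD0 : 0 ≤ D) (hD : ∀ o, |φ o| ≤ D)
    (hmean : ∫ o, φ o ∂(𝔖.law ⟨θ₀, f, g⟩) = 0) {v : EuclideanSpace ℝ (Fin d)} {r : ℝ}
    (hr : |r| * (2 * D) ≤ 1) (hθ : θ₀ + r • v ∈ 𝔖.Θ) :
    𝔖.IsParam (tiltPath 𝔖 f θ₀ g φ v r) where
  theta_mem := hθ
  measurable_f t := (h.measurable_f t).mul
    (measurable_const.add ((h.measurable_armScore hφ t).const_mul r))
  f_nonneg t y hy x hx := by
    have h3 := h.abs_armScore_le hD0 hD t (y, x)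
    have h4 : |r * armScore 𝔖 f φ t (y, x)| ≤ 1 := by
      rw [abs_mul]; exact (mul_le_mul_of_nonneg_left h3 (abs_nonneg _)).trans hr
    refine mul_nonneg (h.c_pos.le.trans (h.density_bounds t y hy x hx).1) ?_
    linarith [(abs_le.1 h4).1]
  prob := by
    have : IsProbabilityMeasure g := hq.prob
    have hm := h.measurable_covScore hq hφ
    have hi : Integrable (covScore 𝔖 f θ₀ φ) g :=
      Integrable.of_bound hm.aestronglyMeasurable D
        (ae_of_all _ fun x => h.abs_covScore_le hq hD0 hD x)
    have hi1 : Integrable (fun x => 1 + r * covScore 𝔖 f θ₀ φ x) g :=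
      (integrable_const 1).add (hi.const_mul r)
    have h0 : ∫ x, covScore 𝔖 f θ₀ φ x ∂g = 0 := by
      rw [← hmean, h.integral_law_eq_condMean hq (h.bddObs_of_bdd hφ hD)]
      refine integral_congr_ae ?_
      filter_upwards [h.ae_goodX hq] with x hx using (condMean_eq_covScore hx).symm
    constructor
    change (g.withDensity fun x => ENNReal.ofReal (1 + r * covScore 𝔖 f θ₀ φ x)) Set.univ = 1
    rw [withDensity_apply _ MeasurableSet.univ, Measure.restrict_univ,
      ← ofReal_integral_eq_lintegral_ofReal hi1,
      integral_add (integrable_const 1) (hi.const_mul r), integral_const_mul, h0]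
    · simp
    · refine ae_of_all _ fun x => ?_
      have h3 := h.abs_covScore_le hq hD0 hD x
      have h4 : |r * covScore 𝔖 f θ₀ φ x| ≤ 1 := by
        rw [abs_mul]
        have h5 := mul_le_mul_of_nonneg_left h3 (abs_nonneg r)
        have h6 : 0 ≤ |r| * D := by positivity
        linarith
      simp only [Pi.zero_apply]
      linarith [(abs_le.1 h4).1]
  ae_mem := (withDensity_absolutelyContinuous g _).ae_le hq.ae_mem
  f_density t := by
    filter_upwards [(withDensity_absolutelyContinuous g _).ae_le (h.ae_goodX hq)] with x hx
    exact (h.goodX_subset_paramX_tiltPath (g := g) hφ hD0 hD v hr hx).2 t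

end Tilt

end RegularModel
end ATTSetup

/-! ### The likelihood ratio of the tilted law -/

namespace ATTSetup

variable {d dU dZ : ℕ} {𝔖 : ATTSetup d dU dZ} {f : Fin 2 → ℝ → Cov dU dZ → ℝ}
  {θ₀ : EuclideanSpace ℝ (Fin d)} {c C : ℝ} {g : Measure (Cov dU dZ)}
  {φ : Obs dU dZ → ℝ} {D : ℝ} {v : EuclideanSpace ℝ (Fin d)}

/-- The likelihood ratio of the tilted law. -/
noncomputable def tiltRatio (𝔖 : ATTSetup d dU dZ) (f : Nuis dU dZ) (θ₀ : EuclideanSpace ℝ (Fin d))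
    (g : Measure (Cov dU dZ)) (φ : Obs dU dZ → ℝ) (v : EuclideanSpace ℝ (Fin d)) (r : ℝ) :
    Obs dU dZ → ℝ :=
  (goodObs 𝔖 f).indicator fun o => wt 𝔖 (tiltPath 𝔖 f θ₀ g φ v r) o.1 o.2.2 /
      wt 𝔖 ⟨θ₀, f, g⟩ o.1 o.2.2 * (1 + r * armScore 𝔖 f φ o.1 o.2) *
        (1 + r * covScore 𝔖 f θ₀ φ o.2.2)

namespace RegularModel

/-- The propensities are bounded away from zero. -/
lemma exists_le_wt (h : RegularModel 𝔖 f θ₀ c C) (hq : 𝔖.IsParam ⟨θ₀, f, g⟩) :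
    ∃ m, 0 < m ∧ ∀ x ∈ goodX 𝔖 f, ∀ t, m ≤ wt 𝔖 ⟨θ₀, f, g⟩ t x := by
  obtain ⟨m, hm, hw⟩ := h.exists_le_one_sub_w
  have hc := h.c_pos
  refine ⟨min m (m * c), lt_min hm (mul_pos hm hc), fun x hx t => ?_⟩
  have h1 := hw (x, f, 0) ⟨hx, h.adm_self⟩ θ₀ h.theta_mem
  simp only at h1
  obtain rfl | rfl := fin_two_eq t
  · simpa [wt] using Or.inl h1
  · have h2 := h.param_odds_goodX hq hx
    have hb : ∀ r ∈ 𝔖.rangeYX 0, c ≤ 𝔖.π r.1 r.2.1 θ₀ / (1 - 𝔖.π r.1 r.2.1 θ₀) ∧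
        𝔖.π r.1 r.2.1 θ₀ / (1 - 𝔖.π r.1 r.2.1 θ₀) ≤ c⁻¹ := fun r hr => by
      obtain ⟨h3, h4, h5⟩ := h.one_sub_pi_bounds hr h.theta_mem
      have h6 := hc.trans_le h3
      constructor
      · rw [le_div_iff₀ h6]; nlinarith
      · rw [div_le_iff₀ h6, inv_mul_eq_div, le_div_iff₀ hc]; nlinarith
    have h3 := h.condE_mono_of_le (t := 0) (m := c) (D := c⁻¹)
      (q := fun r => 𝔖.π r.1 r.2.1 θ₀ / (1 - 𝔖.π r.1 r.2.1 θ₀))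
      (h.measurable_odds_indicator (fun a _ => a / (1 - a))
        (measurable_fst.div (measurable_const.sub measurable_fst)) 0 θ₀)
      (fun r hr => by rw [abs_of_nonneg (hc.le.trans (hb r hr).1)]; exact (hb r hr).2)
      hx.1 h.adm_self fun r hr => (hb r hr).1
    rw [hx.2 0, mul_one] at h3
    have h4 : wt 𝔖 ⟨θ₀, f, g⟩ 1 x = 𝔖.w f θ₀ x := by simp [wt]
    rw [h4, ← h2]
    exact (min_le_right _ _).trans (mul_le_mul h1 h3 hc.le (hm.le.trans h1))

lemma measurable_tiltRatio (h : RegularModel 𝔖 f θ₀ c C) (hq : 𝔖.IsParam ⟨θ₀, f, g⟩)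
    (hφ : Measurable φ) {r : ℝ} (hr : 𝔖.IsParam (tiltPath 𝔖 f θ₀ g φ v r)) :
    Measurable (tiltRatio 𝔖 f θ₀ g φ v r) := by
  refine Measurable.indicator ?_ h.measurableSet_goodObs
  refine measurable_from_prod_countable_right fun t => ?_
  exact ((((h.measurable_wt hr t).comp measurable_snd).div
    ((h.measurable_wt hq t).comp measurable_snd)).mul
      (measurable_const.add ((h.measurable_armScore hφ t).const_mul r))).mul
        (measurable_const.add (((h.measurable_covScore hq hφ).comp measurable_snd).const_mul r))

lemma tilt_factors_nonneg (h : RegularModel 𝔖 f θ₀ c C) (hq : 𝔖.IsParam ⟨θ₀, f, g⟩)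
    (hD0 : 0 ≤ D) (hD : ∀ o, |φ o| ≤ D) {r : ℝ} (hr : |r| * (2 * D) ≤ 1) (t : Fin 2)
    (s : ℝ × Cov dU dZ) (x : Cov dU dZ) :
    0 ≤ 1 + r * armScore 𝔖 f φ t s ∧ 0 ≤ 1 + r * covScore 𝔖 f θ₀ φ x := by
  have h1 := mul_le_mul_of_nonneg_left (h.abs_armScore_le hD0 hD t s) (abs_nonneg r)
  have h2 := mul_le_mul_of_nonneg_left (h.abs_covScore_le hq hD0 hD x) (abs_nonneg r)
  rw [← abs_mul] at h1 h2
  have h3 : 0 ≤ |r| * D := by positivity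
  constructor
  · linarith [(abs_le.1 (h1.trans hr)).1]
  · linarith [(abs_le.1 (h2.trans (show |r| * D ≤ 1 by linarith))).1]

lemma tiltRatio_nonneg (h : RegularModel 𝔖 f θ₀ c C) (hq : 𝔖.IsParam ⟨θ₀, f, g⟩)
    (hφ : Measurable φ) (hD0 : 0 ≤ D) (hD : ∀ o, |φ o| ≤ D) {r : ℝ} (hr : |r| * (2 * D) ≤ 1)
    (hrp : 𝔖.IsParam (tiltPath 𝔖 f θ₀ g φ v r)) (o : Obs dU dZ) :
    0 ≤ tiltRatio 𝔖 f θ₀ g φ v r o := by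
  refine Set.indicator_nonneg (fun o ho => ?_) o
  obtain ⟨h1, h2⟩ := h.tilt_factors_nonneg hq hD0 hD hr o.1 o.2 o.2.2
  have h3 := h.wt_nonneg hrp (h.goodX_subset_paramX_tiltPath (g := g) hφ hD0 hD v hr ho.2) o.1
  have h4 : o.2.2 ∈ paramX 𝔖 ⟨θ₀, f, g⟩ := by rw [← h.goodX_eq_paramX]; exact ho.2
  exact mul_nonneg (mul_nonneg (div_nonneg h3 (h.wt_nonneg hq h4 o.1)) h1) h2

/-- `tiltRatio` is the density of the tilted law with respect to the original one. -/
lemma law_tiltPath (h : RegularModel 𝔖 f θ₀ c C) (hq : 𝔖.IsParam ⟨θ₀, f, g⟩)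
    (hφ : Measurable φ) (hD0 : 0 ≤ D) (hD : ∀ o, |φ o| ≤ D) {r : ℝ} (hr : |r| * (2 * D) ≤ 1)
    (hrp : 𝔖.IsParam (tiltPath 𝔖 f θ₀ g φ v r)) :
    𝔖.law (tiltPath 𝔖 f θ₀ g φ v r) = (𝔖.law ⟨θ₀, f, g⟩).withDensity
      fun o => ENNReal.ofReal (tiltRatio 𝔖 f θ₀ g φ v r o) := by
  have : IsProbabilityMeasure g := hq.prob
  obtain ⟨m, hm, hwt⟩ := h.exists_le_wt hq
  refine Measure.ext_of_lintegral _ fun G hG => ?_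
  have hρm := (h.measurable_tiltRatio (v := v) hq hφ hrp).ennreal_ofReal
  rw [h.lintegral_law hrp hG, lintegral_withDensity_eq_lintegral_mul _ hρm hG,
    h.lintegral_law hq (hρm.mul hG)]
  refine Finset.sum_congr rfl fun t _ => ?_
  have := h.finite t
  have hcm : Measurable fun x => ENNReal.ofReal (1 + r * covScore 𝔖 f θ₀ φ x) :=
    (measurable_const.add ((h.measurable_covScore hq hφ).const_mul r)).ennreal_ofReal
  have e : ((𝔖.ν t).restrict (𝔖.𝒴 t)).prod (tiltPath 𝔖 f θ₀ g φ v r).g =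
      (((𝔖.ν t).restrict (𝔖.𝒴 t)).prod g).withDensity
        fun s => ENNReal.ofReal (1 + r * covScore 𝔖 f θ₀ φ s.2) := prod_withDensity_right hcm
  have hdm := (h.measurable_lawDensity hrp t).ennreal_ofReal
  have hcm2 : Measurable fun s : ℝ × Cov dU dZ => ENNReal.ofReal (1 + r * covScore 𝔖 f θ₀ φ s.2) :=
    hcm.comp measurable_snd
  have hGm : Measurable fun s : ℝ × Cov dU dZ =>
      ENNReal.ofReal (wt 𝔖 (tiltPath 𝔖 f θ₀ g φ v r) t s.2 *
        (tiltPath 𝔖 f θ₀ g φ v r).f t s.1 s.2) * G (t, s) :=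
    hdm.mul (hG.comp measurable_prodMk_left)
  rw [e, lintegral_withDensity_eq_lintegral_mul _ hcm2 hGm]
  refine lintegral_congr_ae ?_
  filter_upwards [Measure.quasiMeasurePreserving_fst.ae (ae_restrict_mem (h.measurableSet_𝒴 t)),
    Measure.quasiMeasurePreserving_snd.ae (h.ae_goodX hq)] with s h1 h2
  have h3 : ((t, s) : Obs dU dZ) ∈ goodObs 𝔖 f := ⟨h1, h2⟩
  have h4 := hm.trans_le (hwt s.2 h2 t)
  obtain ⟨h5, h6⟩ := h.tilt_factors_nonneg hq hD0 hD hr t s s.2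
  have h7 := h.c_pos.trans_le (h.density_bounds t s.1 h1 s.2 h2.1).1
  have h8 := h.tiltRatio_nonneg hq hφ hD0 hD hr hrp (t, s)
  simp only [Pi.mul_apply, ← mul_assoc]
  congr 1
  rw [← ENNReal.ofReal_mul h6, ← ENNReal.ofReal_mul (mul_nonneg h4.le h7.le)]
  congr 1
  simp only [tiltRatio, Set.indicator_of_mem h3, tiltPath]
  field_simp

/-- First-order expansion of `{1 - w}⁻¹` along the path. -/
lemma exists_inv_mean_expand (h : RegularModel 𝔖 f θ₀ c C)
    (hφ : Measurable φ) (hD0 : 0 ≤ D) (hD : ∀ o, |φ o| ≤ D) (v : EuclideanSpace ℝ (Fin d)) :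
    ∃ L, 0 ≤ L ∧ ∀ r : ℝ, θ₀ + r • v ∈ 𝔖.Θ → ∀ x ∈ goodX 𝔖 f,
      |𝔖.condE (tiltPath 𝔖 f θ₀ g φ v r).f 0 (fun y => (1 - 𝔖.π y x.1 (θ₀ + r • v))⁻¹) x -
        𝔖.condE f 0 (fun y => (1 - 𝔖.π y x.1 θ₀)⁻¹) x -
        r * 𝔖.condE f 0 (fun y => (1 - 𝔖.resid θ₀ (0, y, x)) * armScore 𝔖 f φ 0 (y, x) -
          ∑ l, v l * 𝔖.gradResid θ₀ (0, y, x) l) x| ≤ L * r ^ 2 := by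
  obtain ⟨L₁, hL₁, -, hexp⟩ := h.exists_resid_expand
  obtain ⟨L₂, hL₂, hlip⟩ := h.obsJet_resid
  have hlip' : ∀ o ∈ goodObs 𝔖 f, ∀ θ ∈ 𝔖.Θ, |𝔖.resid θ o - 𝔖.resid θ₀ o| ≤ L₂ * ‖θ - θ₀‖ :=
    fun o ho θ hθ => hlip.lip (o, f, 0) ⟨ho, h.adm_self⟩ θ hθ θ₀ h.theta_mem
  refine ⟨L₁ * ‖v‖ ^ 2 + 2 * D * (L₂ * ‖v‖), by positivity, fun r hθ x hx => ?_⟩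
  -- In the control arm the residual is `-π / (1 - π)`, so that `(1 - π)⁻¹` is one minus it.
  have hinv : ∀ θ ∈ 𝔖.Θ, ∀ y ∈ 𝔖.𝒴 0, (1 - 𝔖.π y x.1 θ)⁻¹ = 1 - 𝔖.resid θ (0, y, x) := by
    intro θ hθ y hy
    have h1 := h.c_pos.trans_le
      (h.one_sub_pi_bounds (r := (y, x)) ⟨hy, hx.1⟩ hθ).1
    have h2 := h1.ne'
    simp only at h2
    simp only [resid, tval_zero, sub_zero, one_mul, zero_sub, sub_neg_eq_add]
    field_simp
    ring
  have hR := fun θ (hθ : θ ∈ 𝔖.Θ) => h.bddObs_resid hθ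
  have hs := h.bddObs_armScore hφ hD0 hD 0
  have b1 : BddObs 𝔖 f fun o => (1 - 𝔖.resid (θ₀ + r • v) o) * (1 + r * armScore 𝔖 f φ 0 o.2) :=
    ((BddObs.const h 1).sub h (hR _ hθ)).mul ((BddObs.const h 1).add (hs.const_mul h r))
  have b2 : BddObs 𝔖 f fun o => 1 - 𝔖.resid θ₀ o := (BddObs.const h 1).sub h (hR _ h.theta_mem)
  have b3 : BddObs 𝔖 f fun o => (1 - 𝔖.resid θ₀ o) * armScore 𝔖 f φ 0 o.2 -
      ∑ l, v l * 𝔖.gradResid θ₀ o l :=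
    (b2.mul hs).sub h (.sum h _ fun l _ => (h.bddObs_gradResid l).const_mul h (v l))
  have e1 : 𝔖.condE (tiltPath 𝔖 f θ₀ g φ v r).f 0 (fun y => (1 - 𝔖.π y x.1 (θ₀ + r • v))⁻¹) x =
      𝔖.condE f 0 (fun y => (1 - 𝔖.resid (θ₀ + r • v) (0, y, x)) *
        (1 + r * armScore 𝔖 f φ 0 (y, x))) x := by
    refine setIntegral_congr_fun (h.measurableSet_𝒴 0) fun y hy => ?_
    simp only [tiltPath, hinv _ hθ y hy]
    ring
  have i1 : Integrable (fun y => (1 - 𝔖.resid (θ₀ + r • v) (0, y, x)) *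
      (1 + r * armScore 𝔖 f φ 0 (y, x)) * f 0 y x) ((𝔖.ν 0).restrict (𝔖.𝒴 0)) :=
    h.integrable_section b1 hx 0
  have i2 : Integrable (fun y => (1 - 𝔖.resid θ₀ (0, y, x)) * f 0 y x)
      ((𝔖.ν 0).restrict (𝔖.𝒴 0)) := h.integrable_section b2 hx 0
  have i3 : Integrable (fun y => r * (((1 - 𝔖.resid θ₀ (0, y, x)) * armScore 𝔖 f φ 0 (y, x) -
      ∑ l, v l * 𝔖.gradResid θ₀ (0, y, x) l) * f 0 y x)) ((𝔖.ν 0).restrict (𝔖.𝒴 0)) :=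
    (h.integrable_section b3 hx 0).const_mul r
  have i12 : Integrable (fun y => (1 - 𝔖.resid (θ₀ + r • v) (0, y, x)) *
      (1 + r * armScore 𝔖 f φ 0 (y, x)) * f 0 y x - (1 - 𝔖.resid θ₀ (0, y, x)) * f 0 y x)
      ((𝔖.ν 0).restrict (𝔖.𝒴 0)) := i1.sub i2
  have e2 : 𝔖.condE f 0 (fun y => (1 - 𝔖.resid (θ₀ + r • v) (0, y, x)) *
        (1 + r * armScore 𝔖 f φ 0 (y, x))) x - 𝔖.condE f 0 (fun y => 1 - 𝔖.resid θ₀ (0, y, x)) x -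
        r * 𝔖.condE f 0 (fun y => (1 - 𝔖.resid θ₀ (0, y, x)) * armScore 𝔖 f φ 0 (y, x) -
          ∑ l, v l * 𝔖.gradResid θ₀ (0, y, x) l) x =
      𝔖.condE f 0 (fun y => (1 - 𝔖.resid (θ₀ + r • v) (0, y, x)) *
        (1 + r * armScore 𝔖 f φ 0 (y, x)) - (1 - 𝔖.resid θ₀ (0, y, x)) -
        r * ((1 - 𝔖.resid θ₀ (0, y, x)) * armScore 𝔖 f φ 0 (y, x) -
          ∑ l, v l * 𝔖.gradResid θ₀ (0, y, x) l)) x := by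
    simp only [condE]
    rw [← integral_sub i1 i2, ← integral_const_mul, ← integral_sub i12 i3]
    refine integral_congr_ae (ae_of_all _ fun y => ?_)
    simp only
    ring
  rw [e1, h.condE_congr (hinv θ₀ h.theta_mem) x, e2]
  refine h.abs_condE_le (fun y hy => ?_) hx
  have ho : ((0, y, x) : Obs dU dZ) ∈ goodObs 𝔖 f := ⟨hy, hx⟩
  have h1 := hexp _ (goodObs_subset ho) _ hθ
  have h2 := hlip' _ ho _ hθ
  have h3 := h.abs_armScore_le hD0 hD 0 (y, x)
  rw [add_sub_cancel_left, norm_smul, Real.norm_eq_abs] at h1 h2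
  have e3 : ∑ l, 𝔖.gradResid θ₀ (0, y, x) l * ((θ₀ + r • v) l - θ₀ l) =
      r * ∑ l, v l * 𝔖.gradResid θ₀ (0, y, x) l := by
    rw [Finset.mul_sum]
    refine Finset.sum_congr rfl fun l _ => ?_
    simp only [PiLp.add_apply, PiLp.smul_apply, smul_eq_mul]
    ring
  rw [e3] at h1
  have h4 : |(𝔖.resid (θ₀ + r • v) (0, y, x) - 𝔖.resid θ₀ (0, y, x)) *
      (r * armScore 𝔖 f φ 0 (y, x))| ≤ (L₂ * (|r| * ‖v‖)) * (|r| * (2 * D)) := by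
    rw [abs_mul, abs_mul r]
    exact mul_le_mul h2 (mul_le_mul_of_nonneg_left h3 (abs_nonneg _)) (by positivity) (by positivity)
  -- The first bracket is the remainder of the residual in `θ`; the second product is the
  -- interaction of the changes of `θ` and of the density, of second order.
  have e4 : (1 - 𝔖.resid (θ₀ + r • v) (0, y, x)) * (1 + r * armScore 𝔖 f φ 0 (y, x)) -
      (1 - 𝔖.resid θ₀ (0, y, x)) - r * ((1 - 𝔖.resid θ₀ (0, y, x)) * armScore 𝔖 f φ 0 (y, x) -
        ∑ l, v l * 𝔖.gradResid θ₀ (0, y, x) l) =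
      -(𝔖.resid (θ₀ + r • v) (0, y, x) - 𝔖.resid θ₀ (0, y, x) -
        r * ∑ l, v l * 𝔖.gradResid θ₀ (0, y, x) l) -
      (𝔖.resid (θ₀ + r • v) (0, y, x) - 𝔖.resid θ₀ (0, y, x)) *
        (r * armScore 𝔖 f φ 0 (y, x)) := by ring
  rw [e4]
  refine (abs_sub _ _).trans ?_
  rw [abs_neg]
  refine (add_le_add h1 h4).trans (le_of_eq ?_)
  rw [mul_pow, sq_abs, ← sq_abs r]
  ring

/-- The derivative of `{1 - w}⁻¹` along the path, when `v` represents the conditional covariance of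
`resid` and `φ`. -/
lemma one_sub_w_mul_deriv (h : RegularModel 𝔖 f θ₀ c C) (hq : 𝔖.IsParam ⟨θ₀, f, g⟩)
    (hφ : Measurable φ) (hD0 : 0 ≤ D) (hD : ∀ o, |φ o| ≤ D) {x : Cov dU dZ}
    (hx : x ∈ goodX 𝔖 f) (hv : condMean 𝔖 f θ₀ (fun o => 𝔖.resid θ₀ o * φ o) x =
      ∑ l, v l * 𝔖.A f θ₀ x l) :
    (1 - 𝔖.w f θ₀ x) * 𝔖.condE f 0 (fun y => (1 - 𝔖.resid θ₀ (0, y, x)) *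
      armScore 𝔖 f φ 0 (y, x) - ∑ l, v l * 𝔖.gradResid θ₀ (0, y, x) l) x =
      𝔖.w f θ₀ x * (armMean 𝔖 f φ 1 x - armMean 𝔖 f φ 0 x) := by
  have hR := h.bddObs_resid h.theta_mem
  have hs := h.bddObs_armScore hφ hD0 hD 0
  have b2 : BddObs 𝔖 f fun o => 1 - 𝔖.resid θ₀ o := (BddObs.const h 1).sub h hR
  have bg : ∀ l, BddObs 𝔖 f fun o => -v l * 𝔖.gradResid θ₀ o l :=
    fun l => (h.bddObs_gradResid l).const_mul h _
  have hsum : 𝔖.condE f 0 (fun y => ∑ l, -v l * 𝔖.gradResid θ₀ (0, y, x) l) x =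
      ∑ l, -v l * 𝔖.condE f 0 (fun y => 𝔖.gradResid θ₀ (0, y, x) l) x := by
    simp only [condE, Finset.sum_mul]
    rw [integral_finsetSum _ fun l _ => h.integrable_section (bg l) hx 0]
    simp only [mul_assoc, integral_const_mul]
  have h1 := h.condE_add_bddObs (k := fun o => (1 - 𝔖.resid θ₀ o) * armScore 𝔖 f φ 0 o.2)
    (k' := fun o => ∑ l, -v l * 𝔖.gradResid θ₀ o l) (b2.mul hs) (.sum h _ fun l _ => bg l) hx 0
  have h2 := h.condE_armScore hφ hD hx 0 _ b2
  have h3 : ∀ k : Obs dU dZ → ℝ, BddObs 𝔖 f k →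
      𝔖.condE f 0 (fun y => (1 - 𝔖.resid θ₀ (0, y, x)) * k (0, y, x)) x =
        𝔖.condE f 0 (fun y => k (0, y, x)) x -
          𝔖.condE f 0 (fun y => 𝔖.resid θ₀ (0, y, x) * k (0, y, x)) x := fun k hk => by
    have := h.condE_add_bddObs (k := k) (k' := fun o => -1 * (𝔖.resid θ₀ o * k o)) hk
      ((hR.mul hk).const_mul h _) hx 0
    rw [condE_const_mul] at this
    rw [sub_eq_add_neg, ← neg_one_mul (𝔖.condE f 0 _ x), ← this]
    congr 1
    funext y
    ring
  have h4 := h3 φ (h.bddObs_of_bdd hφ hD)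
  have h5 := h3 (fun _ => 1) (.const h 1)
  simp only [mul_one, condE_const _ hx] at h5
  have h6 := h.condMean_resid hq hx
  have h7 : ∀ l, (1 - 𝔖.w f θ₀ x) * 𝔖.condE f 0 (fun y => 𝔖.gradResid θ₀ (0, y, x) l) x =
      -𝔖.A f θ₀ x l := fun l => by
    rw [← condMean_gradResid]
    simp [condMean, gradResid, condE]
  have m1 : armMean 𝔖 f φ 1 x = 𝔖.condE f 1 (fun y => φ (1, y, x)) x := by
    rw [armMean, Set.indicator_of_mem hx]
  have m0 : armMean 𝔖 f φ 0 x = 𝔖.condE f 0 (fun y => φ (0, y, x)) x := by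
    rw [armMean, Set.indicator_of_mem hx]
  have r1 : ∀ y, 𝔖.resid θ₀ (1, y, x) = 1 := fun y => by simp [resid]
  simp only [condMean, r1, one_mul, condE_const _ hx, ← m1] at h6 hv
  have e1 : 𝔖.condE f 0 (fun y => (1 - 𝔖.resid θ₀ (0, y, x)) *
      armScore 𝔖 f φ 0 (y, x) - ∑ l, v l * 𝔖.gradResid θ₀ (0, y, x) l) x =
      𝔖.condE f 0 (fun y => (1 - 𝔖.resid θ₀ (0, y, x)) * armScore 𝔖 f φ 0 (y, x) +
        ∑ l, -v l * 𝔖.gradResid θ₀ (0, y, x) l) x := by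
    congr 1
    funext y
    simp only [neg_mul, Finset.sum_neg_distrib]
    ring
  rw [e1, h1, hsum, h2, h4, h5, ← m0]
  have e2 : (1 - 𝔖.w f θ₀ x) * ∑ l, -v l * 𝔖.condE f 0 (fun y => 𝔖.gradResid θ₀ (0, y, x) l) x =
      ∑ l, v l * 𝔖.A f θ₀ x l := by
    rw [Finset.mul_sum]
    refine Finset.sum_congr rfl fun l _ => ?_
    have := h7 l
    linear_combination (-v l) * this
  -- The covariance with `φ` comes from `hv`; `h6`, the centring of the residual, turns the mean
  -- of `armMean` in the control arm into a multiple of `w`.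
  linear_combination e2 - hv + armMean 𝔖 f φ 0 x * h6

end RegularModel
end ATTSetup

/-! ### The efficiency bound -/

namespace ATTSetup

variable {d dU dZ : ℕ} {𝔖 : ATTSetup d dU dZ} {f : Fin 2 → ℝ → Cov dU dZ → ℝ}
  {θ₀ : EuclideanSpace ℝ (Fin d)} {c C : ℝ} {g : Measure (Cov dU dZ)}
  {φ : Obs dU dZ → ℝ} {D : ℝ} {v : EuclideanSpace ℝ (Fin d)}

namespace RegularModel

/-- If `e₁ = e + r * e' + O(r ^ 2)` with `e₁ ≥ 1`, then `e / e₁ = 1 - r * (e' / e) + O(r ^ 2)`; the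
constant is explicit, so that the expansion can be used uniformly in the covariates. -/
lemma abs_inv_ratio_expand_le {e e₁ e' b m r L D : ℝ} (hL : 0 ≤ L) (hr : |r| ≤ 1)
    (he0 : 0 < e) (he : e ≤ m⁻¹) (he₁ : 1 ≤ e₁) (hb : e⁻¹ * e' = b) (hbD : |b| ≤ D)
    (hexp : |e₁ - e - r * e'| ≤ L * r ^ 2) :
    |e / e₁ - 1 + r * b| ≤ (L + D * (D * m⁻¹ + L)) * r ^ 2 := by
  have hD : 0 ≤ D := (abs_nonneg b).trans hbD
  have he' : e' = b * e := by rw [← hb]; field_simp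
  have h0 : 0 < e₁ := one_pos.trans_le he₁
  have e1 : e / e₁ - 1 + r * b = (-(e₁ - e - r * e') + r * b * (e₁ - e)) / e₁ := by
    rw [he']
    field_simp
    ring
  have h1 : |e₁ - e| ≤ |r| * (D * m⁻¹ + L) := by
    have h2 : e₁ - e = (e₁ - e - r * e') + r * e' := by ring
    have h3 : |r * e'| ≤ |r| * (D * m⁻¹) := by
      rw [he', abs_mul, abs_mul b, abs_of_pos he0]
      exact mul_le_mul_of_nonneg_left (mul_le_mul hbD he he0.le hD) (abs_nonneg _)
    have h4 : L * r ^ 2 ≤ |r| * L := by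
      rw [← sq_abs]
      nlinarith [mul_nonneg hL (mul_nonneg (abs_nonneg r) (sub_nonneg.2 hr))]
    rw [h2]
    linarith [abs_add_le (e₁ - e - r * e') (r * e')]
  have h2 : |r * b * (e₁ - e)| ≤ (|r| * D) * (|r| * (D * m⁻¹ + L)) := by
    rw [abs_mul, abs_mul]
    exact mul_le_mul (mul_le_mul_of_nonneg_left hbD (abs_nonneg _)) h1 (abs_nonneg _)
      (by positivity)
  rw [e1, abs_div, abs_of_pos h0]
  refine (div_le_self (abs_nonneg _) he₁).trans ((abs_add_le _ _).trans ?_)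
  rw [abs_neg]
  refine (add_le_add hexp h2).trans (le_of_eq ?_)
  rw [← sq_abs r]
  ring

/-- First-order expansion of the propensities along the path. -/
lemma exists_wt_tiltPath_expand (h : RegularModel 𝔖 f θ₀ c C) (hq : 𝔖.IsParam ⟨θ₀, f, g⟩)
    (hφ : Measurable φ) (hD0 : 0 ≤ D) (hD : ∀ o, |φ o| ≤ D)
    (hmean : ∫ o, φ o ∂(𝔖.law ⟨θ₀, f, g⟩) = 0)
    (hv : ∀ x ∈ goodX 𝔖 f, condMean 𝔖 f θ₀ (fun o => 𝔖.resid θ₀ o * φ o) x =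
      ∑ l, v l * 𝔖.A f θ₀ x l) :
    ∃ K, 0 ≤ K ∧ ∀ r : ℝ, |r| ≤ 1 → |r| * (2 * D) ≤ 1 → θ₀ + r • v ∈ 𝔖.Θ →
      ∀ x ∈ goodX 𝔖 f, ∀ t : Fin 2,
        |wt 𝔖 (tiltPath 𝔖 f θ₀ g φ v r) t x / wt 𝔖 ⟨θ₀, f, g⟩ t x - 1 -
          r * ((tval t - 𝔖.w f θ₀ x) * (armMean 𝔖 f φ 1 x - armMean 𝔖 f φ 0 x))| ≤ K * r ^ 2 := by
  obtain ⟨m, hm, hwt⟩ := h.exists_le_wt hq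
  obtain ⟨L₀, hL₀, hexp⟩ := h.exists_inv_mean_expand hφ hD0 hD v
  obtain ⟨L₁, hL₁⟩ : ∃ L₁, L₁ = L₀ + 2 * D * (2 * D * m⁻¹ + L₀) := ⟨_, rfl⟩
  have hL₁0 : 0 ≤ L₁ := by rw [hL₁]; positivity
  have hLm : 0 ≤ L₁ * m⁻¹ := by positivity
  refine ⟨L₁ + L₁ * m⁻¹, by positivity, fun r hr1 hr hθ x hx t => ?_⟩
  have hrp := h.isParam_tiltPath hq hφ hD0 hD hmean hr hθ
  obtain ⟨hw0, hw1, hwe⟩ := h.w_bounds hq hx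
  obtain ⟨hv0, hv1, hve, -⟩ := h.param_odds hrp
    (h.goodX_subset_paramX_tiltPath (g := g) hφ hD0 hD v hr hx)
  have hb := h.one_sub_w_mul_deriv hq hφ hD0 hD hx (hv x hx)
  have hex := hexp r hθ x hx
  have hm0 : m ≤ 1 - 𝔖.w f θ₀ x := by simpa [wt] using hwt x hx 0
  have hm1 : m ≤ 𝔖.w f θ₀ x := by simpa [wt] using hwt x hx 1
  have hκ : |𝔖.w f θ₀ x * (armMean 𝔖 f φ 1 x - armMean 𝔖 f φ 0 x)| ≤ 2 * D := by
    have a1 := h.abs_armMean_le hD0 hD 1 x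
    have a0 := h.abs_armMean_le hD0 hD 0 x
    rw [abs_mul, abs_of_nonneg hw0]
    refine (mul_le_of_le_one_left (abs_nonneg _) (by linarith)).trans ((abs_sub _ _).trans ?_)
    linarith
  have e0 : (1 - 𝔖.w f θ₀ x)⁻¹ = 𝔖.condE f 0 (fun y => (1 - 𝔖.π y x.1 θ₀)⁻¹) x :=
    inv_eq_of_mul_eq_one_right hwe
  have e1 : (1 - 𝔖.w (tiltPath 𝔖 f θ₀ g φ v r).f (tiltPath 𝔖 f θ₀ g φ v r).θ x)⁻¹ =
      𝔖.condE (tiltPath 𝔖 f θ₀ g φ v r).f 0 (fun y => (1 - 𝔖.π y x.1 (θ₀ + r • v))⁻¹) x :=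
    inv_eq_of_mul_eq_one_right hve
  rw [← e0, ← e1] at hex
  have hδ := abs_inv_ratio_expand_le hL₀ hr1 (inv_pos.2 hw1) (inv_anti₀ hm hm0)
    ((one_le_inv₀ hv1).2 (by linarith)) (by rw [inv_inv]; exact hb) hκ hex
  rw [inv_div_inv, ← hL₁] at hδ
  rw [add_mul]
  obtain rfl | rfl := fin_two_eq t
  · refine (le_of_eq ?_).trans (hδ.trans (le_add_of_nonneg_right (by positivity)))
    simp only [wt, zero_ne_one, if_false, tval_zero]
    congr 1
    ring
  · have hw' : 0 < 𝔖.w f θ₀ x := hm.trans_le hm1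
    -- The two propensities add up to one, so the expansion in the treated arm follows from the one
    -- in the control arm.
    have e2 : wt 𝔖 (tiltPath 𝔖 f θ₀ g φ v r) 1 x / wt 𝔖 ⟨θ₀, f, g⟩ 1 x - 1 -
        r * ((tval 1 - 𝔖.w f θ₀ x) * (armMean 𝔖 f φ 1 x - armMean 𝔖 f φ 0 x)) =
        -((1 - 𝔖.w f θ₀ x) / 𝔖.w f θ₀ x) *
        ((1 - 𝔖.w (tiltPath 𝔖 f θ₀ g φ v r).f (tiltPath 𝔖 f θ₀ g φ v r).θ x) /
          (1 - 𝔖.w f θ₀ x) - 1 + r * (𝔖.w f θ₀ x *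
            (armMean 𝔖 f φ 1 x - armMean 𝔖 f φ 0 x))) := by
      simp only [wt, if_true, tval_one]
      field_simp
      ring
    have h3 : (1 - 𝔖.w f θ₀ x) / 𝔖.w f θ₀ x ≤ m⁻¹ := by
      rw [div_le_iff₀ hw', inv_mul_eq_div, le_div_iff₀ hm]
      nlinarith
    rw [e2, abs_mul, abs_neg, abs_of_pos (div_pos hw1 hw')]
    calc _ ≤ m⁻¹ * (L₁ * r ^ 2) := mul_le_mul h3 hδ (abs_nonneg _) (by positivity)
      _ = L₁ * m⁻¹ * r ^ 2 := by ring
      _ ≤ _ := le_add_of_nonneg_left (by positivity)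

/-- First-order expansion of the likelihood ratio of the tilted law, uniformly in the
observation. -/
lemma exists_tiltRatio_expand (h : RegularModel 𝔖 f θ₀ c C) (hq : 𝔖.IsParam ⟨θ₀, f, g⟩)
    (hφ : Measurable φ) (hD0 : 0 ≤ D) (hD : ∀ o, |φ o| ≤ D)
    (hmean : ∫ o, φ o ∂(𝔖.law ⟨θ₀, f, g⟩) = 0)
    (hv : ∀ x ∈ goodX 𝔖 f, condMean 𝔖 f θ₀ (fun o => 𝔖.resid θ₀ o * φ o) x =
      ∑ l, v l * 𝔖.A f θ₀ x l) :
    ∃ L, ∀ r : ℝ, |r| ≤ 1 → |r| * (2 * D) ≤ 1 → θ₀ + r • v ∈ 𝔖.Θ → ∀ o ∈ goodObs 𝔖 f,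
      |tiltRatio 𝔖 f θ₀ g φ v r o - 1 - r * φ o| ≤ L * r ^ 2 := by
  obtain ⟨K₀, hK₀, hwt⟩ := h.exists_wt_tiltPath_expand hq hφ hD0 hD hmean hv
  obtain ⟨K, hKn, hK0, hKD⟩ : ∃ K, 0 ≤ K ∧ K₀ ≤ K ∧ 2 * D ≤ K :=
    ⟨K₀ + 2 * D, by positivity, by linarith, by linarith⟩
  obtain ⟨K', hK'n, hK'⟩ : ∃ K', 0 ≤ K' ∧ 2 * K + 5 * K ^ 2 = K' := ⟨_, by positivity, rfl⟩
  have hKK' : K + K ≤ K' := by rw [← hK']; nlinarith [sq_nonneg K]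
  refine ⟨2 * K' + 5 * K' ^ 2, fun r hr1 hr hθ o ho => ?_⟩
  obtain ⟨t, y, x⟩ := o
  have hx : x ∈ goodX 𝔖 f := ho.2
  obtain ⟨hw0, hw1, -⟩ := h.w_bounds hq hx
  have hκ : |(tval t - 𝔖.w f θ₀ x) * (armMean 𝔖 f φ 1 x - armMean 𝔖 f φ 0 x)| ≤ K := by
    have a1 := h.abs_armMean_le hD0 hD 1 x
    have a0 := h.abs_armMean_le hD0 hD 0 x
    have h1 : |tval t - 𝔖.w f θ₀ x| ≤ 1 := by
      obtain rfl | rfl := fin_two_eq t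
      · rw [tval_zero, abs_le]; constructor <;> linarith
      · rw [tval_one, abs_le]; constructor <;> linarith
    rw [abs_mul]
    refine (mul_le_of_le_one_left (abs_nonneg _) h1).trans ((abs_sub _ _).trans ?_)
    linarith
  have hs := (h.abs_armScore_le hD0 hD t (y, x)).trans hKD
  have hc : |covScore 𝔖 f θ₀ φ x| ≤ K' := (h.abs_covScore_le hq hD0 hD x).trans (by linarith)
  have hz : ∀ (s B : ℝ), 0 ≤ B → |1 + r * s - 1 - r * s| ≤ B * r ^ 2 := fun s B hB => by
    rw [show 1 + r * s - 1 - r * s = 0 by ring, abs_zero]; positivity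
  -- The ratio is a product of three factors, for the propensity, the conditional density and the
  -- covariates, whose first-order terms add up to `φ`.
  have k1 := abs_mul_sub_expand_le hr1 hκ hs
    ((hwt r hr1 hr hθ x hx t).trans (mul_le_mul_of_nonneg_right hK0 (sq_nonneg r))) (hz _ K hKn)
  rw [hK'] at k1
  have k2 := abs_mul_sub_expand_le hr1 ((abs_add_le _ _).trans ((add_le_add hκ hs).trans hKK')) hc
    k1 (hz _ K' hK'n)
  refine (le_of_eq ?_).trans k2
  rw [tiltRatio, Set.indicator_of_mem ho]
  congr 2
  congr 1
  simp only [armScore, covScore, Set.indicator_of_mem hx]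
  obtain rfl | rfl := fin_two_eq t
  · rw [tval_zero]; ring
  · rw [tval_one]; ring

/-- Every bounded mean-zero function whose conditional covariance with the residual is a
combination of the `A j` is the score of a regular submodel. -/
lemma isRegularSubmodel_tiltPath (h : RegularModel 𝔖 f θ₀ c C) (hq : 𝔖.IsParam ⟨θ₀, f, g⟩)
    (hint : θ₀ ∈ _root_.interior 𝔖.Θ) (hφ : Measurable φ) (hD0 : 0 ≤ D) (hD : ∀ o, |φ o| ≤ D)
    (hmean : ∫ o, φ o ∂(𝔖.law ⟨θ₀, f, g⟩) = 0)
    (hv : ∀ x ∈ goodX 𝔖 f, condMean 𝔖 f θ₀ (fun o => 𝔖.resid θ₀ o * φ o) x =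
      ∑ l, v l * 𝔖.A f θ₀ x l) :
    𝔖.IsRegularSubmodel ⟨θ₀, f, g⟩ (tiltPath 𝔖 f θ₀ g φ v) φ := by
  have hPr := h.isProbabilityMeasure_law hq
  obtain ⟨L, hL⟩ := h.exists_tiltRatio_expand hq hφ hD0 hD hmean hv
  have hθ : ∀ᶠ r : ℝ in 𝓝 0, θ₀ + r • v ∈ 𝔖.Θ := by
    have h1 : Tendsto (fun r : ℝ => θ₀ + r • v) (𝓝 0) (𝓝 θ₀) := by
      have : Continuous fun r : ℝ => θ₀ + r • v := by fun_prop
      simpa using this.tendsto 0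
    exact h1.eventually (mem_interior_iff_mem_nhds.1 hint)
  have hr1 : ∀ᶠ r : ℝ in 𝓝 0, |r| ≤ 1 := by
    have : Tendsto (fun r : ℝ => |r|) (𝓝 0) (𝓝 0) := by simpa using (continuous_abs.tendsto (0 : ℝ))
    exact (this.eventually (gt_mem_nhds one_pos)).mono fun r hr => le_of_lt hr
  have hr2 : ∀ᶠ r : ℝ in 𝓝 0, |r| * (2 * D) ≤ 1 := by
    have : Tendsto (fun r : ℝ => |r| * (2 * D)) (𝓝 0) (𝓝 0) := by
      have hc : Continuous fun r : ℝ => |r| * (2 * D) := by fun_prop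
      simpa using hc.tendsto 0
    exact (this.eventually (gt_mem_nhds one_pos)).mono fun r hr => le_of_lt hr
  refine ⟨?_, ?_, ?_, ?_, ?_⟩
  · simp [tiltPath]
  · filter_upwards [hθ, hr2] with r h1 h2 using h.isParam_tiltPath hq hφ hD0 hD hmean h2 h1
  · have : Differentiable ℝ fun r : ℝ => θ₀ + r • v := by fun_prop
    exact this 0
  · exact MemLp.of_bound hφ.aestronglyMeasurable D (ae_of_all _ fun o => hD o)
  · refine tendsto_dqm_of_expand (ρ := tiltRatio 𝔖 f θ₀ g φ v) (L := L) hD ?_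
    filter_upwards [hθ, hr1, hr2] with r h1 h2 h3
    have h4 := h.isParam_tiltPath hq hφ hD0 hD hmean h3 h1
    have h5 := h.isProbabilityMeasure_law h4
    refine ⟨h.measurable_tiltRatio hq hφ h4, h.tiltRatio_nonneg hq hφ hD0 hD h3 h4,
      inferInstance, h.law_tiltPath hq hφ hD0 hD h3 h4, ?_⟩
    filter_upwards [h.ae_law_goodObs hq] with o ho using hL r h2 h3 h1 o ho

/-- The second moment of `φeff` is the semiparametric efficiency bound: it bounds the Cramér–Rao
bounds of all regular submodels, and is the one of the submodel with score `φeff`. -/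
lemma isEfficiencyBound (h : RegularModel 𝔖 f θ₀ c C) (hq : 𝔖.IsParam ⟨θ₀, f, g⟩)
    (hint : θ₀ ∈ _root_.interior 𝔖.Θ) {p Δ : ℝ}
    (hM : IsUnit (𝔖.M f θ₀ g).det) (hp0 : p ≠ 0)
    (hp : ∫ o, tval o.1 ∂(𝔖.law ⟨θ₀, f, g⟩) = p)
    (hΔ : ∫ o, 𝔖.altNum θ₀ o ∂(𝔖.law ⟨θ₀, f, g⟩) = p * Δ) {q : Fin d → ℝ}
    (hQ : ∀ l, ∫ o, o.2.1 * 𝔖.gradResid θ₀ o l ∂(𝔖.law ⟨θ₀, f, g⟩) = -q l) :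
    𝔖.IsEfficiencyBound ⟨θ₀, f, g⟩ (∫ o, 𝔖.φeff f θ₀ g q p Δ o ^ 2 ∂(𝔖.law ⟨θ₀, f, g⟩)) := by
  refine ⟨fun b hb => h.cramerRao_le hq hM hp0 hp hΔ hQ hb, fun b hb => hb ?_⟩
  -- It remains to exhibit a submodel with score `φeff`; the path needs a version of it that is
  -- bounded and measurable everywhere.
  obtain ⟨k, hk, ⟨D, hD0, hD⟩, hkφ⟩ := (h.bddObs_φeff (g := g) q p Δ).exists_measurable
  have hae : k =ᵐ[𝔖.law ⟨θ₀, f, g⟩] 𝔖.φeff f θ₀ g q p Δ :=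
    (h.ae_law_goodObs hq).mono fun o ho => hkφ o ho
  have hmean : ∫ o, k o ∂(𝔖.law ⟨θ₀, f, g⟩) = 0 := by
    rw [integral_congr_ae hae, h.integral_φeff hq hp hΔ]
  -- The conditional covariance of the residual with `φeff` is a combination of the `A j`; its
  -- coefficients give the direction in which `θ` has to move.
  have hv : ∀ x ∈ goodX 𝔖 f, condMean 𝔖 f θ₀ (fun o => 𝔖.resid θ₀ o * k o) x =
      ∑ l, (WithLp.toLp 2 fun j => p⁻¹ * effCoef 𝔖 f θ₀ g q Δ j : EuclideanSpace ℝ (Fin d)) l *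
        𝔖.A f θ₀ x l := fun x hx => by
    rw [h.condMean_congr hx (k' := fun o => 𝔖.resid θ₀ o * 𝔖.φeff f θ₀ g q p Δ o)
      fun o ho => by rw [hkφ o ho], h.condMean_resid_mul_φeff hq hx, Finset.mul_sum]
    simp only [mul_assoc]
  have hreg := h.isRegularSubmodel_tiltPath hq hint hk hD0 hD hmean hv
  refine ⟨_, k, _, hreg, h.hasDerivAt_att hq hM hp0 hp hΔ hQ hreg, ?_⟩
  have e1 : ∫ o, 𝔖.φeff f θ₀ g q p Δ o * k o ∂(𝔖.law ⟨θ₀, f, g⟩) =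
      ∫ o, 𝔖.φeff f θ₀ g q p Δ o ^ 2 ∂(𝔖.law ⟨θ₀, f, g⟩) :=
    integral_congr_ae (hae.mono fun o ho => by simp only [ho]; ring)
  have e2 : ∫ o, k o ^ 2 ∂(𝔖.law ⟨θ₀, f, g⟩) =
      ∫ o, 𝔖.φeff f θ₀ g q p Δ o ^ 2 ∂(𝔖.law ⟨θ₀, f, g⟩) :=
    integral_congr_ae (hae.mono fun o ho => by simp only [ho])
  rw [e1, e2, sq, mul_self_div_self]

end RegularModel
end ATTSetup

/-! ### A uniform law of large numbers with estimated nuisances -/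

namespace ATTSetup

variable {d dU dZ : ℕ} {𝔖 : ATTSetup d dU dZ} {f : Fin 2 → ℝ → Cov dU dZ → ℝ}
  {θ₀ : EuclideanSpace ℝ (Fin d)} {c C : ℝ}
  {Ω : Type*} [MeasurableSpace Ω] {μ : Measure Ω} [IsProbabilityMeasure μ]
  {T : ℕ → Ω → Fin 2} {Y : Fin 2 → ℕ → Ω → ℝ} {X : ℕ → Ω → Cov dU dZ}
  {Kf : ℕ} {fold : ∀ n : ℕ, Ω → Fin n → Fin Kf} {learn : Learner dU dZ}

namespace IsSample

lemma measurable_select : Measurable fun r : Fin 2 × (Fin 2 → ℝ) × Cov dU dZ =>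
    ((r.1, r.2.1 r.1, r.2.2) : Obs dU dZ) :=
  measurable_from_prod_countable_right fun t => measurable_const.prodMk
    (((measurable_pi_apply t).comp measurable_fst).prodMk measurable_snd)

lemma iIndepFun_obs (hs : 𝔖.IsSample f θ₀ μ T Y X) : iIndepFun (obs T Y X) μ :=
  hs.indep.comp (fun _ r => ((r.1, r.2.1 r.1, r.2.2) : Obs dU dZ)) fun _ => measurable_select

lemma identDistrib_obs (hs : 𝔖.IsSample f θ₀ μ T Y X) (i : ℕ) :
    IdentDistrib (obs T Y X i) (obs T Y X 0) μ μ :=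
  (hs.ident i).comp measurable_select

lemma ae_goodObs (hs : 𝔖.IsSample f θ₀ μ T Y X) (h : RegularModel 𝔖 f θ₀ c C) :
    ∀ᵐ ω ∂μ, ∀ i, obs T Y X i ω ∈ goodObs 𝔖 f := by
  refine ae_all_iff.2 fun i => ?_
  refine (hs.identDistrib_obs i).symm.ae_snd (p := fun o => o ∈ goodObs 𝔖 f)
    h.measurableSet_goodObs ?_
  have h1 := h.ae_law_goodObs (hs.isParam h)
  rw [← hs.map_obs h] at h1
  exact ae_of_ae_map (hs.measurable_obs 0).aemeasurable h1

lemma integral_obs (hs : 𝔖.IsSample f θ₀ μ T Y X) (h : RegularModel 𝔖 f θ₀ c C)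
    {k : Obs dU dZ → ℝ} (hk : BddObs 𝔖 f k) :
    ∫ ω, k (obs T Y X 0 ω) ∂μ = ∫ o, k o ∂(𝔖.law ⟨θ₀, f, μ.map (X 0)⟩) := by
  have h1 := (h.integrable_bddObs (hs.isParam h) hk).aestronglyMeasurable
  rw [← hs.map_obs h] at h1 ⊢
  exact (integral_map (hs.measurable_obs 0).aemeasurable h1).symm

/-- The law of large numbers for bounded functions of the observation. -/
lemma tendsto_average (hs : 𝔖.IsSample f θ₀ μ T Y X) (h : RegularModel 𝔖 f θ₀ c C)
    {k : Obs dU dZ → ℝ} (hk : BddObs 𝔖 f k) :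
    Tendsto (fun q : ℕ × Ω => (q.1 : ℝ)⁻¹ * ∑ i : Fin q.1, k (obs T Y X i q.2)) (whp μ)
      (𝓝 (∫ o, k o ∂(𝔖.law ⟨θ₀, f, μ.map (X 0)⟩))) := by
  rw [← hs.integral_obs h hk]
  refine tendsto_average_whp hs.iIndepFun_obs hs.identDistrib_obs ?_
  rw [hs.map_obs h]
  exact h.integrable_bddObs (hs.isParam h) hk

end IsSample

/-- The nuisance estimate that is evaluated at the `i`-th observation of the sample of size `n` at
`q = (n, ω)`: it is trained outside the fold of `i`. -/
noncomputable def foldNuis (T : ℕ → Ω → Fin 2) (Y : Fin 2 → ℕ → Ω → ℝ) (X : ℕ → Ω → Cov dU dZ)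
    (fold : ∀ n : ℕ, Ω → Fin n → Fin Kf) (learn : Learner dU dZ) (q : ℕ × Ω) (i : Fin q.1) :
    Nuis dU dZ := fhat T Y X fold learn q.1 (fold q.1 q.2 i) q.2

/-- The cross-fitted average `n⁻¹ ∑ F(W_i; θ, f̂)`. -/
noncomputable def fitAvg (T : ℕ → Ω → Fin 2) (Y : Fin 2 → ℕ → Ω → ℝ) (X : ℕ → Ω → Cov dU dZ)
    (fold : ∀ n : ℕ, Ω → Fin n → Fin Kf) (learn : Learner dU dZ)
    (F : Nuis dU dZ → EuclideanSpace ℝ (Fin d) → Obs dU dZ → ℝ) (θ : EuclideanSpace ℝ (Fin d))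
    (q : ℕ × Ω) : ℝ :=
  (q.1 : ℝ)⁻¹ * ∑ i : Fin q.1, F (foldNuis T Y X fold learn q i) θ (obs T Y X i q.2)

/-- The assumptions on the sample, the random partition and the nuisance estimates. -/
structure CrossFit (𝔖 : ATTSetup d dU dZ) (f : Nuis dU dZ) (θ₀ : EuclideanSpace ℝ (Fin d))
    (c C : ℝ) (μ : Measure Ω) (T : ℕ → Ω → Fin 2) (Y : Fin 2 → ℕ → Ω → ℝ)
    (X : ℕ → Ω → Cov dU dZ) (fold : ∀ n : ℕ, Ω → Fin n → Fin Kf) (learn : Learner dU dZ) :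
    Prop where
  model : RegularModel 𝔖 f θ₀ c C
  sample : 𝔖.IsSample f θ₀ μ T Y X
  part : IsRandomPartition μ T Y X fold
  learner : MeasurableLearner learn
  quality : 𝔖.NuisanceQuality f μ T Y X fold learn

namespace CrossFit

lemma measurable_fhat (hc : CrossFit 𝔖 f θ₀ c C μ T Y X fold learn) (n : ℕ) (k : Fin Kf) (ω : Ω)
    (t : Fin 2) : Measurable fun r : ℝ × Cov dU dZ => fhat T Y X fold learn n k ω t r.1 r.2 :=
  (hc.learner n t _).comp (measurable_const.prodMk measurable_id)

/-- Uniform closeness to the true densities gives admissibility: `ε ≤ c` keeps the perturbed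
densities nonnegative, and the bound on `ε` times the mass of the range of the outcomes keeps their
total mass at least one half. -/
lemma adm_of_near (hc : CrossFit 𝔖 f θ₀ c C μ T Y X fold learn) {g : Nuis dU dZ} {ε δ : ℝ}
    (hg : ∀ t, Measurable (fun r : ℝ × Cov dU dZ => g t r.1 r.2))
    (hε : 0 ≤ ε) (h1 : ε ≤ δ) (h2 : δ ≤ 1) (h3 : ε ≤ c)
    (h4 : ∀ t, ε * (𝔖.ν t).real (𝔖.𝒴 t) ≤ 1 / 2)
    (hn : ∀ t, ∀ y ∈ 𝔖.𝒴 t, ∀ x ∈ 𝔖.𝒳, |g t y x - f t y x| ≤ ε) : Adm 𝔖 f g δ where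
  nonneg := hε.trans h1
  le_one := h2
  meas := hg
  near t y hy x hx := (hn t y hy x hx).trans h1
  dens_nonneg t y hy x hx := by
    have h5 := (abs_le.1 (hn t y hy x hx)).1
    linarith [(hc.model.density_bounds t y hy x hx).1]
  half_le t x hx := by
    have h := hc.model
    have := h.finite t
    have hf : Integrable (fun y => f t y x) ((𝔖.ν t).restrict (𝔖.𝒴 t)) := by
      simpa using h.integrable_section (.const h 1) hx t
    have hgf : Integrable (fun y => g t y x - f t y x) ((𝔖.ν t).restrict (𝔖.𝒴 t)) := by
      refine Integrable.of_bound (C := ε) (Measurable.aestronglyMeasurable ?_) ?_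
      · exact ((hg t).comp measurable_prodMk_right).sub
          ((h.measurable_f t).comp measurable_prodMk_right)
      · filter_upwards [ae_restrict_mem (h.measurableSet_𝒴 t)] with y hy using hn t y hy x hx.1
    have e1 : ∫ y in 𝔖.𝒴 t, g t y x ∂(𝔖.ν t) =
        ∫ y in 𝔖.𝒴 t, f t y x ∂(𝔖.ν t) + ∫ y in 𝔖.𝒴 t, (g t y x - f t y x) ∂(𝔖.ν t) := by
      rw [← integral_add hf hgf]
      simp
    have h5 := h.abs_setIntegral_le fun y hy => hn t y hy x hx.1
    rw [e1, hx.2 t]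
    linarith [(abs_le.1 h5).1, h4 t]

/-- With probability tending to one the observations are in the good range and the nuisance
estimates are admissible perturbations of the true densities. -/
lemma eventually_good (hc : CrossFit 𝔖 f θ₀ c C μ T Y X fold learn) {δ : ℝ} (hδ : 0 < δ)
    (hδ1 : δ ≤ 1) : ∀ᶠ q in whp μ, (∀ i, obs T Y X i q.2 ∈ goodObs 𝔖 f) ∧
      ∀ i : Fin q.1, Adm 𝔖 f (foldNuis T Y X fold learn q i) δ := by
  refine (eventually_whp_of_ae fun n => hc.sample.ae_goodObs hc.model).and ?_
  obtain ⟨N, hN0, hN⟩ : ∃ N, 0 < N ∧ ∀ t, (𝔖.ν t).real (𝔖.𝒴 t) ≤ N := by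
    refine ⟨1 + ∑ t, (𝔖.ν t).real (𝔖.𝒴 t), by positivity, fun t => ?_⟩
    have := Finset.single_le_sum (f := fun t => (𝔖.ν t).real (𝔖.𝒴 t)) (fun _ _ => measureReal_nonneg)
      (Finset.mem_univ t)
    linarith
  obtain ⟨ε, hε, h1, h2, h3⟩ : ∃ ε, 0 < ε ∧ ε ≤ δ ∧ ε ≤ c ∧ ε ≤ 1 / (2 * N) :=
    ⟨min δ (min c (1 / (2 * N))), lt_min hδ (lt_min hc.model.c_pos (by positivity)),
      min_le_left _ _, (min_le_right _ _).trans (min_le_left _ _),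
      (min_le_right _ _).trans (min_le_right _ _)⟩
  have hsup : ∀ t (k : Fin Kf), ∀ᶠ q in whp μ, ¬ ∃ y ∈ 𝔖.𝒴 t, ∃ x ∈ 𝔖.𝒳,
      ε < |fhat T Y X fold learn q.1 k q.2 t y x - f t y x| := fun t k => by
    rw [eventually_whp]
    simpa only [not_not] using hc.quality.sup t k ε hε
  filter_upwards [eventually_all.2 fun t => eventually_all.2 (hsup t)] with q hq i
  refine hc.adm_of_near (fun t => hc.measurable_fhat _ _ _ t) hε.le h1 hδ1 h2 (fun t => ?_)
    fun t y hy x hx => ?_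
  · calc ε * (𝔖.ν t).real (𝔖.𝒴 t) ≤ 1 / (2 * N) * N :=
        mul_le_mul h3 (hN t) measureReal_nonneg (by positivity)
      _ = 1 / 2 := by field_simp
  · by_contra hlt
    exact hq t _ ⟨y, hy, x, hx, not_le.1 hlt⟩

lemma abs_average_le {n : ℕ} {u : Fin n → ℝ} {B : ℝ} (hB0 : 0 ≤ B) (hu : ∀ i, |u i| ≤ B) :
    |(n : ℝ)⁻¹ * ∑ i, u i| ≤ B := by
  rw [abs_mul, abs_inv, Nat.abs_cast]
  have h1 : |∑ i, u i| ≤ n * B :=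
    (Finset.abs_sum_le_sum_abs _ _).trans ((Finset.sum_le_sum fun i _ => hu i).trans (by simp))
  rcases Nat.eq_zero_or_pos n with rfl | hn
  · simpa using hB0
  · have : (0 : ℝ) < n := by exact_mod_cast hn
    rw [inv_mul_le_iff₀ this]
    exact h1

/-- The mean of a statistic is Lipschitz in the parameter. -/
lemma abs_integral_sub_le (hc : CrossFit 𝔖 f θ₀ c C μ T Y X fold learn)
    {F : Nuis dU dZ → EuclideanSpace ℝ (Fin d) → Obs dU dZ → ℝ}
    {G : Obs dU dZ × Nuis dU dZ × ℝ → Fin d → ℝ} {L : ℝ}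
    (hL : JetBound 𝔖.Θ θ₀ {k : Obs dU dZ × Nuis dU dZ × ℝ | k.1 ∈ goodObs 𝔖 f ∧
      Adm 𝔖 f k.2.1 k.2.2} (fun k => (k.1, f, 0)) (fun k => k.2.2) (fun k θ => F k.2.1 θ k.1) G L)
    (hb : ∀ θ ∈ 𝔖.Θ, BddObs 𝔖 f (F f θ)) {θ θ' : EuclideanSpace ℝ (Fin d)}
    (hθ : θ ∈ 𝔖.Θ) (hθ' : θ' ∈ 𝔖.Θ) :
    |∫ o, F f θ o ∂(𝔖.law ⟨θ₀, f, μ.map (X 0)⟩) -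
      ∫ o, F f θ' o ∂(𝔖.law ⟨θ₀, f, μ.map (X 0)⟩)| ≤ L * ‖θ - θ'‖ := by
  have h := hc.model
  have hq := hc.sample.isParam h
  have hP := h.isProbabilityMeasure_law hq
  rw [← integral_sub (h.integrable_bddObs hq (hb θ hθ)) (h.integrable_bddObs hq (hb θ' hθ'))]
  have := norm_integral_le_of_norm_le_const (μ := 𝔖.law ⟨θ₀, f, μ.map (X 0)⟩)
    (f := fun o => F f θ o - F f θ' o) (C := L * ‖θ - θ'‖)
    ((h.ae_law_goodObs hq).mono fun o ho => hL.lip (o, f, 0) ⟨ho, h.adm_self⟩ θ hθ θ' hθ')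
  simpa using this

lemma continuousOn_integral (hc : CrossFit 𝔖 f θ₀ c C μ T Y X fold learn)
    {F : Nuis dU dZ → EuclideanSpace ℝ (Fin d) → Obs dU dZ → ℝ}
    {G : Obs dU dZ × Nuis dU dZ × ℝ → Fin d → ℝ} (hF : ObsJet 𝔖 f θ₀ F G)
    (hb : ∀ θ ∈ 𝔖.Θ, BddObs 𝔖 f (F f θ)) :
    ContinuousOn (fun θ => ∫ o, F f θ o ∂(𝔖.law ⟨θ₀, f, μ.map (X 0)⟩)) 𝔖.Θ := by
  obtain ⟨L, hL0, hL⟩ := hF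
  refine LipschitzOnWith.continuousOn (K := L.toNNReal) (LipschitzOnWith.of_dist_le_mul
    fun θ hθ θ' hθ' => ?_)
  rw [Real.dist_eq, dist_eq_norm, Real.coe_toNNReal _ hL0]
  exact hc.abs_integral_sub_le hL hb hθ hθ'

/-- A uniform law of large numbers over the compact parameter set, with estimated nuisances. -/
lemma eventually_abs_fitAvg_sub_le (hc : CrossFit 𝔖 f θ₀ c C μ T Y X fold learn)
    {F : Nuis dU dZ → EuclideanSpace ℝ (Fin d) → Obs dU dZ → ℝ}
    {G : Obs dU dZ × Nuis dU dZ × ℝ → Fin d → ℝ} (hF : ObsJet 𝔖 f θ₀ F G)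
    (hb : ∀ θ ∈ 𝔖.Θ, BddObs 𝔖 f (F f θ)) {ε : ℝ} (hε : 0 < ε) :
    ∀ᶠ q in whp μ, ∀ θ ∈ 𝔖.Θ, |fitAvg T Y X fold learn F θ q -
      ∫ o, F f θ o ∂(𝔖.law ⟨θ₀, f, μ.map (X 0)⟩)| ≤ ε := by
  obtain ⟨L, hL0, hL⟩ := hF
  have h := hc.model
  obtain ⟨ρ, hρ0, hρ1, hρ⟩ : ∃ ρ, 0 < ρ ∧ ρ ≤ 1 ∧ L * ρ ≤ ε / 4 := by
    refine ⟨min 1 (ε / (4 * (L + 1))), lt_min one_pos (by positivity), min_le_left _ _, ?_⟩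
    calc L * min 1 (ε / (4 * (L + 1))) ≤ (L + 1) * (ε / (4 * (L + 1))) :=
          mul_le_mul (by linarith) (min_le_right _ _) (le_min zero_le_one (by positivity))
            (by positivity)
      _ = ε / 4 := by field_simp
  -- A finite net of mesh `ρ` of the parameter set, at whose points the law of large numbers is
  -- applied.
  obtain ⟨s, hsΘ, hsf, hs⟩ := h.compact.finite_cover_balls hρ0
  have hlln : ∀ᶠ q in whp μ, ∀ θ ∈ s, |(q.1 : ℝ)⁻¹ * ∑ i : Fin q.1, F f θ (obs T Y X i q.2) -
      ∫ o, F f θ o ∂(𝔖.law ⟨θ₀, f, μ.map (X 0)⟩)| < ε / 4 := by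
    refine (eventually_all_finite hsf).2 fun θ hθ => ?_
    have := (hc.sample.tendsto_average h (hb θ (hsΘ hθ)))
    simpa [Real.dist_eq] using Metric.tendsto_nhds.1 this (ε / 4) (by positivity)
  filter_upwards [hlln, hc.eventually_good hρ0 hρ1] with q hq1 hq2 θ hθ
  obtain ⟨θ', hθ', hd⟩ := Set.mem_iUnion₂.1 (hs hθ)
  have hd' : L * ‖θ - θ'‖ ≤ ε / 4 :=
    (mul_le_mul_of_nonneg_left (mem_ball_iff_norm.1 hd).le hL0).trans hρ
  have h1 : |fitAvg T Y X fold learn F θ q -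
      (q.1 : ℝ)⁻¹ * ∑ i : Fin q.1, F f θ' (obs T Y X i q.2)| ≤ ε / 4 + ε / 4 := by
    rw [fitAvg, ← mul_sub, ← Finset.sum_sub_distrib]
    refine abs_average_le (by positivity) fun i => ?_
    have k1 := hL.near (obs T Y X i q.2, _, ρ) ⟨hq2.1 i, hq2.2 i⟩ θ hθ
    have k2 := hL.lip (obs T Y X i q.2, f, 0) ⟨hq2.1 i, h.adm_self⟩ θ hθ θ' (hsΘ hθ')
    refine (abs_sub_le _ (F f θ (obs T Y X i q.2)) _).trans ?_
    exact add_le_add (k1.trans hρ) (k2.trans hd')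
  have h2 := hc.abs_integral_sub_le hL hb (hsΘ hθ') hθ
  rw [norm_sub_rev] at h2
  have h3 := abs_sub_le (fitAvg T Y X fold learn F θ q)
    ((q.1 : ℝ)⁻¹ * ∑ i : Fin q.1, F f θ' (obs T Y X i q.2))
    (∫ o, F f θ o ∂(𝔖.law ⟨θ₀, f, μ.map (X 0)⟩))
  have h4 := abs_sub_le ((q.1 : ℝ)⁻¹ * ∑ i : Fin q.1, F f θ' (obs T Y X i q.2))
    (∫ o, F f θ' o ∂(𝔖.law ⟨θ₀, f, μ.map (X 0)⟩)) (∫ o, F f θ o ∂(𝔖.law ⟨θ₀, f, μ.map (X 0)⟩))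
  linarith [(hq1 θ' hθ').le]

end CrossFit
end ATTSetup

/-! ### Consistency and first-order expansion -/

namespace ATTSetup

variable {d dU dZ : ℕ} {𝔖 : ATTSetup d dU dZ} {f : Fin 2 → ℝ → Cov dU dZ → ℝ}
  {θ₀ : EuclideanSpace ℝ (Fin d)} {c C : ℝ}
  {Ω : Type*} [MeasurableSpace Ω] {μ : Measure Ω} [IsProbabilityMeasure μ]
  {T : ℕ → Ω → Fin 2} {Y : Fin 2 → ℕ → Ω → ℝ} {X : ℕ → Ω → Cov dU dZ}
  {Kf : ℕ} {fold : ∀ n : ℕ, Ω → Fin n → Fin Kf} {learn : Learner dU dZ}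
  {θhat : ℕ → Ω → EuclideanSpace ℝ (Fin d)}

/-- A function of the covariates, the nuisances and the parameter that is smooth in the parameter,
Lipschitz in the nuisances, and measurable. -/
structure CovStat (𝔖 : ATTSetup d dU dZ) (f : Nuis dU dZ) (θ₀ : EuclideanSpace ℝ (Fin d))
    (a : Nuis dU dZ → EuclideanSpace ℝ (Fin d) → Cov dU dZ → ℝ) : Prop where
  jet : ∃ G, CovJet 𝔖 f θ₀ a G
  meas : ∀ {P : Type} [MeasurableSpace P] {g : P → Nuis dU dZ},
    (∀ t, Measurable fun r : P × ℝ × Cov dU dZ => g r.1 t r.2.1 r.2.2) → ∀ θ ∈ 𝔖.Θ,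
      RegularModel.JointMeas 𝔖 fun p x => a (g p) θ x

namespace RegularModel

lemma covStat_ratioA (h : RegularModel 𝔖 f θ₀ c C) (j : Fin d) : CovStat 𝔖 f θ₀ (𝔖.ratioA j) :=
  ⟨h.covJet_ratioA j, fun hg _ hθ => h.jointMeas_ratioA hg hθ j⟩

lemma covStat_ratioV (h : RegularModel 𝔖 f θ₀ c C) (Δ : ℝ) : CovStat 𝔖 f θ₀ (𝔖.ratioV Δ) :=
  ⟨h.covJet_ratioV Δ, fun hg _ hθ => h.jointMeas_ratioV hg measurable_const (fun _ => hθ) Δ⟩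

lemma covStat_w_div_B (h : RegularModel 𝔖 f θ₀ c C) :
    CovStat 𝔖 f θ₀ (fun g θ x => 𝔖.w g θ x / 𝔖.B g θ x) :=
  ⟨h.covJet_w_div_B, fun hg _ hθ => h.jointMeas_w_div_B hg measurable_const fun _ => hθ⟩

end RegularModel

namespace CovStat

variable {a : Nuis dU dZ → EuclideanSpace ℝ (Fin d) → Cov dU dZ → ℝ}

lemma jointMeas_self (ha : CovStat 𝔖 f θ₀ a) (h : RegularModel 𝔖 f θ₀ c C)
    {θ : EuclideanSpace ℝ (Fin d)} (hθ : θ ∈ 𝔖.Θ) :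
    RegularModel.JointMeas 𝔖 fun (_ : Unit) x => a f θ x :=
  ha.meas (P := Unit) (g := fun _ => f) (fun t => (h.measurable_f t).comp measurable_snd) θ hθ

lemma bddObs (ha : CovStat 𝔖 f θ₀ a) (h : RegularModel 𝔖 f θ₀ c C)
    {θ : EuclideanSpace ℝ (Fin d)} (hθ : θ ∈ 𝔖.Θ) : BddObs 𝔖 f fun o => a f θ o.2.2 :=
  let ⟨_, hG⟩ := ha.jet
  .of_cov h hG hθ (ha.jointMeas_self h hθ)

lemma bddObs_grad (ha : CovStat 𝔖 f θ₀ a) (h : RegularModel 𝔖 f θ₀ c C)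
    {G : Cov dU dZ × Nuis dU dZ × ℝ → Fin d → ℝ} (hG : CovJet 𝔖 f θ₀ a G) (l : Fin d) :
    BddObs 𝔖 f fun o => G (o.2.2, f, 0) l := by
  have h1 : Jet 𝔖.Θ θ₀ (goodX 𝔖 f) id (fun _ => 0) (fun x θ => a f θ x) fun x => G (x, f, 0) :=
    hG.comp (fun x => (x, f, 0)) (fun x hx => ⟨hx, h.adm_self⟩) (fun _ _ => rfl) (fun _ _ => rfl)
      fun _ _ => le_rfl
  have h2 := h1.measurable_grad h.interior (fun θ hθ => by
    have h3 := (ha.jointMeas_self h hθ).measurable.indicator h.measurableSet_goodX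
    refine measurable_of_eq h3 fun x => ?_
    by_cases hx : x ∈ goodX 𝔖 f
    · rw [Set.indicator_of_mem hx, Set.indicator_of_mem hx, Set.indicator_of_mem hx.1]
    · rw [Set.indicator_of_notMem hx, Set.indicator_of_notMem hx]) l
  obtain ⟨L, hL0, hL⟩ := h1
  refine BddObs.congr (k := fun o => (goodX 𝔖 f).indicator (fun x => G (x, f, 0) l) o.2.2)
    (.of_measurable h (h2.comp (measurable_snd.comp measurable_snd)) (D := L) fun o ho => ?_)
    fun o ho => ?_
  · rw [Set.indicator_of_mem ho.2]
    exact hL.grad_bdd _ ho.2 l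
  · rw [Set.indicator_of_mem ho.2]

end CovStat

namespace CrossFit

/-- The estimator of `θ` is consistent. -/
lemma tendsto_theta (hc : CrossFit 𝔖 f θ₀ c C μ T Y X fold learn)
    (hr : 𝔖.Regularity f θ₀ μ T Y X) (hθ : 𝔖.IsEfficientTheta μ T Y X fold learn θhat) :
    Tendsto (fun q : ℕ × Ω => θhat q.1 q.2) (whp μ) (𝓝 θ₀) := by
  have h := hc.model
  set m := fun (j : Fin d) θ => ∫ o, 𝔖.Seff f θ o j ∂(𝔖.law ⟨θ₀, f, μ.map (X 0)⟩) with hm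
  have hjet : ∀ j, ∃ G, ObsJet 𝔖 f θ₀ (fun g θ o => 𝔖.Seff g θ o j) G := fun j =>
    let ⟨_, hG⟩ := h.covJet_ratioA j
    ⟨_, h.obsJet_resid_mul hG⟩
  have hb : ∀ j, ∀ θ ∈ 𝔖.Θ, BddObs 𝔖 f fun o => 𝔖.Seff f θ o j :=
    fun j θ hθ => h.bddObs_Seff hθ j
  have hcont : ContinuousOn (fun θ => ∑ j, |m j θ|) 𝔖.Θ :=
    continuousOn_finsetSum _ fun j _ =>
      (let ⟨_, hG⟩ := hjet j; hc.continuousOn_integral hG (hb j)).abs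
  have huni : ∀ ε > 0, ∀ᶠ q in whp μ, ∀ j, |m j (θhat q.1 q.2)| ≤ ε := fun ε hε => by
    have hsol : ∀ᶠ q in whp μ, ∀ j, fitAvg T Y X fold learn (fun g θ o => 𝔖.Seff g θ o j)
        (θhat q.1 q.2) q = 0 := hθ.solves
    filter_upwards [hsol, eventually_all.2 fun j =>
      let ⟨_, hG⟩ := hjet j; hc.eventually_abs_fitAvg_sub_le hG (hb j) hε] with q h1 h2 j
    have h3 := h2 j _ (hθ.mem q.1 q.2)
    rwa [h1 j, zero_sub, abs_neg] at h3
  refine tendsto_nhds.2 fun U hU hθU => ?_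
  rcases (𝔖.Θ \ U).eq_empty_or_nonempty with he | hne
  · refine Eventually.of_forall fun q => ?_
    by_contra hn
    have : θhat q.1 q.2 ∈ 𝔖.Θ \ U := ⟨hθ.mem _ _, hn⟩
    simp [he] at this
  -- Off the neighbourhood `U` the mean score is bounded away from zero, by compactness and
  -- identification, whereas at the estimator it tends to zero.
  obtain ⟨θ₁, hθ₁, hmin⟩ := (h.compact.diff hU).exists_isMinOn hne (hcont.mono Set.sdiff_subset)
  have hpos : 0 < ∑ j, |m j θ₁| := by
    by_contra hn
    have h0 : ∀ j, m j θ₁ = 0 := fun j => by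
      have := Finset.single_le_sum (f := fun j => |m j θ₁|) (fun _ _ => abs_nonneg _)
        (Finset.mem_univ j)
      exact abs_eq_zero.1 (le_antisymm (this.trans (not_lt.1 hn)) (abs_nonneg _))
    have h1 := hr.identified θ₁ hθ₁.1 fun j => by
      rw [hc.sample.integral_obs h (hb j θ₁ hθ₁.1)]
      exact h0 j
    exact hθ₁.2 (h1 ▸ hθU)
  filter_upwards [huni ((∑ j, |m j θ₁|) / (d + 1)) (by positivity)] with q hq
  by_contra hn
  have h1 : ∑ j, |m j θ₁| ≤ ∑ j, |m j (θhat q.1 q.2)| :=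
    isMinOn_iff.1 hmin _ ⟨hθ.mem _ _, hn⟩
  have h2 := Finset.sum_le_sum fun j (_ : j ∈ Finset.univ) => hq j
  rw [Finset.sum_const, Finset.card_univ, Fintype.card_fin, nsmul_eq_mul] at h2
  have h3 : (d : ℝ) * ((∑ j, |m j θ₁|) / (d + 1)) < ∑ j, |m j θ₁| := by
    rw [mul_div_assoc', div_lt_iff₀ (by positivity)]
    nlinarith
  linarith

/-- First-order expansion of a cross-fitted average at a consistent estimator. The hypothesis
`hcross` says that estimating the nuisances has no first-order effect at the true parameter. -/
lemma isLittleO_expand (hc : CrossFit 𝔖 f θ₀ c C μ T Y X fold learn)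
    (hmem : ∀ n ω, θhat n ω ∈ 𝔖.Θ)
    (hθ : Tendsto (fun q : ℕ × Ω => θhat q.1 q.2) (whp μ) (𝓝 θ₀))
    {F : Nuis dU dZ → EuclideanSpace ℝ (Fin d) → Obs dU dZ → ℝ}
    {G : Obs dU dZ × Nuis dU dZ × ℝ → Fin d → ℝ} (hF : ObsJet 𝔖 f θ₀ F G)
    (hG : ∀ l, BddObs 𝔖 f fun o => G (o, f, 0) l)
    (hcross : Tendsto (fun q : ℕ × Ω => √(q.1 : ℝ) * (fitAvg T Y X fold learn F θ₀ q -
      (q.1 : ℝ)⁻¹ * ∑ i : Fin q.1, F f θ₀ (obs T Y X i q.2))) (whp μ) (𝓝 0)) :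
    (fun q : ℕ × Ω => √(q.1 : ℝ) * (fitAvg T Y X fold learn F (θhat q.1 q.2) q -
      (q.1 : ℝ)⁻¹ * ∑ i : Fin q.1, F f θ₀ (obs T Y X i q.2)) -
      ∑ l, (∫ o, G (o, f, 0) l ∂(𝔖.law ⟨θ₀, f, μ.map (X 0)⟩)) *
        (√(q.1 : ℝ) * (θhat q.1 q.2 l - θ₀ l))) =o[whp μ]
      fun q => 1 + √(q.1 : ℝ) * ‖θhat q.1 q.2 - θ₀‖ := by
  obtain ⟨L, hL0, hL⟩ := hF
  have h := hc.model
  refine Asymptotics.isLittleO_iff.2 fun ε hε => ?_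
  obtain ⟨ρ, hρ0, hρ1, hρ⟩ : ∃ ρ, 0 < ρ ∧ ρ ≤ 1 ∧ L * ρ * (1 + d) ≤ ε / 2 := by
    refine ⟨min 1 (ε / (2 * (L + 1) * (1 + d))), lt_min one_pos (by positivity), min_le_left _ _, ?_⟩
    calc L * min 1 (ε / (2 * (L + 1) * (1 + d))) * (1 + d) ≤
          (L + 1) * (ε / (2 * (L + 1) * (1 + d))) * (1 + d) :=
          mul_le_mul_of_nonneg_right (mul_le_mul (by linarith) (min_le_right _ _)
            (le_min zero_le_one (by positivity)) (by positivity)) (by positivity)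
      _ = ε / 2 := by field_simp
  have hη : 0 < ε / (2 * (1 + d)) := by positivity
  have e1 := hθ.eventually (Metric.ball_mem_nhds θ₀ hρ0)
  have e2 : ∀ᶠ q in whp μ, ∀ l, |(q.1 : ℝ)⁻¹ * ∑ i : Fin q.1, G (obs T Y X i q.2, f, 0) l -
      ∫ o, G (o, f, 0) l ∂(𝔖.law ⟨θ₀, f, μ.map (X 0)⟩)| < ε / (2 * (1 + d)) :=
    eventually_all.2 fun l => by
      simpa [Real.dist_eq] using
        Metric.tendsto_nhds.1 (hc.sample.tendsto_average h (hG l)) _ hη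
  have e3 := Metric.tendsto_nhds.1 hcross ε hε
  filter_upwards [e1, e2, e3, hc.eventually_good hρ0 hρ1] with q h1 h2 h3 h4
  rw [Real.dist_eq, sub_zero] at h3
  set u := θhat q.1 q.2 - θ₀ with hu
  have hu1 : ‖u‖ ≤ ρ := (mem_ball_iff_norm.1 h1).le
  have hul : ∀ l, |θhat q.1 q.2 l - θ₀ l| ≤ ‖u‖ := fun l => PiLp.norm_apply_le u l
  have hsum : ∀ b : Fin d → ℝ, ∀ B, (∀ l, |b l| ≤ B) →
      |∑ l, b l * (θhat q.1 q.2 l - θ₀ l)| ≤ d * (B * ‖u‖) := fun b B hb => by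
    refine (Finset.abs_sum_le_sum_abs _ _).trans ((Finset.sum_le_sum fun l _ => ?_).trans_eq
      (by rw [Finset.sum_const, Finset.card_univ, Fintype.card_fin, nsmul_eq_mul]))
    rw [abs_mul]
    exact mul_le_mul (hb l) (hul l) (abs_nonneg _) ((abs_nonneg _).trans (hb l))
  -- Taylor expansion of each summand; the gradient at the estimated nuisances is within `L * ρ` of
  -- the gradient at the true ones.
  have k1 : |fitAvg T Y X fold learn F (θhat q.1 q.2) q - fitAvg T Y X fold learn F θ₀ q -
      ∑ l, (q.1 : ℝ)⁻¹ * (∑ i : Fin q.1, G (obs T Y X i q.2, f, 0) l) *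
        (θhat q.1 q.2 l - θ₀ l)| ≤ ε / 2 * ‖u‖ := by
    have e : fitAvg T Y X fold learn F (θhat q.1 q.2) q - fitAvg T Y X fold learn F θ₀ q -
        ∑ l, (q.1 : ℝ)⁻¹ * (∑ i : Fin q.1, G (obs T Y X i q.2, f, 0) l) *
          (θhat q.1 q.2 l - θ₀ l) = (q.1 : ℝ)⁻¹ * ∑ i : Fin q.1,
        (F (foldNuis T Y X fold learn q i) (θhat q.1 q.2) (obs T Y X i q.2) -
          F (foldNuis T Y X fold learn q i) θ₀ (obs T Y X i q.2) -
          ∑ l, G (obs T Y X i q.2, f, 0) l * (θhat q.1 q.2 l - θ₀ l)) := by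
      have e0 : ∑ l, (q.1 : ℝ)⁻¹ * (∑ i : Fin q.1, G (obs T Y X i q.2, f, 0) l) *
          (θhat q.1 q.2 l - θ₀ l) = (q.1 : ℝ)⁻¹ * ∑ i : Fin q.1,
            ∑ l, G (obs T Y X i q.2, f, 0) l * (θhat q.1 q.2 l - θ₀ l) := by
        rw [Finset.sum_comm, Finset.mul_sum]
        exact Finset.sum_congr rfl fun l _ => by rw [mul_assoc, Finset.sum_mul]
      rw [e0, fitAvg, fitAvg, ← mul_sub, ← mul_sub, ← Finset.sum_sub_distrib,
        ← Finset.sum_sub_distrib]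
    rw [e]
    refine abs_average_le (by positivity) fun i => ?_
    have hk : ((obs T Y X i q.2, foldNuis T Y X fold learn q i, ρ) :
        Obs dU dZ × Nuis dU dZ × ℝ) ∈ {k : Obs dU dZ × Nuis dU dZ × ℝ |
          k.1 ∈ goodObs 𝔖 f ∧ Adm 𝔖 f k.2.1 k.2.2} := ⟨h4.1 i, h4.2 i⟩
    have k2 := hL.expand _ hk _ (hmem q.1 q.2)
    have k3 := hsum (fun l => G (obs T Y X i q.2, foldNuis T Y X fold learn q i, ρ) l -
      G (obs T Y X i q.2, f, 0) l) (L * ρ) fun l => hL.grad_near _ hk l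
    simp only [sub_mul, Finset.sum_sub_distrib] at k3
    have k4 : L * ‖u‖ ^ 2 ≤ L * ρ * ‖u‖ := by
      rw [sq, ← mul_assoc]
      exact mul_le_mul_of_nonneg_right (mul_le_mul_of_nonneg_left hu1 hL0) (norm_nonneg _)
    have k5 : L * ρ * (1 + d) * ‖u‖ ≤ ε / 2 * ‖u‖ := mul_le_mul_of_nonneg_right hρ (norm_nonneg _)
    have k6 := (abs_add_le _ _).trans (add_le_add (k2.trans k4) k3)
    refine (le_of_eq ?_).trans (k6.trans ((le_of_eq (by ring)).trans k5))
    congr 1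
    simp only
    ring
  -- The average gradient is replaced by its mean, by the law of large numbers.
  have k2 := hsum (fun l => (q.1 : ℝ)⁻¹ * (∑ i : Fin q.1, G (obs T Y X i q.2, f, 0) l) -
    ∫ o, G (o, f, 0) l ∂(𝔖.law ⟨θ₀, f, μ.map (X 0)⟩)) _ fun l => (h2 l).le
  simp only [sub_mul, Finset.sum_sub_distrib] at k2
  have k3 : d * (ε / (2 * (1 + d)) * ‖u‖) ≤ ε / 2 * ‖u‖ := by
    have : (d : ℝ) * (ε / (2 * (1 + d))) ≤ ε / 2 := by
      rw [mul_div_assoc', div_le_div_iff₀ (by positivity) (by positivity)]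
      nlinarith
    rw [← mul_assoc]
    exact mul_le_mul_of_nonneg_right this (norm_nonneg _)
  have k4 := mul_le_mul_of_nonneg_left ((abs_add_le _ _).trans (add_le_add k1 (k2.trans k3)))
    (Real.sqrt_nonneg (q.1 : ℝ))
  rw [← abs_of_nonneg (Real.sqrt_nonneg (q.1 : ℝ)), ← abs_mul,
    abs_of_nonneg (Real.sqrt_nonneg (q.1 : ℝ))] at k4
  have k5 := (abs_add_le _ _).trans (add_le_add k4 h3.le)
  rw [Real.norm_eq_abs, Real.norm_eq_abs, abs_of_nonneg (by positivity :
    0 ≤ 1 + √(q.1 : ℝ) * ‖u‖)]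
  refine (le_of_eq ?_).trans (k5.trans (le_of_eq (by ring)))
  congr 1
  simp only [mul_left_comm _ (√(q.1 : ℝ)), ← Finset.mul_sum]
  ring

end CrossFit
end ATTSetup

/-! ### Cross-fitted averages of residuals -/

namespace ATTSetup

variable {d dU dZ : ℕ} {𝔖 : ATTSetup d dU dZ} {f : Fin 2 → ℝ → Cov dU dZ → ℝ}
  {θ₀ : EuclideanSpace ℝ (Fin d)} {c C : ℝ}
  {Ω : Type*} [MeasurableSpace Ω] {μ : Measure Ω} [IsProbabilityMeasure μ]
  {T : ℕ → Ω → Fin 2} {Y : Fin 2 → ℕ → Ω → ℝ} {X : ℕ → Ω → Cov dU dZ}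
  {Kf : ℕ} {fold : ∀ n : ℕ, Ω → Fin n → Fin Kf} {learn : Learner dU dZ}
  {θhat : ℕ → Ω → EuclideanSpace ℝ (Fin d)}

namespace CrossFit

variable {a : Nuis dU dZ → EuclideanSpace ℝ (Fin d) → Cov dU dZ → ℝ}

/-- Both sides vanish for `n = 0`. -/
lemma inv_sqrt_eq (n : ℕ) : (√(n : ℝ))⁻¹ = √(n : ℝ) * (n : ℝ)⁻¹ := by
  rcases Nat.eq_zero_or_pos n with rfl | hn
  · simp
  · have : (0 : ℝ) < n := by exact_mod_cast hn
    have h2 := Real.sqrt_pos.2 this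
    field_simp
    rw [Real.sq_sqrt this.le]

/-- The residual is conditionally centred given the covariates, so that estimating a function of
the covariates by which it is multiplied has no first-order effect. -/
lemma tendsto_cross_resid_mul (hc : CrossFit 𝔖 f θ₀ c C μ T Y X fold learn)
    (ha : CovStat 𝔖 f θ₀ a) :
    Tendsto (fun q : ℕ × Ω => √(q.1 : ℝ) *
      (fitAvg T Y X fold learn (fun g θ o => 𝔖.resid θ o * a g θ o.2.2) θ₀ q -
        (q.1 : ℝ)⁻¹ * ∑ i : Fin q.1, 𝔖.resid θ₀ (obs T Y X i q.2) *
          a f θ₀ (obs T Y X i q.2).2.2)) (whp μ) (𝓝 0) := by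
  have h := hc.model
  have hq := hc.sample.isParam h
  obtain ⟨G, L, hL0, hL⟩ := ha.jet
  obtain ⟨R, hR, ⟨D, hD0, hD⟩, hRe⟩ := (h.bddObs_resid h.theta_mem).exists_measurable
  -- The averages of the residual times a function of the covariates are centred.
  have hR0 : ∀ (ψ : Cov dU dZ → ℝ) (B : ℝ), Measurable ψ → (∀ x, |ψ x| ≤ B) →
      ∫ o, R o * ψ o.2.2 ∂(μ.map (obs T Y X 0)) = 0 := fun ψ B hψ hB => by
    have hb : BddObs 𝔖 f fun o => ψ o.2.2 :=
      .of_measurable h (hψ.comp (measurable_snd.comp measurable_snd)) fun o _ => hB _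
    rw [hc.sample.map_obs h, ← h.integral_resid_mul_cov hq hb]
    refine integral_congr_ae ((h.ae_law_goodObs hq).mono fun o ho => ?_)
    simp only [hRe o ho]
  have hm : ∀ n (S : Finset (Fin n)), Measurable fun s : (S → Obs dU dZ) × Cov dU dZ =>
      𝔖.𝒳.indicator (fun x => a (fun t y x => learn n t S s.1 y x) θ₀ x - a f θ₀ x) s.2 := by
    intro n S
    have h1 := ha.meas (P := S → Obs dU dZ) (g := fun w t y x => learn n t S w y x)
      (fun t => hc.learner n t S) θ₀ h.theta_mem
    have h2 := (ha.jointMeas_self h h.theta_mem).measurable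
    refine measurable_of_eq (h1.sub (h2.comp measurable_snd)) fun s => ?_
    by_cases hx : s.2 ∈ 𝔖.𝒳 <;> simp [hx]
  have key := tendsto_crossfit_whp (W := obs T Y X) (μ := μ) hc.sample.measurable_obs
    hc.sample.iIndepFun_obs hc.sample.identDistrib_obs hc.part.measurable hc.part.indep
    (x := fun o : Obs dU dZ => o.2.2) (measurable_snd.comp measurable_snd) hR hD hR0 hm
    fun ε hε => by
      obtain ⟨δ, hδ0, hδ1, hδ⟩ : ∃ δ, 0 < δ ∧ δ ≤ 1 ∧ L * δ ≤ ε := by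
        refine ⟨min 1 (ε / (L + 1)), lt_min one_pos (by positivity), min_le_left _ _, ?_⟩
        calc L * min 1 (ε / (L + 1)) ≤ (L + 1) * (ε / (L + 1)) :=
              mul_le_mul (by linarith) (min_le_right _ _) (le_min zero_le_one (by positivity))
                (by positivity)
          _ = ε := by field_simp
      filter_upwards [hc.eventually_good hδ0 hδ1] with q hq i
      have hx := (hq.1 i).2
      rw [Set.indicator_of_mem hx.1]
      exact (hL.near (_, foldNuis T Y X fold learn q i, δ) ⟨hx, hq.2 i⟩ θ₀ h.theta_mem).trans hδ
  refine key.congr' ?_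
  filter_upwards [hc.eventually_good one_pos le_rfl] with q hq
  rw [inv_sqrt_eq, mul_assoc, fitAvg, ← mul_sub, ← Finset.sum_sub_distrib]
  congr 2
  refine Finset.sum_congr rfl fun i _ => ?_
  rw [Set.indicator_of_mem (hq.1 i).2.1, hRe _ (hq.1 i), ← mul_sub]
  rfl

/-- Expansion of the cross-fitted averages of the residual times a function of the covariates. -/
lemma isLittleO_resid_mul (hc : CrossFit 𝔖 f θ₀ c C μ T Y X fold learn)
    (hmem : ∀ n ω, θhat n ω ∈ 𝔖.Θ)
    (hθ : Tendsto (fun q : ℕ × Ω => θhat q.1 q.2) (whp μ) (𝓝 θ₀)) (ha : CovStat 𝔖 f θ₀ a) :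
    (fun q : ℕ × Ω => √(q.1 : ℝ) *
      (fitAvg T Y X fold learn (fun g θ o => 𝔖.resid θ o * a g θ o.2.2) (θhat q.1 q.2) q -
        (q.1 : ℝ)⁻¹ * ∑ i : Fin q.1, 𝔖.resid θ₀ (obs T Y X i q.2) *
          a f θ₀ (obs T Y X i q.2).2.2) +
      ∑ l, (∫ o, a f θ₀ o.2.2 * 𝔖.A f θ₀ o.2.2 l ∂(𝔖.law ⟨θ₀, f, μ.map (X 0)⟩)) *
        (√(q.1 : ℝ) * (θhat q.1 q.2 l - θ₀ l))) =o[whp μ]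
      fun q => 1 + √(q.1 : ℝ) * ‖θhat q.1 q.2 - θ₀‖ := by
  have h := hc.model
  have hq := hc.sample.isParam h
  obtain ⟨G, hG⟩ := ha.jet
  have hb := ha.bddObs h h.theta_mem
  have hg := fun l => (h.bddObs_resid h.theta_mem).mul (ha.bddObs_grad h hG l)
  have hr := fun l => hb.mul (h.bddObs_gradResid l)
  have key := hc.isLittleO_expand hmem hθ (h.obsJet_resid_mul hG) (fun l => (hg l).add (hr l))
    (hc.tendsto_cross_resid_mul ha)
  -- The gradient of `a` does not contribute, as it is multiplied by the centred residual.
  have e : ∀ l, ∫ o, (𝔖.resid θ₀ o * G (o.2.2, f, 0) l + a f θ₀ o.2.2 * 𝔖.gradResid θ₀ o l)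
      ∂(𝔖.law ⟨θ₀, f, μ.map (X 0)⟩) =
      -∫ o, a f θ₀ o.2.2 * 𝔖.A f θ₀ o.2.2 l ∂(𝔖.law ⟨θ₀, f, μ.map (X 0)⟩) := fun l => by
    rw [integral_add (h.integrable_bddObs hq (hg l)) (h.integrable_bddObs hq (hr l)),
      h.integral_resid_mul_cov hq (a := fun x => G (x, f, 0) l) (ha.bddObs_grad h hG l), zero_add,
      h.integral_cov_mul_gradResid hq hb]
  refine key.congr_left fun q => ?_
  simp only [e, neg_mul, Finset.sum_neg_distrib, sub_neg_eq_add]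

/-- The numerator of `Δalt` involves no nuisances, so only the change of the parameter enters its
expansion. -/
lemma isLittleO_altNum (hc : CrossFit 𝔖 f θ₀ c C μ T Y X fold learn)
    (hmem : ∀ n ω, θhat n ω ∈ 𝔖.Θ)
    (hθ : Tendsto (fun q : ℕ × Ω => θhat q.1 q.2) (whp μ) (𝓝 θ₀)) :
    (fun q : ℕ × Ω => √(q.1 : ℝ) *
      (fitAvg T Y X fold learn (fun _ θ o => 𝔖.altNum θ o) (θhat q.1 q.2) q -
        (q.1 : ℝ)⁻¹ * ∑ i : Fin q.1, 𝔖.altNum θ₀ (obs T Y X i q.2)) +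
      ∑ l, 𝔖.Q μ (Y 0 0) (X 0) θ₀ l * (√(q.1 : ℝ) * (θhat q.1 q.2 l - θ₀ l))) =o[whp μ]
      fun q => 1 + √(q.1 : ℝ) * ‖θhat q.1 q.2 - θ₀‖ := by
  have h := hc.model
  have key := hc.isLittleO_expand hmem hθ h.obsJet_altNum
    (fun l => h.bddObs_outcome.mul (h.bddObs_gradResid l))
    (by simp only [fitAvg, sub_self, mul_zero]; exact tendsto_const_nhds)
  refine key.congr_left fun q => ?_
  simp only [hc.sample.integral_outcome_gradResid h, neg_mul, Finset.sum_neg_distrib,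
    sub_neg_eq_add]

end CrossFit

/-- Normalized sums of a bounded function with mean zero are bounded in mean square. -/
lemma IsSample.exists_measurable_scaled (hs : 𝔖.IsSample f θ₀ μ T Y X)
    (h : RegularModel 𝔖 f θ₀ c C) {k : Obs dU dZ → ℝ} (hk : BddObs 𝔖 f k)
    (h0 : ∫ o, k o ∂(𝔖.law ⟨θ₀, f, μ.map (X 0)⟩) = 0) :
    ∃ B, ∀ n : ℕ, AEMeasurable (fun ω => √(n : ℝ) * ((n : ℝ)⁻¹ *
        ∑ i : Fin n, k (obs T Y X i ω))) μ ∧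
      ∫⁻ ω, ENNReal.ofReal ((√(n : ℝ) * ((n : ℝ)⁻¹ * ∑ i : Fin n, k (obs T Y X i ω))) ^ 2) ∂μ ≤
        ENNReal.ofReal B := by
  have hq := hs.isParam h
  obtain ⟨k', hm, ⟨D, hD0, hD⟩, hkk⟩ := hk.exists_measurable
  refine ⟨D ^ 2, fun n => ?_⟩
  have hsm : Measurable fun ω => ∑ i : Fin n, k' (obs T Y X i ω) :=
    Finset.measurable_sum _ fun i _ => hm.comp (hs.measurable_obs i)
  have hae : (fun ω => √(n : ℝ) * ((n : ℝ)⁻¹ * ∑ i : Fin n, k (obs T Y X i ω))) =ᵐ[μ]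
      fun ω => √(n : ℝ) * ((n : ℝ)⁻¹ * ∑ i : Fin n, k' (obs T Y X i ω)) := by
    filter_upwards [hs.ae_goodObs h] with ω hω
    simp only [hkk _ (hω _)]
  have h0' : ∫ o, k' o ∂(μ.map (obs T Y X 0)) = 0 := by
    rw [hs.map_obs h, ← h0]
    exact integral_congr_ae ((h.ae_law_goodObs hq).mono fun o ho => hkk o ho)
  -- The variance bound for cross-fitted sums, with an empty training set.
  have hvar := lintegral_sq_sum_compl_le hs.measurable_obs hs.iIndepFun_obs hs.identDistrib_obs
    (n := n) ∅ (g := fun r => k' r.2) (hm.comp measurable_snd) (fun r => hD r.2) fun _ => h0'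
  rw [Finset.compl_empty] at hvar
  refine ⟨⟨_, (hsm.const_mul _).const_mul _, hae⟩, ?_⟩
  have e : ∀ ω, (√(n : ℝ) * ((n : ℝ)⁻¹ * ∑ i : Fin n, k' (obs T Y X i ω))) ^ 2 =
      (n : ℝ)⁻¹ * (∑ i : Fin n, k' (obs T Y X i ω)) ^ 2 := fun ω => by
    rw [← mul_assoc, ← CrossFit.inv_sqrt_eq, mul_pow, inv_pow, Real.sq_sqrt (Nat.cast_nonneg n)]
  have hint : Integrable (fun ω => (n : ℝ)⁻¹ * (∑ i : Fin n, k' (obs T Y X i ω)) ^ 2) μ := by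
    refine Integrable.of_bound ((hsm.pow_const 2).const_mul _).aestronglyMeasurable
      ((n : ℝ)⁻¹ * (n * D) ^ 2) (ae_of_all _ fun ω => ?_)
    have h1 : |∑ i : Fin n, k' (obs T Y X i ω)| ≤ n * D :=
      (Finset.abs_sum_le_sum_abs _ _).trans ((Finset.sum_le_sum fun i _ => hD _).trans (by simp))
    rw [Real.norm_eq_abs, abs_mul, abs_pow, abs_inv, Nat.abs_cast]
    gcongr
  have hae2 : ∀ᵐ ω ∂μ, ENNReal.ofReal ((√(n : ℝ) * ((n : ℝ)⁻¹ *
      ∑ i : Fin n, k (obs T Y X i ω))) ^ 2) =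
      ENNReal.ofReal ((n : ℝ)⁻¹ * (∑ i : Fin n, k' (obs T Y X i ω)) ^ 2) := by
    filter_upwards [hae] with ω hω
    rw [hω, e]
  rw [lintegral_congr_ae hae2,
    ← ofReal_integral_eq_lintegral_ofReal hint (ae_of_all _ fun ω => by positivity),
    integral_const_mul]
  refine ENNReal.ofReal_le_ofReal ?_
  rcases Nat.eq_zero_or_pos n with rfl | hn
  · simp [sq_nonneg]
  · have : (0 : ℝ) < n := by exact_mod_cast hn
    rw [inv_mul_le_iff₀ this]
    exact hvar

end ATTSetup

/-! ### Root-`n` consistency -/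

namespace ATTSetup

variable {d dU dZ : ℕ} {𝔖 : ATTSetup d dU dZ} {f : Fin 2 → ℝ → Cov dU dZ → ℝ}
  {θ₀ : EuclideanSpace ℝ (Fin d)} {c C : ℝ}
  {Ω : Type*} [MeasurableSpace Ω] {μ : Measure Ω} [IsProbabilityMeasure μ]
  {T : ℕ → Ω → Fin 2} {Y : Fin 2 → ℕ → Ω → ℝ} {X : ℕ → Ω → Cov dU dZ}
  {Kf : ℕ} {fold : ∀ n : ℕ, Ω → Fin n → Fin Kf} {learn : Learner dU dZ}
  {θhat : ℕ → Ω → EuclideanSpace ℝ (Fin d)}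

/-- The normalized sum `n^{-1/2} ∑ k(W_i)`, at `q = (n, ω)`. -/
noncomputable def normSum (T : ℕ → Ω → Fin 2) (Y : Fin 2 → ℕ → Ω → ℝ) (X : ℕ → Ω → Cov dU dZ)
    (k : Obs dU dZ → ℝ) (q : ℕ × Ω) : ℝ :=
  √(q.1 : ℝ) * ((q.1 : ℝ)⁻¹ * ∑ i : Fin q.1, k (obs T Y X i q.2))

lemma normSum_add (k k' : Obs dU dZ → ℝ) (q : ℕ × Ω) :
    normSum T Y X (fun o => k o + k' o) q = normSum T Y X k q + normSum T Y X k' q := by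
  simp only [normSum, Finset.sum_add_distrib, mul_add]

lemma normSum_const_mul (r : ℝ) (k : Obs dU dZ → ℝ) (q : ℕ × Ω) :
    normSum T Y X (fun o => r * k o) q = r * normSum T Y X k q := by
  simp only [normSum, ← Finset.mul_sum]
  ring

lemma normSum_sum {ι : Type*} (s : Finset ι) (k : ι → Obs dU dZ → ℝ) (q : ℕ × Ω) :
    normSum T Y X (fun o => ∑ j ∈ s, k j o) q = ∑ j ∈ s, normSum T Y X (k j) q := by
  simp only [normSum]
  rw [Finset.sum_comm, Finset.mul_sum, Finset.mul_sum]

/-- A remainder that is of smaller order than normalized sums of mean-zero functions vanishes. -/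
lemma IsSample.tendsto_zero_of_isLittleO (hs : 𝔖.IsSample f θ₀ μ T Y X)
    (h : RegularModel 𝔖 f θ₀ c C) {ι : Type*} [Fintype ι] {k : ι → Obs dU dZ → ℝ}
    (hk : ∀ j, BddObs 𝔖 f (k j)) (h0 : ∀ j, ∫ o, k j o ∂(𝔖.law ⟨θ₀, f, μ.map (X 0)⟩) = 0)
    {V : ℕ × Ω → ℝ} (hV : V =o[whp μ] fun q => 1 + ∑ j, |normSum T Y X (k j) q|) :
    Tendsto V (whp μ) (𝓝 0) := by
  choose B hB using fun j => hs.exists_measurable_scaled h (hk j) (h0 j)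
  refine tendsto_zero_of_isLittleO_tight (Z := fun n ω => ∑ j, |normSum T Y X (k j) (n, ω)|)
    (B := ∑ j, Fintype.card ι * |B j|) (fun n => ?_) (fun n => ?_) (hV.congr_right fun q => ?_)
  · exact Finset.aemeasurable_fun_sum _ fun j _ => ((hB j n).1).abs
  · have h1 : ∀ ω, ENNReal.ofReal ((∑ j, |normSum T Y X (k j) (n, ω)|) ^ 2) ≤
        ∑ j, ENNReal.ofReal (Fintype.card ι) * ENNReal.ofReal (normSum T Y X (k j) (n, ω) ^ 2) := by
      intro ω
      have h2 := sq_sum_le_card_mul_sum_sq (s := Finset.univ)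
        (f := fun j => |normSum T Y X (k j) (n, ω)|)
      simp only [sq_abs, Finset.card_univ] at h2
      refine (ENNReal.ofReal_le_ofReal h2).trans (le_of_eq ?_)
      rw [ENNReal.ofReal_mul (Nat.cast_nonneg _),
        ENNReal.ofReal_sum_of_nonneg fun _ _ => sq_nonneg _, Finset.mul_sum]
    have hm : ∀ j, AEMeasurable (fun ω => ENNReal.ofReal (normSum T Y X (k j) (n, ω) ^ 2)) μ :=
      fun j => ((hB j n).1.pow_const 2).ennreal_ofReal
    refine (lintegral_mono h1).trans ?_
    rw [lintegral_finsetSum' _ fun j _ => (hm j).const_mul _,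
      ENNReal.ofReal_sum_of_nonneg fun _ _ => by positivity]
    refine Finset.sum_le_sum fun j _ => ?_
    rw [lintegral_const_mul'' _ (hm j), ENNReal.ofReal_mul (Nat.cast_nonneg _)]
    exact mul_le_mul_right ((hB j n).2.trans (ENNReal.ofReal_le_ofReal (le_abs_self _))) _
  · rw [abs_of_nonneg (Finset.sum_nonneg fun _ _ => abs_nonneg _)]

/-- If the denominator tends to `p` and the centred numerator is asymptotically linear with
influence function `p * ψ`, then the ratio is asymptotically linear with influence function `ψ`. -/
lemma IsSample.tendsto_ratio (hs : 𝔖.IsSample f θ₀ μ T Y X) (h : RegularModel 𝔖 f θ₀ c C)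
    {ψ : Obs dU dZ → ℝ} (hψ : BddObs 𝔖 f ψ)
    (h0 : ∫ o, ψ o ∂(𝔖.law ⟨θ₀, f, μ.map (X 0)⟩) = 0) {num den : ℕ × Ω → ℝ} {p Δ : ℝ}
    (hp : p ≠ 0) (hden : Tendsto den (whp μ) (𝓝 p))
    (hnum : Tendsto (fun q => √(q.1 : ℝ) * (num q - Δ * den q) - p * normSum T Y X ψ q) (whp μ)
      (𝓝 0)) :
    Tendsto (fun q => √(q.1 : ℝ) * (num q / den q - Δ) - normSum T Y X ψ q) (whp μ) (𝓝 0) := by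
  -- Replacing the denominator by its limit costs `o_p(1)` times the normalized sum, which is
  -- bounded in probability.
  have h1 : Tendsto (fun q => (p - den q) / den q * normSum T Y X ψ q) (whp μ) (𝓝 0) := by
    refine hs.tendsto_zero_of_isLittleO h (ι := Unit) (k := fun _ => ψ) (fun _ => hψ)
      (fun _ => h0) ?_
    have h2 : Tendsto (fun q => (p - den q) / den q) (whp μ) (𝓝 0) := by
      have h4 := ((tendsto_const_nhds (x := p)).sub hden).div hden hp
      rw [sub_self, zero_div] at h4
      exact h4
    have h3 : (fun q => normSum T Y X ψ q) =O[whp μ]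
        fun q => 1 + ∑ _j : Unit, |normSum T Y X ψ q| := by
      refine Asymptotics.isBigO_of_le _ fun q => ?_
      simp only [Finset.univ_unique, Finset.sum_const, Finset.card_singleton, one_smul,
        Real.norm_eq_abs]
      rw [abs_of_nonneg (by positivity : 0 ≤ 1 + |normSum T Y X ψ q|)]
      linarith
    simpa using ((Asymptotics.isLittleO_one_iff ℝ).2 h2).mul_isBigO h3
  have h2 := (hnum.div hden hp).add h1
  rw [zero_div, add_zero] at h2
  refine h2.congr' ?_
  filter_upwards [hden.eventually_ne hp] with q hq
  simp only [Pi.div_apply]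
  field_simp
  ring

namespace CrossFit

/-- The estimating equation, expanded. -/
lemma isLittleO_score (hc : CrossFit 𝔖 f θ₀ c C μ T Y X fold learn)
    (hr : 𝔖.Regularity f θ₀ μ T Y X) (hθ : 𝔖.IsEfficientTheta μ T Y X fold learn θhat) (l : Fin d) :
    (fun q : ℕ × Ω => √(q.1 : ℝ) * (θhat q.1 q.2 l - θ₀ l) - ∑ j,
      (𝔖.M f θ₀ (μ.map (X 0)))⁻¹ l j * normSum T Y X (fun o => 𝔖.Seff f θ₀ o j) q) =o[whp μ]
      fun q => 1 + √(q.1 : ℝ) * ‖θhat q.1 q.2 - θ₀‖ := by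
  have h := hc.model
  have hq := hc.sample.isParam h
  have hsol : ∀ᶠ q in whp μ, ∀ j, fitAvg T Y X fold learn (fun g θ o => 𝔖.Seff g θ o j)
      (θhat q.1 q.2) q = 0 := hθ.solves
  -- The Jacobian of the mean score at the truth is `-M`, and the average score at the estimator
  -- vanishes.
  have hj : ∀ j, (fun q : ℕ × Ω => (𝔖.M f θ₀ (μ.map (X 0)) *ᵥ
      fun l => √(q.1 : ℝ) * (θhat q.1 q.2 l - θ₀ l)) j -
      normSum T Y X (fun o => 𝔖.Seff f θ₀ o j) q) =o[whp μ]
        fun q => 1 + √(q.1 : ℝ) * ‖θhat q.1 q.2 - θ₀‖ := fun j => by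
    refine (hc.isLittleO_resid_mul hθ.mem (hc.tendsto_theta hr hθ) (h.covStat_ratioA j)).congr'
      ?_ EventuallyEq.rfl
    filter_upwards [hsol] with q h1
    have h2 : fitAvg T Y X fold learn (fun g θ o => 𝔖.resid θ o * 𝔖.ratioA j g θ o.2.2)
      (θhat q.1 q.2) q = 0 := h1 j
    simp only [h2, ← h.M_eq hq, Matrix.mulVec, dotProduct, normSum, Seff_eq]
    ring
  have hsum := Asymptotics.IsLittleO.sum (s := Finset.univ) fun j _ =>
    (hj j).const_mul_left ((𝔖.M f θ₀ (μ.map (X 0)))⁻¹ l j)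
  refine hsum.congr_left fun q => ?_
  have h1 : ((𝔖.M f θ₀ (μ.map (X 0)))⁻¹ *ᵥ (𝔖.M f θ₀ (μ.map (X 0)) *ᵥ
      fun l => √(q.1 : ℝ) * (θhat q.1 q.2 l - θ₀ l))) l =
      √(q.1 : ℝ) * (θhat q.1 q.2 l - θ₀ l) := by
    rw [Matrix.mulVec_mulVec, Matrix.nonsing_inv_mul _ hr.invertible, Matrix.one_mulVec]
  rw [Finset.sum_apply, ← h1, Matrix.mulVec, dotProduct, ← Finset.sum_sub_distrib]
  exact Finset.sum_congr rfl fun j _ => mul_sub _ _ _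

/-- The estimator of `θ` is root-`n` consistent: remainders of smaller order than
`1 + √n ‖θhat - θ₀‖` vanish. -/
lemma tendsto_of_isLittleO (hc : CrossFit 𝔖 f θ₀ c C μ T Y X fold learn)
    (hr : 𝔖.Regularity f θ₀ μ T Y X) (hθ : 𝔖.IsEfficientTheta μ T Y X fold learn θhat)
    {V : ℕ × Ω → ℝ} (hV : V =o[whp μ] fun q => 1 + √(q.1 : ℝ) * ‖θhat q.1 q.2 - θ₀‖) :
    Tendsto V (whp μ) (𝓝 0) := by
  have h := hc.model
  have hq := hc.sample.isParam h
  refine hc.sample.tendsto_zero_of_isLittleO h (k := fun j o => 𝔖.Seff f θ₀ o j)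
    (fun j => h.bddObs_Seff h.theta_mem j)
    (fun j => h.integral_resid_mul_cov hq (h.bddObs_ratioA h.theta_mem j))
    (hV.trans_isBigO ?_)
  obtain ⟨N, hN0, hN⟩ : ∃ N, 0 ≤ N ∧ ∀ l, ∀ j, |(𝔖.M f θ₀ (μ.map (X 0)))⁻¹ l j| ≤ N :=
    ⟨∑ l, ∑ j, |(𝔖.M f θ₀ (μ.map (X 0)))⁻¹ l j|, by positivity, fun l j =>
      (Finset.single_le_sum (f := fun j => |(𝔖.M f θ₀ (μ.map (X 0)))⁻¹ l j|)
        (fun _ _ => abs_nonneg _) (Finset.mem_univ j)).trans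
      (Finset.single_le_sum (f := fun l => ∑ j, |(𝔖.M f θ₀ (μ.map (X 0)))⁻¹ l j|)
        (fun _ _ => by positivity) (Finset.mem_univ l))⟩
  -- With the coefficient `1 / (2 * (d + 1))` in each of the `d` coordinates, the remainder amounts
  -- to at most half of `1 + √n ‖θhat - θ₀‖`, and the norm is absorbed into the left side.
  have hsmall : ∀ᶠ q in whp μ, ∀ l, _ :=
    eventually_all.2 fun l => Asymptotics.isLittleO_iff.1 (hc.isLittleO_score hr hθ l)
      (show (0 : ℝ) < 1 / (2 * (d + 1)) by positivity)
  refine Asymptotics.IsBigO.of_bound (2 * (1 + d * N)) ?_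
  filter_upwards [hsmall] with q hq1
  set S := ∑ j, |normSum T Y X (fun o => 𝔖.Seff f θ₀ o j) q| with hS
  have hS0 : 0 ≤ S := by positivity
  set W := √(q.1 : ℝ) * ‖θhat q.1 q.2 - θ₀‖ with hW
  have hW0 : 0 ≤ W := by positivity
  have h1 : ∀ l, |√(q.1 : ℝ) * (θhat q.1 q.2 l - θ₀ l)| ≤ N * S + 1 / (2 * (d + 1)) * (1 + W) := by
    intro l
    have h2 := hq1 l
    rw [Real.norm_eq_abs, Real.norm_eq_abs, abs_of_nonneg (by positivity : 0 ≤ 1 + W)] at h2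
    have h3 : |∑ j, (𝔖.M f θ₀ (μ.map (X 0)))⁻¹ l j *
        normSum T Y X (fun o => 𝔖.Seff f θ₀ o j) q| ≤ N * S := by
      rw [hS, Finset.mul_sum]
      refine (Finset.abs_sum_le_sum_abs _ _).trans (Finset.sum_le_sum fun j _ => ?_)
      rw [abs_mul]
      exact mul_le_mul_of_nonneg_right (hN l j) (abs_nonneg _)
    have h4 := abs_sub_abs_le_abs_sub (√(q.1 : ℝ) * (θhat q.1 q.2 l - θ₀ l))
      (∑ j, (𝔖.M f θ₀ (μ.map (X 0)))⁻¹ l j * normSum T Y X (fun o => 𝔖.Seff f θ₀ o j) q)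
    linarith
  have h2 : W ≤ ∑ l, |√(q.1 : ℝ) * (θhat q.1 q.2 l - θ₀ l)| := by
    have h3 : ‖θhat q.1 q.2 - θ₀‖ ≤ ∑ l, |θhat q.1 q.2 l - θ₀ l| := by
      rw [EuclideanSpace.norm_eq, Real.sqrt_le_left (by positivity)]
      simp only [PiLp.sub_apply, Real.norm_eq_abs]
      exact Finset.sum_sq_le_sq_sum_of_nonneg fun _ _ => abs_nonneg _
    simp only [abs_mul, abs_of_nonneg (Real.sqrt_nonneg _), ← Finset.mul_sum]
    exact mul_le_mul_of_nonneg_left h3 (Real.sqrt_nonneg _)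
  have h3 := h2.trans (Finset.sum_le_sum fun l _ => h1 l)
  rw [Finset.sum_const, Finset.card_univ, Fintype.card_fin, nsmul_eq_mul, mul_add] at h3
  have h4 : (d : ℝ) * (1 / (2 * (d + 1)) * (1 + W)) ≤ 1 / 2 * (1 + W) := by
    rw [← mul_assoc]
    refine mul_le_mul_of_nonneg_right ?_ (by positivity)
    rw [mul_one_div, div_le_div_iff₀ (by positivity) (by positivity)]
    nlinarith
  rw [Real.norm_eq_abs, Real.norm_eq_abs, abs_of_nonneg (by positivity : 0 ≤ 1 + W),
    abs_of_nonneg (by positivity : 0 ≤ 1 + S)]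
  have h5 : 0 ≤ (d : ℝ) * N := by positivity
  nlinarith

/-- Asymptotic linearity of linear functionals of the estimator of `θ`. -/
lemma tendsto_sum_mul_theta (hc : CrossFit 𝔖 f θ₀ c C μ T Y X fold learn)
    (hr : 𝔖.Regularity f θ₀ μ T Y X) (hθ : 𝔖.IsEfficientTheta μ T Y X fold learn θhat)
    (v : Fin d → ℝ) :
    Tendsto (fun q : ℕ × Ω => ∑ l, v l * (√(q.1 : ℝ) * (θhat q.1 q.2 l - θ₀ l)) -
      normSum T Y X (fun o => ∑ j, ((𝔖.M f θ₀ (μ.map (X 0)))⁻¹ *ᵥ v) j * 𝔖.Seff f θ₀ o j) q)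
      (whp μ) (𝓝 0) := by
  have h1 := Asymptotics.IsLittleO.sum (s := Finset.univ) fun l _ =>
    (hc.isLittleO_score hr hθ l).const_mul_left (v l)
  refine (hc.tendsto_of_isLittleO hr hθ h1).congr fun q => ?_
  have hM : ∀ i j, (𝔖.M f θ₀ (μ.map (X 0)))⁻¹ i j = (𝔖.M f θ₀ (μ.map (X 0)))⁻¹ j i := fun i j => by
    have := Matrix.transpose_nonsing_inv (𝔖.M f θ₀ (μ.map (X 0)))
    rw [RegularModel.transpose_M] at this
    exact (congr_fun (congr_fun this i) j).symm ▸ rfl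
  rw [Finset.sum_apply]
  simp only [mul_sub, Finset.sum_sub_distrib, normSum_sum, normSum_const_mul]
  congr 1
  simp only [Finset.mul_sum]
  rw [Finset.sum_comm]
  refine Finset.sum_congr rfl fun j _ => ?_
  rw [Matrix.mulVec, dotProduct, Finset.sum_mul]
  refine Finset.sum_congr rfl fun l _ => ?_
  rw [hM l j]
  ring

end CrossFit
end ATTSetup

/-! ### Asymptotic linearity and normality -/

namespace ATTSetup

variable {d dU dZ : ℕ} {𝔖 : ATTSetup d dU dZ} {f : Fin 2 → ℝ → Cov dU dZ → ℝ}
  {θ₀ : EuclideanSpace ℝ (Fin d)} {c C : ℝ}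
  {Ω : Type*} [MeasurableSpace Ω] {μ : Measure Ω} [IsProbabilityMeasure μ]
  {T : ℕ → Ω → Fin 2} {Y : Fin 2 → ℕ → Ω → ℝ} {X : ℕ → Ω → Cov dU dZ}
  {Kf : ℕ} {fold : ∀ n : ℕ, Ω → Fin n → Fin Kf} {learn : Learner dU dZ}
  {θhat : ℕ → Ω → EuclideanSpace ℝ (Fin d)}

namespace IsSample

variable {est : ℕ → Ω → ℝ} {Δ : ℝ} {ψ : Obs dU dZ → ℝ}

/-- An asymptotic linear representation with a bounded centred function, restated with the
definition of an influence function. -/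
lemma hasInfluenceFunction (hs : 𝔖.IsSample f θ₀ μ T Y X) (h : RegularModel 𝔖 f θ₀ c C)
    (hψ : BddObs 𝔖 f ψ) (h0 : ∫ o, ψ o ∂(𝔖.law ⟨θ₀, f, μ.map (X 0)⟩) = 0)
    (hlin : Tendsto (fun q : ℕ × Ω => √(q.1 : ℝ) * (est q.1 q.2 - Δ) - normSum T Y X ψ q)
      (whp μ) (𝓝 0)) : HasInfluenceFunction μ T Y X est Δ ψ where
  memLp := by
    obtain ⟨k, hk, ⟨D, hD0, hD⟩, hkk⟩ := hψ.exists_measurable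
    have h1 : MemLp (fun ω => k (obs T Y X 0 ω)) 2 μ :=
      MemLp.of_bound (hk.comp (hs.measurable_obs 0)).aestronglyMeasurable D
        (ae_of_all _ fun ω => hD _)
    refine h1.ae_eq ?_
    filter_upwards [hs.ae_goodObs h] with ω hω using hkk _ (hω 0)
  mean_zero := by rw [hs.integral_obs h hψ, h0]
  linear := by
    rw [tendstoInMeasure_iff_whp]
    refine hlin.congr fun q => ?_
    rw [normSum, CrossFit.inv_sqrt_eq, mul_assoc]

/-- The central limit theorem for asymptotically linear estimators. -/
lemma hasAsymptoticVariance (hs : 𝔖.IsSample f θ₀ μ T Y X) (h : RegularModel 𝔖 f θ₀ c C)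
    (hψ : BddObs 𝔖 f ψ) (h0 : ∫ o, ψ o ∂(𝔖.law ⟨θ₀, f, μ.map (X 0)⟩) = 0)
    (hlin : Tendsto (fun q : ℕ × Ω => √(q.1 : ℝ) * (est q.1 q.2 - Δ) - normSum T Y X ψ q)
      (whp μ) (𝓝 0)) (hest : ∀ n, AEMeasurable (est n) μ) :
    HasAsymptoticVariance μ est Δ (∫ ω, ψ (obs T Y X 0 ω) ^ 2 ∂μ) := by
  obtain ⟨k, hk, ⟨D, hD0, hD⟩, hkk⟩ := hψ.exists_measurable
  have hgood := hs.ae_goodObs h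
  have hkm : ∀ i, Measurable fun ω => k (obs T Y X i ω) := fun i => hk.comp (hs.measurable_obs i)
  have hmean : ∫ ω, k (obs T Y X 0 ω) ∂μ = 0 := by
    rw [← h0, ← hs.integral_obs h hψ]
    exact integral_congr_ae (hgood.mono fun ω hω => hkk _ (hω 0))
  have hvar : Var[fun ω => k (obs T Y X 0 ω); μ] = ∫ ω, ψ (obs T Y X 0 ω) ^ 2 ∂μ := by
    rw [variance_of_integral_eq_zero (hkm 0).aemeasurable hmean]
    exact integral_congr_ae (hgood.mono fun ω hω => by simp only [hkk _ (hω 0)])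
  have hclt := tendstoInDistribution_inv_sqrt_mul_sum_sub (P := μ)
    (X := fun i ω => k (obs T Y X i ω)) (P' := gaussianReal 0
      (Var[fun ω => k (obs T Y X 0 ω); μ]).toNNReal) (Y := id) ⟨aemeasurable_id, Measure.map_id⟩
    (MemLp.of_bound (hkm 0).aestronglyMeasurable D (ae_of_all _ fun ω => hD _))
    (hs.iIndepFun_obs.comp (fun _ => k) fun _ => hk) (fun i => (hs.identDistrib_obs i).comp hk)
  rw [hvar, hmean] at hclt
  refine ⟨integral_nonneg fun ω => sq_nonneg _, ?_⟩
  refine tendstoInDistribution_of_tendstoInMeasure_sub _ _ hclt ?_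
    fun n => ((hest n).sub_const Δ).const_mul _
  refine tendstoInMeasure_iff_whp.2 (hlin.congr' ?_)
  refine eventually_whp_of_ae fun n => ?_
  filter_upwards [hgood] with ω hω
  simp only [Pi.sub_apply, normSum, mul_zero, sub_zero, CrossFit.inv_sqrt_eq, mul_assoc,
    hkk _ (hω _), Finset.sum_range]

end IsSample

namespace CrossFit

section Measurability

variable {n : ℕ}

/-- Measurability of the summands of the estimators. The folds take finitely many values, so that
it suffices to treat each value separately. -/
lemma aemeasurable_resid_mul (hc : CrossFit 𝔖 f θ₀ c C μ T Y X fold learn)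
    (hθ : 𝔖.IsEfficientTheta μ T Y X fold learn θhat)
    {a : Nuis dU dZ → EuclideanSpace ℝ (Fin d) → Cov dU dZ → ℝ}
    (hm : ∀ g : Ω → Nuis dU dZ, (∀ t, Measurable fun r : Ω × ℝ × Cov dU dZ => g r.1 t r.2.1 r.2.2) →
      RegularModel.JointMeas 𝔖 fun ω x => a (g ω) (θhat n ω) x) (i : Fin n) :
    AEMeasurable (fun ω => 𝔖.resid (θhat n ω) (obs T Y X i ω) *
      a (fhat T Y X fold learn n (fold n ω i) ω) (θhat n ω) (obs T Y X i ω).2.2) μ := by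
  have h := hc.model
  have hobs := fun i : Fin n => hc.sample.measurable_obs i
  have hR : Measurable fun ω => (goodObs 𝔖 f).indicator (𝔖.resid (θhat n ω)) (obs T Y X i ω) :=
    (h.measurable_resid_joint (hθ.measurable n) (hθ.mem n)).comp (measurable_id.prodMk (hobs i))
  have hH : Measurable fun r : (Fin n → Fin Kf) × Ω => 𝔖.𝒳.indicator
      (a (fun t => learn n t (Finset.univ.filter fun j => r.1 j ≠ r.1 i)
        fun j => obs T Y X (j : Fin n) r.2) (θhat n r.2)) (obs T Y X i r.2).2.2 := by
    refine measurable_from_prod_countable_right fun F => ?_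
    have hg : ∀ t, Measurable fun r : Ω × ℝ × Cov dU dZ =>
        learn n t (Finset.univ.filter fun j => F j ≠ F i)
          (fun j => obs T Y X (j : Fin n) r.1) r.2.1 r.2.2 := fun t =>
      (hc.learner n t (Finset.univ.filter fun j => F j ≠ F i)).comp
        ((measurable_pi_lambda (fun (r : Ω × ℝ × Cov dU dZ)
          (j : (Finset.univ.filter fun j => F j ≠ F i : Finset (Fin n))) =>
            obs T Y X (j : Fin n) r.1) fun j => (hobs j).comp measurable_fst).prodMk measurable_snd)
    exact (hm (fun ω t y x => learn n t (Finset.univ.filter fun j => F j ≠ F i)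
      (fun j => obs T Y X (j : Fin n) ω) y x) hg).comp
        (measurable_id.prodMk ((measurable_snd.comp measurable_snd).comp (hobs i)))
  refine ⟨_, hR.mul (hH.comp ((hc.part.measurable n).prodMk measurable_id)), ?_⟩
  filter_upwards [hc.sample.ae_goodObs h] with ω hω
  simp only [Pi.mul_apply, Function.comp_apply, id_eq]
  rw [Set.indicator_of_mem (hω i), Set.indicator_of_mem (hω i).2.1]
  rfl

lemma aemeasurable_altNum (hc : CrossFit 𝔖 f θ₀ c C μ T Y X fold learn)
    (hθ : 𝔖.IsEfficientTheta μ T Y X fold learn θhat) (i : Fin n) :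
    AEMeasurable (fun ω => 𝔖.altNum (θhat n ω) (obs T Y X i ω)) μ := by
  have h1 := hc.aemeasurable_resid_mul hθ (n := n) (a := fun _ _ _ => 1)
    (fun _ _ => hc.model.jointMeas_const 1) i
  have h2 : Measurable fun ω => (obs T Y X i ω).2.1 :=
    (measurable_fst.comp measurable_snd).comp (hc.sample.measurable_obs i)
  refine (h1.mul h2.aemeasurable).congr (ae_of_all _ fun ω => ?_)
  simp only [Pi.mul_apply, mul_one, altNum_eq]

lemma aemeasurable_Δalt (hc : CrossFit 𝔖 f θ₀ c C μ T Y X fold learn)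
    (hθ : 𝔖.IsEfficientTheta μ T Y X fold learn θhat) (n : ℕ) :
    AEMeasurable (fun ω => 𝔖.Δalt T Y X n (θhat n ω) ω) μ := by
  refine AEMeasurable.div (AEMeasurable.const_mul (Finset.aemeasurable_fun_sum _ fun i _ =>
    hc.aemeasurable_altNum hθ i) _) (AEMeasurable.const_mul (Finset.aemeasurable_fun_sum _
      fun i _ => ?_) _)
  exact ((measurable_of_countable tval).comp (hc.sample.measurable_T i)).aemeasurable

lemma aemeasurable_Δeff (hc : CrossFit 𝔖 f θ₀ c C μ T Y X fold learn)
    (hθ : 𝔖.IsEfficientTheta μ T Y X fold learn θhat) (n : ℕ) :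
    AEMeasurable (fun ω => 𝔖.Δeff T Y X fold learn n (θhat n ω) ω) μ := by
  have h := hc.model
  refine AEMeasurable.div (AEMeasurable.const_mul (Finset.aemeasurable_fun_sum _ fun i _ =>
    ?_) _) (AEMeasurable.const_mul (Finset.aemeasurable_fun_sum _ fun i _ => ?_) _)
  · have h1 := hc.aemeasurable_resid_mul hθ (n := n) (a := fun g θ x => (𝔖.B g θ x)⁻¹ * 𝔖.K g θ x)
      (fun g hg => (h.jointMeas_B hg (hθ.measurable n) (hθ.mem n)).inv.mul
        (h.jointMeas_K hg (hθ.measurable n) (hθ.mem n))) i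
    refine ((hc.aemeasurable_altNum hθ i).sub h1).congr (ae_of_all _ fun ω => ?_)
    simp only [Pi.sub_apply, altNum_eq, effNum, mul_assoc]
  · have h1 := hc.aemeasurable_resid_mul hθ (n := n) (a := fun g θ x => 𝔖.w g θ x / 𝔖.B g θ x)
      (fun g hg => h.jointMeas_w_div_B hg (hθ.measurable n) (hθ.mem n)) i
    exact ((measurable_of_countable tval).comp (hc.sample.measurable_T i)).aemeasurable.sub h1

end Measurability

section Linear

variable {p Δ : ℝ}

/-- Averages of the residual times a function of the covariates tend to zero at a consistent
estimator; the denominator of `Δeff` therefore tends to `p`, as does the one of `Δalt`. -/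
lemma tendsto_fitAvg_resid_mul (hc : CrossFit 𝔖 f θ₀ c C μ T Y X fold learn)
    (hmem : ∀ n ω, θhat n ω ∈ 𝔖.Θ)
    (hθ : Tendsto (fun q : ℕ × Ω => θhat q.1 q.2) (whp μ) (𝓝 θ₀))
    {a : Nuis dU dZ → EuclideanSpace ℝ (Fin d) → Cov dU dZ → ℝ} (ha : CovStat 𝔖 f θ₀ a) :
    Tendsto (fun q : ℕ × Ω => fitAvg T Y X fold learn (fun g θ o => 𝔖.resid θ o * a g θ o.2.2)
      (θhat q.1 q.2) q) (whp μ) (𝓝 0) := by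
  have h := hc.model
  obtain ⟨G, hG⟩ := ha.jet
  have hb : ∀ θ ∈ 𝔖.Θ, BddObs 𝔖 f fun o => 𝔖.resid θ o * a f θ o.2.2 :=
    fun θ hθ => (h.bddObs_resid hθ).mul (ha.bddObs h hθ)
  have h1 := ((hc.continuousOn_integral (h.obsJet_resid_mul hG) hb) θ₀ h.theta_mem).tendsto.comp
    (tendsto_nhdsWithin_iff.2 ⟨hθ, Eventually.of_forall fun q => hmem q.1 q.2⟩)
  rw [h.integral_resid_mul_cov (hc.sample.isParam h) (ha.bddObs h h.theta_mem)] at h1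
  refine Metric.tendsto_nhds.2 fun ε hε => ?_
  filter_upwards [Metric.tendsto_nhds.1 h1 (ε / 2) (by positivity),
    hc.eventually_abs_fitAvg_sub_le (h.obsJet_resid_mul hG) hb (half_pos (half_pos hε))] with q h2 h3
  have h4 := h3 _ (hmem q.1 q.2)
  rw [Real.dist_eq, sub_zero] at h2 ⊢
  simp only [Function.comp_apply] at h2
  have h5 := abs_add_le (fitAvg T Y X fold learn (fun g θ o => 𝔖.resid θ o * a g θ o.2.2)
    (θhat q.1 q.2) q - ∫ o, 𝔖.resid (θhat q.1 q.2) o * a f (θhat q.1 q.2) o.2.2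
      ∂(𝔖.law ⟨θ₀, f, μ.map (X 0)⟩)) (∫ o, 𝔖.resid (θhat q.1 q.2) o * a f (θhat q.1 q.2) o.2.2
      ∂(𝔖.law ⟨θ₀, f, μ.map (X 0)⟩))
  rw [sub_add_cancel] at h5
  linarith

/-- Asymptotic linearity of `Δalt`: the expansion of its numerator has the linear term
`-Qᵀ (θhat - θ₀)`, into which the representation of `θhat` by the efficient score is inserted. -/
lemma tendsto_Δalt (hc : CrossFit 𝔖 f θ₀ c C μ T Y X fold learn)
    (hr : 𝔖.Regularity f θ₀ μ T Y X) (hθ : 𝔖.IsEfficientTheta μ T Y X fold learn θhat) :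
    Tendsto (fun q : ℕ × Ω => √(q.1 : ℝ) * (𝔖.Δalt T Y X q.1 (θhat q.1 q.2) q.2 - Δtrue μ T Y) -
      normSum T Y X (fun o => 𝔖.φalt (ATTSetup.p μ T) (Δtrue μ T Y) θ₀ o - (ATTSetup.p μ T)⁻¹ *
        (𝔖.Q μ (Y 0 0) (X 0) θ₀ ⬝ᵥ ((𝔖.M f θ₀ (μ.map (X 0)))⁻¹ *ᵥ 𝔖.Seff f θ₀ o))) q)
      (whp μ) (𝓝 0) := by
  have h := hc.model
  have hs := hc.sample
  have hq := hs.isParam h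
  have hp := (hs.p_pos h).ne'
  have hden := hs.tendsto_average h h.bddObs_tval
  rw [hs.integral_tval_law h] at hden
  refine hs.tendsto_ratio h (h.bddObs_ψalt _ _ _)
    (h.integral_ψalt hq (hs.integral_tval_law h) (hs.integral_altNum_law h) _) hp
    hden ?_
  have h1 := hc.tendsto_of_isLittleO hr hθ (hc.isLittleO_altNum hθ.mem (hc.tendsto_theta hr hθ))
  have h2 := h1.sub (hc.tendsto_sum_mul_theta hr hθ (𝔖.Q μ (Y 0 0) (X 0) θ₀))
  rw [sub_zero] at h2
  refine h2.congr fun q => ?_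
  have e : (fun o => 𝔖.φalt (ATTSetup.p μ T) (Δtrue μ T Y) θ₀ o - (ATTSetup.p μ T)⁻¹ *
      (𝔖.Q μ (Y 0 0) (X 0) θ₀ ⬝ᵥ ((𝔖.M f θ₀ (μ.map (X 0)))⁻¹ *ᵥ 𝔖.Seff f θ₀ o))) = fun o =>
      (ATTSetup.p μ T)⁻¹ * ((𝔖.altNum θ₀ o + (-Δtrue μ T Y) * tval o.1) + (-1) * ∑ j,
        ((𝔖.M f θ₀ (μ.map (X 0)))⁻¹ *ᵥ 𝔖.Q μ (Y 0 0) (X 0) θ₀) j * 𝔖.Seff f θ₀ o j) := by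
    funext o
    rw [RegularModel.ψalt_eq]
    ring
  rw [e, normSum_const_mul, mul_inv_cancel_left₀ hp, normSum_add, normSum_add, normSum_const_mul,
    normSum_const_mul]
  simp only [normSum, fitAvg, obs]
  ring

/-- Asymptotic linearity of `Δeff`: the centred numerator is the one of `Δalt` minus the average of
the residual times `V / B`, whose linear term in `θ` is `-Dᵀ (θhat - θ₀)`. Hence the coefficient
`D - Q` of the efficient score in the influence function. -/
lemma tendsto_Δeff (hc : CrossFit 𝔖 f θ₀ c C μ T Y X fold learn)
    (hr : 𝔖.Regularity f θ₀ μ T Y X) (hθ : 𝔖.IsEfficientTheta μ T Y X fold learn θhat) :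
    Tendsto (fun q : ℕ × Ω => √(q.1 : ℝ) *
      (𝔖.Δeff T Y X fold learn q.1 (θhat q.1 q.2) q.2 - Δtrue μ T Y) - normSum T Y X
        (𝔖.φeff f θ₀ (μ.map (X 0)) (𝔖.Q μ (Y 0 0) (X 0) θ₀) (ATTSetup.p μ T) (Δtrue μ T Y)) q)
      (whp μ) (𝓝 0) := by
  have h := hc.model
  have hs := hc.sample
  have hq := hs.isParam h
  have hp := (hs.p_pos h).ne'
  have hcons := hc.tendsto_theta hr hθ
  have hden : Tendsto (fun q : ℕ × Ω => fitAvg T Y X fold learn (fun g θ o => 𝔖.effDen g θ o)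
      (θhat q.1 q.2) q) (whp μ) (𝓝 (ATTSetup.p μ T)) := by
    have h1 := (hs.tendsto_average h h.bddObs_tval).sub (hc.tendsto_fitAvg_resid_mul hθ.mem hcons
      (h.covStat_w_div_B))
    rw [sub_zero, hs.integral_tval_law h] at h1
    refine h1.congr fun q => ?_
    simp only [fitAvg, effDen, Finset.sum_sub_distrib, mul_sub]
  refine hs.tendsto_ratio h (h.bddObs_φeff _ _ _)
    (h.integral_φeff hq (hs.integral_tval_law h) (hs.integral_altNum_law h) _) hp hden ?_
  have h1 := hc.tendsto_of_isLittleO hr hθ (hc.isLittleO_altNum hθ.mem hcons)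
  have h2 := hc.tendsto_of_isLittleO hr hθ (hc.isLittleO_resid_mul hθ.mem hcons
    (h.covStat_ratioV (Δtrue μ T Y)))
  have h3 := (h1.sub h2).add (hc.tendsto_sum_mul_theta hr hθ
    (𝔖.D f θ₀ (μ.map (X 0)) (Δtrue μ T Y) - 𝔖.Q μ (Y 0 0) (X 0) θ₀))
  rw [sub_zero, add_zero] at h3
  refine h3.congr fun q => ?_
  have e : 𝔖.φeff f θ₀ (μ.map (X 0)) (𝔖.Q μ (Y 0 0) (X 0) θ₀) (ATTSetup.p μ T) (Δtrue μ T Y) =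
      fun o => (ATTSetup.p μ T)⁻¹ * (((𝔖.altNum θ₀ o + (-Δtrue μ T Y) * tval o.1) +
        (-1) * (𝔖.resid θ₀ o * 𝔖.ratioV (Δtrue μ T Y) f θ₀ o.2.2)) + ∑ j,
        ((𝔖.M f θ₀ (μ.map (X 0)))⁻¹ *ᵥ (𝔖.D f θ₀ (μ.map (X 0)) (Δtrue μ T Y) -
          𝔖.Q μ (Y 0 0) (X 0) θ₀)) j * 𝔖.Seff f θ₀ o j) := by
    funext o
    rw [RegularModel.φeff_eq, RegularModel.effCore, RegularModel.effCoef]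
    ring
  -- The terms `K / B` of the numerator and `w / B` of the denominator combine to `V / B`.
  have e2 : fitAvg T Y X fold learn (fun g θ o => 𝔖.effNum g θ o) (θhat q.1 q.2) q -
      Δtrue μ T Y * fitAvg T Y X fold learn (fun g θ o => 𝔖.effDen g θ o) (θhat q.1 q.2) q =
      fitAvg T Y X fold learn (fun _ θ o => 𝔖.altNum θ o) (θhat q.1 q.2) q -
        Δtrue μ T Y * ((q.1 : ℝ)⁻¹ * ∑ i : Fin q.1, tval (obs T Y X i q.2).1) -
        fitAvg T Y X fold learn (fun g θ o => 𝔖.resid θ o * 𝔖.ratioV (Δtrue μ T Y) g θ o.2.2)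
          (θhat q.1 q.2) q := by
    simp only [fitAvg, Finset.mul_sum, ← Finset.sum_sub_distrib]
    refine Finset.sum_congr rfl fun i _ => ?_
    linear_combination (q.1 : ℝ)⁻¹ * 𝔖.effNum_sub_mul_effDen (Δtrue μ T Y)
      (foldNuis T Y X fold learn q i) (θhat q.1 q.2) (obs T Y X i q.2)
  have e3 : fitAvg T Y X fold learn (fun g θ o => 𝔖.effNum g θ o) (θhat q.1 q.2) q =
      (q.1 : ℝ)⁻¹ * ∑ i : Fin q.1, 𝔖.effNum (fhat T Y X fold learn q.1 (fold q.1 q.2 i) q.2)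
        (θhat q.1 q.2) (obs T Y X i q.2) := rfl
  have e4 : fitAvg T Y X fold learn (fun g θ o => 𝔖.effDen g θ o) (θhat q.1 q.2) q =
      (q.1 : ℝ)⁻¹ * ∑ i : Fin q.1, 𝔖.effDen (fhat T Y X fold learn q.1 (fold q.1 q.2 i) q.2)
        (θhat q.1 q.2) (obs T Y X i q.2) := rfl
  rw [← e3, ← e4, e2, e, normSum_const_mul, mul_inv_cancel_left₀ hp, normSum_add, normSum_add,
    normSum_add, normSum_const_mul, normSum_const_mul]
  simp only [h.D_eq hq, Pi.sub_apply, sub_mul, Finset.sum_sub_distrib]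
  simp only [← h.D_eq hq, normSum]
  ring

end Linear

end CrossFit
end ATTSetup

theorem mainTheorem6 {d dU dZ : ℕ} (𝔖 : ATTSetup d dU dZ)
    {Ω : Type*} [MeasurableSpace Ω] (μ : Measure Ω) [IsProbabilityMeasure μ]
    (T : ℕ → Ω → Fin 2) (Y : Fin 2 → ℕ → Ω → ℝ) (X : ℕ → Ω → Cov dU dZ)
    (f : Fin 2 → ℝ → Cov dU dZ → ℝ) (θ₀ : EuclideanSpace ℝ (Fin d))
    (hdata : 𝔖.IsSample f θ₀ μ T Y X)
    (hreg : 𝔖.Regularity f θ₀ μ T Y X)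
    {Kf : ℕ} (hKf : 0 < Kf) (fold : ∀ n : ℕ, Ω → Fin n → Fin Kf)
    (hfold : ATTSetup.IsRandomPartition μ T Y X fold)
    (learn : ATTSetup.Learner dU dZ) (hlearn : ATTSetup.MeasurableLearner learn)
    (hquality : 𝔖.NuisanceQuality f μ T Y X fold learn)
    (θhat : ℕ → Ω → EuclideanSpace ℝ (Fin d))
    (hθhat : 𝔖.IsEfficientTheta μ T Y X fold learn θhat)
    (PX : Measure (Cov dU dZ)) (hPX : PX = μ.map (X 0))
    (p Δ₀ : ℝ) (hp : p = ATTSetup.p μ T) (hΔ₀ : Δ₀ = ATTSetup.Δtrue μ T Y)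
    (Q : Fin d → ℝ) (hQ : Q = 𝔖.Q μ (Y 0 0) (X 0) θ₀)
    (ψalt φeff : Obs dU dZ → ℝ)
    (hψalt : ψalt = fun o =>
      𝔖.φalt p Δ₀ θ₀ o - p⁻¹ * (Q ⬝ᵥ ((𝔖.M f θ₀ PX)⁻¹ *ᵥ 𝔖.Seff f θ₀ o)))
    (hφeff : φeff = 𝔖.φeff f θ₀ PX Q p Δ₀) :
    ATTSetup.HasInfluenceFunction μ T Y X (fun n ω => 𝔖.Δalt T Y X n (θhat n ω) ω) Δ₀ ψalt ∧
    ATTSetup.HasAsymptoticVariance μ (fun n ω => 𝔖.Δalt T Y X n (θhat n ω) ω) Δ₀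
      (∫ ω, ψalt (ATTSetup.obs T Y X 0 ω) ^ 2 ∂μ) ∧
    𝔖.IsEfficiencyBound ⟨θ₀, f, PX⟩ (∫ ω, φeff (ATTSetup.obs T Y X 0 ω) ^ 2 ∂μ) ∧
    ATTSetup.HasInfluenceFunction μ T Y X
      (fun n ω => 𝔖.Δeff T Y X fold learn n (θhat n ω) ω) Δ₀ φeff ∧
    ATTSetup.HasAsymptoticVariance μ (fun n ω => 𝔖.Δeff T Y X fold learn n (θhat n ω) ω) Δ₀
      (∫ ω, φeff (ATTSetup.obs T Y X 0 ω) ^ 2 ∂μ) ∧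
    ∫ ω, φeff (ATTSetup.obs T Y X 0 ω) ^ 2 ∂μ ≤ ∫ ω, ψalt (ATTSetup.obs T Y X 0 ω) ^ 2 ∂μ := by
  subst hPX hp hΔ₀ hQ hψalt hφeff
  obtain ⟨c, C, h⟩ := hdata.exists_regularModel hreg
  have hc : ATTSetup.CrossFit 𝔖 f θ₀ c C μ T Y X fold learn :=
    ⟨h, hdata, hfold, hlearn, hquality⟩
  have hq := hdata.isParam h
  have hp := hdata.integral_tval_law h
  have hΔ := hdata.integral_altNum_law h
  have hψ := h.bddObs_ψalt (g := μ.map (X 0)) (𝔖.Q μ (Y 0 0) (X 0) θ₀) (ATTSetup.p μ T)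
    (ATTSetup.Δtrue μ T Y)
  have hφ := h.bddObs_φeff (g := μ.map (X 0)) (𝔖.Q μ (Y 0 0) (X 0) θ₀) (ATTSetup.p μ T)
    (ATTSetup.Δtrue μ T Y)
  have hψ0 := h.integral_ψalt hq hp hΔ (𝔖.Q μ (Y 0 0) (X 0) θ₀)
  have hφ0 := h.integral_φeff hq hp hΔ (𝔖.Q μ (Y 0 0) (X 0) θ₀)
  have hψ2 := hdata.integral_obs h ((hψ.mul hψ).congr fun o _ => sq _)
  have hφ2 := hdata.integral_obs h ((hφ.mul hφ).congr fun o _ => sq _)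
  refine ⟨hdata.hasInfluenceFunction h hψ hψ0 (hc.tendsto_Δalt hreg hθhat),
    hdata.hasAsymptoticVariance h hψ hψ0 (hc.tendsto_Δalt hreg hθhat)
      (hc.aemeasurable_Δalt hθhat), ?_,
    hdata.hasInfluenceFunction h hφ hφ0 (hc.tendsto_Δeff hreg hθhat),
    hdata.hasAsymptoticVariance h hφ hφ0 (hc.tendsto_Δeff hreg hθhat)
      (hc.aemeasurable_Δeff hθhat), ?_⟩
  · rw [hφ2]
    exact h.isEfficiencyBound hq hreg.interior hreg.invertible (hdata.p_pos h).ne' hp hΔ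
      (hdata.integral_outcome_gradResid h)
  · rw [hφ2, hψ2]
    exact h.integral_φeff_sq_le hq hreg.invertible _ _ _
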